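/- Consider the lattice system $\dot u_{n,m}=d(\Delta u)_{n,m}+f(u_{n,m},\mu)$, $(n,m)\in\mathbb{Z}^2$, on $\ell^\infty(\mathbb{Z}^2)$, where $(\Delta u)_{n,m}=u_{n+1,m}+u_{n-1,m}+u_{n,m+1}+u_{n,m-1}-4u_{n,m}$. Let $f:\mathbb{R}^2\to\mathbb{R}$ be smooth and assume: (a) for each $\mu\in(0,1)$ the nonnegative zeros of $f(\cdot,\mu)$ are exactly $0<u_-(\mu)<u_+(\mu)$, with $f_u(0,\mu)<0$, $f_u(u_-(\mu),\mu)>0$, $f_u(u_+(\mu),\mu)<0$; (b) $f$ has a transcritical bifurcation at $(0,0)$: $f(u,\mu)=-\mu u+u^2+O(\mu^2+|\mu| u^2+|u|^3)$ as $(u,\mu)\to(0,0)$; (c) $u_+(\mu)\to1$ as $\mu\searrow0$, and $f_u(1,0)<0$. A function on $\mathbb{Z}^2$ is called $D_4$-symmetric off-site (resp. on-site) if it is invariant under $(n,m)\mapsto(m,n)$ and $(n,m)\mapsto(1-n,m)$ (resp. $(n,m)\mapsto(2-n,m)$); it is determined by its values on the wedge $1\le m\le n$. For $1\le M\le N$ let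 $\bar u^{(N,M)}(\mu)$ be the symmetric pattern that equals $u_+(\mu)$ for $1\le m\le n<N$ and for $n=N$, $1\le m\le M$, and $0$ elsewhere on the wedge. Let $\bar v^{(N,M)}(\mu)$ be the pattern with the same values except that it equals $u_-(\mu)$ at $(n,m)=(N,M)$. Then the following holds separately for off-site and for on-site symmetry in each of the two cases (i) $N\ge2$, $1\le M\le N-1$, with $\bar u=\bar u^{(N,M)}$, $\bar v=\bar v^{(N,M+1)}$, $\kappa=2\sqrt2$, and $k=4$ if $M=N-1$, $k=8$ if $M\ne N-1$; (ii) $N\in\{1,2\}$, with $\bar u=\bar u^{(N,N)}$, $\bar v=\bar v^{(N+1,1)}$, $\kappa=2$, and $k=8$ for off-site symmetry, $k=4$ for on-site symmetry. There are $d_1>0$, $\mu_1\in(0,1)$ and a continuous function $\mu_l:[0,d_1]\to[0,\mu_1)$, smooth on $(0,d_1]$, with $\mu_l(0)=0<\mu_l(d)$ for $d>0$, such that: - Fold bifurcations: for each $d\in(0,d_1]$ and $\mu\in[\mu_l(d),\mu_1]$ there are symmetric steady states $u_l(\mu,d)$ and $v_l(\mu,d)$, distinct for $\mu>\mu_l(d)$.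 They are smooth in $(\mu,d)$ for $\mu>\mu_l(d)$, and for each fixed $\mu\in(0,\mu_1]$ we have $u_l(\mu,d)\to\bar u(\mu)$ and $v_l(\mu,d)\to\bar v(\mu)$ in $\ell^\infty$ as $d\searrow0$. They meet in a generic fold at $\mu=\mu_l(d)$: together they form a regular curve $s\mapsto(U(s,d),m(s,d))$, $s\in[-1,1]$, smooth in $(s,d)$, with $U=u_l(m,d)$ for $s\le0$ and $U=v_l(m,d)$ for $s\ge0$, where $m(\pm1,d)=\mu_1$, $m(\cdot,d)$ decreases on $[-1,0]$ and increases on $[0,1]$, $m=\mu_l(d)$, $\partial_sm=0<\partial_s^2m$ and $\partial_sU\ne0$ at $s=0$. At $s=0$ the kernel of the linearization on symmetric functions is spanned by $\partial_sU$, and all symmetric steady states near the fold lie on the curve. - Expansion: $\mu_l(d)=\kappa\,d^{1/2}+O(d)$ as $d\searrow0$. - Stability: for each $d\in(0,d_1]$, precisely $k$ eigenvalues (with multiplicity) of the linearization $d\Delta+f_u(U,m)$ on $\ell^\infty(\mathbb{Z}^2)$ cross the origin as the branch is traversed from $u_l$ to $v_l$. Each of them is real near its crossing, vanishes exactly once along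 the branch, and does so with positive derivative in $s$. The remaining spectrum stays in a half-plane $\operatorname{Re}z\le-\gamma$ with $\gamma=\gamma(d)>0$. The crossings occur near the fold: for every $\varepsilon>0$ and all sufficiently small $d$, the linearization is invertible at the points of the branch with $m>(1+\varepsilon)\mu_l(d)$. -/

import Mathlib

open Set Filter Topology Asymptotics
open scoped ContDiff ENNReal

noncomputable section

namespace Lattice

/-- The Banach space `ℓ^∞(ℤ²)` with values in `𝕜 = ℝ` or `ℂ`, with the supremum norm. -/
abbrev LInf (𝕜 : Type) [RCLike 𝕜] : Type := lp (fun _ : ℤ × ℤ => 𝕜) ∞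

/-- The five-point discrete Laplacian. -/
def lap {𝕜 : Type} [RCLike 𝕜] (u : ℤ × ℤ → 𝕜) (n m : ℤ) : 𝕜 :=
  u (n + 1, m) + u (n - 1, m) + u (n, m + 1) + u (n, m - 1) - 4 * u (n, m)

/-- `u` solves the steady-state system `d (Δu)_{n,m} + f(u_{n,m}, μ) = 0` on `ℤ²`. -/
def IsSteadyState (f : ℝ → ℝ → ℝ) (u : LInf ℝ) (μ d : ℝ) : Prop :=
  ∀ n m : ℤ, d * lap u n m + f (u (n, m)) μ = 0

/-- The two actions of the dihedral group `D₄` on the lattice. -/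
inductive Site : Type
  | off
  | on

/-- The vertical reflection is `n ↦ c - n`, with `c = 1` (axes through `(1/2, 1/2)`) for
off-site patterns and `c = 2` (axes through `(1, 1)`) for on-site patterns. -/
def Site.c : Site → ℤ
  | Site.off => 1
  | Site.on => 2

/-- Invariance under `D₄`, which is generated by these two reflections. -/
def IsD4Symmetric (σ : Site) (u : ℤ × ℤ → ℝ) : Prop :=
  ∀ n m : ℤ, u (σ.c - n, m) = u (n, m) ∧ u (m, n) = u (n, m)

/-- The `D₄`-symmetric extension to `ℤ²` of a function on the wedge `1 ≤ m ≤ n`. The coordinate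
`n` is first moved to `max n (c - n) ≥ 1`, and the two coordinates are then ordered. -/
def extend (σ : Site) (w : ℤ → ℤ → ℝ) (p : ℤ × ℤ) : ℝ :=
  w (max (max p.1 (σ.c - p.1)) (max p.2 (σ.c - p.2)))
    (min (max p.1 (σ.c - p.1)) (max p.2 (σ.c - p.2)))

/-- The pattern `ū^{(N,M)}` on the wedge, where `up` is the value of `u₊`. -/
def wedgeU (up : ℝ) (N M n m : ℤ) : ℝ :=
  if (1 ≤ m ∧ m ≤ n ∧ n < N) ∨ (n = N ∧ 1 ≤ m ∧ m ≤ M) then up else 0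

/-- The pattern `v̄^{(N,M)}` on the wedge, where `um`, `up` are the values of `u₋`, `u₊`. -/
def wedgeV (um up : ℝ) (N M n m : ℤ) : ℝ :=
  if (1 ≤ m ∧ m ≤ n ∧ n < N) ∨ (n = N ∧ 1 ≤ m ∧ m < M) then up
  else if n = N ∧ m = M then um else 0

theorem memlp_of_bound {𝕜 : Type} [RCLike 𝕜] {a : ℤ × ℤ → 𝕜} (C : ℝ) (h : ∀ p, ‖a p‖ ≤ C) :
    Memℓp a ∞ :=
  memℓp_infty ⟨C, by rintro _ ⟨p, rfl⟩; exact h p⟩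

/-- `ū^{(N,M)}` as a `D₄`-symmetric element of `ℓ^∞(ℤ²)`. -/
def patternU (σ : Site) (up : ℝ) (N M : ℤ) : LInf ℝ :=
  ⟨extend σ (wedgeU up N M), memlp_of_bound |up| fun p => by
    unfold extend wedgeU
    split_ifs <;> simp⟩

/-- `v̄^{(N,M)}` as a `D₄`-symmetric element of `ℓ^∞(ℤ²)`. -/
def patternV (σ : Site) (um up : ℝ) (N M : ℤ) : LInf ℝ :=
  ⟨extend σ (wedgeV um up N M), memlp_of_bound (|um| + |up|) fun p => by
    unfold extend wedgeV
    split_ifs <;> (simp; try positivity)⟩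

/-- The partial derivative `f_u(u, μ)`. -/
def fu (f : ℝ → ℝ → ℝ) (u μ : ℝ) : ℝ := deriv (fun x => f x μ) u

/-- Translation by `a` as a bounded operator on `ℓ^∞(ℤ², ℂ)`. -/
def shift (a : ℤ × ℤ) : LInf ℂ →L[ℂ] LInf ℂ :=
  LinearMap.mkContinuous
    { toFun := fun v => ⟨fun p => v (p + a), memlp_of_bound ‖v‖ fun p =>
        lp.norm_apply_le_norm ENNReal.top_ne_zero v (p + a)⟩
      map_add' := fun _ _ => rfl
      map_smul' := fun _ _ => rfl } 1
    (fun v => by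
      rw [one_mul]
      exact lp.norm_le_of_forall_le (norm_nonneg _) fun p =>
        lp.norm_apply_le_norm ENNReal.top_ne_zero v (p + a))

/-- The discrete Laplacian as a bounded operator on `ℓ^∞(ℤ², ℂ)`. -/
def lapOp : LInf ℂ →L[ℂ] LInf ℂ :=
  shift (1, 0) + shift (-1, 0) + shift (0, 1) + shift (0, -1)
    - (4 : ℂ) • ContinuousLinearMap.id ℂ (LInf ℂ)

theorem shift_apply (a : ℤ × ℤ) (v : LInf ℂ) (p : ℤ × ℤ) : shift a v p = v (p + a) := rfl

theorem lapOp_apply (v : LInf ℂ) (n m : ℤ) : lapOp v (n, m) = lap v n m := by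
  change shift (1, 0) v (n, m) + shift (-1, 0) v (n, m) + shift (0, 1) v (n, m)
    + shift (0, -1) v (n, m) - (4 : ℂ) * v (n, m) = _
  simp [shift_apply, lap, sub_eq_add_neg]

theorem memlp_fu {f : ℝ → ℝ → ℝ} (hf : ContDiff ℝ ∞ (fun p : ℝ × ℝ => f p.1 p.2))
    (u : LInf ℝ) (μ : ℝ) : Memℓp (fun p => ((fu f (u p) μ : ℝ) : ℂ)) ∞ := by
  have h1 : ContDiff ℝ ∞ (fun x : ℝ => f x μ) :=
    hf.comp (contDiff_id.prodMk contDiff_const)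
  have h2 : Continuous (fun x : ℝ => fu f x μ) := h1.continuous_deriv (by simp)
  obtain ⟨C, hC⟩ := (isCompact_Icc (a := -‖u‖) (b := ‖u‖)).exists_bound_of_continuousOn
    h2.continuousOn
  refine memlp_of_bound C fun p => ?_
  have h3 := lp.norm_apply_le_norm ENNReal.top_ne_zero u p
  rw [Real.norm_eq_abs] at h3
  simpa using hC (u p) (abs_le.mp h3)

/-- The linearization `(L v)_{n,m} = d (Δv)_{n,m} + f_u(u_{n,m}, μ) v_{n,m}` of the lattice
dynamical system at `u`, as a bounded operator on the complexified space `ℓ^∞(ℤ², ℂ)`. -/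
def linearization {f : ℝ → ℝ → ℝ} (hf : ContDiff ℝ ∞ (fun p : ℝ × ℝ => f p.1 p.2))
    (u : LInf ℝ) (μ d : ℝ) : LInf ℂ →L[ℂ] LInf ℂ :=
  (d : ℂ) • lapOp + ContinuousLinearMap.mul ℂ (LInf ℂ) ⟨_, memlp_fu hf u μ⟩

theorem linearization_apply {f : ℝ → ℝ → ℝ}
    (hf : ContDiff ℝ ∞ (fun p : ℝ × ℝ => f p.1 p.2))
    (u : LInf ℝ) (μ d : ℝ) (v : LInf ℂ) (n m : ℤ) :
    linearization hf u μ d v (n, m)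
      = d * lap v n m + (fu f (u (n, m)) μ : ℝ) * v (n, m) := by
  rw [← lapOp_apply]
  rfl

/-- The standing assumptions on `f`. The zeros `0 < u₋(μ) < u₊(μ)` are as in the bistable regime
for `0 < μ < 1`, there is a transcritical bifurcation at `(0, 0)`, and at `μ = 0` the zero `u₊`
is `1` and is nondegenerate. -/
structure IsTranscritical (f : ℝ → ℝ → ℝ) (um up : ℝ → ℝ) : Prop where
  smooth : ContDiff ℝ ∞ (fun p : ℝ × ℝ => f p.1 p.2)
  pos : ∀ μ ∈ Ioo (0 : ℝ) 1, 0 < um μ ∧ um μ < up μ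
  zeros : ∀ μ ∈ Ioo (0 : ℝ) 1, ∀ u : ℝ, 0 ≤ u → (f u μ = 0 ↔ u = 0 ∨ u = um μ ∨ u = up μ)
  signs : ∀ μ ∈ Ioo (0 : ℝ) 1, fu f 0 μ < 0 ∧ 0 < fu f (um μ) μ ∧ fu f (up μ) μ < 0
  taylor : (fun p : ℝ × ℝ => f p.1 p.2 - (-p.2 * p.1 + p.1 ^ 2))
    =O[𝓝 (0, 0)] (fun p : ℝ × ℝ => p.2 ^ 2 + |p.2| * p.1 ^ 2 + |p.1| ^ 3)
  up_zero : Tendsto up (𝓝[>] 0) (𝓝 1)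
  hyperbolic : fu f 1 0 < 0

/-- For fixed `d`, the solutions `u` and `v` (functions of `μ`) are the two halves of a branch
over `[μl, μ₁]` that has a generic fold at `μ = μl`. The branch is the curve
`s ↦ (U s, m s)`, `-1 ≤ s ≤ 1`, with its fold at `s = 0`. -/
structure IsFoldBranch (f : ℝ → ℝ → ℝ) (σ : Site) (d μl μ₁ : ℝ) (u v : ℝ → LInf ℝ)
    (U : ℝ → LInf ℝ) (m : ℝ → ℝ) : Prop where
  smooth_U : ContDiffOn ℝ ∞ U (Icc (-1) 1)
  smooth_m : ContDiffOn ℝ ∞ m (Icc (-1) 1)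
  m_neg_one : m (-1) = μ₁
  m_zero : m 0 = μl
  m_one : m 1 = μ₁
  decreasing : ∀ s ∈ Ioo (-1 : ℝ) 0, deriv m s < 0
  increasing : ∀ s ∈ Ioo (0 : ℝ) 1, 0 < deriv m s
  eq_u : ∀ s ∈ Icc (-1 : ℝ) 0, U s = u (m s)
  eq_v : ∀ s ∈ Icc (0 : ℝ) 1, U s = v (m s)
  regular : deriv U 0 ≠ 0
  tangent : deriv m 0 = 0
  quadratic : 0 < deriv (deriv m) 0
  /-- The kernel of the linearization on symmetric sequences is one-dimensional at the fold. -/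
  simple_kernel : ∀ w : LInf ℝ, IsD4Symmetric σ w →
    (∀ n k : ℤ, d * lap w n k + fu f (U 0 (n, k)) μl * w (n, k) = 0) → ∃ t : ℝ, w = t • deriv U 0
  /-- Near the fold there are no symmetric steady states besides those on the branch. -/
  isolated : ∃ ε > 0, ∀ (w : LInf ℝ) (μ : ℝ), IsD4Symmetric σ w → IsSteadyState f w μ d →
    ‖w - U 0‖ < ε → |μ - μl| < ε → ∃ s ∈ Icc (-1 : ℝ) 1, w = U s ∧ μ = m s

/-- Precisely `k` eigenvalues of `T s` cross the origin as `s` runs through `[-1, 1]`, they cross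
transversely from left to right, and the rest of the spectrum stays in a half-plane `Re z ≤ -γ`.
To the right of the line `Re z = -γ` the spectrum consists of the real numbers `lam j s`, each an
eigenvalue whose algebraic multiplicity is the number of indices `j` with that value. Values
`lam j s ≤ -γ` carry no information. -/
def EigenvaluesCross (T : ℝ → (LInf ℂ →L[ℂ] LInf ℂ)) (k : ℕ) : Prop :=
  ∃ γ > 0, ∃ lam : Fin k → ℝ → ℝ,
    (∀ j, ContinuousOn (lam j) (Icc (-1) 1)) ∧
    (∀ s ∈ Icc (-1 : ℝ) 1, ∀ z : ℂ, -γ < z.re →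
      (z ∈ spectrum ℂ (T s) ↔ ∃ j, z = (lam j s : ℂ)) ∧
      Module.finrank ℂ
        (Module.End.maxGenEigenspace (T s : LInf ℂ →ₗ[ℂ] LInf ℂ) z)
          = Nat.card {j : Fin k // z = (lam j s : ℂ)}) ∧
    (∀ j, ∃ s₀ ∈ Ioo (-1 : ℝ) 1, lam j s₀ = 0 ∧
      (∀ s ∈ Icc (-1 : ℝ) 1, lam j s = 0 → s = s₀) ∧
      ∃ a > 0, HasDerivAt (lam j) a s₀)

/-- For small `d > 0`, symmetric solutions that emanate from the patterns `ubar μ` and `vbar μ`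
meet in a fold at `μ = μl d = κ √d + O(d)`, where `k` eigenvalues cross the origin. -/
def ContinuesThroughFold {f : ℝ → ℝ → ℝ} (hf : ContDiff ℝ ∞ (fun p : ℝ × ℝ => f p.1 p.2))
    (σ : Site) (ubar vbar : ℝ → LInf ℝ) (κ : ℝ) (k : ℕ) : Prop :=
  ∃ d₁ > 0, ∃ μ₁ ∈ Ioo (0 : ℝ) 1, ∃ μl : ℝ → ℝ, ∃ ul vl : ℝ → ℝ → LInf ℝ,
  ∃ U : ℝ → ℝ → LInf ℝ, ∃ m : ℝ → ℝ → ℝ,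
    -- the location of the fold
    ContinuousOn μl (Icc 0 d₁) ∧ ContDiffOn ℝ ∞ μl (Ioc 0 d₁) ∧
    μl 0 = 0 ∧ (∀ d ∈ Ioc 0 d₁, 0 < μl d ∧ μl d < μ₁) ∧
    (fun d => μl d - κ * √d) =O[𝓝[>] 0] (fun d => d) ∧
    -- the two solutions
    (∀ d ∈ Ioc 0 d₁, ∀ μ ∈ Icc (μl d) μ₁,
      IsD4Symmetric σ (ul μ d) ∧ IsSteadyState f (ul μ d) μ d ∧
      IsD4Symmetric σ (vl μ d) ∧ IsSteadyState f (vl μ d) μ d) ∧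
    (∀ d ∈ Ioc 0 d₁, ∀ μ ∈ Ioc (μl d) μ₁, ul μ d ≠ vl μ d) ∧
    ContDiffOn ℝ ∞ (fun p : ℝ × ℝ => ul p.1 p.2)
      {p | p.2 ∈ Ioc 0 d₁ ∧ p.1 ∈ Ioc (μl p.2) μ₁} ∧
    ContDiffOn ℝ ∞ (fun p : ℝ × ℝ => vl p.1 p.2)
      {p | p.2 ∈ Ioc 0 d₁ ∧ p.1 ∈ Ioc (μl p.2) μ₁} ∧
    (∀ μ ∈ Ioc 0 μ₁, Tendsto (fun d => ul μ d) (𝓝[>] 0) (𝓝 (ubar μ)) ∧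
      Tendsto (fun d => vl μ d) (𝓝[>] 0) (𝓝 (vbar μ))) ∧
    -- the fold, with a parametrization of the branch that is smooth in `(s, d)`
    ContDiffOn ℝ ∞ (fun p : ℝ × ℝ => U p.1 p.2) (Icc (-1) 1 ×ˢ Ioc 0 d₁) ∧
    ContDiffOn ℝ ∞ (fun p : ℝ × ℝ => m p.1 p.2) (Icc (-1) 1 ×ˢ Ioc 0 d₁) ∧
    (∀ d ∈ Ioc 0 d₁, IsFoldBranch f σ d (μl d) μ₁ (fun μ => ul μ d) (fun μ => vl μ d)
      (fun s => U s d) (fun s => m s d)) ∧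
    -- the critical eigenvalues, and the fact that they cross near the fold
    (∀ d ∈ Ioc 0 d₁, EigenvaluesCross (fun s => linearization hf (U s d) (m s d) d) k) ∧
    (∀ ε > 0, ∃ d₀ > 0, ∀ d ∈ Ioc 0 d₁, d < d₀ → ∀ s ∈ Icc (-1 : ℝ) 1,
      0 ∈ spectrum ℂ (linearization hf (U s d) (m s d) d) → m s d ≤ (1 + ε) * μl d)

end Lattice

end

/-! Fix a symmetric patch `P` of sites at which the solution is close to `u₊`, and let the sites of
one further orbit `C` of the symmetry group pass from small values to `u₋`, with all other sites
close to zero (`IsConfig`; the patches of the theorem are `isConfig_side` and `isConfig_square`).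

**Reduction to one unknown.** Let `x` be the common value of a symmetric solution on `C`. The
system at the remaining sites has a solution between an explicit subsolution and an explicit
supersolution (`LocalModel.exists_sol`). In a neighbourhood of that order interval the derivative
of `f` off `C` is negative, so that the linearization is diagonally dominant there: the solution
`sol` is unique, isolated and smooth in `(x, μ, d)`. The equation at a site of `C` is left over,
a scalar equation `red (x, μ, d) = 0` with `red (x, μ, d) = x ^ 2 - μ x + j d` up to small terms,
where `j` is the number of neighbours in `P` of a site of `C`. Each neighbour contributes `d`,
because `u₊` is close to `1`. The function `red` is convex in `x` and decreases in `μ` through its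
zeros (`LocalModel.one_le_pd11_red`, `LocalModel.pd2_red_le`), so that its zeros for fixed `d` form
a single curve over an interval of values of `x`, and `μ` has a single minimum on it
(`IsReduced.exists_fold`). This is the fold branch (`IsResolved.isFoldBranch`). At the minimum
`2 x` is close to `μ`, hence `μ = 2 √(j d) + O(d)` (`LocalModel.abs_sub_sqrt_le`), with `j = 2` if
a side of the patch is continued and `j = 1` if a new side is started.

**The special case.** If a new side is started on a square patch of width `N = 2`, there are other
sites next to the patch, which also have one neighbour in `P`, and they are close to a fold of
their own at the same values of `μ` and `d`. These sites have one neighbour in `C` and none among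
themselves, while a site of `C` has two neighbours in `C` or among these sites, so that the fold on
`C` comes first. The domain `dom` is delimited by the condition `gap < 0` that the supersolution at
these sites, slightly below the fold value `μ / 2`, is strict; `LocalModel.red_pos_of_gap` shows
that the branch does not reach the end of the domain.

**Spectrum.** The linearization is `hop d V = d Δ + V`, with `V` negative off the finite set `C`.
Its spectrum near zero and to the right of it is governed by the Schur complement `schur` on `C`,
which is nearly `V` on `C` minus the spectral parameter, up to `O(d)`, and whose dependence on `V`
off `C` is of order `d ^ 2`. It follows that this part of the spectrum is real and semisimple
(`Dissipative.notMem_spectrum`, `Dissipative.hop_eq_zero_of_sq`,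
`Dissipative.finrank_maxGenEigenspace`). A group of commuting reflections acts on `C` with two
orbits, and its characters decompose the Schur complement into symmetric blocks of size two
(`IsCharTable.finrank_ker_eq`), whose eigenvalues `p ± ‖w‖` increase strictly when they vanish,
because `f_u` on `C` increases along the branch with a speed that dominates the other changes
(`IsCrossingFamily.isCrossingPair`). Each eigenvalue can therefore be followed through exactly one
crossing (`IsCrossingPair.exists_eigenvalue_curves`). If both eigenvalues of a block cross at the
same point, the labels are exchanged there, which keeps the curves differentiable at the crossing.
Altogether as many eigenvalues cross as `C` has sites.
-/

noncomputable section

namespace Lattice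

set_option linter.unusedSectionVars false

/-! ### Operators on bounded lattice functions -/

section Operators

variable {𝕜 : Type} [RCLike 𝕜]

/-- The sum of `u` over the four nearest neighbours of `p`. -/
def nb (u : ℤ × ℤ → 𝕜) (p : ℤ × ℤ) : 𝕜 :=
  u (p.1 + 1, p.2) + u (p.1 - 1, p.2) + u (p.1, p.2 + 1) + u (p.1, p.2 - 1)

theorem lap_eq_nb (u : ℤ × ℤ → 𝕜) (n m : ℤ) : lap u n m = nb u (n, m) - 4 * u (n, m) := rfl

/-- A bounded lattice function as an element of `ℓ^∞`. -/
def ofBound (a : ℤ × ℤ → 𝕜) (C : ℝ) (h : ∀ p, ‖a p‖ ≤ C) : LInf 𝕜 := ⟨a, memlp_of_bound C h⟩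

@[simp] theorem ofBound_apply (a : ℤ × ℤ → 𝕜) (C : ℝ) (h : ∀ p, ‖a p‖ ≤ C) (p : ℤ × ℤ) :
    ofBound a C h p = a p := rfl

theorem linf_ext {u v : LInf 𝕜} (h : ∀ p, u p = v p) : u = v := lp.ext (funext h)

theorem norm_apply_le (u : LInf 𝕜) (p : ℤ × ℤ) : ‖u p‖ ≤ ‖u‖ :=
  lp.norm_apply_le_norm ENNReal.top_ne_zero u p

theorem norm_le_of_apply_le {u : LInf 𝕜} {C : ℝ} (h : ∀ p, ‖u p‖ ≤ C) : ‖u‖ ≤ C :=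
  lp.norm_le_of_forall_le ((norm_nonneg _).trans (h 0)) h

theorem norm_nb_le {u : ℤ × ℤ → 𝕜} {C : ℝ} (h : ∀ p, ‖u p‖ ≤ C) (p : ℤ × ℤ) :
    ‖nb u p‖ ≤ 4 * C := by
  unfold nb
  refine (norm_add_le _ _).trans ?_
  have h1 := norm_add_le (u (p.1 + 1, p.2) + u (p.1 - 1, p.2)) (u (p.1, p.2 + 1))
  have h2 := norm_add_le (u (p.1 + 1, p.2)) (u (p.1 - 1, p.2))
  linarith [h (p.1 + 1, p.2), h (p.1 - 1, p.2), h (p.1, p.2 + 1), h (p.1, p.2 - 1)]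

theorem nb_add (u v : ℤ × ℤ → 𝕜) (p : ℤ × ℤ) : nb (fun q => u q + v q) p = nb u p + nb v p := by
  unfold nb; ring

theorem nb_sub (u v : ℤ × ℤ → 𝕜) (p : ℤ × ℤ) : nb (fun q => u q - v q) p = nb u p - nb v p := by
  unfold nb; ring

theorem nb_mul (c : 𝕜) (u : ℤ × ℤ → 𝕜) (p : ℤ × ℤ) : nb (fun q => c * u q) p = c * nb u p := by
  unfold nb; ring

theorem nb_mono {u v : ℤ × ℤ → ℝ} (h : ∀ p, u p ≤ v p) (p : ℤ × ℤ) : nb u p ≤ nb v p := by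
  unfold nb; gcongr <;> exact h _

/-- The evaluation functional at a lattice point. -/
def ev (𝕜 : Type) [RCLike 𝕜] (p : ℤ × ℤ) : LInf 𝕜 →L[𝕜] 𝕜 :=
  LinearMap.mkContinuous
    { toFun := fun u => u p, map_add' := fun _ _ => rfl, map_smul' := fun _ _ => rfl } 1
    (fun u => (norm_apply_le u p).trans_eq (one_mul _).symm)

@[simp] theorem ev_apply (p : ℤ × ℤ) (u : LInf 𝕜) : ev 𝕜 p u = u p := rfl

variable (𝕜) in
/-- The sum over nearest neighbours as a bounded operator. -/
def nbOp : LInf 𝕜 →L[𝕜] LInf 𝕜 :=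
  LinearMap.mkContinuous
    { toFun := fun u => ofBound (nb u) (4 * ‖u‖) fun p => norm_nb_le (norm_apply_le u) p
      map_add' := fun u v => linf_ext fun p => nb_add u v p
      map_smul' := fun c u => linf_ext fun p => nb_mul c u p } 4
    (fun u => norm_le_of_apply_le fun p => norm_nb_le (norm_apply_le u) p)

@[simp] theorem nbOp_apply (u : LInf 𝕜) (p : ℤ × ℤ) : nbOp 𝕜 u p = nb u p := rfl

theorem norm_nbOp_le : ‖nbOp 𝕜‖ ≤ 4 := LinearMap.mkContinuous_norm_le _ (by norm_num) _

variable (𝕜) in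
/-- Multiplication by bounded functions, as a bounded bilinear map. -/
def mulOp : LInf 𝕜 →L[𝕜] LInf 𝕜 →L[𝕜] LInf 𝕜 := ContinuousLinearMap.mul 𝕜 (LInf 𝕜)

@[simp] theorem mulOp_apply (a u : LInf 𝕜) (p : ℤ × ℤ) : mulOp 𝕜 a u p = a p * u p := rfl

theorem norm_mulOp_le (a : LInf 𝕜) : ‖mulOp 𝕜 a‖ ≤ ‖a‖ :=
  ContinuousLinearMap.opNorm_mul_apply_le 𝕜 (LInf 𝕜) a

variable (𝕜) in
/-- The indicator function of a set of lattice points. -/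
def ind (A : Set (ℤ × ℤ)) : LInf 𝕜 :=
  ofBound (A.indicator fun _ => (1 : 𝕜)) 1 fun p => by
    by_cases h : p ∈ A <;> simp [h]

theorem ind_of_mem {A : Set (ℤ × ℤ)} {p : ℤ × ℤ} (h : p ∈ A) : ind 𝕜 A p = 1 := by
  simp [ind, h]

theorem ind_of_notMem {A : Set (ℤ × ℤ)} {p : ℤ × ℤ} (h : p ∉ A) : ind 𝕜 A p = 0 := by
  simp [ind, h]

/-- The operator `v ↦ d Δv + V v` off the set `C`, completed by the identity on `C`. -/
def pinned (C : Set (ℤ × ℤ)) (d : ℝ) (V : LInf 𝕜) : LInf 𝕜 →L[𝕜] LInf 𝕜 :=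
  mulOp 𝕜 (ind 𝕜 Cᶜ) ∘L ((d : 𝕜) • nbOp 𝕜 + mulOp 𝕜 V
    - (4 * d : 𝕜) • ContinuousLinearMap.id 𝕜 (LInf 𝕜)) + mulOp 𝕜 (ind 𝕜 C)

theorem pinned_apply_of_mem {C : Set (ℤ × ℤ)} {p : ℤ × ℤ} (h : p ∈ C) (d : ℝ) (V v : LInf 𝕜) :
    pinned C d V v p = v p := by
  change ind 𝕜 Cᶜ p * ((d : 𝕜) * nb v p + V p * v p - 4 * d * v p) + ind 𝕜 C p * v p = _
  rw [ind_of_notMem (by simpa using h), ind_of_mem h]; ring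

theorem pinned_apply_of_notMem {C : Set (ℤ × ℤ)} {p : ℤ × ℤ} (h : p ∉ C) (d : ℝ)
    (V v : LInf 𝕜) : pinned C d V v p = d * nb v p + (V p - 4 * d) * v p := by
  change ind 𝕜 Cᶜ p * ((d : 𝕜) * nb v p + V p * v p - 4 * d * v p) + ind 𝕜 C p * v p = _
  rw [ind_of_mem (by simpa using h), ind_of_notMem h]; ring

theorem norm_sub_ge_of_re_le {c : 𝕜} {d : ℝ} : 4 * d - RCLike.re c ≤ ‖c - 4 * (d : 𝕜)‖ := by
  have h := RCLike.abs_re_le_norm (c - 4 * (d : 𝕜))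
  have h1 : RCLike.re (c - 4 * (d : 𝕜)) = RCLike.re c - 4 * d := by simp [map_sub]
  rw [h1] at h
  linarith [neg_abs_le (RCLike.re c - 4 * d)]

/-- The maximum principle for a diagonally dominant system: where `re c p ≤ -δ < 0` off `C`, a
bounded solution is controlled by its values on `C` and by the ratio of the right-hand side to the
dissipation `-re c`. -/
theorem norm_le_of_dominant {C : Set (ℤ × ℤ)} {d δ B : ℝ} (hd : 0 < d) (hδ : 0 < δ)
    {v : LInf 𝕜} {c g : ℤ × ℤ → 𝕜} (hc : ∀ p ∉ C, RCLike.re (c p) ≤ -δ)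
    (hv : ∀ p ∉ C, d * nb v p + (c p - 4 * d) * v p = g p)
    (hg : ∀ p ∉ C, ‖g p‖ ≤ B * -RCLike.re (c p)) (hC : ∀ p ∈ C, ‖v p‖ ≤ B) (p : ℤ × ℤ) :
    ‖v p‖ ≤ B := by
  by_contra! hB
  have hS : B < ‖v‖ := hB.trans_le (norm_apply_le v p)
  have hlt : max B (‖v‖ - δ * (‖v‖ - B) / (4 * d + δ)) < ‖v‖ := by
    refine max_lt hS ?_
    have : 0 < δ * (‖v‖ - B) / (4 * d + δ) := by
      have : 0 < ‖v‖ - B := by linarith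
      positivity
    linarith
  refine absurd (norm_le_of_apply_le (u := v) fun q => ?_) (not_le.2 hlt)
  by_cases hq : q ∈ C
  · exact (hC q hq).trans (le_max_left _ _)
  refine le_max_of_le_right ?_
  have h1 : ‖(c q - 4 * d) * v q‖ ≤ 4 * d * ‖v‖ + B * -RCLike.re (c q) := by
    have : (c q - 4 * d) * v q = g q - d * nb v q := by rw [← hv q hq]; ring
    rw [this]
    refine (norm_sub_le _ _).trans ?_
    have h2 : ‖(d : 𝕜) * nb v q‖ ≤ d * (4 * ‖v‖) := by
      rw [norm_mul, RCLike.norm_ofReal, abs_of_pos hd]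
      exact mul_le_mul_of_nonneg_left (norm_nb_le (norm_apply_le v) q) hd.le
    linarith [hg q hq]
  rw [norm_mul] at h1
  set τ := -RCLike.re (c q) with hτ
  have hτδ : δ ≤ τ := by have := hc q hq; linarith
  have h3 : (4 * d + τ) * ‖v q‖ ≤ 4 * d * ‖v‖ + B * τ := by
    refine (mul_le_mul_of_nonneg_right ?_ (norm_nonneg _)).trans h1
    have := norm_sub_ge_of_re_le (c := c q) (d := d)
    linarith
  have h4 : ‖v q‖ ≤ (4 * d * ‖v‖ + B * τ) / (4 * d + τ) := by
    rw [le_div_iff₀ (by linarith)]; linarith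
  refine h4.trans ?_
  have h5 : (4 * d * ‖v‖ + B * τ) / (4 * d + τ) = ‖v‖ - τ * (‖v‖ - B) / (4 * d + τ) := by
    have : 4 * d + τ ≠ 0 := by linarith
    field_simp; ring
  rw [h5]
  gcongr ‖v‖ - ?_
  rw [div_le_div_iff₀ (by linarith) (by linarith)]
  have : 0 ≤ (‖v‖ - B) * (τ - δ) := mul_nonneg (by linarith) (by linarith)
  nlinarith

/-- One Jacobi step off `C`: a uniform bound on `v` yields a bound by the ratio `4 d / δ`. -/
theorem norm_apply_le_of_dominant {d δ B G : ℝ} (hd : 0 < d) (hδ : 0 < δ)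
    {v : LInf 𝕜} {c g : 𝕜} {p : ℤ × ℤ} (hc : RCLike.re c ≤ -δ)
    (hv : d * nb v p + (c - 4 * d) * v p = g)
    (hB : ∀ q, ‖v q‖ ≤ B) (hG : ‖g‖ ≤ G) : ‖v p‖ ≤ (4 * d * B + G) / δ := by
  have h1 : ‖(c - 4 * d) * v p‖ ≤ 4 * d * B + G := by
    have : (c - 4 * d) * v p = g - d * nb v p := by rw [← hv]; ring
    rw [this]
    refine (norm_sub_le _ _).trans ?_
    have h2 : ‖(d : 𝕜) * nb v p‖ ≤ d * (4 * B) := by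
      rw [norm_mul, RCLike.norm_ofReal, abs_of_pos hd]
      exact mul_le_mul_of_nonneg_left (norm_nb_le hB p) hd.le
    linarith
  rw [norm_mul] at h1
  rw [le_div_iff₀ hδ, mul_comm]
  refine (mul_le_mul_of_nonneg_right ?_ (norm_nonneg _)).trans h1
  have := norm_sub_ge_of_re_le (c := c) (d := d)
  linarith

theorem isUnit_pinned {C : Set (ℤ × ℤ)} {d δ : ℝ} (hd : 0 < d) (hδ : 0 < δ) {V : LInf 𝕜}
    (hV : ∀ p ∉ C, RCLike.re (V p) ≤ -δ) : IsUnit (pinned C d V) := by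
  classical
  have hne : ∀ p ∉ C, 4 * d + δ ≤ ‖V p - 4 * (d : 𝕜)‖ := fun p hp => by
    have := norm_sub_ge_of_re_le (c := V p) (d := d)
    linarith [hV p hp]
  have hbd : ∀ p ∉ C, ‖(V p - 4 * (d : 𝕜))⁻¹‖ ≤ (4 * d + δ)⁻¹ := fun p hp => by
    rw [norm_inv]; exact inv_anti₀ (by positivity) (hne p hp)
  have h0 : ∀ p ∉ C, V p - 4 * (d : 𝕜) ≠ 0 := fun p hp h => by
    have := hne p hp; rw [h, norm_zero] at this; linarith
  let w : LInf 𝕜 := ofBound (fun p => if p ∈ C then 0 else (V p - 4 * (d : 𝕜))⁻¹) (4 * d + δ)⁻¹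
    fun p => by
      by_cases hp : p ∈ C
      · simp only [hp, if_true, norm_zero]; positivity
      · simpa [hp] using hbd p hp
  let K : LInf 𝕜 →L[𝕜] LInf 𝕜 := -(mulOp 𝕜 w ∘L ((d : 𝕜) • nbOp 𝕜))
  have hw : ‖w‖ ≤ (4 * d + δ)⁻¹ := norm_le_of_apply_le fun p => by
    by_cases hp : p ∈ C
    · simp only [w, ofBound_apply, hp, if_true, norm_zero]; positivity
    · simpa [w, hp] using hbd p hp
  have hK : ‖K‖ < 1 := by
    rw [norm_neg]
    refine (ContinuousLinearMap.opNorm_comp_le _ _).trans_lt ?_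
    have h1 : ‖(d : 𝕜) • nbOp 𝕜‖ ≤ d * 4 := by
      rw [norm_smul, RCLike.norm_ofReal, abs_of_pos hd]
      exact mul_le_mul_of_nonneg_left norm_nbOp_le hd.le
    calc ‖mulOp 𝕜 w‖ * ‖(d : 𝕜) • nbOp 𝕜‖ ≤ (4 * d + δ)⁻¹ * (d * 4) :=
          mul_le_mul ((norm_mulOp_le w).trans hw) h1 (norm_nonneg _) (by positivity)
      _ < 1 := by rw [inv_mul_lt_iff₀ (by positivity)]; linarith
  let D : LInf 𝕜 := ofBound (fun p => if p ∈ C then 1 else V p - 4 * (d : 𝕜))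
    (1 + ‖V‖ + 4 * d) fun p => by
      by_cases hp : p ∈ C
      · simp only [hp, if_true, norm_one]; linarith [norm_nonneg V]
      · simp only [hp, if_false]
        refine (norm_sub_le _ _).trans ?_
        rw [norm_mul, RCLike.norm_ofReal, abs_of_pos hd, RCLike.norm_ofNat]
        linarith [norm_apply_le V p]
  let D' : LInf 𝕜 := ofBound (fun p => if p ∈ C then 1 else (V p - 4 * (d : 𝕜))⁻¹)
    (1 + (4 * d + δ)⁻¹) fun p => by
      have : 0 < (4 * d + δ)⁻¹ := by positivity
      by_cases hp : p ∈ C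
      · simp only [hp, if_true, norm_one]; linarith
      · simp only [hp, if_false]; linarith [hbd p hp]
  have hD : IsUnit (mulOp 𝕜 D) := by
    refine ⟨⟨mulOp 𝕜 D, mulOp 𝕜 D', ?_, ?_⟩, rfl⟩ <;>
    · ext1 v
      refine linf_ext fun p => ?_
      change _ * (_ * v p) = v p
      by_cases hp : p ∈ C
      · simp [D, D', hp]
      · simp only [D, D', ofBound_apply, hp, if_false]
        field_simp [h0 p hp]
  have hprod : pinned C d V = mulOp 𝕜 D * (1 - K) := by
    ext1 v
    refine linf_ext fun p => ?_
    change _ = D p * (v p - -(w p * ((d : 𝕜) * nb v p)))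
    by_cases hp : p ∈ C
    · rw [pinned_apply_of_mem hp]; simp [D, w, hp]
    · rw [pinned_apply_of_notMem hp]
      simp only [D, w, ofBound_apply, hp, if_false]
      linear_combination (-(d : 𝕜) * nb v p) * mul_inv_cancel₀ (h0 p hp)
  rw [hprod]
  exact hD.mul (isUnit_one_sub_of_norm_lt_one hK)

end Operators

/-! ### Superposition operators -/

section Superposition

/-- The partial derivative of `g` in its first variable. -/
def D1 (g : ℝ × ℝ → ℝ) (p : ℝ × ℝ) : ℝ := fderiv ℝ g p (1, 0)

/-- The partial derivative of `g` in its second variable. -/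
def D2 (g : ℝ × ℝ → ℝ) (p : ℝ × ℝ) : ℝ := fderiv ℝ g p (0, 1)

variable {g : ℝ × ℝ → ℝ}

theorem contDiff_D1 (hg : ContDiff ℝ ∞ g) : ContDiff ℝ ∞ (D1 g) :=
  (hg.fderiv_right (m := ∞) (by simp)).clm_apply contDiff_const

theorem contDiff_D2 (hg : ContDiff ℝ ∞ g) : ContDiff ℝ ∞ (D2 g) :=
  (hg.fderiv_right (m := ∞) (by simp)).clm_apply contDiff_const

theorem fderiv_eq_D1_D2 (p v : ℝ × ℝ) : fderiv ℝ g p v = D1 g p * v.1 + D2 g p * v.2 := by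
  have : v = v.1 • ((1 : ℝ), (0 : ℝ)) + v.2 • ((0 : ℝ), (1 : ℝ)) := by ext <;> simp
  conv_lhs => rw [this]
  rw [map_add, map_smul, map_smul, smul_eq_mul, smul_eq_mul, D1, D2]; ring

theorem hasDerivAt_curve (hg : ContDiff ℝ ∞ g) {a b : ℝ → ℝ} {a' b' t : ℝ}
    (ha : HasDerivAt a a' t) (hb : HasDerivAt b b' t) :
    HasDerivAt (fun s => g (a s, b s)) (D1 g (a t, b t) * a' + D2 g (a t, b t) * b') t := by
  have h := (hg.differentiable (by simp) (a t, b t)).hasFDerivAt.comp_hasDerivAt t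
    (ha.prodMk hb)
  rw [fderiv_eq_D1_D2] at h
  exact h

theorem hasDerivAt_D1 (hg : ContDiff ℝ ∞ g) (x μ : ℝ) :
    HasDerivAt (fun t => g (t, μ)) (D1 g (x, μ)) x := by
  simpa using hasDerivAt_curve hg (hasDerivAt_id x) (hasDerivAt_const x μ)

theorem hasDerivAt_D2 (hg : ContDiff ℝ ∞ g) (x μ : ℝ) :
    HasDerivAt (fun t => g (x, t)) (D2 g (x, μ)) μ := by
  simpa using hasDerivAt_curve hg (hasDerivAt_const μ x) (hasDerivAt_id μ)

theorem abs_le_norm_prod (u : LInf ℝ) (μ : ℝ) (p : ℤ × ℤ) :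
    (u p, μ) ∈ Metric.closedBall (0 : ℝ × ℝ) ‖(u, μ)‖ := by
  rw [mem_closedBall_zero_iff, Prod.norm_def, Prod.norm_def]
  exact max_le_max (norm_apply_le u p) le_rfl

/-- The superposition operator `(u, μ) ↦ (p ↦ g (u p, μ))` on `ℓ^∞ × ℝ`. -/
def nem (g : ℝ × ℝ → ℝ) (hg : Continuous g) (y : LInf ℝ × ℝ) : LInf ℝ :=
  ⟨fun p => g (y.1 p, y.2), by
    obtain ⟨C, hC⟩ := (isCompact_closedBall (0 : ℝ × ℝ) ‖y‖).exists_bound_of_continuousOn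
      hg.continuousOn
    exact memlp_of_bound C fun p => hC _ (abs_le_norm_prod y.1 y.2 p)⟩

@[simp] theorem nem_apply (hg : Continuous g) (y : LInf ℝ × ℝ) (p : ℤ × ℤ) :
    nem g hg y p = g (y.1 p, y.2) := rfl

/-- The derivative of a superposition operator, from the two coefficient functions. -/
def nemDeriv : LInf ℝ × LInf ℝ →L[ℝ] (LInf ℝ × ℝ →L[ℝ] LInf ℝ) :=
  ((ContinuousLinearMap.compL ℝ (LInf ℝ × ℝ) (LInf ℝ) (LInf ℝ)).flip
      (ContinuousLinearMap.fst ℝ (LInf ℝ) ℝ)) ∘L mulOp ℝ ∘L ContinuousLinearMap.fst ℝ _ _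
  + (ContinuousLinearMap.smulRightL ℝ (LInf ℝ × ℝ) (LInf ℝ)
      (ContinuousLinearMap.snd ℝ (LInf ℝ) ℝ)) ∘L ContinuousLinearMap.snd ℝ _ _

theorem nemDeriv_apply (a b h : LInf ℝ) (k : ℝ) (p : ℤ × ℤ) :
    nemDeriv (a, b) (h, k) p = a p * h p + k * b p := rfl

theorem hasFDerivAt_nem (hg : ContDiff ℝ ∞ g) (y : LInf ℝ × ℝ) :
    HasFDerivAt (nem g hg.continuous)
      (nemDeriv (nem _ (contDiff_D1 hg).continuous y, nem _ (contDiff_D2 hg).continuous y)) y := by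
  rw [hasFDerivAt_iff_isLittleO_nhds_zero, Asymptotics.isLittleO_iff]
  intro ε hε
  have hc : Continuous (fderiv ℝ g) := hg.continuous_fderiv (by simp)
  have hu := (isCompact_closedBall (0 : ℝ × ℝ) (‖y‖ + 1)).uniformContinuousOn_of_continuous
    hc.continuousOn
  rw [Metric.uniformContinuousOn_iff] at hu
  obtain ⟨δ, hδ, hu⟩ := hu ε hε
  filter_upwards [Metric.ball_mem_nhds (0 : LInf ℝ × ℝ) (lt_min hδ one_pos)] with h hh
  rw [mem_ball_zero_iff, lt_min_iff] at hh
  refine norm_le_of_apply_le fun p => ?_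
  set P : ℝ × ℝ := (y.1 p, y.2)
  set Q : ℝ × ℝ := (h.1 p, h.2)
  have hP : ‖P‖ ≤ ‖y‖ := mem_closedBall_zero_iff.1 (abs_le_norm_prod y.1 y.2 p)
  have hQ : ‖Q‖ ≤ ‖h‖ := mem_closedBall_zero_iff.1 (abs_le_norm_prod h.1 h.2 p)
  have key := (convex_closedBall P ‖h‖).norm_image_sub_le_of_norm_hasFDerivWithin_le'
    (f := g) (f' := fderiv ℝ g) (φ := fderiv ℝ g P) (C := ε) (x := P) (y := P + Q)
    (fun x _ => (hg.differentiable (by simp) x).hasFDerivAt.hasFDerivWithinAt)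
    (fun x hx => by
      rw [mem_closedBall_iff_norm] at hx
      rw [← dist_eq_norm]
      refine (hu x ?_ P ?_ ?_).le
      · rw [mem_closedBall_zero_iff]
        calc ‖x‖ = ‖x - P + P‖ := by rw [sub_add_cancel]
          _ ≤ ‖x - P‖ + ‖P‖ := norm_add_le _ _
          _ ≤ _ := by linarith [hh.2]
      · rw [mem_closedBall_zero_iff]; linarith
      · rw [dist_eq_norm]; linarith [hh.1])
    (by simp) (by simpa [mem_closedBall_iff_norm] using hQ)
  rw [add_sub_cancel_left, fderiv_eq_D1_D2] at key
  refine le_trans (le_of_eq ?_) (key.trans (mul_le_mul_of_nonneg_left hQ hε.le))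
  change ‖g (y.1 p + h.1 p, y.2 + h.2) - g (y.1 p, y.2)
    - (D1 g P * h.1 p + h.2 * D2 g P)‖ = ‖g (y.1 p + h.1 p, y.2 + h.2) - g (y.1 p, y.2) -
      (D1 g P * h.1 p + D2 g P * h.2)‖
  rw [mul_comm h.2]

theorem contDiff_nem (hg : ContDiff ℝ ∞ g) : ContDiff ℝ ∞ (nem g hg.continuous) := by
  rw [contDiff_infty]
  intro n
  induction n generalizing g with
  | zero =>
    exact contDiff_zero.2 (continuous_iff_continuousAt.2 fun y =>
      (hasFDerivAt_nem hg y).continuousAt)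
  | succ n ih =>
    refine (contDiff_succ_iff_hasFDerivAt (n := n)).2 ⟨_, ?_, fun y => hasFDerivAt_nem hg y⟩
    exact nemDeriv.contDiff.comp ((ih (contDiff_D1 hg)).prodMk (ih (contDiff_D2 hg)))

end Superposition

/-! ### Implicit functions and sign changes -/

section Implicit

variable {E₁ E₂ F : Type*} [NormedAddCommGroup E₁] [NormedSpace ℝ E₁] [CompleteSpace E₁]
  [NormedAddCommGroup E₂] [NormedSpace ℝ E₂] [CompleteSpace E₂]
  [NormedAddCommGroup F] [NormedSpace ℝ F] [CompleteSpace F]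

/-- Nondegenerate zeros persist, smoothly in the parameter. -/
theorem exists_implicit {f : E₁ × E₂ → F} {e : E₁} {y : E₂} (hf : ContDiffAt ℝ ∞ f (e, y))
    (h0 : f (e, y) = 0) {L : E₂ →L[ℝ] F} (hL : L.IsInvertible)
    (hd : HasFDerivAt (fun z => f (e, z)) L y) :
    ∃ ψ : E₁ → E₂, ContDiffAt ℝ ∞ ψ e ∧ ψ e = y ∧ ∀ᶠ x in 𝓝 e, f (x, ψ x) = 0 := by
  have hL' : fderiv ℝ f (e, y) ∘L .inr ℝ E₁ E₂ = L := by
    have h1 : HasFDerivAt (fun z => f (e, z)) (fderiv ℝ f (e, y) ∘L .inr ℝ E₁ E₂) y :=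
      (hf.differentiableAt (by simp)).hasFDerivAt.comp y (hasFDerivAt_prodMk_right e y)
    exact h1.unique hd
  have hI : (fderiv ℝ f (e, y) ∘L .inr ℝ E₁ E₂).IsInvertible := hL' ▸ hL
  refine ⟨hf.implicitFunction (by simp) hI, hf.contDiffAt_implicitFunction (by simp) hI,
    hf.implicitFunction_apply_self (by simp) hI, ?_⟩
  have := hf.eventually_apply_implicitFunction (by simp) hI
  simpa [h0] using this

/-- A function selecting the locally unique nondegenerate zero is smooth. -/
theorem contDiffAt_of_unique_zero {f : E₁ × E₂ → F} {φ : E₁ → E₂} {e : E₁} {y : E₂}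
    (hf : ContDiffAt ℝ ∞ f (e, y))
    (h0 : f (e, y) = 0) {L : E₂ →L[ℝ] F} (hL : L.IsInvertible)
    (hd : HasFDerivAt (fun z => f (e, z)) L y)
    (hu : ∀ᶠ v in 𝓝 (e, y), f v = 0 → φ v.1 = v.2) : ContDiffAt ℝ ∞ φ e := by
  obtain ⟨ψ, h1, h2, h3⟩ := exists_implicit hf h0 hL hd
  refine h1.congr_of_eventuallyEq ?_
  have h4 : Tendsto (fun x => (x, ψ x)) (𝓝 e) (𝓝 (e, y)) := by
    have := (continuousAt_id.prodMk h1.continuousAt : ContinuousAt (fun x => (x, ψ x)) e)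
    simpa [ContinuousAt, h2] using this
  filter_upwards [h3, h4.eventually hu] with x hx hx' using hx' hx

theorem isInvertible_real {c : ℝ} (hc : c ≠ 0) :
    (ContinuousLinearMap.toSpanSingleton ℝ c : ℝ →L[ℝ] ℝ).IsInvertible := by
  refine ⟨ContinuousLinearEquiv.unitsEquivAut ℝ (Units.mk0 c hc), ?_⟩
  ext; simp

/-- The scalar case of `contDiffAt_of_unique_zero`. -/
theorem contDiffAt_of_unique_real_zero {f : E₁ × ℝ → ℝ} {φ : E₁ → ℝ} {e : E₁} {y c : ℝ}
    (hf : ContDiffAt ℝ ∞ f (e, y)) (h0 : f (e, y) = 0) (hc : c ≠ 0)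
    (hd : HasDerivAt (fun z => f (e, z)) c y)
    (hu : ∀ᶠ v in 𝓝 (e, y), f v = 0 → φ v.1 = v.2) : ContDiffAt ℝ ∞ φ e :=
  contDiffAt_of_unique_zero hf h0 (isInvertible_real hc) hd.hasFDerivAt hu

/-- A nondegenerate real zero persists, within any given neighbourhood. -/
theorem eventually_exists_real_zero {f : E₁ × ℝ → ℝ} {e : E₁} {y c : ℝ}
    (hf : ContDiffAt ℝ ∞ f (e, y)) (h0 : f (e, y) = 0) (hc : c ≠ 0)
    (hd : HasDerivAt (fun z => f (e, z)) c y) {S : Set (E₁ × ℝ)} (hS : S ∈ 𝓝 (e, y)) :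
    ∀ᶠ x in 𝓝 e, ∃ z, (x, z) ∈ S ∧ f (x, z) = 0 := by
  obtain ⟨ψ, h1, h2, h3⟩ := exists_implicit hf h0 (isInvertible_real hc) hd.hasFDerivAt
  have h4 : Tendsto (fun x => (x, ψ x)) (𝓝 e) (𝓝 (e, y)) := by
    have := (continuousAt_id.prodMk h1.continuousAt : ContinuousAt (fun x => (x, ψ x)) e)
    simpa [ContinuousAt, h2] using this
  filter_upwards [h3, h4.eventually hS] with x hx hx' using ⟨ψ x, hx', hx⟩

/-- A continuous function that crosses zero upwards at each of its zeros is positive to the right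
of any zero. -/
theorem pos_of_upcrossing {g : ℝ → ℝ} {a b : ℝ} (hg : ContinuousOn g (Icc a b)) (ha : g a = 0)
    (hup : ∀ x ∈ Icc a b, g x = 0 →
      (∀ᶠ y in 𝓝[>] x, 0 < g y) ∧ ∀ᶠ y in 𝓝[<] x, g y < 0) :
    ∀ x ∈ Ioc a b, 0 < g x := by
  intro x hx
  by_contra! hgx
  obtain ⟨y, hy, hyx⟩ : ∃ y, y ∈ Ioo a x ∧ 0 < g y := by
    have h1 := (hup a ⟨le_rfl, hx.1.le.trans hx.2⟩ ha).1
    have h2 : ∀ᶠ y in 𝓝[>] a, y ∈ Ioo a x := Ioo_mem_nhdsGT hx.1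
    obtain ⟨y, hy1, hy2⟩ := (h2.and h1).exists
    exact ⟨y, hy1, hy2⟩
  -- the first zero after `y` is approached from positive values, so it is no upward crossing
  set S : Set ℝ := {t ∈ Icc y x | g t ≤ 0}
  have hSub : Icc y x ⊆ Icc a b := Icc_subset_Icc hy.1.le hx.2
  have hScl : IsCompact S := by
    have : IsClosed S := by
      have := (hg.mono hSub).preimage_isClosed_of_isClosed isClosed_Icc
        (isClosed_Iic (a := (0 : ℝ)))
      exact this
    exact isCompact_Icc.of_isClosed_subset this fun t ht => ht.1
  have hSne : S.Nonempty := ⟨x, ⟨hy.2.le, le_rfl⟩, hgx⟩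
  obtain ⟨z, hz, hmin⟩ := hScl.exists_isLeast hSne
  have hyz : y < z := lt_of_le_of_ne hz.1.1 fun h => by
    have := hz.2; rw [← h] at this; linarith
  have hz0 : g z = 0 := by
    refine le_antisymm hz.2 ?_
    by_contra! hlt
    have hiv := intermediate_value_Icc' hyz.le (hg.mono ((Icc_subset_Icc_right hz.1.2).trans hSub))
    obtain ⟨t, ht, ht0⟩ := hiv ⟨hlt.le, hyx.le⟩
    have h1 : z ≤ t := hmin ⟨⟨ht.1, ht.2.trans hz.1.2⟩, ht0.le⟩
    have h2 : t = z := le_antisymm ht.2 h1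
    rw [h2] at ht0; linarith
  have h1 := (hup z (hSub hz.1) hz0).2
  have h2 : ∀ᶠ t in 𝓝[<] z, t ∈ Ioo y z := Ioo_mem_nhdsLT hyz
  obtain ⟨t, ht1, ht2⟩ := (h1.and h2).exists
  have := hmin ⟨⟨ht2.1.le, ht2.2.le.trans hz.1.2⟩, ht1.le⟩
  linarith [ht2.2]

/-- A continuous function that crosses zero upwards at each of its zeros is negative to the left
of any zero. -/
theorem neg_of_upcrossing {g : ℝ → ℝ} {a b : ℝ} (hg : ContinuousOn g (Icc a b)) (hb : g b = 0)
    (hup : ∀ x ∈ Icc a b, g x = 0 →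
      (∀ᶠ y in 𝓝[>] x, 0 < g y) ∧ ∀ᶠ y in 𝓝[<] x, g y < 0) :
    ∀ x ∈ Ico a b, g x < 0 := by
  intro x hx
  have key := pos_of_upcrossing (g := fun t => -g (-t)) (a := -b) (b := -a)
    (ContinuousOn.neg (hg.comp continuousOn_neg fun t ht =>
      ⟨by linarith [ht.2], by linarith [ht.1]⟩))
    (by simpa using hb)
    (fun t ht h0 => by
      obtain ⟨h1, h2⟩ := hup (-t) ⟨by linarith [ht.2], by linarith [ht.1]⟩ (by simpa using h0)
      constructor
      · have := (tendsto_neg_nhdsGT (a := t)).eventually h2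
        filter_upwards [this] with y hy; linarith
      · have := (tendsto_neg_nhdsLT (a := t)).eventually h1
        filter_upwards [this] with y hy; linarith)
    (-x) ⟨by linarith [hx.2], by linarith [hx.1]⟩
  simpa using key

theorem upcrossing_of_deriv_pos {g : ℝ → ℝ} {x c : ℝ} (h : HasDerivAt g c x) (hc : 0 < c)
    (h0 : g x = 0) : (∀ᶠ y in 𝓝[>] x, 0 < g y) ∧ ∀ᶠ y in 𝓝[<] x, g y < 0 := by
  have h1 := (hasDerivAt_iff_tendsto_slope.1 h).eventually (lt_mem_nhds hc)
  have h2 : ∀ᶠ y in 𝓝[>] x, 0 < slope g x y := nhdsWithin_mono x (fun y hy => ne_of_gt hy) h1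
  have h3 : ∀ᶠ y in 𝓝[<] x, 0 < slope g x y := nhdsWithin_mono x (fun y hy => ne_of_lt hy) h1
  constructor
  · filter_upwards [h2, self_mem_nhdsWithin] with y hy hxy
    have hxy' : (0 : ℝ) < y - x := sub_pos.2 hxy
    rw [slope_def_field, h0, sub_zero] at hy
    exact (div_pos_iff_of_pos_right hxy').1 hy
  · filter_upwards [h3, self_mem_nhdsWithin] with y hy hxy
    have hxy' : y - x < 0 := sub_neg.2 hxy
    rw [slope_def_field, h0, sub_zero] at hy
    rcases div_pos_iff.1 hy with h | h
    · linarith [h.2]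
    · exact h.1

end Implicit

/-! ### Eigenvalue curves of a family of symmetric two-by-two matrices -/

section Roots

/-- The roots of a family of uniformly decreasing functions depend continuously on the
parameter. -/
theorem exists_continuousOn_root {e : ℝ → ℝ → ℝ} {I : Set ℝ}
    (hz : ∀ x ∈ I, Continuous fun z => e z x) (hx : ∀ z, ContinuousOn (fun x => e z x) I)
    (hs : ∀ x ∈ I, ∀ z z', z ≤ z' → e z' x ≤ e z x - (z' - z) / 2) :
    ∃ lam : ℝ → ℝ, ContinuousOn lam I ∧ ∀ x ∈ I, e (lam x) x = 0 := by
  have hex : ∀ x, ∃ z, x ∈ I → e z x = 0 := fun x => by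
    by_cases hxI : x ∈ I
    · have h1 : e (2 * |e 0 x|) x ≤ 0 := by
        have := hs x hxI 0 (2 * |e 0 x|) (by positivity)
        linarith [le_abs_self (e 0 x)]
      have h2 : 0 ≤ e (-(2 * |e 0 x|)) x := by
        have := hs x hxI (-(2 * |e 0 x|)) 0 (by simp)
        linarith [neg_abs_le (e 0 x)]
      obtain ⟨z, -, hz0⟩ := intermediate_value_Icc' (a := -(2 * |e 0 x|)) (b := 2 * |e 0 x|)
        (by linarith [abs_nonneg (e 0 x)]) (hz x hxI).continuousOn ⟨h1, h2⟩
      exact ⟨z, fun _ => hz0⟩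
    · exact ⟨0, fun h => absurd h hxI⟩
  choose lam hlam using hex
  refine ⟨lam, fun x₀ hx₀ => ?_, fun x hxI => hlam x hxI⟩
  have hle : ∀ x ∈ I, |lam x - lam x₀| ≤ 2 * |e (lam x₀) x| := fun x hxI => by
    rcases le_total (lam x₀) (lam x) with h | h
    · have := hs x hxI _ _ h
      rw [hlam x hxI] at this
      rw [abs_of_nonneg (by linarith)]
      linarith [le_abs_self (e (lam x₀) x)]
    · have := hs x hxI _ _ h
      rw [hlam x hxI] at this
      rw [abs_of_nonpos (by linarith)]
      linarith [neg_abs_le (e (lam x₀) x)]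
  have h1 : Tendsto (fun x => 2 * |e (lam x₀) x|) (𝓝[I] x₀) (𝓝 0) := by
    have := ((hx (lam x₀)) x₀ hx₀).abs.const_mul 2
    simpa [ContinuousWithinAt, hlam x₀ hx₀] using this
  rw [ContinuousWithinAt, tendsto_iff_dist_tendsto_zero]
  refine squeeze_zero' (Eventually.of_forall fun _ => dist_nonneg) ?_ h1
  filter_upwards [self_mem_nhdsWithin] with x hxI
  exact hle x hxI

/-- Implicit differentiation of a root when the equation is merely asymptotic to a function `E`
that vanishes along the line of slope `ζ`. -/
theorem hasDerivAt_root {e E : ℝ → ℝ → ℝ} {lam : ℝ → ℝ} {x₀ ζ M γ : ℝ} (hγ : 0 < γ)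
    (h0 : lam x₀ = 0) (hlc : ContinuousAt lam x₀) (hroot : ∀ᶠ x in 𝓝 x₀, e (lam x) x = 0)
    (hs : ∀ᶠ x in 𝓝 x₀, ∀ z, -γ < z → |z| / 2 ≤ |e z x - e 0 x|)
    (hE : (fun q : ℝ × ℝ => e q.1 q.2 - E q.1 (q.2 - x₀)) =o[𝓝 (0, x₀)]
      fun q : ℝ × ℝ => |q.1| + |q.2 - x₀|)
    (hEs : ∀ z z' ξ, |z - z'| / 2 ≤ |E z ξ - E z' ξ|) (hEζ : ∀ ξ, E (ζ * ξ) ξ = 0)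
    (hE0 : ∀ ξ, |E 0 ξ| ≤ M * |ξ|) : HasDerivAt lam ζ x₀ := by
  have hM : 0 ≤ M := by simpa using (abs_nonneg _).trans (hE0 1)
  rw [hasDerivAt_iff_isLittleO, isLittleO_iff]
  intro ε hε
  set η : ℝ := min 1 (ε / (2 * (2 * M + 3))) with hη
  have hηpos : 0 < η := lt_min one_pos (by positivity)
  have hb := (isLittleO_iff.1 hE) hηpos
  have ht1 : Tendsto (fun x => ((0 : ℝ), x)) (𝓝 x₀) (𝓝 (0, x₀)) :=
    (Continuous.prodMk continuous_const continuous_id).tendsto' _ _ rfl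
  have ht2 : Tendsto (fun x => (lam x, x)) (𝓝 x₀) (𝓝 (0, x₀)) := by
    have : ContinuousAt (fun x => (lam x, x)) x₀ := hlc.prodMk continuousAt_id
    simpa [ContinuousAt, h0] using this
  have hγ' : ∀ᶠ x in 𝓝 x₀, -γ < lam x := by
    have : Tendsto lam (𝓝 x₀) (𝓝 0) := by simpa [ContinuousAt, h0] using hlc
    exact this.eventually (lt_mem_nhds (by linarith))
  filter_upwards [hroot, hs, ht1.eventually hb, ht2.eventually hb, hγ'] with x h1 h2 h3 h4 h5
  simp only [Real.norm_eq_abs, abs_zero, zero_add, abs_abs] at h3 h4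
  rw [h1] at h4
  have h6 := h2 (lam x) h5
  rw [h1] at h6
  rw [abs_of_nonneg (a := |lam x| + |x - x₀|) (by positivity)] at h4
  have h7 : |lam x| ≤ 2 * (M + 1) * |x - x₀| := by
    have a1 : |0 - e 0 x| ≤ |e 0 x - E 0 (x - x₀)| + |E 0 (x - x₀)| := by
      rw [zero_sub, abs_neg]
      calc |e 0 x| = |(e 0 x - E 0 (x - x₀)) + E 0 (x - x₀)| := by rw [sub_add_cancel]
        _ ≤ _ := abs_add_le _ _
    have a2 : η * |x - x₀| ≤ 1 * |x - x₀| :=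
      mul_le_mul_of_nonneg_right (min_le_left _ _) (abs_nonneg _)
    linarith [hE0 (x - x₀)]
  have h8 := hEs (lam x) (ζ * (x - x₀)) (x - x₀)
  rw [hEζ, sub_zero] at h8
  rw [zero_sub, abs_neg] at h4
  have h9 : |lam x - ζ * (x - x₀)| ≤ 2 * (η * ((2 * M + 3) * |x - x₀|)) := by
    have : η * (|lam x| + |x - x₀|) ≤ η * ((2 * M + 3) * |x - x₀|) :=
      mul_le_mul_of_nonneg_left (by linarith) hηpos.le
    linarith
  have h10 : η * (2 * (2 * M + 3)) ≤ ε := by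
    have : η ≤ ε / (2 * (2 * M + 3)) := min_le_right _ _
    rwa [le_div_iff₀ (by positivity)] at this
  rw [h0, sub_zero, smul_eq_mul, Real.norm_eq_abs, Real.norm_eq_abs, mul_comm (x - x₀)]
  calc _ ≤ _ := h9
    _ = (η * (2 * (2 * M + 3))) * |x - x₀| := by ring
    _ ≤ _ := mul_le_mul_of_nonneg_right h10 (abs_nonneg _)

theorem slope_pz {pz : ℝ} {n : ℝ → ℝ} (hpz : |pz + 1| ≤ 1 / 4) (b : ℝ)
    (hn : ∀ z z', |n z - n z'| ≤ 1 / 4 * |z - z'|) (z z' : ℝ) :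
    |z - z'| / 2 ≤ |(pz * z + b + n z) - (pz * z' + b + n z')| := by
  have h1 : (pz * z + b + n z) - (pz * z' + b + n z')
      = -(z - z') + ((pz + 1) * (z - z') + (n z - n z')) := by ring
  have h2 : |(pz + 1) * (z - z')| ≤ 1 / 4 * |z - z'| := by
    rw [abs_mul]; exact mul_le_mul_of_nonneg_right hpz (abs_nonneg _)
  have h3 := abs_add_le ((pz + 1) * (z - z')) (n z - n z')
  have h4 := abs_sub_abs_le_abs_sub (z - z') ((pz + 1) * (z - z') + (n z - n z'))
  have h5 : |-(z - z') + ((pz + 1) * (z - z') + (n z - n z'))|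
      = |(z - z') - ((pz + 1) * (z - z') + (n z - n z'))| := by rw [← abs_neg]; congr 1; ring
  rw [h1, h5]
  linarith [hn z z']

/-- The root in `z` of an equation with slope close to `-1` is positive if the constant term is. -/
theorem exists_pos_root {pz b : ℝ} {n : ℝ → ℝ} (hpz : |pz + 1| ≤ 1 / 4)
    (hn : ∀ z z', |n z - n z'| ≤ 1 / 4 * |z - z'|) (hb : |n 0| < b) :
    ∃ ζ > 0, pz * ζ + b + n ζ = 0 := by
  have hnc : Continuous n := by
    refine (LipschitzWith.of_dist_le_mul (K := 1) fun z z' => ?_).continuous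
    rw [Real.dist_eq, Real.dist_eq]
    have := hn z z'
    simp only [NNReal.coe_one, one_mul]
    linarith [abs_nonneg (z - z')]
  have h0 : 0 < b + n 0 := by linarith [neg_abs_le (n 0)]
  set Z := 2 * (b + n 0)
  have hZ : 0 < Z := by positivity
  have h1 : pz * Z + b + n Z ≤ 0 := by
    have a1 := hn Z 0
    rw [sub_zero, abs_of_pos hZ] at a1
    have a2 := (abs_le.1 hpz).2
    nlinarith [(abs_le.1 a1).2]
  obtain ⟨ζ, hζ, hζ0⟩ := intermediate_value_Icc' (f := fun z => pz * z + b + n z) hZ.le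
    (by fun_prop) ⟨h1, by simpa using h0.le⟩
  refine ⟨ζ, lt_of_le_of_ne hζ.1 fun h => ?_, hζ0⟩
  rw [← h] at hζ0
  simp only [mul_zero, zero_add] at hζ0
  linarith

end Roots

section Pairs

/-- A family of symmetric matrices `p + (w.re, w.im; w.im, -w.re)`, with eigenvalues `p ± ‖w‖`,
depending on a spectral parameter `z ≥ -γ`, in which `p` is close to `-z` up to a constant, and on
a parameter `x ∈ [a, b]` that moves the eigenvalues transversely through `0`. -/
structure IsCrossingPair (γ a b : ℝ) (p : ℝ → ℝ → ℝ) (w : ℝ → ℝ → ℂ) : Prop where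
  cont_p : ∀ z ≥ -γ, ContinuousOn (fun x => p z x) (Icc a b)
  cont_w : ∀ z ≥ -γ, ContinuousOn (fun x => w z x) (Icc a b)
  slope_p : ∀ x ∈ Icc a b, ∀ z ≥ -γ, ∀ z' ≥ -γ, |(p z x - p z' x) + (z - z')| ≤ 1 / 4 * |z - z'|
  slope_w : ∀ x ∈ Icc a b, ∀ z ≥ -γ, ∀ z' ≥ -γ, ‖w z x - w z' x‖ ≤ 1 / 4 * |z - z'|
  left : p 0 a < -‖w 0 a‖
  right : ‖w 0 b‖ < p 0 b
  cross : ∀ x ∈ Ioo a b, |p 0 x| = ‖w 0 x‖ → ∃ (P : ℝ × ℝ →L[ℝ] ℝ) (W : ℝ × ℝ →L[ℝ] ℂ),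
    HasFDerivAt (fun q : ℝ × ℝ => p q.1 q.2) P (0, x) ∧
    HasFDerivAt (fun q : ℝ × ℝ => w q.1 q.2) W (0, x) ∧ ‖W (0, 1)‖ < P (0, 1)

namespace IsCrossingPair

theorem clm_apply {F : Type*} [NormedAddCommGroup F] [NormedSpace ℝ F] (L : ℝ × ℝ →L[ℝ] F)
    (q : ℝ × ℝ) : L q = q.1 • L (1, 0) + q.2 • L (0, 1) := by
  rw [← map_smul, ← map_smul, ← map_add]
  congr 1
  ext <;> simp

theorem isLittleO_gauge {F : Type*} [NormedAddCommGroup F] {x : ℝ} {g : ℝ × ℝ → F}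
    (h : g =o[𝓝 (0, x)] fun q => q - (0, x)) :
    g =o[𝓝 (0, x)] fun q : ℝ × ℝ => |q.1| + |q.2 - x| := by
  refine h.trans_isBigO (IsBigO.of_bound 1 (Eventually.of_forall fun q => ?_))
  rw [one_mul, Real.norm_eq_abs, abs_of_nonneg (by positivity), Prod.norm_def]
  refine max_le ?_ ?_
  · simp
  · simp

variable {γ a b : ℝ} {p : ℝ → ℝ → ℝ} {w : ℝ → ℝ → ℂ} (H : IsCrossingPair γ a b p w)

include H

theorem abs_signed_norm_sub {σ : ℝ} (hσ : |σ| = 1) {x : ℝ}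
    (hx : x ∈ Icc a b) {z z' : ℝ} (hz : -γ ≤ z) (hz' : -γ ≤ z') :
    |((p z x + σ * ‖w z x‖) - (p z' x + σ * ‖w z' x‖)) + (z - z')| ≤ 1 / 2 * |z - z'| := by
  have h1 := H.slope_p x hx z hz z' hz'
  have h2 : |σ * (‖w z x‖ - ‖w z' x‖)| ≤ 1 / 4 * |z - z'| := by
    rw [abs_mul, hσ, one_mul]
    exact (abs_norm_sub_norm_le _ _).trans (H.slope_w x hx z hz z' hz')
  calc _ = |((p z x - p z' x) + (z - z')) + σ * (‖w z x‖ - ‖w z' x‖)| := by congr 1; ring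
    _ ≤ _ := (abs_add_le _ _).trans (by linarith)

/-- The curve of zeros in `z` of the eigenvalue `p + σ ‖w‖`, continued below `-γ` by a line. -/
theorem exists_curve {σ : ℝ} (hσ : |σ| = 1) :
    ∃ lam : ℝ → ℝ, ContinuousOn lam (Icc a b) ∧
      ∀ x ∈ Icc a b, ∀ z > -γ, (z = lam x ↔ p z x + σ * ‖w z x‖ = 0) := by
  set e : ℝ → ℝ → ℝ := fun z x =>
    (p (max z (-γ)) x + σ * ‖w (max z (-γ)) x‖) - min (z + γ) 0 with he
  have hdec : ∀ x ∈ Icc a b, ∀ z z', -γ ≤ z → z ≤ z' →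
      p z' x + σ * ‖w z' x‖ ≤ p z x + σ * ‖w z x‖ - (z' - z) / 2 := fun x hx z z' hz hzz => by
    have := (abs_le.1 (H.abs_signed_norm_sub hσ hx (hz.trans hzz) hz)).2
    rw [abs_of_nonneg (by linarith)] at this
    linarith
  have hs : ∀ x ∈ Icc a b, ∀ z z', z ≤ z' → e z' x ≤ e z x - (z' - z) / 2 := by
    intro x hx z z' hzz
    have h1 := hdec x hx (max z (-γ)) (max z' (-γ)) (le_max_right _ _) (max_le_max hzz le_rfl)
    simp only [he]
    rcases le_total z (-γ) with h2 | h2 <;> rcases le_total z' (-γ) with h3 | h3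
    · rw [max_eq_right h2, max_eq_right h3] at *
      rw [min_eq_left (by linarith), min_eq_left (by linarith)]; linarith
    · rw [max_eq_right h2, max_eq_left h3] at *
      rw [min_eq_right (by linarith), min_eq_left (by linarith)]; linarith
    · have : z = z' := le_antisymm hzz (h3.trans h2)
      subst this; linarith
    · rw [max_eq_left h2, max_eq_left h3] at *
      rw [min_eq_right (by linarith), min_eq_right (by linarith)]; linarith
  have hzc : ∀ x ∈ Icc a b, Continuous fun z => e z x := fun x hx => by
    have h1 : ContinuousOn (fun z => p z x + σ * ‖w z x‖) (Ici (-γ)) := by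
      refine LipschitzOnWith.continuousOn (K := 2) (LipschitzOnWith.of_dist_le_mul ?_)
      intro z hz z' hz'
      rw [Real.dist_eq, Real.dist_eq]
      have h := H.abs_signed_norm_sub hσ hx hz hz'
      set X := (p z x + σ * ‖w z x‖) - (p z' x + σ * ‖w z' x‖)
      have h2 : |X| ≤ |X + (z - z')| + |z - z'| := by
        have := abs_sub (X + (z - z')) (z - z')
        rwa [add_sub_cancel_right] at this
      have h3 : ((2 : NNReal) : ℝ) = 2 := rfl
      rw [h3]
      linarith [abs_nonneg (z - z')]
    have h2 : Continuous fun z : ℝ => max z (-γ) := by fun_prop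
    have h3 := h1.comp_continuous h2 fun z => mem_Ici.2 (le_max_right _ _)
    exact h3.sub (by fun_prop)
  have hxc : ∀ z, ContinuousOn (fun x => e z x) (Icc a b) := fun z => by
    have h1 := H.cont_p (max z (-γ)) (le_max_right _ _)
    have h2 := H.cont_w (max z (-γ)) (le_max_right _ _)
    exact (h1.add (continuousOn_const.mul h2.norm)).sub continuousOn_const
  obtain ⟨lam, hl1, hl2⟩ := exists_continuousOn_root hzc hxc hs
  refine ⟨lam, hl1, fun x hx z hz => ⟨fun h => ?_, fun h => ?_⟩⟩
  · have h3 := hl2 x hx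
    rw [← h] at h3
    simp only [he] at h3
    rwa [max_eq_left hz.le, min_eq_right (by linarith), sub_zero] at h3
  · have h3 : e z x = 0 := by
      simp only [he]
      rwa [max_eq_left hz.le, min_eq_right (by linarith), sub_zero]
    rcases le_total z (lam x) with h4 | h4
    · have := hs x hx _ _ h4
      rw [h3, hl2 x hx] at this; linarith
    · have := hs x hx _ _ h4
      rw [h3, hl2 x hx] at this; linarith

theorem abs_P_le (hγ : 0 < γ) {x : ℝ} (hx : x ∈ Icc a b)
    {P : ℝ × ℝ →L[ℝ] ℝ} (hP : HasFDerivAt (fun q : ℝ × ℝ => p q.1 q.2) P (0, x)) :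
    |P (1, 0) + 1| ≤ 1 / 4 := by
  have h1 : HasDerivAt (fun z => p z x + z) (P (1, 0) + 1) 0 := by
    have h2 : HasDerivAt (fun z : ℝ => (z, x)) (1, 0) 0 :=
      (hasDerivAt_id (0 : ℝ)).prodMk (hasDerivAt_const (0 : ℝ) x)
    exact (hP.comp_hasDerivAt (0 : ℝ) h2).add (hasDerivAt_id 0)
  have h3 := h1.le_of_lip' (C := 1 / 4) (by norm_num) (by
    filter_upwards [lt_mem_nhds (show -γ < 0 by linarith)] with z hz
    have := H.slope_p x hx z hz.le 0 (by linarith)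
    rw [Real.norm_eq_abs, Real.norm_eq_abs]
    convert this using 2; ring)
  simpa using h3

theorem norm_W_le (hγ : 0 < γ) {x : ℝ} (hx : x ∈ Icc a b)
    {W : ℝ × ℝ →L[ℝ] ℂ} (hW : HasFDerivAt (fun q : ℝ × ℝ => w q.1 q.2) W (0, x)) :
    ‖W (1, 0)‖ ≤ 1 / 4 := by
  have h1 : HasDerivAt (fun z => w z x) (W (1, 0)) 0 := by
    have h2 : HasDerivAt (fun z : ℝ => (z, x)) (1, 0) 0 :=
      (hasDerivAt_id (0 : ℝ)).prodMk (hasDerivAt_const (0 : ℝ) x)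
    exact hW.comp_hasDerivAt (0 : ℝ) h2
  exact h1.le_of_lip' (C := 1 / 4) (by norm_num) (by
    filter_upwards [lt_mem_nhds (show -γ < 0 by linarith)] with z hz
    simpa using H.slope_w x hx z hz.le 0 (by linarith))

/-- Implicit differentiation along a curve of zeros of `p + τ ‖w‖`, where `τ` is a sign that may
depend on the parameter. -/
theorem hasDerivAt_of_root (hγ : 0 < γ) {τ : ℝ → ℝ} (hτ : ∀ x, |τ x| = 1) {lam : ℝ → ℝ}
    (hl : ContinuousOn lam (Icc a b))
    (hr : ∀ x ∈ Icc a b, ∀ z > -γ, (z = lam x ↔ p z x + τ x * ‖w z x‖ = 0)) {x₀ : ℝ}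
    (hx₀ : x₀ ∈ Ioo a b) (h0 : lam x₀ = 0) {E : ℝ → ℝ → ℝ} {ζ M : ℝ}
    (hE : (fun q : ℝ × ℝ => p q.1 q.2 + τ q.2 * ‖w q.1 q.2‖ - E q.1 (q.2 - x₀))
      =o[𝓝 (0, x₀)] fun q : ℝ × ℝ => |q.1| + |q.2 - x₀|)
    (hEs : ∀ z z' ξ, |z - z'| / 2 ≤ |E z ξ - E z' ξ|) (hEζ : ∀ ξ, E (ζ * ξ) ξ = 0)
    (hE0 : ∀ ξ, |E 0 ξ| ≤ M * |ξ|) : HasDerivAt lam ζ x₀ := by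
  have hI := Icc_mem_nhds hx₀.1 hx₀.2
  have hlc := hl.continuousAt hI
  refine hasDerivAt_root (e := fun z x => p z x + τ x * ‖w z x‖) hγ h0 hlc ?_ ?_ hE hEs hEζ hE0
  · have h1 : Tendsto lam (𝓝 x₀) (𝓝 0) := by simpa [ContinuousAt, h0] using hlc
    filter_upwards [h1.eventually (lt_mem_nhds (show -γ < 0 by linarith)), hI] with x hx1 hx2
    exact (hr x hx2 _ hx1).1 rfl
  · filter_upwards [hI] with x hx z hz
    have := H.abs_signed_norm_sub (hτ x) hx hz.le (show -γ ≤ 0 by linarith)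
    rw [sub_zero] at this
    set X := p z x + τ x * ‖w z x‖ - (p 0 x + τ x * ‖w 0 x‖)
    have h2 := abs_sub (X + z) X
    rw [add_sub_cancel_left] at h2
    linarith

/-- Where exactly one of the two eigenvalues vanishes, it crosses with positive speed. -/
theorem hasDerivAt_simple (hγ : 0 < γ) {σ : ℝ} (hσ : |σ| = 1)
    {lam : ℝ → ℝ} (hl : ContinuousOn lam (Icc a b))
    (hr : ∀ x ∈ Icc a b, ∀ z > -γ, (z = lam x ↔ p z x + σ * ‖w z x‖ = 0)) {x₀ : ℝ}
    (hx₀ : x₀ ∈ Ioo a b) (h0 : lam x₀ = 0) (hw : w 0 x₀ ≠ 0) :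
    ∃ c > 0, HasDerivAt lam c x₀ := by
  have hx' := Ioo_subset_Icc_self hx₀
  have he0 : p 0 x₀ + σ * ‖w 0 x₀‖ = 0 := (hr x₀ hx' 0 (by linarith)).1 h0.symm
  obtain ⟨P, W, hP, hW, hPW⟩ := H.cross x₀ hx₀ (by
    have : p 0 x₀ = -(σ * ‖w 0 x₀‖) := by linarith
    rw [this, abs_neg, abs_mul, hσ, one_mul, abs_norm])
  have hP1 := H.abs_P_le hγ hx' hP
  have hW1 := H.norm_W_le hγ hx' hW
  set N := fderiv ℝ (fun v : ℂ => ‖v‖) (w 0 x₀) with hN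
  have hNd : HasFDerivAt (fun v : ℂ => ‖v‖) N (w 0 x₀) :=
    ((contDiffAt_norm ℝ hw).differentiableAt one_ne_zero).hasFDerivAt
  have hN1 : ∀ v, ‖N v‖ ≤ ‖v‖ := fun v => by
    refine (N.le_opNorm v).trans ?_
    have : ‖N‖ ≤ 1 := norm_fderiv_le_of_lipschitz ℝ (C := 1) lipschitzWith_one_norm
    nlinarith [norm_nonneg v]
  have hD : HasFDerivAt (fun q : ℝ × ℝ => p q.1 q.2 + σ * ‖w q.1 q.2‖) (P + σ • (N ∘L W))
      (0, x₀) := hP.add ((hNd.comp (0, x₀) hW).const_mul σ)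
  have hn : ∀ z z' : ℝ, |σ * N (z • W (1, 0) + W (0, 1)) - σ * N (z' • W (1, 0) + W (0, 1))|
      ≤ 1 / 4 * |z - z'| := fun z z' => by
    rw [← mul_sub, ← map_sub, add_sub_add_right_eq_sub, ← sub_smul, abs_mul, hσ, one_mul]
    refine (hN1 _).trans ?_
    rw [norm_smul, Real.norm_eq_abs, mul_comm]
    exact mul_le_mul_of_nonneg_right hW1 (abs_nonneg _)
  obtain ⟨ζ, hζ, hζ0⟩ := exists_pos_root (b := P (0, 1)) hP1 hn (by
    rw [zero_smul, zero_add, abs_mul, hσ, one_mul]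
    exact (hN1 _).trans_lt hPW)
  set L := P + σ • (N ∘L W) with hL
  have hLq : ∀ z ξ, L (z, ξ) = P (1, 0) * z + P (0, 1) * ξ
      + σ * N (z • W (1, 0) + ξ • W (0, 1)) := fun z ξ => by
    have : L (z, ξ) = P (z, ξ) + σ * N (W (z, ξ)) := rfl
    rw [this, clm_apply P, clm_apply W]
    simp only [smul_eq_mul]; ring
  refine ⟨ζ, hζ, H.hasDerivAt_of_root hγ (τ := fun _ => σ) (fun _ => hσ) hl hr hx₀ h0
    (E := fun z ξ => L (z, ξ)) (M := ‖L (0, 1)‖) ?_ ?_ ?_ ?_⟩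
  · refine (isLittleO_gauge hD.isLittleO).congr_left fun q => ?_
    have : q - (0, x₀) = (q.1, q.2 - x₀) := by ext <;> simp
    rw [this, he0]; simp
  · intro z z' ξ
    simp only [hLq]
    refine slope_pz (n := fun z => σ * N (z • W (1, 0) + ξ • W (0, 1))) hP1 (P (0, 1) * ξ)
      (fun z z' => ?_) z z'
    rw [← mul_sub, ← map_sub, add_sub_add_right_eq_sub, ← sub_smul, abs_mul, hσ, one_mul]
    refine (hN1 _).trans ?_
    rw [norm_smul, Real.norm_eq_abs, mul_comm]
    exact mul_le_mul_of_nonneg_right hW1 (abs_nonneg _)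
  · intro ξ
    have h1 : L (ζ * ξ, ξ) = ξ * L (ζ, 1) := by
      have : ((ζ * ξ, ξ) : ℝ × ℝ) = ξ • (ζ, 1) := by ext <;> simp [mul_comm]
      rw [this, map_smul, smul_eq_mul]
    have h2 : L (ζ, 1) = 0 := by rw [hLq, one_smul, mul_one]; exact hζ0
    rw [h1, h2, mul_zero]
  · intro ξ
    have : ((0, ξ) : ℝ × ℝ) = ξ • (0, 1) := by ext <;> simp
    rw [this, map_smul, smul_eq_mul, abs_mul, mul_comm, Real.norm_eq_abs]

/-- Where both eigenvalues vanish, the curve that follows the eigenvalue `p + σ ‖w‖` up to the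
crossing and `p - σ ‖w‖` from there on is differentiable and crosses with positive speed. -/
theorem hasDerivAt_double (hγ : 0 < γ) {σ : ℝ} (hσ : |σ| = 1)
    {lam : ℝ → ℝ} {x₀ : ℝ} (hl : ContinuousOn lam (Icc a b))
    (hr : ∀ x ∈ Icc a b, ∀ z > -γ,
      (z = lam x ↔ p z x + (if x ≤ x₀ then σ else -σ) * ‖w z x‖ = 0))
    (hx₀ : x₀ ∈ Ioo a b) (h0 : lam x₀ = 0) (hw : w 0 x₀ = 0) :
    ∃ c > 0, HasDerivAt lam c x₀ := by
  have hx' := Ioo_subset_Icc_self hx₀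
  have he0 : p 0 x₀ = 0 := by
    simpa [hw] using (hr x₀ hx' 0 (by linarith)).1 h0.symm
  obtain ⟨P, W, hP, hW, hPW⟩ := H.cross x₀ hx₀ (by simp [he0, hw])
  have hP1 := H.abs_P_le hγ hx' hP
  have hW1 := H.norm_W_le hγ hx' hW
  have hn : ∀ (τ : ℝ) (ξ : ℝ), |τ| = 1 → ∀ z z' : ℝ,
      |τ * ‖z • W (1, 0) + ξ • W (0, 1)‖ - τ * ‖z' • W (1, 0) + ξ • W (0, 1)‖|
      ≤ 1 / 4 * |z - z'| := fun τ ξ hτ z z' => by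
    rw [← mul_sub, abs_mul, hτ, one_mul]
    refine (abs_norm_sub_norm_le _ _).trans ?_
    rw [add_sub_add_right_eq_sub, ← sub_smul, norm_smul, Real.norm_eq_abs, mul_comm]
    exact mul_le_mul_of_nonneg_right hW1 (abs_nonneg _)
  obtain ⟨ζ, hζ, hζ0⟩ := exists_pos_root (b := P (0, 1)) hP1
    (hn (-σ) 1 (by rwa [abs_neg])) (by
      rw [zero_smul, zero_add, one_smul, abs_mul, abs_neg, hσ, one_mul, abs_norm]; exact hPW)
  have hs1 : ∀ ξ : ℝ, |(if ξ ≤ 0 then σ else -σ)| = 1 := fun ξ => by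
    split_ifs <;> simp [hσ]
  have hs2 : ∀ x : ℝ, (if x ≤ x₀ then σ else -σ) = if x - x₀ ≤ 0 then σ else -σ := fun x => by
    simp only [sub_nonpos]
  refine ⟨ζ, hζ, H.hasDerivAt_of_root hγ (τ := fun x => if x ≤ x₀ then σ else -σ)
    (fun x => by split_ifs <;> simp [hσ]) hl hr hx₀ h0
    (E := fun z ξ => P (1, 0) * z + P (0, 1) * ξ
      + (if ξ ≤ 0 then σ else -σ) * ‖z • W (1, 0) + ξ • W (0, 1)‖)
    (M := |P (0, 1)| + ‖W (0, 1)‖) ?_ ?_ ?_ ?_⟩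
  · have h1 := (isLittleO_gauge hP.isLittleO).norm_left.add (isLittleO_gauge hW.isLittleO).norm_left
    refine IsBigO.trans_isLittleO (IsBigO.of_bound 1 (Eventually.of_forall fun q => ?_)) h1
    have hq : q - (0, x₀) = (q.1, q.2 - x₀) := by ext <;> simp
    rw [hq, clm_apply P (q.1, q.2 - x₀), clm_apply W (q.1, q.2 - x₀), he0, hw, sub_zero,
      sub_zero, hs2, one_mul, Real.norm_eq_abs, Real.norm_eq_abs,
      abs_of_nonneg (a := _ + _) (by positivity)]
    simp only [smul_eq_mul]
    set τ := if q.2 - x₀ ≤ 0 then σ else -σ with hτ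
    have hτ1 : |τ| = 1 := hs1 _
    calc _ = |(p q.1 q.2 - (q.1 * P (1, 0) + (q.2 - x₀) * P (0, 1)))
          + τ * (‖w q.1 q.2‖ - ‖q.1 • W (1, 0) + (q.2 - x₀) • W (0, 1)‖)| := by
            congr 1; ring
      _ ≤ _ := (abs_add_le _ _).trans ?_
    gcongr ?_ + ?_
    · rw [Real.norm_eq_abs]
    · rw [abs_mul, hτ1, one_mul]; exact abs_norm_sub_norm_le _ _
  · intro z z' ξ
    exact slope_pz hP1 (P (0, 1) * ξ) (hn _ ξ (hs1 ξ)) z z'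
  · intro ξ
    have h1 : (if ξ ≤ 0 then σ else -σ) * ‖(ζ * ξ) • W (1, 0) + ξ • W (0, 1)‖
        = ξ * (-σ * ‖ζ • W (1, 0) + (1 : ℝ) • W (0, 1)‖) := by
      have : (ζ * ξ) • W (1, 0) + ξ • W (0, 1) = ξ • (ζ • W (1, 0) + (1 : ℝ) • W (0, 1)) := by
        rw [smul_add, smul_smul, smul_smul, mul_comm ξ, mul_one]
      rw [this, norm_smul, Real.norm_eq_abs]
      split_ifs with h
      · rw [abs_of_nonpos h]; ring
      · rw [abs_of_pos (not_le.1 h)]; ring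
    simp only [h1]
    linear_combination ξ * hζ0
  · intro ξ
    rw [mul_zero, zero_add, zero_smul, zero_add, norm_smul, Real.norm_eq_abs]
    refine (abs_add_le _ _).trans ?_
    rw [abs_mul, abs_mul, hs1, abs_mul, abs_abs, abs_norm]
    apply le_of_eq; ring

/-- The signed eigenvalues pass through zero from below, even where they are not differentiable. -/
theorem upcrossing {σ : ℝ} (hσ : |σ| = 1) {x : ℝ}
    (hx : x ∈ Ioo a b) (h0 : p 0 x + σ * ‖w 0 x‖ = 0) :
    (∀ᶠ y in 𝓝[>] x, 0 < p 0 y + σ * ‖w 0 y‖) ∧ ∀ᶠ y in 𝓝[<] x, p 0 y + σ * ‖w 0 y‖ < 0 := by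
  obtain ⟨P, W, hP, hW, hPW⟩ := H.cross x hx (by
    have : p 0 x = -(σ * ‖w 0 x‖) := by linarith
    rw [this, abs_neg, abs_mul, hσ, one_mul, abs_norm])
  have h2 : HasDerivAt (fun y : ℝ => ((0 : ℝ), y)) (0, 1) x :=
    (hasDerivAt_const x (0 : ℝ)).prodMk (hasDerivAt_id x)
  have hp := hP.comp_hasDerivAt x h2
  have hw := hW.comp_hasDerivAt x h2
  rw [hasDerivAt_iff_isLittleO, isLittleO_iff] at hp hw
  set ε := (P (0, 1) - ‖W (0, 1)‖) / 3 with hε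
  have hε0 : 0 < ε := by rw [hε]; linarith
  have key : ∀ᶠ y in 𝓝 x, |(p 0 y + σ * ‖w 0 y‖) - (y - x) * P (0, 1)|
      ≤ (‖W (0, 1)‖ + 2 * ε) * |y - x| := by
    filter_upwards [hp hε0, hw hε0] with y h3 h4
    simp only [Function.comp, smul_eq_mul, Real.norm_eq_abs] at h3 h4
    have h5 : ‖w 0 y - w 0 x‖ ≤ (‖W (0, 1)‖ + ε) * |y - x| := by
      have := norm_add_le (w 0 y - w 0 x - (y - x) • W (0, 1)) ((y - x) • W (0, 1))
      rw [sub_add_cancel, norm_smul, Real.norm_eq_abs] at this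
      linarith
    have h6 : |σ * (‖w 0 y‖ - ‖w 0 x‖)| ≤ (‖W (0, 1)‖ + ε) * |y - x| := by
      rw [abs_mul, hσ, one_mul]
      exact (abs_norm_sub_norm_le _ _).trans h5
    calc _ = |(p 0 y - p 0 x - (y - x) * P (0, 1)) + σ * (‖w 0 y‖ - ‖w 0 x‖)| := by
          congr 1; linear_combination h0
      _ ≤ _ := (abs_add_le _ _).trans (by linarith)
  have hP3 : P (0, 1) = ‖W (0, 1)‖ + 3 * ε := by rw [hε]; ring
  constructor
  · filter_upwards [nhdsWithin_le_nhds key, self_mem_nhdsWithin] with y h3 hy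
    have hy' : 0 < y - x := sub_pos.2 hy
    rw [abs_of_pos hy', hP3] at h3
    nlinarith [(abs_le.1 h3).1]
  · filter_upwards [nhdsWithin_le_nhds key, self_mem_nhdsWithin] with y h3 hy
    have hy' : y - x < 0 := sub_neg.2 hy
    rw [abs_of_neg hy', hP3] at h3
    nlinarith [(abs_le.1 h3).2]

theorem exists_unique_zero (hγ : 0 < γ) (hab : a < b) {σ : ℝ}
    (hσ : |σ| = 1) : ∃ x₀ ∈ Ioo a b, p 0 x₀ + σ * ‖w 0 x₀‖ = 0 ∧
      ∀ x ∈ Icc a b, p 0 x + σ * ‖w 0 x‖ = 0 → x = x₀ := by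
  have hc : ContinuousOn (fun x => p 0 x + σ * ‖w 0 x‖) (Icc a b) :=
    (H.cont_p 0 (by linarith)).add (continuousOn_const.mul (H.cont_w 0 (by linarith)).norm)
  have hσn : ∀ v : ℂ, |σ * ‖v‖| = ‖v‖ := fun v => by rw [abs_mul, hσ, one_mul, abs_norm]
  have h1 : p 0 a + σ * ‖w 0 a‖ < 0 := by
    linarith [H.left, le_abs_self (σ * ‖w 0 a‖), hσn (w 0 a)]
  have h2 : 0 < p 0 b + σ * ‖w 0 b‖ := by
    linarith [H.right, neg_abs_le (σ * ‖w 0 b‖), hσn (w 0 b)]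
  obtain ⟨x₀, hx₀, h0⟩ := intermediate_value_Ioo hab.le hc ⟨h1, h2⟩
  have hIoo : ∀ x ∈ Icc a b, p 0 x + σ * ‖w 0 x‖ = 0 → x ∈ Ioo a b := fun x hx h => by
    refine ⟨lt_of_le_of_ne hx.1 ?_, lt_of_le_of_ne hx.2 ?_⟩
    · rintro rfl; linarith
    · rintro rfl; linarith
  refine ⟨x₀, hx₀, h0, fun x hx hx0 => ?_⟩
  rcases lt_trichotomy x x₀ with h | h | h
  · have hsub : Icc x x₀ ⊆ Icc a b := Icc_subset_Icc hx.1 hx₀.2.le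
    have := pos_of_upcrossing (hc.mono hsub) hx0
      (fun y hy hy0 => H.upcrossing hσ (hIoo y (hsub hy) hy0) hy0) x₀ ⟨h, le_rfl⟩
    simp only [h0] at this; exact absurd this (lt_irrefl _)
  · exact h
  · have hsub : Icc x₀ x ⊆ Icc a b := Icc_subset_Icc hx₀.1.le hx.2
    have := pos_of_upcrossing (hc.mono hsub) h0
      (fun y hy hy0 => H.upcrossing hσ (hIoo y (hsub hy) hy0) hy0) x ⟨h, le_rfl⟩
    simp only [hx0] at this; exact absurd this (lt_irrefl _)

/-- The two eigenvalue curves can be labelled so that both are continuous and each crosses zero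
exactly once, differentiably and with positive speed. When both vanish at the same parameter, the
labels are exchanged there. -/
theorem exists_eigenvalue_curves (hγ : 0 < γ) (hab : a < b) :
    ∃ l₁ l₂ : ℝ → ℝ, (∀ l ∈ ({l₁, l₂} : Set (ℝ → ℝ)), ContinuousOn l (Icc a b) ∧
      ∃ x₀ ∈ Ioo a b, l x₀ = 0 ∧ (∀ x ∈ Icc a b, l x = 0 → x = x₀) ∧
        ∃ c > 0, HasDerivAt l c x₀) ∧
      ∀ x ∈ Icc a b, ∀ z > -γ, (z = l₁ x ∧ p z x + ‖w z x‖ = 0 ∨ z ≠ l₁ x ∧ p z x + ‖w z x‖ ≠ 0) ∧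
          (z = l₂ x ∧ p z x - ‖w z x‖ = 0 ∨ z ≠ l₂ x ∧ p z x - ‖w z x‖ ≠ 0) ∨
        (z = l₁ x ∧ p z x - ‖w z x‖ = 0 ∨ z ≠ l₁ x ∧ p z x - ‖w z x‖ ≠ 0) ∧
          (z = l₂ x ∧ p z x + ‖w z x‖ = 0 ∨ z ≠ l₂ x ∧ p z x + ‖w z x‖ ≠ 0) := by
  have h1 : |(1 : ℝ)| = 1 := abs_one
  have h2 : |(-1 : ℝ)| = 1 := by simp
  obtain ⟨lp, hlp, hlp'⟩ := H.exists_curve h1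
  obtain ⟨lm, hlm, hlm'⟩ := H.exists_curve h2
  obtain ⟨xp, hxp, hxp0, hxpu⟩ := H.exists_unique_zero hγ hab h1
  obtain ⟨xm, hxm, hxm0, hxmu⟩ := H.exists_unique_zero hγ hab h2
  have hzp : ∀ x ∈ Icc a b, lp x = 0 → x = xp := fun x hx h =>
    hxpu x hx ((hlp' x hx 0 (by linarith)).1 h.symm)
  have hzm : ∀ x ∈ Icc a b, lm x = 0 → x = xm := fun x hx h =>
    hxmu x hx ((hlm' x hx 0 (by linarith)).1 h.symm)
  have hp0 : lp xp = 0 := ((hlp' xp (Ioo_subset_Icc_self hxp) 0 (by linarith)).2 hxp0).symm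
  have hm0 : lm xm = 0 := ((hlm' xm (Ioo_subset_Icc_self hxm) 0 (by linarith)).2 hxm0).symm
  by_cases hne : xp = xm
  · subst hne
    have hw : w 0 xp = 0 := by
      have : ‖w 0 xp‖ = 0 := by linarith
      exact norm_eq_zero.1 this
    have key : ∀ (σ : ℝ) (f g : ℝ → ℝ), |σ| = 1 → ContinuousOn f (Icc a b) →
        ContinuousOn g (Icc a b) → f xp = 0 → g xp = 0 →
        (∀ x ∈ Icc a b, ∀ z > -γ, (z = f x ↔ p z x + σ * ‖w z x‖ = 0)) →
        (∀ x ∈ Icc a b, ∀ z > -γ, (z = g x ↔ p z x + -σ * ‖w z x‖ = 0)) →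
        (∀ x ∈ Icc a b, f x = 0 → x = xp) → (∀ x ∈ Icc a b, g x = 0 → x = xp) →
        ContinuousOn (fun x => if x ≤ xp then f x else g x) (Icc a b) ∧
        ∃ x₀ ∈ Ioo a b, (if x₀ ≤ xp then f x₀ else g x₀) = 0 ∧
          (∀ x ∈ Icc a b, (if x ≤ xp then f x else g x) = 0 → x = x₀) ∧
          ∃ c > 0, HasDerivAt (fun x => if x ≤ xp then f x else g x) c x₀ := by
      intro σ f g hσ hf hg hf0 hg0 hfr hgr hfu hgu
      have hc : ContinuousOn (fun x => if x ≤ xp then f x else g x) (Icc a b) := by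
        refine ContinuousOn.if ?_ (hf.mono inter_subset_left) (hg.mono inter_subset_left)
        rintro x ⟨-, hx⟩
        have : x = xp := frontier_Iic_subset xp hx
        rw [this, hf0, hg0]
      refine ⟨hc, xp, hxp, by rw [if_pos le_rfl, hf0], fun x hx h => ?_,
        H.hasDerivAt_double hγ hσ hc (fun x hx z hz => ?_) hxp (by rw [if_pos le_rfl, hf0]) hw⟩
      · split_ifs at h
        exacts [hfu x hx h, hgu x hx h]
      · split_ifs
        exacts [hfr x hx z hz, hgr x hx z hz]
    refine ⟨fun x => if x ≤ xp then lp x else lm x, fun x => if x ≤ xp then lm x else lp x, ?_,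
      fun x hx z hz => ?_⟩
    · rintro l (rfl | rfl)
      · exact key 1 lp lm h1 hlp hlm hp0 hm0 hlp' hlm' hzp hzm
      · exact key (-1) lm lp h2 hlm hlp hm0 hp0 hlm' (by simpa using hlp') hzm hzp
    · have e1 := hlp' x hx z hz
      have e2 := hlm' x hx z hz
      rw [one_mul] at e1
      rw [neg_one_mul, ← sub_eq_add_neg] at e2
      beta_reduce
      split_ifs
      · rw [e1, e2]; tauto
      · rw [e1, e2]; tauto
  · refine ⟨lp, lm, ?_, fun x hx z hz => ?_⟩
    · rintro l (rfl | rfl)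
      · refine ⟨hlp, xp, hxp, hp0, hzp, H.hasDerivAt_simple hγ h1 hlp hlp' hxp hp0 fun hw => hne ?_⟩
        refine hxmu xp (Ioo_subset_Icc_self hxp) ?_
        rw [hw] at hxp0 ⊢; simpa using hxp0
      · refine ⟨hlm, xm, hxm, hm0, hzm, H.hasDerivAt_simple hγ h2 hlm hlm' hxm hm0 fun hw => hne ?_⟩
        refine (hxpu xm (Ioo_subset_Icc_self hxm) ?_).symm
        rw [hw] at hxm0 ⊢; simpa using hxm0
    · have e1 := hlp' x hx z hz
      have e2 := hlm' x hx z hz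
      rw [one_mul] at e1
      rw [neg_one_mul, ← sub_eq_add_neg] at e2
      rw [e1, e2]; tauto

end IsCrossingPair

end Pairs

/-! ### The Schur complement of a lattice Schrödinger operator on a finite set -/

section Schur

variable {𝕜 : Type} [RCLike 𝕜]

/-- The operator `v ↦ d Δv + V v`. -/
def hop (d : ℝ) (V : LInf 𝕜) : LInf 𝕜 →L[𝕜] LInf 𝕜 :=
  (d : 𝕜) • nbOp 𝕜 + mulOp 𝕜 V - (4 * d : 𝕜) • ContinuousLinearMap.id 𝕜 (LInf 𝕜)

theorem hop_apply (d : ℝ) (V v : LInf 𝕜) (p : ℤ × ℤ) :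
    hop d V v p = d * nb v p + (V p - 4 * d) * v p := by
  change (d : 𝕜) * nb v p + V p * v p - 4 * d * v p = _
  ring

/-- The potential `V` shifted by the spectral parameter. -/
def shiftPot (V : LInf 𝕜) (z : 𝕜) : LInf 𝕜 := V - z • ind 𝕜 univ

@[simp] theorem shiftPot_apply (V : LInf 𝕜) (z : 𝕜) (p : ℤ × ℤ) : shiftPot V z p = V p - z := by
  change V p - z * ind 𝕜 univ p = _
  rw [ind_of_mem (mem_univ p), mul_one]

theorem hop_shiftPot (d : ℝ) (V : LInf 𝕜) (z : 𝕜) : hop d (shiftPot V z)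
    = hop d V - algebraMap 𝕜 (LInf 𝕜 →L[𝕜] LInf 𝕜) z := by
  ext1 v
  refine linf_ext fun p => ?_
  rw [hop_apply, shiftPot_apply]
  change _ = hop d V v p - z * v p
  rw [hop_apply]; ring

variable {I : Type} [Fintype I] [DecidableEq I]

/-- The solution of `d Δv + V v = 0` off the range of `ι` that takes the value `1` at `ι j` and
`0` at the other points of the range. -/
def extBasis (ι : I → ℤ × ℤ) (d : ℝ) (V : LInf 𝕜) (j : I) : LInf 𝕜 :=
  Ring.inverse (pinned (range ι) d V) (ind 𝕜 {ι j})

/-- The Schur complement of `d Δ + V` on the range of `ι`. -/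
def schur (ι : I → ℤ × ℤ) (d : ℝ) (V : LInf 𝕜) : Matrix I I 𝕜 :=
  fun i j => hop d V (extBasis ι d V j) (ι i)

/-- The hypotheses under which the Schur complement is formed: the potential is dissipative off the
finite set. -/
structure Dissipative (ι : I → ℤ × ℤ) (d δ : ℝ) (V : LInf 𝕜) : Prop where
  inj : Function.Injective ι
  d_pos : 0 < d
  δ_pos : 0 < δ
  re_le : ∀ p ∉ range ι, RCLike.re (V p) ≤ -δ

/-- The solution off the finite set with prescribed values `a` on it. -/
def extendBy (ι : I → ℤ × ℤ) (d : ℝ) (V : LInf 𝕜) : (I → 𝕜) →ₗ[𝕜] LInf 𝕜 :=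
  Fintype.linearCombination 𝕜 (extBasis ι d V)

theorem extendBy_apply (ι : I → ℤ × ℤ) (d : ℝ) (V : LInf 𝕜) (a : I → 𝕜) :
    extendBy ι d V a = ∑ j, a j • extBasis ι d V j := Fintype.linearCombination_apply _ _ _

theorem sum_apply {J : Type} (s : Finset J) (F : J → LInf 𝕜) (p : ℤ × ℤ) :
    (∑ j ∈ s, F j) p = ∑ j ∈ s, F j p := map_sum (ev 𝕜 p) F s

theorem hop_extendBy_range (ι : I → ℤ × ℤ) (d : ℝ) (V : LInf 𝕜) (a : I → 𝕜) (i : I) :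
    hop d V (extendBy ι d V a) (ι i) = (schur ι d V).mulVec a i := by
  rw [extendBy_apply, map_sum, sum_apply]
  refine Finset.sum_congr rfl fun j _ => ?_
  rw [map_smul]
  exact mul_comm _ _

namespace Dissipative

variable {ι : I → ℤ × ℤ} {d δ : ℝ} {V : LInf 𝕜} (H : Dissipative ι d δ V)

include H

theorem isUnit : IsUnit (pinned (range ι) d V) :=
  isUnit_pinned H.d_pos H.δ_pos H.re_le

theorem pinned_inverse (g : LInf 𝕜) :
    pinned (range ι) d V (Ring.inverse (pinned (range ι) d V) g) = g := by
  have := Ring.mul_inverse_cancel _ H.isUnit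
  exact DFunLike.congr_fun this g

theorem extBasis_apply (i j : I) :
    extBasis ι d V j (ι i) = if i = j then 1 else 0 := by
  have h := congrArg (fun u : LInf 𝕜 => u (ι i)) (H.pinned_inverse (ind 𝕜 {ι j}))
  simp only [pinned_apply_of_mem (mem_range_self i)] at h
  rw [extBasis, h]
  split_ifs with hij
  · subst hij; exact ind_of_mem rfl
  · exact ind_of_notMem fun hm => hij (H.inj hm)

theorem hop_extBasis_of_notMem (j : I) {p : ℤ × ℤ} (hp : p ∉ range ι) :
    hop d V (extBasis ι d V j) p = 0 := by
  have h := congrArg (fun u : LInf 𝕜 => u p) (H.pinned_inverse (ind 𝕜 {ι j}))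
  simp only [pinned_apply_of_notMem hp] at h
  rw [hop_apply, extBasis, h]
  exact ind_of_notMem fun hm => hp (by rw [mem_singleton_iff.1 hm]; exact mem_range_self j)

/-- Solutions of the equation off the finite set are bounded by their values on it. -/
theorem norm_le {v : LInf 𝕜} {B G : ℝ}
    (hv : ∀ p ∉ range ι, ‖hop d V v p‖ ≤ G) (hB : ∀ i, ‖v (ι i)‖ ≤ B) (hGB : G ≤ B * δ)
    (p : ℤ × ℤ) : ‖v p‖ ≤ B := by
  by_cases hI : ∃ q, q ∈ range ι ∨ ‖hop d V v q‖ ≤ G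
  · refine norm_le_of_dominant H.d_pos H.δ_pos (C := range ι) (c := fun p => V p)
      (g := fun p => hop d V v p) H.re_le (fun p _ => (hop_apply d V v p).symm)
      (fun q hq => (hv q hq).trans ?_) (by rintro _ ⟨i, rfl⟩; exact hB i) p
    have hB0 : 0 ≤ B := by
      have h1 : 0 ≤ G := (norm_nonneg _).trans (hv q hq)
      have h2 : 0 ≤ B * δ := h1.trans hGB
      exact nonneg_of_mul_nonneg_left h2 H.δ_pos
    exact hGB.trans (mul_le_mul_of_nonneg_left (by linarith [H.re_le q hq]) hB0)
  · push Not at hI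
    exact absurd (hv p (hI p).1) (not_le.2 (hI p).2)

theorem eq_of_hop_eq {v w : LInf 𝕜}
    (h1 : ∀ p ∉ range ι, hop d V v p = hop d V w p) (h2 : ∀ i, v (ι i) = w (ι i)) : v = w := by
  refine linf_ext fun p => ?_
  have := H.norm_le (v := v - w) (B := 0) (G := 0) (fun q hq => ?_) (fun i => ?_) (by simp) p
  · exact sub_eq_zero.1 (norm_le_zero_iff.1 this)
  · rw [map_sub]
    change ‖hop d V v q - hop d V w q‖ ≤ 0
    rw [h1 q hq, sub_self, norm_zero]
  · change ‖v (ι i) - w (ι i)‖ ≤ 0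
    rw [h2 i, sub_self, norm_zero]

theorem norm_extBasis_le (j : I) (p : ℤ × ℤ) :
    ‖extBasis ι d V j p‖ ≤ 1 :=
  H.norm_le (G := 0) (fun q hq => by rw [H.hop_extBasis_of_notMem j hq, norm_zero])
    (fun i => by rw [H.extBasis_apply]; split_ifs <;> simp) (by simpa using H.δ_pos.le) p

theorem norm_le_of_notMem {v : LInf 𝕜} {B : ℝ}
    (hv : ∀ p ∉ range ι, hop d V v p = 0) (hB : ∀ q, ‖v q‖ ≤ B) {p : ℤ × ℤ} (hp : p ∉ range ι) :
    ‖v p‖ ≤ 4 * d * B / δ := by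
  have := norm_apply_le_of_dominant (G := 0) H.d_pos H.δ_pos (H.re_le p hp)
    ((hop_apply d V v p).symm.trans (hv p hp)) hB (by simp)
  simpa using this

/-- Changing the potential by at most `η` off the finite set, and on it, changes the Schur
complement only in second order in `d`, apart from the direct change of the diagonal. -/
theorem norm_schur_sub_le {V' : LInf 𝕜} (H' : Dissipative ι d δ V')
    {η : ℝ} (hη : ∀ p, ‖V p - V' p‖ ≤ η) (i j : I) :
    ‖schur ι d V i j - schur ι d V' i j - (if i = j then V (ι i) - V' (ι i) else 0)‖
      ≤ 16 * d ^ 2 / δ ^ 2 * η := by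
  have hd := H.d_pos
  have hδ := H.δ_pos
  have hη0 : 0 ≤ η := (norm_nonneg _).trans (hη 0)
  set v := extBasis ι d V j
  set v' := extBasis ι d V' j
  have hoff : ∀ p ∉ range ι, ‖hop d V (v - v') p‖ ≤ η * (4 * d / δ) := fun p hp => by
    have h1 : hop d V (v - v') p = (V' p - V p) * v' p := by
      rw [map_sub]
      change hop d V v p - hop d V v' p = _
      have h2 := H'.hop_extBasis_of_notMem j hp
      rw [H.hop_extBasis_of_notMem j hp, hop_apply, zero_sub]
      rw [hop_apply] at h2
      linear_combination -h2
    rw [h1, norm_mul, norm_sub_rev]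
    refine mul_le_mul (hη p) ?_ (norm_nonneg _) hη0
    have := H'.norm_le_of_notMem (fun q hq => H'.hop_extBasis_of_notMem j hq)
      (H'.norm_extBasis_le j) hp
    simpa using this
  have hB : ∀ p, ‖(v - v') p‖ ≤ η * (4 * d / δ) / δ :=
    H.norm_le hoff (fun i => by
      change ‖v (ι i) - v' (ι i)‖ ≤ _
      rw [H.extBasis_apply, H'.extBasis_apply, sub_self, norm_zero]; positivity)
      (by rw [div_mul_cancel₀ _ hδ.ne'])
  have h3 : schur ι d V i j - schur ι d V' i j - (if i = j then V (ι i) - V' (ι i) else 0)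
      = d * nb (v - v' : LInf 𝕜) (ι i) := by
    have e1 : schur ι d V i j = d * nb v (ι i) + (V (ι i) - 4 * d) * v (ι i) := hop_apply _ _ _ _
    have e2 : schur ι d V' i j = d * nb v' (ι i) + (V' (ι i) - 4 * d) * v' (ι i) :=
      hop_apply _ _ _ _
    have e3 : nb (v - v' : LInf 𝕜) (ι i) = nb v (ι i) - nb v' (ι i) := nb_sub v v' _
    rw [e1, e2, e3, H.extBasis_apply, H'.extBasis_apply]
    split_ifs <;> ring
  rw [h3, norm_mul, RCLike.norm_ofReal, abs_of_pos hd]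
  calc d * ‖nb (v - v' : LInf 𝕜) (ι i)‖ ≤ d * (4 * (η * (4 * d / δ) / δ)) :=
        mul_le_mul_of_nonneg_left (norm_nb_le hB _) hd.le
    _ = _ := by field_simp; ring

theorem norm_schur_le (i j : I) :
    ‖schur ι d V i j - (if i = j then V (ι i) else 0)‖ ≤ 8 * d := by
  have hd := H.d_pos
  have e1 : schur ι d V i j - (if i = j then V (ι i) else 0) = d * nb (extBasis ι d V j) (ι i)
      - (4 * d) * extBasis ι d V j (ι i) := by
    have : schur ι d V i j = _ := hop_apply _ _ _ _
    rw [this, H.extBasis_apply]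
    split_ifs <;> ring
  rw [e1]
  refine (norm_sub_le _ _).trans ?_
  have h1 : ‖(d : 𝕜) * nb (extBasis ι d V j) (ι i)‖ ≤ d * (4 * 1) := by
    rw [norm_mul, RCLike.norm_ofReal, abs_of_pos hd]
    exact mul_le_mul_of_nonneg_left (norm_nb_le (H.norm_extBasis_le j) _) hd.le
  have h2 : ‖(4 * d : 𝕜) * extBasis ι d V j (ι i)‖ ≤ 4 * d * 1 := by
    rw [norm_mul, norm_mul, RCLike.norm_ofReal, abs_of_pos hd, RCLike.norm_ofNat]
    exact mul_le_mul_of_nonneg_left (H.norm_extBasis_le j _) (by positivity)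
  linarith

theorem extendBy_apply_range (a : I → 𝕜) (i : I) :
    extendBy ι d V a (ι i) = a i := by
  rw [extendBy_apply, sum_apply]
  simp_rw [show ∀ j, (a j • extBasis ι d V j) (ι i) = a j * extBasis ι d V j (ι i) from
    fun _ => rfl, H.extBasis_apply]
  simp

theorem hop_extendBy_of_notMem (a : I → 𝕜) {p : ℤ × ℤ}
    (hp : p ∉ range ι) : hop d V (extendBy ι d V a) p = 0 := by
  rw [extendBy_apply, map_sum, sum_apply]
  refine Finset.sum_eq_zero fun j _ => ?_
  rw [map_smul]
  change a j * hop d V (extBasis ι d V j) p = 0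
  rw [H.hop_extBasis_of_notMem j hp, mul_zero]

theorem eq_extendBy {v : LInf 𝕜}
    (hv : ∀ p ∉ range ι, hop d V v p = 0) : v = extendBy ι d V fun i => v (ι i) :=
  H.eq_of_hop_eq (fun p hp => by rw [hv p hp, H.hop_extendBy_of_notMem _ hp])
    fun i => (H.extendBy_apply_range (fun i => v (ι i)) i).symm

/-- The kernel of the operator is parametrized by the kernel of its Schur complement. -/
def kerEquiv :
    LinearMap.ker (Matrix.mulVecLin (schur ι d V)) ≃ₗ[𝕜]
      LinearMap.ker (hop d V : LInf 𝕜 →ₗ[𝕜] LInf 𝕜) where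
  toFun a := ⟨extendBy ι d V a, by
    rw [LinearMap.mem_ker]
    refine linf_ext fun p => ?_
    by_cases hp : p ∈ range ι
    · obtain ⟨i, rfl⟩ := hp
      exact (hop_extendBy_range ι d V a i).trans (congrFun a.2 i)
    · exact H.hop_extendBy_of_notMem a hp⟩
  map_add' a b := by ext1; exact map_add (extendBy ι d V) _ _
  map_smul' c a := by ext1; exact map_smul (extendBy ι d V) _ _
  invFun v := ⟨fun i => (v : LInf 𝕜) (ι i), by
    have h0 : hop d V (v : LInf 𝕜) = 0 := v.2
    have h1 := H.eq_extendBy (v := (v : LInf 𝕜)) (fun p _ => by rw [h0]; rfl)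
    rw [LinearMap.mem_ker]
    funext i
    rw [Matrix.mulVecLin_apply, ← hop_extendBy_range, ← h1, h0]; rfl⟩
  left_inv a := by ext i; exact H.extendBy_apply_range a i
  right_inv v := by
    ext1
    have h0 : hop d V (v : LInf 𝕜) = 0 := v.2
    exact (H.eq_extendBy (v := (v : LInf 𝕜)) (fun p _ => by rw [h0]; rfl)).symm

/-- The operator is invertible as soon as its Schur complement is injective. -/
theorem isUnit_hop (hS : LinearMap.ker (Matrix.mulVecLin (schur ι d V)) = ⊥) :
    IsUnit (hop d V) := by
  have hsurj : Function.Surjective (Matrix.mulVecLin (schur ι d V)) :=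
    LinearMap.injective_iff_surjective.1 (LinearMap.ker_eq_bot.1 hS)
  rw [ContinuousLinearMap.isUnit_iff_bijective]
  constructor
  · refine (LinearMap.ker_eq_bot (f := (hop d V : LInf 𝕜 →ₗ[𝕜] LInf 𝕜))).1 ?_
    rw [← Submodule.subsingleton_iff_eq_bot]
    have : Subsingleton (LinearMap.ker (Matrix.mulVecLin (schur ι d V))) :=
      (Submodule.subsingleton_iff_eq_bot).2 hS
    exact H.kerEquiv.symm.toEquiv.subsingleton
  · intro g
    set y := Ring.inverse (pinned (range ι) d V) (mulOp 𝕜 (ind 𝕜 (range ι)ᶜ) g) with hy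
    have hpin := H.pinned_inverse (mulOp 𝕜 (ind 𝕜 (range ι)ᶜ) g)
    rw [← hy] at hpin
    have hy1 : ∀ p ∉ range ι, hop d V y p = g p := fun p hp => by
      have := congrArg (fun u : LInf 𝕜 => u p) hpin
      simp only [pinned_apply_of_notMem hp, mulOp_apply, ind_of_mem (mem_compl hp), one_mul] at this
      rw [hop_apply, this]
    obtain ⟨b, hb⟩ := hsurj fun i => g (ι i) - hop d V y (ι i)
    refine ⟨extendBy ι d V b + y, linf_ext fun p => ?_⟩
    rw [map_add]
    change hop d V (extendBy ι d V b) p + hop d V y p = g p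
    by_cases hp : p ∈ range ι
    · obtain ⟨i, rfl⟩ := hp
      have := congrFun hb i
      rw [Matrix.mulVecLin_apply] at this
      rw [hop_extendBy_range, this, sub_add_cancel]
    · rw [H.hop_extendBy_of_notMem b hp, hy1 p hp, zero_add]

/-- The Schur complement is equivariant under lattice symmetries of the potential. -/
theorem schur_comp {ρ : ℤ × ℤ → ℤ × ℤ} (hρ : Function.Involutive ρ)
    (hnb : ∀ (u : ℤ × ℤ → 𝕜) p, nb (fun q => u (ρ q)) p = nb u (ρ p)) (hV : ∀ p, V (ρ p) = V p)
    {τ : I → I} (hτ : ∀ i, ι (τ i) = ρ (ι i)) (i j : I) :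
    schur ι d V (τ i) (τ j) = schur ι d V i j := by
  have hop_comp : ∀ u w : LInf 𝕜, (∀ p, w p = u (ρ p)) → ∀ p, hop d V w p = hop d V u (ρ p) := by
    intro u w huw p
    have h1 : nb w p = nb u (ρ p) := by rw [← hnb]; congr 1; funext q; exact huw q
    rw [hop_apply, hop_apply, h1, huw, hV]
  have hττ : ∀ i, τ (τ i) = i := fun i => H.inj (by rw [hτ, hτ, hρ])
  have hρr : ∀ p, p ∉ range ι → ρ p ∉ range ι := fun p hp ⟨i, hi⟩ =>
    hp ⟨τ i, by rw [hτ, hi, hρ]⟩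
  set w : LInf 𝕜 := ofBound (fun p => extBasis ι d V j (ρ p)) 1
    fun p => H.norm_extBasis_le j _
  have hw : w = extBasis ι d V (τ j) := by
    refine H.eq_of_hop_eq (fun p hp => ?_) fun i => ?_
    · rw [H.hop_extBasis_of_notMem _ hp, hop_comp (extBasis ι d V j) w (fun _ => rfl)]
      exact H.hop_extBasis_of_notMem _ (hρr p hp)
    · change extBasis ι d V j (ρ (ι i)) = _
      rw [← hτ, H.extBasis_apply, H.extBasis_apply]
      refine if_congr ⟨fun h => ?_, fun h => ?_⟩ rfl rfl
      · rw [← h, hττ]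
      · rw [h, hττ]
  change hop d V (extBasis ι d V (τ j)) (ι (τ i)) = hop d V (extBasis ι d V j) (ι i)
  rw [← hw, hop_comp (extBasis ι d V j) w (fun _ => rfl), hτ, hρ]

end Dissipative

end Schur

/-! ### Decay of solutions and symmetry of the Schur complement -/

section Symmetry

/-- The square of side `2 n + 1` around the origin. -/
def box (n : ℕ) : Finset (ℤ × ℤ) := Finset.Icc (-(n : ℤ), -(n : ℤ)) ((n : ℤ), (n : ℤ))

theorem mem_box {n : ℕ} {p : ℤ × ℤ} :
    p ∈ box n ↔ -(n : ℤ) ≤ p.1 ∧ p.1 ≤ n ∧ -(n : ℤ) ≤ p.2 ∧ p.2 ≤ n := by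
  rw [box, Finset.mem_Icc, Prod.le_def, Prod.le_def]; tauto

theorem card_box (n : ℕ) : (box n).card = (2 * n + 1) ^ 2 := by
  rw [box, Finset.card_Icc_prod]
  simp only [Int.card_Icc]
  have : ((n : ℤ) + 1 - -(n : ℤ)).toNat = 2 * n + 1 := by omega
  rw [this, sq]

theorem sum_box_shift_le {g : ℤ × ℤ → ℝ} (hg : ∀ p, 0 ≤ g p) (n : ℕ) {e : ℤ × ℤ}
    (he : |e.1| ≤ 1 ∧ |e.2| ≤ 1) : ∑ p ∈ box n, g (p + e) ≤ ∑ p ∈ box (n + 1), g p := by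
  change ∑ p ∈ box n, g (addRightEmbedding e p) ≤ _
  rw [← Finset.sum_map (box n) (addRightEmbedding e) g]
  refine Finset.sum_le_sum_of_subset_of_nonneg (fun q hq => ?_) fun p _ _ => hg p
  obtain ⟨p, hp, rfl⟩ := Finset.mem_map.1 hq
  rw [mem_box] at hp ⊢
  have h1 := abs_le.1 he.1
  have h2 := abs_le.1 he.2
  simp only [addRightEmbedding_apply, Prod.fst_add, Prod.snd_add]
  push_cast
  omega

theorem sum_box_nb_le {g : ℤ × ℤ → ℝ} (hg : ∀ p, 0 ≤ g p) (n : ℕ) :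
    ∑ p ∈ box n, nb g p ≤ 4 * ∑ p ∈ box (n + 1), g p := by
  have h := fun e he => sum_box_shift_le hg n (e := e) he
  have h1 := h (1, 0) (by simp)
  have h2 := h (-1, 0) (by simp)
  have h3 := h (0, 1) (by simp)
  have h4 := h (0, -1) (by simp)
  have : ∑ p ∈ box n, nb g p = ∑ p ∈ box n, g (p + (1, 0)) + ∑ p ∈ box n, g (p + (-1, 0))
      + ∑ p ∈ box n, g (p + (0, 1)) + ∑ p ∈ box n, g (p + (0, -1)) := by
    rw [← Finset.sum_add_distrib, ← Finset.sum_add_distrib, ← Finset.sum_add_distrib]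
    refine Finset.sum_congr rfl fun p _ => ?_
    simp [nb, Prod.add_def, sub_eq_add_neg]
  rw [this]; linarith

/-- A bounded solution of a dissipative system off a finite set is summable. -/
theorem summable_of_dissipative {C : Set (ℤ × ℤ)} (hC : C.Finite) {d δ : ℝ} (hd : 0 < d)
    (hδ : 0 < δ) {v : LInf ℝ}
    (hv : ∀ p ∉ C, (4 * d + δ) * |v p| ≤ d * nb (fun q => |v q|) p) :
    Summable fun p => v p := by
  classical
  set ρ : ℝ := 4 * d / (4 * d + δ) with hρ
  have hρ0 : 0 < ρ := by positivity
  have hρ1 : ρ < 1 := by rw [hρ, div_lt_one (by positivity)]; linarith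
  set K : ℝ := ∑ p ∈ hC.toFinset, |v p|
  set A : ℕ → ℝ := fun n => ∑ p ∈ box n, |v p|
  have hnb0 : ∀ p, 0 ≤ nb (fun q => |v q|) p := fun p => by unfold nb; positivity
  have hstep : ∀ n, A n ≤ K + ρ * A (n + 1) := fun n => by
    have h1 : ∀ p ∈ box n, |v p| ≤ (if p ∈ hC.toFinset then |v p| else 0)
        + ρ / 4 * nb (fun q => |v q|) p := fun p _ => by
      have h2 : 0 ≤ ρ / 4 * nb (fun q => |v q|) p := mul_nonneg (by positivity) (hnb0 p)
      split_ifs with hp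
      · linarith
      · have := hv p (by simpa using hp)
        rw [zero_add, hρ, div_div, div_mul_eq_mul_div, le_div_iff₀ (by positivity)]
        linarith
    refine (Finset.sum_le_sum h1).trans ?_
    rw [Finset.sum_add_distrib, ← Finset.mul_sum]
    refine add_le_add ?_ ?_
    · rw [← Finset.sum_filter]
      refine Finset.sum_le_sum_of_subset_of_nonneg (fun q hq => (Finset.mem_filter.1 hq).2)
        fun _ _ _ => abs_nonneg _
    · have := sum_box_nb_le (g := fun q => |v q|) (fun _ => abs_nonneg _) n
      calc _ ≤ ρ / 4 * (4 * A (n + 1)) := mul_le_mul_of_nonneg_left this (by positivity)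
        _ = _ := by ring
  have hK : 0 ≤ K := Finset.sum_nonneg fun _ _ => abs_nonneg _
  have hiter : ∀ n m, A n ≤ K / (1 - ρ) + ρ ^ m * A (n + m) := fun n m => by
    have key : A n ≤ K * ∑ i ∈ Finset.range m, ρ ^ i + ρ ^ m * A (n + m) := by
      induction m with
      | zero => simp
      | succ m ih =>
        have h2 := mul_le_mul_of_nonneg_left (hstep (n + m)) (pow_nonneg hρ0.le m)
        rw [Finset.sum_range_succ, pow_succ, ← add_assoc n]
        linarith
    have h3 : ∑ i ∈ Finset.range m, ρ ^ i ≤ (1 - ρ)⁻¹ := by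
      rw [← tsum_geometric_of_lt_one hρ0.le hρ1]
      exact (summable_geometric_of_lt_one hρ0.le hρ1).sum_le_tsum _
        fun i _ => pow_nonneg hρ0.le i
    have h5 := mul_le_mul_of_nonneg_left h3 hK
    rw [div_eq_mul_inv]; linarith
  have hA : ∀ n, A n ≤ ‖v‖ * (2 * n + 1) ^ 2 := fun n => by
    calc A n ≤ ∑ p ∈ box n, ‖v‖ := Finset.sum_le_sum fun p _ => norm_apply_le v p
      _ = _ := by rw [Finset.sum_const, card_box, nsmul_eq_mul]; push_cast; ring
  have hbound : ∀ n, A n ≤ K / (1 - ρ) := fun n => by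
    have ht : Tendsto (fun m : ℕ => K / (1 - ρ)
        + ‖v‖ * (2 * n + 3) ^ 2 * ((m : ℝ) ^ 2 * ρ ^ m)) atTop (𝓝 (K / (1 - ρ) + _ * 0)) :=
      ((tendsto_pow_const_mul_const_pow_of_abs_lt_one 2
        (by rwa [abs_of_pos hρ0])).const_mul _).const_add _
    rw [mul_zero, add_zero] at ht
    refine ge_of_tendsto ht ?_
    filter_upwards [eventually_ge_atTop 1] with m hm
    have hm' : (1 : ℝ) ≤ m := by exact_mod_cast hm
    refine (hiter n m).trans ?_
    have h1 := mul_le_mul_of_nonneg_left (hA (n + m)) (pow_nonneg hρ0.le m)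
    have h2 : (2 * ((n + m : ℕ) : ℝ) + 1) ^ 2 ≤ (2 * n + 3) ^ 2 * (m : ℝ) ^ 2 := by
      rw [← mul_pow]
      refine pow_le_pow_left₀ (by positivity) ?_ 2
      push_cast
      have : (0 : ℝ) ≤ n := Nat.cast_nonneg n
      nlinarith
    have h3 := mul_le_mul_of_nonneg_left h2 (mul_nonneg (pow_nonneg hρ0.le m) (norm_nonneg v))
    nlinarith
  refine Summable.of_abs (summable_of_sum_le (c := K / (1 - ρ)) (fun _ => abs_nonneg _) fun s => ?_)
  obtain ⟨n, hn⟩ : ∃ n, s ⊆ box n := by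
    refine ⟨s.sup fun p => max p.1.natAbs p.2.natAbs, fun p hp => ?_⟩
    have := Finset.le_sup (f := fun p : ℤ × ℤ => max p.1.natAbs p.2.natAbs) hp
    rw [mem_box]
    omega
  exact (Finset.sum_le_sum_of_subset_of_nonneg hn fun _ _ _ => abs_nonneg _).trans (hbound n)

theorem summable_mul_of_bounded {v : ℤ × ℤ → ℝ} (hv : Summable v) (w : LInf ℝ)
    (σ : ℤ × ℤ → ℤ × ℤ) : Summable fun p => v p * w (σ p) := by
  refine Summable.of_norm_bounded (g := fun p => ‖v p‖ * ‖w‖) (hv.norm.mul_right _) fun p => ?_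
  rw [norm_mul]
  exact mul_le_mul_of_nonneg_left (norm_apply_le w _) (norm_nonneg _)

/-- Summation by parts. -/
theorem tsum_mul_nb {v w : LInf ℝ} (hv : Summable fun p => v p) :
    ∑' p, v p * nb w p = ∑' p, nb v p * w p := by
  have hs : ∀ e : ℤ × ℤ, Summable fun p => v p * w (p + e) := fun e =>
    summable_mul_of_bounded hv w _
  have hs' : ∀ e : ℤ × ℤ, Summable fun p => v (p + e) * w p := fun e =>
    summable_mul_of_bounded (v := fun p => v (p + e))
      ((Equiv.addRight e).summable_iff.2 hv) w id
  have he : ∀ e : ℤ × ℤ, ∑' p, v p * w (p + e) = ∑' p, v (p + -e) * w p := fun e => by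
    rw [← (Equiv.addRight e).tsum_eq fun p => v (p + -e) * w p]
    simp
  have h1 : ∀ (u : LInf ℝ) p, nb u p = u (p + (1, 0)) + u (p + (-1, 0)) + u (p + (0, 1))
      + u (p + (0, -1)) := fun u p => by simp [nb, Prod.add_def, sub_eq_add_neg]
  simp_rw [h1, mul_add, add_mul]
  rw [Summable.tsum_add (((hs _).add (hs _)).add (hs _)) (hs _),
    Summable.tsum_add ((hs _).add (hs _)) (hs _), Summable.tsum_add (hs _) (hs _),
    Summable.tsum_add (((hs' _).add (hs' _)).add (hs' _)) (hs' _),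
    Summable.tsum_add ((hs' _).add (hs' _)) (hs' _), Summable.tsum_add (hs' _) (hs' _),
    he, he, he, he]
  simp only [Prod.neg_mk, neg_zero, neg_neg]
  ring

variable {I : Type} [Fintype I] [DecidableEq I] {ι : I → ℤ × ℤ} {d δ : ℝ} {V : LInf ℝ}

theorem Dissipative.summable_extBasis (H : Dissipative ι d δ V) (j : I) :
    Summable fun p => extBasis ι d V j p := by
  refine summable_of_dissipative (finite_range ι) H.d_pos H.δ_pos fun p hp => ?_
  have h1 := H.hop_extBasis_of_notMem j hp
  rw [hop_apply] at h1
  set v := extBasis ι d V j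
  have h2 : (4 * d - V p) * v p = d * nb v p := by
    simp only [RCLike.ofReal_real_eq_id, id_eq] at h1; linarith
  have h3 : |d * nb v p| ≤ d * nb (fun q => |v q|) p := by
    rw [abs_mul, abs_of_pos H.d_pos]
    refine mul_le_mul_of_nonneg_left ?_ H.d_pos.le
    unfold nb
    refine (abs_add_le _ _).trans (add_le_add ((abs_add_le _ _).trans (add_le_add
      (abs_add_le _ _) le_rfl)) le_rfl)
  have h4 : V p ≤ -δ := H.re_le p hp
  have h5 : 4 * d + δ ≤ |4 * d - V p| := by linarith [le_abs_self (4 * d - V p)]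
  rw [← h2, abs_mul] at h3
  exact (mul_le_mul_of_nonneg_right h5 (abs_nonneg _)).trans h3

theorem Dissipative.schur_eq_tsum (H : Dissipative ι d δ V) (i j : I) :
    schur ι d V i j = ∑' p, extBasis ι d V i p * hop d V (extBasis ι d V j) p := by
  rw [tsum_eq_single (ι i)]
  · rw [H.extBasis_apply, if_pos rfl, one_mul]; rfl
  · intro p hp
    by_cases hr : p ∈ range ι
    · obtain ⟨k, rfl⟩ := hr
      rw [H.extBasis_apply, if_neg fun h => hp (by rw [h]), zero_mul]
    · rw [H.hop_extBasis_of_notMem j hr, mul_zero]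

/-- The Schur complement is symmetric. The basis solutions are summable, so that one can sum by
parts. -/
theorem Dissipative.schur_symm (H : Dissipative ι d δ V) (i j : I) :
    schur ι d V i j = schur ι d V j i := by
  rw [H.schur_eq_tsum, H.schur_eq_tsum]
  set v := extBasis ι d V i
  set w := extBasis ι d V j
  have hv : Summable fun p => v p := H.summable_extBasis i
  have hw : Summable fun p => w p := H.summable_extBasis j
  have e : ∀ v w : LInf ℝ, Summable (fun p => v p) → ∑' p, v p * hop d V w p
      = d * ∑' p, v p * nb w p + ∑' p, v p * ((V p - 4 * d) * w p) := fun v w hv => by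
    rw [← tsum_mul_left, ← Summable.tsum_add]
    · refine tsum_congr fun p => ?_
      rw [hop_apply]
      simp only [RCLike.ofReal_real_eq_id, id_eq]; ring
    · exact (summable_mul_of_bounded hv (nbOp ℝ w) id).mul_left d
    · have := summable_mul_of_bounded hv
        (mulOp ℝ V w - (4 * d) • w) id
      refine this.congr fun p => ?_
      change v p * (V p * w p - (4 * d) * w p) = _
      ring
  rw [e v w hv, e w v hw, tsum_mul_nb hv]
  congr 1
  · congr 1; exact tsum_congr fun p => mul_comm _ _
  · exact tsum_congr fun p => by ring

end Symmetry

/-! ### Spectrum of a lattice Schrödinger operator -/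

section Spectrum

/-- A real bounded function as an element of the complexified space. -/
def cx (u : LInf ℝ) : LInf ℂ := ofBound (fun p => (u p : ℂ)) ‖u‖ fun p => by
  rw [Complex.norm_real]; exact norm_apply_le u p

@[simp] theorem cx_apply (u : LInf ℝ) (p : ℤ × ℤ) : cx u p = (u p : ℂ) := rfl

theorem nb_cx (u : LInf ℝ) (p : ℤ × ℤ) : nb (cx u) p = ((nb u p : ℝ) : ℂ) := by
  simp [nb]

theorem hop_cx (d : ℝ) (V v : LInf ℝ) : hop d (cx V) (cx v) = cx (hop d V v) := by
  refine linf_ext fun p => ?_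
  have e1 := hop_apply d (cx V) (cx v) p
  have e2 := hop_apply d V v p
  rw [e1, cx_apply, cx_apply, cx_apply, e2, nb_cx]
  simp

theorem shiftPot_cx (V : LInf ℝ) (z : ℝ) : shiftPot (cx V) (z : ℂ) = cx (shiftPot V z) := by
  refine linf_ext fun p => ?_
  simp

variable {I : Type} [Fintype I] [DecidableEq I] {ι : I → ℤ × ℤ} {d δ : ℝ} {V : LInf ℝ}

namespace Dissipative

theorem cx (H : Dissipative ι d δ V) : Dissipative ι d δ (cx V) :=
  ⟨H.inj, H.d_pos, H.δ_pos, fun p hp => by simpa using H.re_le p hp⟩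

theorem schur_cx (H : Dissipative ι d δ V) (i j : I) :
    schur ι d (Lattice.cx V) i j = ((schur ι d V i j : ℝ) : ℂ) := by
  have h : extBasis ι d (Lattice.cx V) j = Lattice.cx (extBasis ι d V j) := by
    refine H.cx.eq_of_hop_eq (fun p hp => ?_) fun k => ?_
    · rw [H.cx.hop_extBasis_of_notMem j hp, hop_cx, cx_apply, H.hop_extBasis_of_notMem j hp]
      simp
    · rw [H.cx.extBasis_apply, cx_apply, H.extBasis_apply]
      split_ifs <;> simp
  change hop d (Lattice.cx V) (extBasis ι d (Lattice.cx V) j) (ι i) = _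
  rw [h, hop_cx]; rfl

theorem shift (H : Dissipative ι d (2 * δ) V) (hδ : 0 < δ) {z : ℝ} (hz : -δ ≤ z) :
    Dissipative ι d δ (shiftPot V z) :=
  ⟨H.inj, H.d_pos, hδ, fun p hp => by
    have := H.re_le p hp
    simp only [shiftPot_apply, RCLike.re_to_real] at this ⊢
    linarith⟩

theorem shift_cx (H : Dissipative ι d (2 * δ) V) (hδ : 0 < δ) {z : ℂ} (hz : -δ ≤ z.re) :
    Dissipative ι d δ (shiftPot (Lattice.cx V) z) :=
  ⟨H.inj, H.d_pos, hδ, fun p hp => by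
    have := H.re_le p hp
    simp only [shiftPot_apply, RCLike.re_to_real, cx_apply, RCLike.re_to_complex, Complex.sub_re,
      Complex.ofReal_re] at this ⊢
    linarith⟩

theorem isHermitian_schur (H : Dissipative ι d δ V) :
    (schur ι d (Lattice.cx V)).IsHermitian := by
  ext i j
  rw [Matrix.conjTranspose_apply, H.schur_cx, H.schur_cx, H.schur_symm]
  exact Complex.conj_ofReal _

end Dissipative

theorem star_dotProduct_self (a : I → ℂ) :
    dotProduct (star a) a = ((∑ i, ‖a i‖ ^ 2 : ℝ) : ℂ) := by
  rw [dotProduct]; push_cast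
  refine Finset.sum_congr rfl fun i _ => ?_
  rw [Pi.star_apply]; exact Complex.conj_mul' _

theorem norm_quadratic_le {D : Matrix I I ℂ} {η : ℝ} (hD : ∀ i j, ‖D i j‖ ≤ η)
    (a : I → ℂ) : ‖dotProduct (star a) (D.mulVec a)‖ ≤ Fintype.card I * η * ∑ i, ‖a i‖ ^ 2 := by
  have h1 : ‖dotProduct (star a) (D.mulVec a)‖ ≤ η * (∑ i, ‖a i‖) ^ 2 := by
    rw [dotProduct, sq, Finset.sum_mul_sum, Finset.mul_sum]
    refine (norm_sum_le _ _).trans (Finset.sum_le_sum fun i _ => ?_)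
    rw [Matrix.mulVec, dotProduct, norm_mul, Finset.mul_sum, Pi.star_apply, norm_star]
    refine (mul_le_mul_of_nonneg_left (norm_sum_le _ _) (norm_nonneg _)).trans ?_
    rw [Finset.mul_sum]
    refine Finset.sum_le_sum fun j _ => ?_
    rw [norm_mul]
    have := mul_le_mul_of_nonneg_right (hD i j) (mul_nonneg (norm_nonneg (a i)) (norm_nonneg (a j)))
    linarith
  by_cases hI : Nonempty I
  · obtain ⟨i⟩ := hI
    have hη : 0 ≤ η := (norm_nonneg _).trans (hD i i)
    have h2 := sq_sum_le_card_mul_sum_sq (s := Finset.univ) (f := fun i => ‖a i‖)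
    have := mul_le_mul_of_nonneg_left h2 hη
    rw [Finset.card_univ] at this
    linarith
  · rw [not_nonempty_iff] at hI
    simp [dotProduct]

variable (H : Dissipative ι d (2 * δ) V) (hδ : 0 < δ)

include H hδ

/-- Off the real axis and to the right of `-δ` there is no spectrum: the Schur complement differs
from a Hermitian matrix by `-i y` and a small multiple of `y`. -/
theorem Dissipative.notMem_spectrum (hs : 16 * Fintype.card I * d ^ 2 < δ ^ 2) {z : ℂ}
    (hz : -δ ≤ z.re) (hy : z.im ≠ 0) :
    z ∉ spectrum ℂ (hop d (Lattice.cx V)) := by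
  have Hz := H.shift_cx hδ hz
  have H0 := H.shift hδ hz
  rw [spectrum.notMem_iff, ← neg_sub, ← hop_shiftPot]
  refine (IsUnit.neg_iff _).2 (Hz.isUnit_hop ?_)
  rw [LinearMap.ker_eq_bot']
  intro a ha
  rw [Matrix.mulVecLin_apply] at ha
  set S := schur ι d (shiftPot (Lattice.cx V) z)
  set S₀ := schur ι d (Lattice.cx (shiftPot V z.re))
  set D : Matrix I I ℂ := S - S₀ + (z.im * Complex.I) • (1 : Matrix I I ℂ) with hDdef
  have hD : ∀ i j, ‖D i j‖ ≤ 16 * d ^ 2 / δ ^ 2 * |z.im| := fun i j => by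
    have hη : ∀ p, ‖shiftPot (Lattice.cx V) z p - Lattice.cx (shiftPot V z.re) p‖ ≤ |z.im| := by
      intro p
      rw [shiftPot_apply, cx_apply, cx_apply, shiftPot_apply]
      have : (V p : ℂ) - z - ((V p - z.re : ℝ) : ℂ) = -(z.im * Complex.I) := by
        push_cast
        linear_combination Complex.re_add_im z
      rw [this, norm_neg, norm_mul, Complex.norm_I, mul_one, Complex.norm_real, Real.norm_eq_abs]
    refine le_trans (le_of_eq ?_) (Hz.norm_schur_sub_le H0.cx hη i j)
    congr 1
    rw [hDdef, Matrix.add_apply, Matrix.sub_apply, Matrix.smul_apply, Matrix.one_apply]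
    split_ifs
    · rw [shiftPot_apply, cx_apply, cx_apply, shiftPot_apply]
      simp only [smul_eq_mul, mul_one]
      push_cast
      linear_combination Complex.re_add_im z
    · simp [S, S₀]
  have h1 : dotProduct (star a) (S₀.mulVec a) + dotProduct (star a) (D.mulVec a)
      = z.im * Complex.I * dotProduct (star a) a := by
    have : S = S₀ + D - (z.im * Complex.I) • (1 : Matrix I I ℂ) := by rw [hDdef]; abel
    have h2 : dotProduct (star a) (S.mulVec a) = 0 := by rw [ha, dotProduct_zero]
    rw [this, Matrix.sub_mulVec, Matrix.add_mulVec, Matrix.smul_mulVec, Matrix.one_mulVec,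
      dotProduct_sub, dotProduct_add, dotProduct_smul, smul_eq_mul] at h2
    linear_combination h2
  have h2 := star_dotProduct_self a
  have h3 : (dotProduct (star a) (S₀.mulVec a)).im = 0 :=
    H0.isHermitian_schur.im_star_dotProduct_mulVec_self a
  have h4 := congrArg Complex.im h1
  rw [Complex.add_im, h3, zero_add, h2] at h4
  simp only [Complex.mul_im, Complex.mul_re, Complex.ofReal_re, Complex.ofReal_im, Complex.I_re,
    Complex.I_im] at h4
  have h5 : |z.im| * ∑ i, ‖a i‖ ^ 2
      ≤ Fintype.card I * (16 * d ^ 2 / δ ^ 2 * |z.im|) * ∑ i, ‖a i‖ ^ 2 := by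
    refine le_trans (le_of_eq ?_) ((Complex.abs_im_le_norm _).trans (norm_quadratic_le hD a))
    rw [h4]
    have h0 : 0 ≤ ∑ i, ‖a i‖ ^ 2 := by positivity
    rw [← abs_of_nonneg h0, ← abs_mul]
    congr 1
    rw [abs_of_nonneg h0]; ring
  have h6 : (Fintype.card I * (16 * d ^ 2 / δ ^ 2) : ℝ) < 1 := by
    rw [← mul_div_assoc, div_lt_one (by positivity)]; linarith
  have h7 : ∑ i, ‖a i‖ ^ 2 ≤ 0 := by
    by_contra! h
    have hy' : 0 < |z.im| := abs_pos.2 hy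
    have := mul_pos hy' h
    nlinarith
  funext i
  have h8 := (Finset.sum_eq_zero_iff_of_nonneg fun i _ => sq_nonneg ‖a i‖).1
    (le_antisymm h7 (by positivity)) i (Finset.mem_univ i)
  simpa using h8

/-- There are no Jordan chains to the right of `-δ`: such a chain would make the small correction
in the derivative of the Schur complement as large as its leading part `-1`. -/
theorem Dissipative.hop_eq_zero_of_sq (hs : 16 * Fintype.card I * d ^ 2 < δ ^ 2) {z : ℝ}
    (hz : -δ ≤ z) {v : LInf ℂ}
    (hv : hop d (Lattice.cx (shiftPot V z)) (hop d (Lattice.cx (shiftPot V z)) v) = 0) :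
    hop d (Lattice.cx (shiftPot V z)) v = 0 := by
  have H0 := (H.shift hδ hz).cx
  have hherm := (H.shift hδ hz).isHermitian_schur
  set W := Lattice.cx (shiftPot V z)
  have hd := H0.d_pos
  set v₂ := hop d W v
  set a : I → ℂ := fun i => v₂ (ι i)
  set b : I → ℂ := fun i => v (ι i)
  set S := schur ι d W
  have hext : v₂ = extendBy ι d W a := H0.eq_extendBy fun p _ => by rw [hv]; rfl
  have hSa : S.mulVec a = 0 := by
    funext i
    rw [← hop_extendBy_range, ← hext, hv]; rfl
  have hv₂1 : ∀ p, ‖v₂ p‖ ≤ ‖a‖ := H0.norm_le (G := 0)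
    (fun p _ => by rw [hv]; exact norm_zero.le) (norm_le_pi_norm a)
    (mul_nonneg (norm_nonneg a) hδ.le)
  have hv₂2 : ∀ p ∉ range ι, ‖v₂ p‖ ≤ 4 * d * ‖a‖ / δ := fun p hp =>
    H0.norm_le_of_notMem (fun q _ => by rw [hv]; rfl) hv₂1 hp
  set y := v - extendBy ι d W b with hy
  have hyι : ∀ i, y (ι i) = 0 := fun i => by
    change v (ι i) - extendBy ι d W b (ι i) = 0
    rw [H0.extendBy_apply_range, sub_self]
  have hyoff : ∀ p ∉ range ι, hop d W y p = v₂ p := fun p hp => by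
    rw [hy, map_sub]
    change hop d W v p - hop d W (extendBy ι d W b) p = _
    rw [H0.hop_extendBy_of_notMem b hp, sub_zero]
  have hyB : ∀ p, ‖y p‖ ≤ 4 * d * ‖a‖ / δ / δ :=
    H0.norm_le (fun p hp => by rw [hyoff p hp]; exact hv₂2 p hp)
      (fun i => by rw [hyι, norm_zero]; positivity) (by rw [div_mul_cancel₀ _ hδ.ne'])
  set r : I → ℂ := fun i => d * nb y (ι i)
  have har : a = S.mulVec b + r := by
    funext i
    have h1 : hop d W y (ι i) = r i := by rw [hop_apply, hyι, mul_zero, add_zero]; rfl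
    have h2 : hop d W y (ι i) = a i - S.mulVec b i := by
      rw [hy, map_sub]
      change hop d W v (ι i) - hop d W (extendBy ι d W b) (ι i) = _
      rw [hop_extendBy_range]
    rw [Pi.add_apply, ← h1, h2]; ring
  have hr : ∀ i, ‖r i‖ ≤ 16 * d ^ 2 / δ ^ 2 * ‖a‖ := fun i => by
    rw [norm_mul, Complex.norm_real, Real.norm_eq_abs, abs_of_pos hd]
    refine (mul_le_mul_of_nonneg_left (norm_nb_le hyB _) hd.le).trans (le_of_eq ?_)
    field_simp; ring
  have horth : dotProduct (star a) (S.mulVec b) = 0 := by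
    rw [Matrix.dotProduct_mulVec]
    have : Matrix.vecMul (star a) S = star (S.mulVec a) := by
      rw [Matrix.star_mulVec, hherm.eq]
    rw [this, hSa, star_zero, zero_dotProduct]
  have h1 : dotProduct (star a) a = dotProduct (star a) r := by
    calc dotProduct (star a) a = dotProduct (star a) (S.mulVec b + r) := by rw [← har]
      _ = _ := by rw [dotProduct_add, horth, zero_add]
  have h2 := star_dotProduct_self a
  have h3 : ∑ i, ‖a i‖ ^ 2 ≤ Fintype.card I * (‖a‖ * (16 * d ^ 2 / δ ^ 2 * ‖a‖)) := by
    have h4 : ‖dotProduct (star a) r‖ ≤ ∑ _i : I, ‖a‖ * (16 * d ^ 2 / δ ^ 2 * ‖a‖) := by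
      refine (norm_sum_le _ _).trans (Finset.sum_le_sum fun i _ => ?_)
      rw [norm_mul, Pi.star_apply, norm_star]
      exact mul_le_mul (norm_le_pi_norm a i) (hr i) (norm_nonneg _) (norm_nonneg _)
    rw [← h1, h2, Complex.norm_real, Finset.sum_const, Finset.card_univ, nsmul_eq_mul] at h4
    exact (le_abs_self _).trans h4
  have h6 : (Fintype.card I * (16 * d ^ 2 / δ ^ 2) : ℝ) < 1 := by
    rw [← mul_div_assoc, div_lt_one (by positivity)]; linarith
  have ha0 : a = 0 := by
    by_contra hne
    have hpos : 0 < ‖a‖ := norm_pos_iff.2 hne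
    have h7 : ‖a‖ ^ 2 ≤ ∑ i, ‖a i‖ ^ 2 := by
      refine (Real.le_sqrt (norm_nonneg a) (by positivity)).1 ?_
      refine (pi_norm_le_iff_of_nonneg (Real.sqrt_nonneg _)).2 fun i => Real.le_sqrt_of_sq_le ?_
      exact Finset.single_le_sum (f := fun i => ‖a i‖ ^ 2) (fun _ _ => by positivity)
        (Finset.mem_univ i)
    have h8 : 0 < ‖a‖ ^ 2 := by positivity
    nlinarith
  rw [hext, ha0, map_zero]

/-- To the right of `-δ`, algebraic multiplicities are the dimensions of the kernels of the Schur
complement. -/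
theorem Dissipative.finrank_maxGenEigenspace (hs : 16 * Fintype.card I * d ^ 2 < δ ^ 2)
    {z : ℝ} (hz : -δ ≤ z) :
    Module.finrank ℂ (Module.End.maxGenEigenspace
        (hop d (Lattice.cx V) : LInf ℂ →ₗ[ℂ] LInf ℂ) (z : ℂ))
      = Module.finrank ℂ (LinearMap.ker
        (Matrix.mulVecLin (schur ι d (Lattice.cx (shiftPot V z))))) := by
  have H0 := (H.shift hδ hz).cx
  rw [H0.kerEquiv.finrank_eq]
  set W := Lattice.cx (shiftPot V z) with hW
  have hg : ∀ v : LInf ℂ, ((hop d (Lattice.cx V) : LInf ℂ →ₗ[ℂ] LInf ℂ)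
      - (z : ℂ) • (1 : Module.End ℂ (LInf ℂ))) v = hop d W v := fun v => by
    rw [hW, ← shiftPot_cx, hop_shiftPot]; rfl
  have hgen : Module.End.maxGenEigenspace (hop d (Lattice.cx V) : LInf ℂ →ₗ[ℂ] LInf ℂ) (z : ℂ)
      = LinearMap.ker (hop d W : LInf ℂ →ₗ[ℂ] LInf ℂ) := by
    ext v
    rw [Module.End.mem_maxGenEigenspace, LinearMap.mem_ker]
    constructor
    · rintro ⟨n, hn⟩
      induction n with
      | zero =>
        rw [pow_zero] at hn
        have : v = 0 := hn
        rw [this, map_zero]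
      | succ n ih =>
        cases n with
        | zero => rw [pow_one, hg] at hn; exact hn
        | succ n =>
          refine ih ?_
          rw [pow_succ', pow_succ', Module.End.mul_apply, Module.End.mul_apply, hg, hg] at hn
          rw [pow_succ', Module.End.mul_apply, hg]
          exact H.hop_eq_zero_of_sq hδ hs hz hn
    · intro hv
      exact ⟨1, by rw [pow_one, hg]; exact hv⟩
  rw [hgen]

theorem Dissipative.mem_spectrum_iff {z : ℝ}
    (hz : -δ ≤ z) : (z : ℂ) ∈ spectrum ℂ (hop d (Lattice.cx V)) ↔
      Module.finrank ℂ (LinearMap.ker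
        (Matrix.mulVecLin (schur ι d (Lattice.cx (shiftPot V z))))) ≠ 0 := by
  have H0 := (H.shift hδ hz).cx
  have halg : algebraMap ℂ (LInf ℂ →L[ℂ] LInf ℂ) z - hop d (Lattice.cx V)
      = -hop d (Lattice.cx (shiftPot V z)) := by
    rw [← shiftPot_cx, hop_shiftPot, neg_sub]
  constructor
  · intro h h0
    rw [Submodule.finrank_eq_zero] at h0
    refine spectrum.notMem_iff.2 ?_ h
    rw [halg]
    exact (IsUnit.neg_iff _).2 (H0.isUnit_hop h0)
  · intro h
    by_contra hn
    rw [spectrum.notMem_iff, halg] at hn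
    have h1 := ContinuousLinearMap.isUnit_iff_bijective.1 ((IsUnit.neg_iff _).1 hn)
    refine h ?_
    rw [H0.kerEquiv.finrank_eq]
    have : LinearMap.ker (hop d (Lattice.cx (shiftPot V z)) : LInf ℂ →ₗ[ℂ] LInf ℂ) = ⊥ :=
      LinearMap.ker_eq_bot.2 h1.1
    rw [this]
    exact finrank_bot ℂ _

end Spectrum

/-! ### Block decomposition of the Schur complement by reflections -/

section Blocks

/-- A table of the real characters of a finite elementary abelian `2`-group. -/
structure IsCharTable {Γ : Type} [AddCommGroup Γ] [Fintype Γ] [DecidableEq Γ] (χ : Γ → Γ → ℤ) :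
    Prop where
  two_torsion : ∀ g : Γ, g + g = 0
  map_add : ∀ t g h, χ t (g + h) = χ t g * χ t h
  sign : ∀ t g, χ t g = 1 ∨ χ t g = -1
  sum_eq : ∀ g, ∑ t, χ t g = if g = 0 then (Fintype.card Γ : ℤ) else 0

variable {Γ : Type} [AddCommGroup Γ] [Fintype Γ] [DecidableEq Γ] {χ : Γ → Γ → ℤ}

/-- The block of an invariant matrix that belongs to the character `t`. -/
def block {𝕜 : Type} [RCLike 𝕜] (χ : Γ → Γ → ℤ) (s : Matrix (Γ × Fin 2) (Γ × Fin 2) 𝕜) (t : Γ) :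
    Matrix (Fin 2) (Fin 2) 𝕜 := fun i j => ∑ g, (χ t g : 𝕜) * s (0, i) (g, j)

/-- Invariance of a matrix under the translation action of the group on the first index. -/
def IsInvariant {𝕜 : Type} (s : Matrix (Γ × Fin 2) (Γ × Fin 2) 𝕜) : Prop :=
  ∀ g h h' i j, s (g + h, i) (g + h', j) = s (h, i) (h', j)

namespace IsCharTable

theorem abs_eq (hχ : IsCharTable χ) (t g : Γ) : |(χ t g : ℝ)| = 1 := by
  rcases hχ.sign t g with h | h <;> simp [h]

/-- The character transform of a vector. -/
def transform (χ : Γ → Γ → ℤ) : (Γ × Fin 2 → ℂ) →ₗ[ℂ] (Γ → Fin 2 → ℂ) where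
  toFun a t i := ∑ h, (χ t h : ℂ) * a (h, i)
  map_add' a b := by
    funext t i
    simp [mul_add, Finset.sum_add_distrib]
  map_smul' c a := by
    funext t i
    simp only [Pi.smul_apply, smul_eq_mul, Finset.mul_sum, RingHom.id_apply]
    exact Finset.sum_congr rfl fun h _ => by ring

theorem transform_apply (χ : Γ → Γ → ℤ) (a : Γ × Fin 2 → ℂ) (t : Γ) (i : Fin 2) :
    transform χ a t i = ∑ h, (χ t h : ℂ) * a (h, i) := rfl

theorem transform_injective (hχ : IsCharTable χ) : Function.Injective (transform χ) := by
  rw [← LinearMap.ker_eq_bot, LinearMap.ker_eq_bot']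
  intro a ha
  funext ⟨g, i⟩
  have h1 : ∑ t, (χ t g : ℂ) * transform χ a t i = Fintype.card Γ * a (g, i) := by
    simp_rw [transform_apply, Finset.mul_sum]
    rw [Finset.sum_comm]
    have h2 : ∀ h, ∑ t, (χ t g : ℂ) * ((χ t h : ℂ) * a (h, i))
        = (if g + h = 0 then (Fintype.card Γ : ℂ) else 0) * a (h, i) := fun h => by
      have := hχ.sum_eq (g + h)
      simp_rw [hχ.map_add] at this
      have h3 : ∑ t, (χ t g : ℂ) * (χ t h : ℂ) = if g + h = 0 then (Fintype.card Γ : ℂ) else 0 := by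
        exact_mod_cast this
      rw [← h3, Finset.sum_mul]
      exact Finset.sum_congr rfl fun t _ => by ring
    rw [Finset.sum_congr rfl fun h _ => h2 h, Finset.sum_eq_single g]
    · rw [if_pos (hχ.two_torsion g)]
    · intro h _ hne
      rw [if_neg, zero_mul]
      intro h0
      apply hne
      rw [← add_left_cancel_iff (a := g), h0, hχ.two_torsion]
    · intro h; exact absurd (Finset.mem_univ g) h
  rw [ha] at h1
  simp only [Pi.zero_apply, mul_zero, Finset.sum_const_zero] at h1
  have h2 : (Fintype.card Γ : ℂ) ≠ 0 := by
    have : 0 < Fintype.card Γ := Fintype.card_pos_iff.2 ⟨0⟩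
    exact_mod_cast this.ne'
  rcases mul_eq_zero.1 h1.symm with h | h
  · exact absurd h h2
  · exact h

theorem transform_mulVec (hχ : IsCharTable χ) {s : Matrix (Γ × Fin 2) (Γ × Fin 2) ℂ}
    (hs : IsInvariant s) (a : Γ × Fin 2 → ℂ) (t : Γ) :
    transform χ (s.mulVec a) t = (block χ s t).mulVec (transform χ a t) := by
  funext i
  have h1 : ∀ h, s.mulVec a (h, i) = ∑ j, ∑ g, s (0, i) (g, j) * a (h + g, j) := fun h => by
    rw [Matrix.mulVec, dotProduct, Fintype.sum_prod_type, Finset.sum_comm]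
    refine Finset.sum_congr rfl fun j _ => ?_
    refine (Fintype.sum_equiv (Equiv.addLeft h) _ _ fun g => ?_).symm
    have := hs h 0 g i j
    rw [add_zero] at this
    rw [Equiv.coe_addLeft, this]
  rw [transform_apply, Matrix.mulVec, dotProduct]
  simp_rw [h1, Finset.mul_sum]
  rw [Finset.sum_comm]
  refine Finset.sum_congr rfl fun j _ => ?_
  rw [Finset.sum_comm, block, Finset.sum_mul]
  refine Finset.sum_congr rfl fun g _ => ?_
  rw [transform_apply, Finset.mul_sum]
  refine Fintype.sum_equiv (Equiv.addRight g) _ _ fun h => ?_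
  rw [Equiv.coe_addRight, hχ.map_add]
  rcases hχ.sign t g with h | h <;> rw [h] <;> push_cast <;> ring

/-- The kernel of an invariant matrix is the direct sum of the kernels of its blocks. -/
theorem finrank_ker_eq (hχ : IsCharTable χ) {s : Matrix (Γ × Fin 2) (Γ × Fin 2) ℂ}
    (hs : IsInvariant s) : Module.finrank ℂ (LinearMap.ker s.mulVecLin)
      = ∑ t, Module.finrank ℂ (LinearMap.ker (block χ s t).mulVecLin) := by
  have hdim : Module.finrank ℂ (Γ × Fin 2 → ℂ) = Module.finrank ℂ (Γ → Fin 2 → ℂ) := by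
    rw [Module.finrank_fintype_fun_eq_card, Module.finrank_pi_fintype]
    simp
  let A := LinearMap.linearEquivOfInjective (transform χ) hχ.transform_injective hdim
  have hA : ∀ a, A a = transform χ a := fun a => rfl
  let E : LinearMap.ker s.mulVecLin ≃ₗ[ℂ] (∀ t, LinearMap.ker (block χ s t).mulVecLin) :=
    { toFun := fun a t => ⟨A a t, by
        have h0 : s.mulVec (a : Γ × Fin 2 → ℂ) = 0 := a.2
        rw [LinearMap.mem_ker, Matrix.mulVecLin_apply, hA, ← hχ.transform_mulVec hs, h0,
          _root_.map_zero]
        rfl⟩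
      map_add' := fun a b => by
        funext t; ext1
        exact congrFun (_root_.map_add A (a : Γ × Fin 2 → ℂ) b) t
      map_smul' := fun c a => by
        funext t; ext1
        exact congrFun (_root_.map_smul A c (a : Γ × Fin 2 → ℂ)) t
      invFun := fun b => ⟨A.symm fun t => b t, by
        rw [LinearMap.mem_ker, Matrix.mulVecLin_apply]
        apply hχ.transform_injective
        rw [_root_.map_zero]
        funext t
        rw [hχ.transform_mulVec hs, ← hA, A.apply_symm_apply]
        exact (b t).2⟩
      left_inv := fun a => by ext1; exact A.symm_apply_apply _
      right_inv := fun b => by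
        funext t; ext1
        exact congrFun (A.apply_symm_apply fun t => (b t : Fin 2 → ℂ)) t }
  rw [E.finrank_eq, Module.finrank_pi_fintype]

theorem block_symm (hχ : IsCharTable χ) {s : Matrix (Γ × Fin 2) (Γ × Fin 2) ℝ}
    (hs : IsInvariant s) (hsym : ∀ i j, s i j = s j i) (t : Γ) (i j : Fin 2) :
    block χ s t i j = block χ s t j i := by
  refine Finset.sum_congr rfl fun g _ => ?_
  have := hs g g 0 i j
  rw [hχ.two_torsion, add_zero] at this
  rw [this, hsym]

end IsCharTable

/-- The dimension of the kernel of a real symmetric two-by-two matrix. -/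
theorem finrank_ker_two (p : ℝ) (w : ℂ) {M : Matrix (Fin 2) (Fin 2) ℂ}
    (h00 : M 0 0 = ((p + w.re : ℝ) : ℂ)) (h01 : M 0 1 = (w.im : ℂ)) (h10 : M 1 0 = (w.im : ℂ))
    (h11 : M 1 1 = ((p - w.re : ℝ) : ℂ)) :
    Module.finrank ℂ (LinearMap.ker M.mulVecLin)
      = (if p + ‖w‖ = 0 then 1 else 0) + (if p - ‖w‖ = 0 then 1 else 0) := by
  have hdet : M.det = (((p + ‖w‖) * (p - ‖w‖) : ℝ) : ℂ) := by
    have h1 : ‖w‖ * ‖w‖ = w.re * w.re + w.im * w.im := by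
      rw [← sq, Complex.sq_norm, Complex.normSq_apply]
    have h2 : (p + ‖w‖) * (p - ‖w‖) = (p + w.re) * (p - w.re) - w.im * w.im := by
      linear_combination -h1
    rw [Matrix.det_fin_two, h00, h01, h10, h11, h2]; push_cast; ring
  have hzero : M = 0 → p = 0 ∧ w = 0 := by
    intro h
    rw [h, Matrix.zero_apply] at h00 h01 h11
    have e1 : p + w.re = 0 := by exact_mod_cast h00.symm
    have e2 : p - w.re = 0 := by exact_mod_cast h11.symm
    have e3 : w.im = 0 := by exact_mod_cast h01.symm
    exact ⟨by linarith, Complex.ext (by simp; linarith) (by simpa using e3)⟩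
  have hone : M ≠ 0 → M.det = 0 → Module.finrank ℂ (LinearMap.ker M.mulVecLin) = 1 := by
    intro hne h0
    obtain ⟨v, hv, hMv⟩ := Matrix.exists_mulVec_eq_zero_iff.2 h0
    have h1 : 0 < Module.finrank ℂ (LinearMap.ker M.mulVecLin) := by
      rw [Module.finrank_pos_iff]
      exact ⟨⟨⟨v, hMv⟩, 0, fun h => hv (congrArg Subtype.val h)⟩⟩
    have h2 : Module.finrank ℂ (LinearMap.ker M.mulVecLin) < 2 := by
      have := Submodule.finrank_lt (K := ℂ) (V := Fin 2 → ℂ) (s := LinearMap.ker M.mulVecLin) (by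
        intro h
        apply hne
        have := LinearMap.ker_eq_top.1 h
        ext i j
        have h3 := congrFun (congrArg (fun l => l (Pi.single j 1)) this) i
        simpa using h3)
      simpa using this
    omega
  by_cases hp : p + ‖w‖ = 0 <;> by_cases hm : p - ‖w‖ = 0
  · have hp0 : p = 0 := by linarith
    have hw0 : w = 0 := norm_eq_zero.1 (by linarith)
    have hM : M = 0 := by
      ext i j
      fin_cases i <;> fin_cases j <;> simp [h00, h01, h10, h11, hp0, hw0]
    rw [if_pos hp, if_pos hm, hM, Matrix.mulVecLin_zero, LinearMap.ker_zero, finrank_top]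
    simp
  · rw [if_pos hp, if_neg hm]
    refine hone (fun h => hm ?_) (by rw [hdet, hp]; simp)
    obtain ⟨h1, h2⟩ := hzero h
    simp [h1, h2]
  · rw [if_neg hp, if_pos hm]
    refine hone (fun h => hp ?_) (by rw [hdet, hm]; simp)
    obtain ⟨h1, h2⟩ := hzero h
    simp [h1, h2]
  · have h0 : M.det ≠ 0 := by
      rw [hdet]
      exact_mod_cast mul_ne_zero hp hm
    have : LinearMap.ker M.mulVecLin = ⊥ := by
      rw [LinearMap.ker_eq_bot']
      intro v hv
      by_contra hne
      exact h0 (Matrix.exists_mulVec_eq_zero_iff.1 ⟨v, hne, hv⟩)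
    rw [this, if_neg hp, if_neg hm]
    simp

end Blocks

/-! ### Eigenvalue crossings of a family of discrete Schrödinger operators -/

section SchurDeriv

variable {I : Type} [Fintype I] [DecidableEq I] {ι : I → ℤ × ℤ} {d δ : ℝ} {V : LInf ℝ}

theorem Dissipative.of_norm_sub_le (H : Dissipative ι d (2 * δ) V) (hδ : 0 < δ) {W : LInf ℝ}
    (hW : ‖W - V‖ ≤ δ) : Dissipative ι d δ W :=
  ⟨H.inj, H.d_pos, hδ, fun p hp => by
    have h1 := H.re_le p hp
    have h2 := (norm_apply_le (W - V) p).trans hW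
    rw [show (W - V) p = W p - V p from rfl, Real.norm_eq_abs] at h2
    simp only [RCLike.re_to_real] at h1 ⊢
    linarith [le_abs_self (W p - V p)]⟩

theorem Dissipative.differentiableAt_schur (H : Dissipative ι d δ V) (i j : I) :
    DifferentiableAt ℝ (fun W : LInf ℝ => schur ι d W i j) V := by
  have h1 : DifferentiableAt ℝ (fun W : LInf ℝ => pinned (range ι) d W) V := by
    unfold pinned
    have : DifferentiableAt ℝ (fun W : LInf ℝ => ((d : ℝ) • nbOp ℝ + mulOp ℝ W
      - (4 * d : ℝ) • ContinuousLinearMap.id ℝ (LInf ℝ))) V :=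
      (((mulOp ℝ).differentiableAt).const_add _).sub_const _
    exact ((differentiableAt_const (c := mulOp ℝ (ind ℝ (range ι)ᶜ))).clm_comp this).add_const _
  have h2 : DifferentiableAt ℝ (fun W : LInf ℝ => Ring.inverse (pinned (range ι) d W)) V :=
    (differentiableAt_inverse (𝕜 := ℝ) H.isUnit).comp V h1
  have h3 : DifferentiableAt ℝ (fun W : LInf ℝ => extBasis ι d W j) V :=
    h2.clm_apply (differentiableAt_const _)
  have h4 : DifferentiableAt ℝ (fun W : LInf ℝ => hop d W) V := by
    unfold hop
    exact (((mulOp ℝ).differentiableAt).const_add _).sub_const _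
  exact ((ev ℝ (ι i)).differentiableAt).comp V (h4.clm_apply h3)

/-- The derivative of the Schur complement in the potential is evaluation on the diagonal, up to
second order in `d`. -/
theorem Dissipative.exists_hasFDerivAt_schur (H : Dissipative ι d (2 * δ) V) (hδ : 0 < δ)
    (i j : I) : ∃ D : LInf ℝ →L[ℝ] ℝ, HasFDerivAt (fun W : LInf ℝ => schur ι d W i j) D V ∧
      ∀ W, |D W - if i = j then W (ι i) else 0| ≤ 16 * d ^ 2 / δ ^ 2 * ‖W‖ := by
  have H1 : Dissipative ι d δ V := H.of_norm_sub_le hδ (by rw [sub_self, norm_zero]; exact hδ.le)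
  obtain ⟨D, hD⟩ := H1.differentiableAt_schur i j
  set E : LInf ℝ →L[ℝ] ℝ := if i = j then ev ℝ (ι i) else 0 with hE
  have hEa : ∀ W : LInf ℝ, E W = if i = j then W (ι i) else 0 := fun W => by
    rw [hE]; split_ifs <;> rfl
  refine ⟨D, hD, fun W => ?_⟩
  have h1 : HasFDerivAt (fun W : LInf ℝ => schur ι d W i j - E W) (D - E) V :=
    hD.sub E.hasFDerivAt
  have h2 : ‖D - E‖ ≤ 16 * d ^ 2 / δ ^ 2 := by
    refine h1.le_of_lip' (by positivity) ?_
    filter_upwards [Metric.closedBall_mem_nhds V hδ] with W hW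
    rw [Metric.mem_closedBall, dist_eq_norm] at hW
    have h3 := (H.of_norm_sub_le hδ hW).norm_schur_sub_le H1 (η := ‖W - V‖)
      (fun p => norm_apply_le (W - V) p) i j
    refine le_of_eq_of_le ?_ h3
    congr 1
    rw [hEa, hEa]
    split_ifs <;> ring
  rw [← hEa]
  exact ((D - E).le_opNorm W).trans (mul_le_mul_of_nonneg_right h2 (norm_nonneg _))

end SchurDeriv

section Crossing

variable {Γ : Type} [AddCommGroup Γ] [Fintype Γ] [DecidableEq Γ] {χ : Γ → Γ → ℤ}

theorem IsCharTable.map_zero' (hχ : IsCharTable χ) (t : Γ) : χ t 0 = 1 := by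
  have h := hχ.map_add t 0 0
  rw [add_zero] at h
  rcases hχ.sign t 0 with h1 | h1
  · exact h1
  · rw [h1] at h; norm_num at h

theorem IsCharTable.abs_block_sub_le (hχ : IsCharTable χ) (t : Γ)
    {s : Γ → Fin 2 → ℝ} {i : Fin 2} {c η : ℝ} (j : Fin 2)
    (h : ∀ g j, |s g j - if ((0 : Γ), i) = (g, j) then c else 0| ≤ η) :
    |∑ g, (χ t g : ℝ) * s g j - if i = j then c else 0| ≤ Fintype.card Γ * η := by
  have h1 : (if i = j then c else 0) = ∑ g, (χ t g : ℝ) *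
      if ((0 : Γ), i) = (g, j) then c else 0 := by
    rw [Finset.sum_eq_single 0]
    · simp [hχ.map_zero']
    · intro g _ hg
      rw [if_neg, mul_zero]
      intro h; exact hg (Prod.ext_iff.1 h).1.symm
    · intro h; exact absurd (Finset.mem_univ _) h
  rw [h1, ← Finset.sum_sub_distrib]
  refine (Finset.abs_sum_le_sum_abs _ _).trans ?_
  refine (Finset.sum_le_card_nsmul _ _ η fun g _ => ?_).trans_eq (by simp)
  rw [← mul_sub, abs_mul, hχ.abs_eq, one_mul]
  exact h g j

/-- A family of potentials `V x`, `a ≤ x ≤ b`, that are dissipative off a finite set, equal to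
`θ x` on it, and invariant under reflections that act on the finite set, which is indexed by
`Γ × Fin 2`, as a finite group acts on two copies of itself. The function `θ` increases from large
negative to large positive values (compared with the coupling constant `d`). -/
structure IsCrossingFamily (ι : Γ × Fin 2 → ℤ × ℤ) (d δ a b : ℝ) (V : ℝ → LInf ℝ)
    (θ : ℝ → ℝ) : Prop where
  lt : a < b
  δ_pos : 0 < δ
  card_le : Fintype.card Γ ≤ 4
  small : 512 * d ^ 2 ≤ δ ^ 2
  cont : ContinuousOn V (Icc a b)
  dissipative : ∀ x ∈ Icc a b, Dissipative ι d (2 * δ) (V x)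
  eq_θ : ∀ x ∈ Icc a b, ∀ i, V x (ι i) = θ x
  reflection : ∀ g, ∃ ρ : ℤ × ℤ → ℤ × ℤ, Function.Involutive ρ ∧
    (∀ (u : ℤ × ℤ → ℝ) p, nb (fun q => u (ρ q)) p = nb u (ρ p)) ∧
    (∀ h i, ι (g + h, i) = ρ (ι (h, i))) ∧ ∀ x ∈ Icc a b, ∀ p, V x (ρ p) = V x p
  left : θ a < -(96 * d)
  right : 96 * d < θ b
  cross : ∀ x ∈ Ioo a b, |θ x| ≤ 96 * d → ∃ (V' : LInf ℝ) (θ' : ℝ), HasDerivAt V V' x ∧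
    (∀ i, V' (ι i) = θ') ∧ 192 * d ^ 2 / δ ^ 2 * ‖V'‖ < θ'

namespace IsCrossingFamily

variable {ι : Γ × Fin 2 → ℤ × ℤ} {d δ a b : ℝ} {V : ℝ → LInf ℝ} {θ : ℝ → ℝ}

/-- The entries of the block of the Schur complement that belongs to the character `t`. -/
def entry (χ : Γ → Γ → ℤ) (ι : Γ × Fin 2 → ℤ × ℤ) (d : ℝ) (t : Γ) (i j : Fin 2) (W : LInf ℝ) : ℝ :=
  block χ (schur ι d W) t i j

theorem abs_entry_sub_le (hχ : IsCharTable χ) {W : LInf ℝ} (H : Dissipative ι d δ W) {c : ℝ}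
    (hc : ∀ i, W (ι i) = c) (t : Γ) (i j : Fin 2) :
    |entry χ ι d t i j W - if i = j then c else 0| ≤ Fintype.card Γ * (8 * d) := by
  refine hχ.abs_block_sub_le t (s := fun g j => schur ι d W (0, i) (g, j)) j fun g j => ?_
  have := H.norm_schur_le (0, i) (g, j)
  rwa [hc, Real.norm_eq_abs] at this

theorem abs_entry_sub_entry_le (hχ : IsCharTable χ) {W W' : LInf ℝ} (H : Dissipative ι d δ W)
    (H' : Dissipative ι d δ W') {c η : ℝ} (hη : ∀ p, ‖W p - W' p‖ ≤ η)
    (hc : ∀ i, W (ι i) - W' (ι i) = c) (t : Γ) (i j : Fin 2) :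
    |entry χ ι d t i j W - entry χ ι d t i j W' - if i = j then c else 0|
      ≤ Fintype.card Γ * (16 * d ^ 2 / δ ^ 2 * η) := by
  have := hχ.abs_block_sub_le t
    (s := fun g j => schur ι d W (0, i) (g, j) - schur ι d W' (0, i) (g, j)) (i := i) (c := c)
    (η := 16 * d ^ 2 / δ ^ 2 * η) j fun g j => by
      have := H.norm_schur_sub_le H' hη (0, i) (g, j)
      rwa [hc, Real.norm_eq_abs] at this
  simp only [mul_sub, Finset.sum_sub_distrib] at this
  exact this

theorem exists_hasFDerivAt_entry (hχ : IsCharTable χ) {W : LInf ℝ}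
    (H : Dissipative ι d (2 * δ) W) (hδ : 0 < δ) (t : Γ) (i j : Fin 2) :
    ∃ D : LInf ℝ →L[ℝ] ℝ, HasFDerivAt (entry χ ι d t i j) D W ∧
      ∀ (W' : LInf ℝ) c, (∀ i, W' (ι i) = c) →
        |D W' - if i = j then c else 0| ≤ Fintype.card Γ * (16 * d ^ 2 / δ ^ 2 * ‖W'‖) := by
  choose D hD hD' using fun g j => H.exists_hasFDerivAt_schur hδ (0, i) (g, j)
  refine ⟨∑ g, (χ t g : ℝ) • D g j, ?_, fun W' c hc => ?_⟩
  · exact HasFDerivAt.fun_sum fun g _ => (hD g j).const_mul _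
  · have := hχ.abs_block_sub_le t (s := fun g j => D g j W') (i := i) (c := c)
      (η := 16 * d ^ 2 / δ ^ 2 * ‖W'‖) j fun g j => by
        have := hD' g j W'
        rwa [hc] at this
    simpa using this

/-- Half the trace of a block. -/
def halfTrace (χ : Γ → Γ → ℤ) (ι : Γ × Fin 2 → ℤ × ℤ) (d : ℝ) (t : Γ) (W : LInf ℝ) : ℝ :=
  (entry χ ι d t 0 0 W + entry χ ι d t 1 1 W) / 2

/-- The trace-free part of a block, as a complex number. -/
def traceFree (χ : Γ → Γ → ℤ) (ι : Γ × Fin 2 → ℤ × ℤ) (d : ℝ) (t : Γ) (W : LInf ℝ) : ℂ :=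
  ⟨(entry χ ι d t 0 0 W - entry χ ι d t 1 1 W) / 2, entry χ ι d t 0 1 W⟩

/-- Bounds for half the trace and for the trace-free part of a matrix close to a multiple of the
identity. -/
theorem abs_halfTrace_le {e : Fin 2 → Fin 2 → ℝ} {c η : ℝ}
    (h : ∀ i j, |e i j - if i = j then c else 0| ≤ η) : |(e 0 0 + e 1 1) / 2 - c| ≤ η ∧
      |(e 0 0 - e 1 1) / 2| + |e 0 1| ≤ 2 * η := by
  have h0 := abs_le.1 (h 0 0)
  have h1 := abs_le.1 (h 1 1)
  have h2 := h 0 1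
  rw [if_pos rfl] at h0 h1
  rw [if_neg (by decide), sub_zero] at h2
  have h3 : |(e 0 0 - e 1 1) / 2| ≤ η := by rw [abs_le]; constructor <;> linarith
  refine ⟨?_, by linarith⟩
  rw [abs_le]; constructor <;> linarith

theorem shiftPot_eq (W : LInf ℝ) : shiftPot W 0 = W := linf_ext fun p => by simp

theorem hasFDerivAt_shiftPot {x : ℝ} {V' : LInf ℝ} (hV : HasDerivAt V V' x) :
    ∃ L : ℝ × ℝ →L[ℝ] LInf ℝ, HasFDerivAt (fun q : ℝ × ℝ => shiftPot (V q.2) q.1) L (0, x) ∧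
      L (0, 1) = V' := by
  have h1 : HasFDerivAt (fun q : ℝ × ℝ => V q.2) _ ((0 : ℝ), x) :=
    HasFDerivAt.comp (g := V) ((0 : ℝ), x) hV.hasFDerivAt hasFDerivAt_snd
  have h2 : HasFDerivAt (fun q : ℝ × ℝ => q.1 • ind ℝ univ) _ ((0 : ℝ), x) :=
    (hasFDerivAt_fst (𝕜 := ℝ)).smul_const (ind ℝ univ)
  refine ⟨_, h1.sub h2, ?_⟩
  simp

/-- The blocks of the Schur complement of a crossing family are crossing pairs. -/
theorem isCrossingPair (hχ : IsCharTable χ) (H : IsCrossingFamily ι d δ a b V θ) (t : Γ) :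
    IsCrossingPair δ a b (fun z x => halfTrace χ ι d t (shiftPot (V x) z))
      (fun z x => traceFree χ ι d t (shiftPot (V x) z)) := by
  have hδ := H.δ_pos
  have hd : 0 < d := (H.dissipative a (left_mem_Icc.2 H.lt.le)).d_pos
  have hcard : (Fintype.card Γ : ℝ) ≤ 4 := by exact_mod_cast H.card_le
  have hD : ∀ x ∈ Icc a b, ∀ z ≥ -δ, Dissipative ι d δ (shiftPot (V x) z) := fun x hx z hz =>
    (H.dissipative x hx).shift hδ hz
  have hcst : 16 * d ^ 2 / δ ^ 2 ≤ 1 / 32 := by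
    rw [div_le_iff₀ (by positivity)]; linarith [H.small]
  have hcont : ∀ i j, ∀ z ≥ -δ,
      ContinuousOn (fun x => entry χ ι d t i j (shiftPot (V x) z)) (Icc a b) := by
    intro i j z hz
    refine continuousOn_finsetSum _ fun g _ => continuousOn_const.mul ?_
    intro x hx
    have h1 : ContinuousAt (fun W : LInf ℝ => schur ι d W (0, i) (g, j)) (shiftPot (V x) z) :=
      ((hD x hx z hz).differentiableAt_schur _ _).continuousAt
    have h2 : ContinuousWithinAt (fun x => shiftPot (V x) z) (Icc a b) x :=
      (H.cont x hx).sub continuousWithinAt_const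
    exact ContinuousAt.comp_continuousWithinAt (f := fun x => shiftPot (V x) z) h1 h2
  have hbd : ∀ x ∈ Icc a b, ∀ i j,
      |entry χ ι d t i j (shiftPot (V x) 0) - if i = j then θ x else 0| ≤ 32 * d :=
    fun x hx i j => by
      refine (abs_entry_sub_le hχ (hD x hx 0 (by linarith)) (fun k => ?_) t i j).trans ?_
      · rw [shiftPot_apply, sub_zero, H.eq_θ x hx]
      · nlinarith
  have hlip : ∀ x ∈ Icc a b, ∀ z ≥ -δ, ∀ z' ≥ -δ, ∀ i j,
      |entry χ ι d t i j (shiftPot (V x) z) - entry χ ι d t i j (shiftPot (V x) z')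
        - if i = j then -(z - z') else 0| ≤ 1 / 8 * |z - z'| := fun x hx z hz z' hz' i j => by
    refine (abs_entry_sub_entry_le hχ (hD x hx z hz) (hD x hx z' hz') (η := |z - z'|)
      (fun p => ?_) (fun k => ?_) t i j).trans ?_
    · rw [shiftPot_apply, shiftPot_apply, Real.norm_eq_abs, ← abs_neg]
      apply le_of_eq; congr 1; ring
    · rw [shiftPot_apply, shiftPot_apply]; ring
    · have : (Fintype.card Γ : ℝ) * (16 * d ^ 2 / δ ^ 2) ≤ 1 / 8 :=
        (mul_le_mul hcard hcst (by positivity) (by norm_num)).trans_eq (by norm_num)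
      rw [← mul_assoc]
      exact mul_le_mul_of_nonneg_right this (abs_nonneg _)
  have hp : ∀ x ∈ Icc a b, |halfTrace χ ι d t (shiftPot (V x) 0) - θ x| ≤ 32 * d := fun x hx =>
    (abs_halfTrace_le (hbd x hx)).1
  have hw : ∀ x ∈ Icc a b, ‖traceFree χ ι d t (shiftPot (V x) 0)‖ ≤ 64 * d := fun x hx =>
    (Complex.norm_le_abs_re_add_abs_im _).trans
      ((abs_halfTrace_le (hbd x hx)).2.trans_eq (by ring))
  constructor
  · exact fun z hz => ((hcont 0 0 z hz).add (hcont 1 1 z hz)).div_const 2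
  · intro z hz
    exact Complex.equivRealProdCLM.symm.continuous.comp_continuousOn
      ((((hcont 0 0 z hz).sub (hcont 1 1 z hz)).div_const 2).prodMk (hcont 0 1 z hz))
  · intro x hx z hz z' hz'
    have := (abs_halfTrace_le (hlip x hx z hz z' hz')).1
    refine le_trans (le_of_eq ?_) (this.trans (by linarith [abs_nonneg (z - z')]))
    congr 1; simp only [halfTrace]; ring
  · intro x hx z hz z' hz'
    refine (Complex.norm_le_abs_re_add_abs_im _).trans ?_
    refine le_trans (le_of_eq ?_) ((abs_halfTrace_le (hlip x hx z hz z' hz')).2.trans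
      (by linarith))
    rw [Complex.sub_re, Complex.sub_im]
    congr 2; simp only [traceFree]; ring
  · have h1 := abs_le.1 (hp a (left_mem_Icc.2 H.lt.le))
    have h2 := hw a (left_mem_Icc.2 H.lt.le)
    linarith [H.left]
  · have h1 := abs_le.1 (hp b (right_mem_Icc.2 H.lt.le))
    have h2 := hw b (right_mem_Icc.2 H.lt.le)
    linarith [H.right]
  · intro x hx hpw
    have hxI := Ioo_subset_Icc_self hx
    have h1 := abs_le.1 (hp x hxI)
    have h2 := hw x hxI
    have hθ : |θ x| ≤ 96 * d := by
      rw [← hpw] at h2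
      have := abs_le.1 h2
      rw [abs_le]; constructor <;> linarith
    obtain ⟨V', θ', hV', hθ', hlt⟩ := H.cross x hx hθ
    obtain ⟨L, hW, hL1⟩ := hasFDerivAt_shiftPot hV'
    have hx0 : shiftPot (V ((0 : ℝ), x).2) ((0 : ℝ), x).1 = V x := shiftPot_eq _
    choose D hDf hDb using fun i j =>
      exists_hasFDerivAt_entry hχ (H.dissipative x hxI) hδ t i j
    have hcomp : ∀ i j, HasFDerivAt (fun q : ℝ × ℝ => entry χ ι d t i j (shiftPot (V q.2) q.1))
        ((D i j).comp L) ((0 : ℝ), x) := fun i j =>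
      HasFDerivAt.comp (g := entry χ ι d t i j) ((0 : ℝ), x) (by rw [hx0]; exact hDf i j) hW
    have hval : ∀ i j, ((D i j).comp L) (0, 1) = D i j V' := fun i j => by
      rw [ContinuousLinearMap.comp_apply, hL1]
    set E : ℝ := 64 * d ^ 2 / δ ^ 2 * ‖V'‖ with hE
    have hb : ∀ i j, |D i j V' - if i = j then θ' else 0| ≤ E := fun i j => by
      refine (hDb i j V' θ' hθ').trans ?_
      rw [hE, ← mul_assoc]
      refine mul_le_mul_of_nonneg_right ?_ (norm_nonneg _)
      calc _ ≤ 4 * (16 * d ^ 2 / δ ^ 2) := mul_le_mul_of_nonneg_right hcard (by positivity)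
        _ = _ := by ring
    have hE3 : 3 * E < θ' := by
      calc 3 * E = 192 * d ^ 2 / δ ^ 2 * ‖V'‖ := by rw [hE]; ring
        _ < _ := hlt
    obtain ⟨b1, b2⟩ := abs_halfTrace_le hb
    have hP : HasFDerivAt (fun q : ℝ × ℝ => halfTrace χ ι d t (shiftPot (V q.2) q.1))
        ((1 / 2 : ℝ) • ((D 0 0).comp L + (D 1 1).comp L)) ((0 : ℝ), x) := by
      refine (((hcomp 0 0).add (hcomp 1 1)).const_mul (1 / 2)).congr_of_eventuallyEq
        (Eventually.of_forall fun q => ?_)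
      simp only [halfTrace, Pi.add_apply]; ring
    have hre : HasFDerivAt (fun q : ℝ × ℝ => (entry χ ι d t 0 0 (shiftPot (V q.2) q.1)
        - entry χ ι d t 1 1 (shiftPot (V q.2) q.1)) / 2)
        ((1 / 2 : ℝ) • ((D 0 0).comp L - (D 1 1).comp L)) ((0 : ℝ), x) := by
      refine (((hcomp 0 0).sub (hcomp 1 1)).const_mul (1 / 2)).congr_of_eventuallyEq
        (Eventually.of_forall fun q => ?_)
      simp only [Pi.sub_apply]; ring
    have hWd : HasFDerivAt (fun q : ℝ × ℝ => traceFree χ ι d t (shiftPot (V q.2) q.1))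
        ((Complex.equivRealProdCLM.symm : ℝ × ℝ →L[ℝ] ℂ).comp
          (((1 / 2 : ℝ) • ((D 0 0).comp L - (D 1 1).comp L)).prod ((D 0 1).comp L)))
        ((0 : ℝ), x) :=
      HasFDerivAt.comp (g := (Complex.equivRealProdCLM.symm : ℝ × ℝ →L[ℝ] ℂ)) ((0 : ℝ), x)
        (ContinuousLinearMap.hasFDerivAt _) (hre.prodMk (hcomp 0 1))
    refine ⟨_, _, hP, hWd, ?_⟩
    refine (Complex.norm_le_abs_re_add_abs_im _).trans_lt ?_
    have e1 : ((1 / 2 : ℝ) • ((D 0 0).comp L + (D 1 1).comp L)) (0, 1)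
        = (D 0 0 V' + D 1 1 V') / 2 := by
      rw [_root_.smul_apply, _root_.add_apply, hval, hval, smul_eq_mul]
      ring
    have e2 : (((Complex.equivRealProdCLM.symm : ℝ × ℝ →L[ℝ] ℂ).comp
          (((1 / 2 : ℝ) • ((D 0 0).comp L - (D 1 1).comp L)).prod ((D 0 1).comp L))) (0, 1)).re
        = (D 0 0 V' - D 1 1 V') / 2 := by
      have : ((1 / 2 : ℝ) • ((D 0 0).comp L - (D 1 1).comp L)) (0, 1)
          = (D 0 0 V' - D 1 1 V') / 2 := by
        rw [_root_.smul_apply, _root_.sub_apply, hval, hval, smul_eq_mul]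
        ring
      rw [← this]; rfl
    have e3 : (((Complex.equivRealProdCLM.symm : ℝ × ℝ →L[ℝ] ℂ).comp
          (((1 / 2 : ℝ) • ((D 0 0).comp L - (D 1 1).comp L)).prod ((D 0 1).comp L))) (0, 1)).im
        = D 0 1 V' := by
      rw [← hval 0 1]; rfl
    rw [e1, e2, e3]
    linarith [(abs_le.1 b1).1]

theorem isInvariant_schur (H : IsCrossingFamily ι d δ a b V θ) {x : ℝ} (hx : x ∈ Icc a b) {z : ℝ}
    (hz : -δ ≤ z) : IsInvariant (schur ι d (shiftPot (V x) z)) := by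
  intro g h h' i j
  obtain ⟨ρ, hρ, hnb, hι, hV⟩ := H.reflection g
  exact ((H.dissipative x hx).shift H.δ_pos hz).schur_comp hρ hnb
    (fun p => by rw [shiftPot_apply, shiftPot_apply, hV x hx]) (τ := fun k => (g + k.1, k.2))
    (fun k => hι k.1 k.2) (h, i) (h', j)

theorem finrank_ker (hχ : IsCharTable χ) (H : IsCrossingFamily ι d δ a b V θ) {x : ℝ}
    (hx : x ∈ Icc a b) {z : ℝ} (hz : -δ ≤ z) :
    Module.finrank ℂ (LinearMap.ker (Matrix.mulVecLin (schur ι d (cx (shiftPot (V x) z)))))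
      = ∑ t, ((if halfTrace χ ι d t (shiftPot (V x) z) + ‖traceFree χ ι d t (shiftPot (V x) z)‖ = 0
          then 1 else 0)
        + (if halfTrace χ ι d t (shiftPot (V x) z) - ‖traceFree χ ι d t (shiftPot (V x) z)‖ = 0
          then 1 else 0)) := by
  have HD := (H.dissipative x hx).shift H.δ_pos hz
  have hinv := H.isInvariant_schur hx hz
  set W := shiftPot (V x) z
  have hinv' : IsInvariant (schur ι d (cx W)) := fun g h h' i j => by
    rw [HD.schur_cx, HD.schur_cx, hinv g h h' i j]
  rw [hχ.finrank_ker_eq hinv']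
  refine Finset.sum_congr rfl fun t _ => ?_
  have hb : ∀ i j, block χ (schur ι d (cx W)) t i j = (entry χ ι d t i j W : ℂ) := fun i j => by
    unfold entry block
    push_cast
    exact Finset.sum_congr rfl fun g _ => by rw [HD.schur_cx]
  refine finrank_ker_two _ _ ?_ ?_ ?_ ?_
  · rw [hb]; congr 1; simp only [halfTrace, traceFree]; ring
  · rw [hb]; rfl
  · rw [hb]; congr 1
    exact hχ.block_symm hinv HD.schur_symm t 1 0
  · rw [hb]; congr 1; simp only [halfTrace, traceFree]; ring

/-- In a crossing family, as many eigenvalues cross zero as there are points in the finite set. -/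
theorem exists_eigenvalues (hχ : IsCharTable χ) (H : IsCrossingFamily ι d δ a b V θ) :
    ∃ lam : Γ × Fin 2 → ℝ → ℝ, (∀ j, ContinuousOn (lam j) (Icc a b)) ∧
      (∀ x ∈ Icc a b, ∀ z : ℂ, -δ < z.re →
        (z ∈ spectrum ℂ (hop d (cx (V x))) ↔ ∃ j, z = (lam j x : ℂ)) ∧
        Module.finrank ℂ (Module.End.maxGenEigenspace (hop d (cx (V x)) : LInf ℂ →ₗ[ℂ] LInf ℂ) z)
          = Nat.card {j // z = (lam j x : ℂ)}) ∧
      ∀ j, ∃ x₀ ∈ Ioo a b, lam j x₀ = 0 ∧ (∀ x ∈ Icc a b, lam j x = 0 → x = x₀) ∧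
        ∃ c > 0, HasDerivAt (lam j) c x₀ := by
  have hδ := H.δ_pos
  have hd : 0 < d := (H.dissipative a (left_mem_Icc.2 H.lt.le)).d_pos
  choose l₁ l₂ hl hroot using fun t => (H.isCrossingPair hχ t).exists_eigenvalue_curves hδ H.lt
  set lam : Γ × Fin 2 → ℝ → ℝ := fun j => ![l₁ j.1, l₂ j.1] j.2 with hlam
  have hmem : ∀ j, lam j ∈ ({l₁ j.1, l₂ j.1} : Set (ℝ → ℝ)) := by
    rintro ⟨t, i⟩
    fin_cases i <;> simp [hlam]
  have hsmall : 16 * Fintype.card (Γ × Fin 2) * d ^ 2 < δ ^ 2 := by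
    have h1 : ((Fintype.card (Γ × Fin 2) : ℕ) : ℝ) ≤ 8 := by
      have := H.card_le
      rw [Fintype.card_prod, Fintype.card_fin]
      exact_mod_cast (by omega : Fintype.card Γ * 2 ≤ 8)
    have h2 := H.small
    have h3 : 0 < d ^ 2 := by positivity
    nlinarith
  have hcount : ∀ x ∈ Icc a b, ∀ z > -δ, Module.finrank ℂ (LinearMap.ker (Matrix.mulVecLin
      (schur ι d (cx (shiftPot (V x) z))))) = ∑ j, if z = lam j x then 1 else 0 := by
    intro x hx z hz
    rw [H.finrank_ker hχ hx hz.le, Fintype.sum_prod_type]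
    refine Finset.sum_congr rfl fun t _ => ?_
    rw [Fin.sum_univ_two]
    have e0 : lam (t, 0) = l₁ t := rfl
    have e1 : lam (t, 1) = l₂ t := rfl
    rw [e0, e1]
    have h := hroot t x hx z hz
    have key : ∀ {A B : Prop} [Decidable A] [Decidable B], A ∧ B ∨ ¬A ∧ ¬B →
        (if B then 1 else 0 : ℕ) = if A then 1 else 0 := by
      intro A B _ _ h
      rcases h with h | h
      · rw [if_pos h.1, if_pos h.2]
      · rw [if_neg h.1, if_neg h.2]
    rcases h with ⟨h1, h2⟩ | ⟨h1, h2⟩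
    · rw [key h1, key h2]
    · rw [key h1, key h2, add_comm]
  refine ⟨lam, fun j => (hl j.1 _ (hmem j)).1, fun x hx z hz => ?_, fun j => (hl j.1 _ (hmem j)).2⟩
  by_cases hy : z.im = 0
  · obtain ⟨y, rfl⟩ : ∃ y : ℝ, z = (y : ℂ) := ⟨z.re, Complex.ext rfl (by simpa using hy)⟩
    rw [Complex.ofReal_re] at hz
    have hc := hcount x hx y hz
    constructor
    · rw [(H.dissipative x hx).mem_spectrum_iff hδ hz.le, hc, Ne, Finset.sum_eq_zero_iff]
      push Not
      simp
    · rw [(H.dissipative x hx).finrank_maxGenEigenspace hδ hsmall hz.le, hc,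
        Nat.card_eq_fintype_card, Fintype.card_subtype, Finset.card_filter]
      refine Finset.sum_congr rfl fun j _ => ?_
      simp [Complex.ofReal_inj]
  · have hn := (H.dissipative x hx).notMem_spectrum hδ hsmall hz.le hy
    have hne : ∀ j, z ≠ (lam j x : ℂ) := fun j h => hy (by rw [h, Complex.ofReal_im])
    refine ⟨⟨fun h => absurd h hn, fun ⟨j, hj⟩ => absurd hj (hne j)⟩, ?_⟩
    have : IsEmpty {j // z = (lam j x : ℂ)} := ⟨fun j => hne j.1 j.2⟩
    rw [Nat.card_of_isEmpty]
    have hbot : Module.End.maxGenEigenspace (hop d (cx (V x)) : LInf ℂ →ₗ[ℂ] LInf ℂ) z = ⊥ := by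
      rw [spectrum.notMem_iff, ← IsUnit.neg_iff, neg_sub] at hn
      have hinj := (ContinuousLinearMap.isUnit_iff_bijective.1 hn).1
      rw [Submodule.eq_bot_iff]
      intro v hv
      rw [Module.End.mem_maxGenEigenspace] at hv
      obtain ⟨n, hv⟩ := hv
      induction n with
      | zero => rw [pow_zero] at hv; exact hv
      | succ n ih =>
        apply ih
        rw [pow_succ', Module.End.mul_apply] at hv
        exact hinj (hv.trans (_root_.map_zero _).symm)
    rw [hbot, finrank_bot]

end IsCrossingFamily

end Crossing

theorem linearization_eq_hop {f : ℝ → ℝ → ℝ} (hf : ContDiff ℝ ∞ (fun p : ℝ × ℝ => f p.1 p.2))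
    (u : LInf ℝ) (μ d : ℝ) {V : LInf ℝ} (hV : ∀ p, V p = fu f (u p) μ) :
    linearization hf u μ d = hop d (cx V) := by
  ext1 v
  refine linf_ext fun p => ?_
  obtain ⟨n, m⟩ := p
  rw [linearization_apply, hop_apply, lap_eq_nb, cx_apply, hV]
  simp only [RCLike.ofReal_eq_complex_ofReal]
  ring

/-- The characters of the group with two elements. -/
def charTwo (t g : ZMod 2) : ℤ := if t = 1 ∧ g = 1 then -1 else 1

theorem isCharTable_charTwo : IsCharTable charTwo where
  two_torsion := by decide
  map_add := by decide
  sign := by decide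
  sum_eq := by decide

theorem IsCharTable.prod {Γ Γ' : Type} [AddCommGroup Γ] [Fintype Γ] [DecidableEq Γ]
    [AddCommGroup Γ'] [Fintype Γ'] [DecidableEq Γ'] {χ : Γ → Γ → ℤ} {χ' : Γ' → Γ' → ℤ}
    (h : IsCharTable χ) (h' : IsCharTable χ') :
    IsCharTable fun t g : Γ × Γ' => χ t.1 g.1 * χ' t.2 g.2 where
  two_torsion g := Prod.ext (h.two_torsion _) (h'.two_torsion _)
  map_add t g k := by
    rw [Prod.fst_add, Prod.snd_add, h.map_add, h'.map_add]; ring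
  sign t g := by
    rcases h.sign t.1 g.1 with h1 | h1 <;> rcases h'.sign t.2 g.2 with h2 | h2 <;> simp [h1, h2]
  sum_eq g := by
    rw [Fintype.sum_prod_type]
    simp_rw [← Finset.mul_sum, ← Finset.sum_mul, h.sum_eq, h'.sum_eq]
    simp only [Prod.ext_iff, Prod.fst_zero, Prod.snd_zero, Fintype.card_prod]
    split_ifs <;> simp_all

section Reparam

variable {Γ : Type} [AddCommGroup Γ] [Fintype Γ] [DecidableEq Γ] {χ : Γ → Γ → ℤ}
  {ι : Γ × Fin 2 → ℤ × ℤ} {d δ a b : ℝ} {V : ℝ → LInf ℝ} {θ : ℝ → ℝ}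

/-- The eigenvalue crossings, along a reparametrization of the family. -/
theorem IsCrossingFamily.eigenvaluesCross (hχ : IsCharTable χ)
    (H : IsCrossingFamily ι d δ a b V θ) {T : ℝ → (LInf ℂ →L[ℂ] LInf ℂ)} {X : ℝ → ℝ}
    (hXc : ContinuousOn X (Icc (-1) 1)) (hXm : StrictMonoOn X (Icc (-1) 1)) (hXa : X (-1) = a)
    (hXb : X 1 = b) (hX' : ∀ s ∈ Ioo (-1 : ℝ) 1, ∃ c > 0, HasDerivAt X c s)
    (hT : ∀ s ∈ Icc (-1 : ℝ) 1, T s = hop d (cx (V (X s)))) {k : ℕ}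
    (hk : Fintype.card (Γ × Fin 2) = k) : EigenvaluesCross T k := by
  obtain ⟨lam, hcont, hspec, hcross⟩ := H.exists_eigenvalues hχ
  have h11 : (-1 : ℝ) ≤ 1 := by norm_num
  have hmaps : MapsTo X (Icc (-1) 1) (Icc a b) := fun s hs => by
    rw [← hXa, ← hXb]
    exact ⟨hXm.monotoneOn (left_mem_Icc.2 h11) hs hs.1,
      hXm.monotoneOn hs (right_mem_Icc.2 h11) hs.2⟩
  set e : Fin k ≃ Γ × Fin 2 := (Fintype.equivFinOfCardEq hk).symm
  refine ⟨δ, H.δ_pos, fun j s => lam (e j) (X s), fun j => (hcont (e j)).comp hXc hmaps,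
    fun s hs z hz => ?_, fun j => ?_⟩
  · obtain ⟨h1, h2⟩ := hspec (X s) (hmaps hs) z hz
    rw [hT s hs]
    refine ⟨h1.trans ⟨fun ⟨j, hj⟩ => ⟨e.symm j, by simpa only [e.apply_symm_apply] using hj⟩,
      fun ⟨j, hj⟩ => ⟨e j, hj⟩⟩, h2.trans ?_⟩
    exact Nat.card_congr (e.symm.subtypeEquiv fun j => by
      simp only [e.apply_symm_apply])
  · obtain ⟨x₀, hx₀, hz, hu, c, hc, hd⟩ := hcross (e j)
    obtain ⟨s₀, hs₀, rfl⟩ : ∃ s ∈ Ioo (-1 : ℝ) 1, X s = x₀ := by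
      have h := intermediate_value_Ioo h11 hXc
      rw [hXa, hXb] at h
      exact h hx₀
    obtain ⟨c', hc', hX⟩ := hX' s₀ hs₀
    exact ⟨s₀, hs₀, hz, fun s hs h => hXm.injOn hs (Ioo_subset_Icc_self hs₀) (hu _ (hmaps hs) h),
      c * c', mul_pos hc hc', hd.comp s₀ hX⟩

/-- Zero belongs to the spectrum only where the potential is small on the finite set. -/
theorem IsCrossingFamily.abs_le_of_zero_mem_spectrum (hχ : IsCharTable χ)
    (H : IsCrossingFamily ι d δ a b V θ) {x : ℝ} (hx : x ∈ Icc a b)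
    (h0 : (0 : ℂ) ∈ spectrum ℂ (hop d (cx (V x)))) : |θ x| ≤ 96 * d := by
  have hδ := H.δ_pos
  have hd : 0 < d := (H.dissipative a (left_mem_Icc.2 H.lt.le)).d_pos
  have HD := H.dissipative x hx
  by_contra! hθ
  have hz : -δ ≤ (0 : ℝ) := by linarith
  rw [← Complex.ofReal_zero, HD.mem_spectrum_iff hδ hz, H.finrank_ker hχ hx hz] at h0
  apply h0
  refine Finset.sum_eq_zero fun t _ => ?_
  have HD0 := HD.shift hδ hz
  have hcard : (Fintype.card Γ : ℝ) ≤ 4 := by exact_mod_cast H.card_le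
  have hb : ∀ i j, |IsCrossingFamily.entry χ ι d t i j (shiftPot (V x) 0)
      - if i = j then θ x else 0| ≤ 32 * d := fun i j => by
    refine (IsCrossingFamily.abs_entry_sub_le hχ HD0 (fun k => ?_) t i j).trans ?_
    · rw [shiftPot_apply, sub_zero, H.eq_θ x hx]
    · nlinarith
  have b0 := abs_le.1 (hb 0 0)
  have b1 := abs_le.1 (hb 1 1)
  have b2 := hb 0 1
  rw [if_pos rfl] at b0 b1
  rw [if_neg (by decide), sub_zero] at b2
  have hw : ‖IsCrossingFamily.traceFree χ ι d t (shiftPot (V x) 0)‖ ≤ 64 * d := by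
    refine (Complex.norm_le_abs_re_add_abs_im _).trans ?_
    have h3 : |(IsCrossingFamily.traceFree χ ι d t (shiftPot (V x) 0)).re| ≤ 32 * d := by
      rw [abs_le, IsCrossingFamily.traceFree]; constructor <;> simp only <;> linarith
    have h4 : |(IsCrossingFamily.traceFree χ ι d t (shiftPot (V x) 0)).im| ≤ 32 * d := b2
    linarith
  have hw0 := norm_nonneg (IsCrossingFamily.traceFree χ ι d t (shiftPot (V x) 0))
  have hp : |IsCrossingFamily.halfTrace χ ι d t (shiftPot (V x) 0) - θ x| ≤ 32 * d := by
    rw [abs_le, IsCrossingFamily.halfTrace]; constructor <;> linarith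
  have hp' := abs_le.1 hp
  have hne : ∀ y, |y| ≤ 64 * d →
      IsCrossingFamily.halfTrace χ ι d t (shiftPot (V x) 0) + y ≠ 0 := fun y hy h => by
    have h1 := abs_le.1 hy
    have : |θ x| ≤ 96 * d := abs_le.2 ⟨by linarith, by linarith⟩
    linarith
  rw [if_neg (hne _ (by rwa [abs_of_nonneg hw0])), sub_eq_add_neg,
    if_neg (hne _ (by rwa [abs_neg, abs_of_nonneg hw0]))]
  rfl

end Reparam

/-! ### A scalar equation with a fold -/

section Reduced

/-- The partial derivative in the first variable of a function of three variables. -/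
def pd1 (F : ℝ × ℝ × ℝ → ℝ) (p : ℝ × ℝ × ℝ) : ℝ := fderiv ℝ F p (1, 0, 0)

/-- The partial derivative in the second variable of a function of three variables. -/
def pd2 (F : ℝ × ℝ × ℝ → ℝ) (p : ℝ × ℝ × ℝ) : ℝ := fderiv ℝ F p (0, 1, 0)

/-- A scalar equation `F (x, μ, d) = 0` on an open set `Ω`. The function `F` is convex in `x`,
decreases in `μ` through its zeros, and is positive somewhere on the way out of `Ω` in either
`x`-direction and in the direction of decreasing `μ`. -/
structure IsReduced (Ω : Set (ℝ × ℝ × ℝ)) (F : ℝ × ℝ × ℝ → ℝ) (μ₀ : ℝ) : Prop where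
  isOpen : IsOpen Ω
  smooth : ContDiffOn ℝ ∞ F Ω
  lt_μ₀ : ∀ x μ d, (x, μ, d) ∈ Ω → μ < μ₀
  down : ∀ x μ d, (x, μ, d) ∈ Ω → ∀ x' ∈ Ioc 0 x, (x', μ, d) ∈ Ω
  up : ∀ x μ d, (x, μ, d) ∈ Ω → ∀ μ' ∈ Ico μ μ₀, (x, μ', d) ∈ Ω
  escape_left : ∀ x μ d, (x, μ, d) ∈ Ω → ∃ x' ∈ Ioc 0 x, 0 < F (x', μ, d)
  escape_right : ∀ x μ d, (x, μ, d) ∈ Ω → ∃ x' ≥ x, (x', μ, d) ∈ Ω ∧ 0 < F (x', μ, d)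
  escape_down : ∀ x μ d, (x, μ, d) ∈ Ω → ∃ μ' ≤ μ, (x, μ', d) ∈ Ω ∧ 0 < F (x, μ', d)
  convex : ∀ p ∈ Ω, 0 < pd1 (pd1 F) p
  decreasing : ∀ p ∈ Ω, F p = 0 → pd2 F p < 0

namespace IsReduced

variable {Ω : Set (ℝ × ℝ × ℝ)} {F : ℝ × ℝ × ℝ → ℝ} {μ₀ : ℝ}

theorem hasDerivAt_curve_pd {G : ℝ × ℝ × ℝ → ℝ} {a b : ℝ → ℝ} {a' b' t d : ℝ}
    (hG : DifferentiableAt ℝ G (a t, b t, d)) (ha : HasDerivAt a a' t) (hb : HasDerivAt b b' t) :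
    HasDerivAt (fun s => G (a s, b s, d)) (pd1 G (a t, b t, d) * a' + pd2 G (a t, b t, d) * b')
      t := by
  have h := HasFDerivAt.comp_hasDerivAt t hG.hasFDerivAt
    (ha.prodMk (hb.prodMk (hasDerivAt_const t d)))
  have e : ((a', b', (0 : ℝ)) : ℝ × ℝ × ℝ) = a' • (1, 0, 0) + b' • (0, 1, 0) := by ext <;> simp
  rw [e, map_add, map_smul, map_smul, smul_eq_mul, smul_eq_mul, mul_comm a', mul_comm b'] at h
  exact h

theorem hasDerivAt_fst {G : ℝ × ℝ × ℝ → ℝ} {x μ d : ℝ} (hG : DifferentiableAt ℝ G (x, μ, d)) :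
    HasDerivAt (fun t => G (t, μ, d)) (pd1 G (x, μ, d)) x := by
  simpa using hasDerivAt_curve_pd (a := id) (b := fun _ => μ) hG (hasDerivAt_id x)
    (hasDerivAt_const x μ)

theorem hasDerivAt_snd {G : ℝ × ℝ × ℝ → ℝ} {x μ d : ℝ} (hG : DifferentiableAt ℝ G (x, μ, d)) :
    HasDerivAt (fun t => G (x, t, d)) (pd2 G (x, μ, d)) μ := by
  simpa using hasDerivAt_curve_pd (a := fun _ => x) (b := id) hG (hasDerivAt_const μ x)
    (hasDerivAt_id μ)

/-- The function takes a negative value for the given parameters. -/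
def IsNeg (Ω : Set (ℝ × ℝ × ℝ)) (F : ℝ × ℝ × ℝ → ℝ) (μ d : ℝ) : Prop :=
  ∃ x, (x, μ, d) ∈ Ω ∧ F (x, μ, d) < 0

/-- The equation has a solution with the given first and third coordinates. -/
def HasZero (Ω : Set (ℝ × ℝ × ℝ)) (F : ℝ × ℝ × ℝ → ℝ) (x d : ℝ) : Prop :=
  ∃ μ, (x, μ, d) ∈ Ω ∧ F (x, μ, d) = 0

open Classical in
/-- The smaller zero of `F (·, μ, d)`, at which the derivative in `x` is negative. -/
def xm (Ω : Set (ℝ × ℝ × ℝ)) (F : ℝ × ℝ × ℝ → ℝ) (μ d : ℝ) : ℝ :=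
  if h : ∃ x, (x, μ, d) ∈ Ω ∧ F (x, μ, d) = 0 ∧ pd1 F (x, μ, d) < 0 then h.choose else 0

open Classical in
/-- The larger zero of `F (·, μ, d)`, at which the derivative in `x` is positive. -/
def xp (Ω : Set (ℝ × ℝ × ℝ)) (F : ℝ × ℝ × ℝ → ℝ) (μ d : ℝ) : ℝ :=
  if h : ∃ x, (x, μ, d) ∈ Ω ∧ F (x, μ, d) = 0 ∧ 0 < pd1 F (x, μ, d) then h.choose else 0

open Classical in
/-- The zero of `F (x, ·, d)`. -/
def mz (Ω : Set (ℝ × ℝ × ℝ)) (F : ℝ × ℝ × ℝ → ℝ) (x d : ℝ) : ℝ :=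
  if h : HasZero Ω F x d then h.choose else 0

theorem mz_spec {x d : ℝ} (h : HasZero Ω F x d) :
    (x, mz Ω F x d, d) ∈ Ω ∧ F (x, mz Ω F x d, d) = 0 := by
  rw [mz, dif_pos h]
  exact h.choose_spec

open Classical in
/-- The first coordinate of the fold point, for the parameter `d`, on the branch that is cut off
at `μ`. -/
def xf (Ω : Set (ℝ × ℝ × ℝ)) (F : ℝ × ℝ × ℝ → ℝ) (μ d : ℝ) : ℝ :=
  if h : ∃ x ∈ Ioo (xm Ω F μ d) (xp Ω F μ d), pd1 F (x, mz Ω F x d, d) = 0 ∧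
      (∀ t ∈ Ico (xm Ω F μ d) x, pd1 F (t, mz Ω F t d, d) < 0) ∧
      ∀ t ∈ Ioc x (xp Ω F μ d), 0 < pd1 F (t, mz Ω F t d, d) then h.choose else 0

variable (H : IsReduced Ω F μ₀)

include H

theorem contDiffAt {p : ℝ × ℝ × ℝ} (hp : p ∈ Ω) : ContDiffAt ℝ ∞ F p :=
  H.smooth.contDiffAt (H.isOpen.mem_nhds hp)

theorem contDiffAt_pd1 {p : ℝ × ℝ × ℝ} (hp : p ∈ Ω) :
    ContDiffAt ℝ ∞ (pd1 F) p :=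
  ((H.contDiffAt hp).fderiv_right (m := ∞) (by simp)).clm_apply contDiffAt_const

theorem contDiffAt_pd2 {p : ℝ × ℝ × ℝ} (hp : p ∈ Ω) :
    ContDiffAt ℝ ∞ (pd2 F) p :=
  ((H.contDiffAt hp).fderiv_right (m := ∞) (by simp)).clm_apply contDiffAt_const

theorem hasDerivAt_x {x μ d : ℝ} (h : (x, μ, d) ∈ Ω) :
    HasDerivAt (fun t => F (t, μ, d)) (pd1 F (x, μ, d)) x :=
  hasDerivAt_fst ((H.contDiffAt h).differentiableAt (by simp))

theorem hasDerivAt_μ {x μ d : ℝ} (h : (x, μ, d) ∈ Ω) :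
    HasDerivAt (fun t => F (x, t, d)) (pd2 F (x, μ, d)) μ :=
  hasDerivAt_snd ((H.contDiffAt h).differentiableAt (by simp))

theorem hasDerivAt_pd1_x {x μ d : ℝ} (h : (x, μ, d) ∈ Ω) :
    HasDerivAt (fun t => pd1 F (t, μ, d)) (pd1 (pd1 F) (x, μ, d)) x :=
  hasDerivAt_fst ((H.contDiffAt_pd1 h).differentiableAt (by simp))

theorem pd1_lt {x x' μ d : ℝ} (hx : 0 < x) (hxx : x < x') (h : (x', μ, d) ∈ Ω) :
    pd1 F (x, μ, d) < pd1 F (x', μ, d) := by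
  have hI : ∀ t ∈ Icc x x', (t, μ, d) ∈ Ω := fun t ht =>
    H.down _ _ _ h t ⟨hx.trans_le ht.1, ht.2⟩
  refine strictMonoOn_of_deriv_pos (convex_Icc x x')
    (fun t ht => (H.hasDerivAt_pd1_x (hI t ht)).continuousAt.continuousWithinAt) (fun t ht => ?_)
    (left_mem_Icc.2 hxx.le) (right_mem_Icc.2 hxx.le) hxx
  have ht' := hI t (interior_subset ht)
  rw [(H.hasDerivAt_pd1_x ht').deriv]
  exact H.convex _ ht'

theorem exists_slope {x x' μ d : ℝ} (hx : 0 < x) (hxx : x < x') (h : (x', μ, d) ∈ Ω) :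
    ∃ c ∈ Ioo x x', pd1 F (c, μ, d) = (F (x', μ, d) - F (x, μ, d)) / (x' - x) := by
  have hI : ∀ t ∈ Icc x x', (t, μ, d) ∈ Ω := fun t ht =>
    H.down _ _ _ h t ⟨hx.trans_le ht.1, ht.2⟩
  exact exists_hasDerivAt_eq_slope (fun t => F (t, μ, d)) (fun t => pd1 F (t, μ, d)) hxx
    (fun t ht => (H.hasDerivAt_x (hI t ht)).continuousAt.continuousWithinAt)
    fun t ht => H.hasDerivAt_x (hI t (Ioo_subset_Icc_self ht))

theorem lt_of_pd1_nonneg {x x' μ d : ℝ} (hx : 0 < x) (hxx : x < x') (h : (x', μ, d) ∈ Ω)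
    (h0 : 0 ≤ pd1 F (x, μ, d)) : F (x, μ, d) < F (x', μ, d) := by
  obtain ⟨c, hc, hs⟩ := H.exists_slope hx hxx h
  have h1 := H.pd1_lt hx hc.1 (H.down _ _ _ h c ⟨hx.trans hc.1, hc.2.le⟩)
  have h2 : 0 < (F (x', μ, d) - F (x, μ, d)) / (x' - x) := hs ▸ h0.trans_lt h1
  have h3 : 0 < x' - x := sub_pos.2 hxx
  have := (div_pos_iff_of_pos_right h3).1 h2
  linarith

theorem lt_of_pd1_nonpos {x x' μ d : ℝ} (hx : 0 < x) (hxx : x < x') (h : (x', μ, d) ∈ Ω)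
    (h0 : pd1 F (x', μ, d) ≤ 0) : F (x', μ, d) < F (x, μ, d) := by
  obtain ⟨c, hc, hs⟩ := H.exists_slope hx hxx h
  have h1 := H.pd1_lt (hx.trans hc.1) hc.2 h
  have h2 : (F (x', μ, d) - F (x, μ, d)) / (x' - x) < 0 := hs ▸ h1.trans_le h0
  have h3 : 0 < x' - x := sub_pos.2 hxx
  rw [div_lt_iff₀ h3, zero_mul] at h2
  linarith

theorem pos {x μ d : ℝ} (h : (x, μ, d) ∈ Ω) : 0 < x := by
  obtain ⟨x', hx', -⟩ := H.escape_left _ _ _ h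
  exact hx'.1.trans_le hx'.2

theorem exists_left_zero {μ d : ℝ} (h : IsNeg Ω F μ d) :
    ∃ x, (x, μ, d) ∈ Ω ∧ F (x, μ, d) = 0 ∧ pd1 F (x, μ, d) < 0 := by
  obtain ⟨x₀, h₀, hF⟩ := h
  obtain ⟨x₁, hx₁, hF₁⟩ := H.escape_left _ _ _ h₀
  have hlt : x₁ < x₀ := lt_of_le_of_ne hx₁.2 fun e => by rw [e] at hF₁; linarith
  have hI : ∀ t ∈ Icc x₁ x₀, (t, μ, d) ∈ Ω := fun t ht =>
    H.down _ _ _ h₀ t ⟨hx₁.1.trans_le ht.1, ht.2⟩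
  obtain ⟨x, hx, hx0⟩ := intermediate_value_Ioo' hlt.le (f := fun t => F (t, μ, d))
    (fun t ht => (H.hasDerivAt_x (hI t ht)).continuousAt.continuousWithinAt) ⟨hF, hF₁⟩
  refine ⟨x, hI x (Ioo_subset_Icc_self hx), hx0, ?_⟩
  by_contra! hn
  have := H.lt_of_pd1_nonneg (hx₁.1.trans hx.1) hx.2 h₀ hn
  simp only at hx0
  linarith

theorem exists_right_zero {μ d : ℝ} (h : IsNeg Ω F μ d) :
    ∃ x, (x, μ, d) ∈ Ω ∧ F (x, μ, d) = 0 ∧ 0 < pd1 F (x, μ, d) := by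
  obtain ⟨x₀, h₀, hF⟩ := h
  obtain ⟨x₁, hx₁, h₁, hF₁⟩ := H.escape_right _ _ _ h₀
  have hlt : x₀ < x₁ := lt_of_le_of_ne hx₁ fun e => by rw [← e] at hF₁; linarith
  have hpos := H.pos h₀
  have hI : ∀ t ∈ Icc x₀ x₁, (t, μ, d) ∈ Ω := fun t ht =>
    H.down _ _ _ h₁ t ⟨hpos.trans_le ht.1, ht.2⟩
  obtain ⟨x, hx, hx0⟩ := intermediate_value_Ioo hlt.le (f := fun t => F (t, μ, d))
    (fun t ht => (H.hasDerivAt_x (hI t ht)).continuousAt.continuousWithinAt) ⟨hF, hF₁⟩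
  have hxΩ := hI x (Ioo_subset_Icc_self hx)
  refine ⟨x, hxΩ, hx0, ?_⟩
  by_contra! hn
  have := H.lt_of_pd1_nonpos hpos hx.1 hxΩ hn
  simp only at hx0
  linarith

theorem eq_of_pd1_neg {x x' μ d : ℝ} (h : (x, μ, d) ∈ Ω) (h' : (x', μ, d) ∈ Ω)
    (h0 : F (x, μ, d) = 0) (h0' : F (x', μ, d) = 0) (hx : pd1 F (x, μ, d) ≤ 0)
    (hx' : pd1 F (x', μ, d) ≤ 0) : x = x' := by
  rcases lt_trichotomy x x' with hlt | heq | hlt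
  · have := H.lt_of_pd1_nonpos (H.pos h) hlt h' hx'; linarith
  · exact heq
  · have := H.lt_of_pd1_nonpos (H.pos h') hlt h hx; linarith

theorem eq_of_pd1_pos {x x' μ d : ℝ} (h : (x, μ, d) ∈ Ω) (h' : (x', μ, d) ∈ Ω)
    (h0 : F (x, μ, d) = 0) (h0' : F (x', μ, d) = 0) (hx : 0 ≤ pd1 F (x, μ, d))
    (hx' : 0 ≤ pd1 F (x', μ, d)) : x = x' := by
  rcases lt_trichotomy x x' with hlt | heq | hlt
  · have := H.lt_of_pd1_nonneg (H.pos h) hlt h' hx; linarith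
  · exact heq
  · have := H.lt_of_pd1_nonneg (H.pos h') hlt h hx'; linarith

theorem isNeg_of_pd1_ne {x μ d : ℝ} (h : (x, μ, d) ∈ Ω) (h0 : F (x, μ, d) = 0)
    (hne : pd1 F (x, μ, d) ≠ 0) : IsNeg Ω F μ d := by
  have hΩ : ∀ᶠ t in 𝓝 x, (t, μ, d) ∈ Ω := by
    have : ContinuousAt (fun t : ℝ => (t, μ, d)) x := by fun_prop
    exact this.eventually (H.isOpen.mem_nhds h)
  rcases hne.lt_or_gt with hn | hp
  · have h1 := (upcrossing_of_deriv_pos ((H.hasDerivAt_x h).neg) (neg_pos.2 hn)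
      (by simp [h0])).1
    obtain ⟨t, ht, htΩ⟩ := (h1.and (nhdsWithin_le_nhds hΩ)).exists
    exact ⟨t, htΩ, by simpa using ht⟩
  · have h1 := (upcrossing_of_deriv_pos (H.hasDerivAt_x h) hp h0).2
    obtain ⟨t, ht, htΩ⟩ := (h1.and (nhdsWithin_le_nhds hΩ)).exists
    exact ⟨t, htΩ, ht⟩

theorem upcrossing_μ {x d a b : ℝ} (hI : ∀ t ∈ Icc a b, (x, t, d) ∈ Ω) :
    ContinuousOn (fun t => -F (x, t, d)) (Icc a b) ∧ ∀ t ∈ Icc a b, -F (x, t, d) = 0 →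
      (∀ᶠ y in 𝓝[>] t, 0 < -F (x, y, d)) ∧ ∀ᶠ y in 𝓝[<] t, -F (x, y, d) < 0 :=
  ⟨fun t ht => (H.hasDerivAt_μ (hI t ht)).neg.continuousAt.continuousWithinAt, fun t ht h0 =>
    upcrossing_of_deriv_pos (H.hasDerivAt_μ (hI t ht)).neg
      (neg_pos.2 (H.decreasing _ (hI t ht) (neg_eq_zero.1 h0))) h0⟩

theorem neg_of_lt {x μ μ' d : ℝ} (h : (x, μ, d) ∈ Ω) (h0 : F (x, μ, d) = 0) (hμ : μ < μ')
    (hμ' : μ' < μ₀) : F (x, μ', d) < 0 := by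
  obtain ⟨h1, h2⟩ := H.upcrossing_μ (x := x) (d := d) (a := μ) (b := μ') fun t ht =>
    H.up _ _ _ h t ⟨ht.1, ht.2.trans_lt hμ'⟩
  have := pos_of_upcrossing h1 (by simp [h0]) h2 μ' ⟨hμ, le_rfl⟩
  linarith

theorem eq_of_zero {x μ μ' d : ℝ} (h : (x, μ, d) ∈ Ω) (h' : (x, μ', d) ∈ Ω)
    (h0 : F (x, μ, d) = 0) (h0' : F (x, μ', d) = 0) : μ = μ' := by
  rcases lt_trichotomy μ μ' with hlt | heq | hlt
  · have := H.neg_of_lt h h0 hlt (H.lt_μ₀ _ _ _ h'); linarith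
  · exact heq
  · have := H.neg_of_lt h' h0' hlt (H.lt_μ₀ _ _ _ h); linarith

theorem hasZero_of_nonpos {x μ d : ℝ} (h : (x, μ, d) ∈ Ω) (hF : F (x, μ, d) ≤ 0) :
    ∃ μ' ≤ μ, (x, μ', d) ∈ Ω ∧ F (x, μ', d) = 0 := by
  obtain ⟨μ₁, hμ₁, h₁, hF₁⟩ := H.escape_down _ _ _ h
  have hI : ∀ t ∈ Icc μ₁ μ, (x, t, d) ∈ Ω := fun t ht =>
    H.up _ _ _ h₁ t ⟨ht.1, ht.2.trans_lt (H.lt_μ₀ _ _ _ h)⟩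
  obtain ⟨t, ht, ht0⟩ := intermediate_value_Icc' hμ₁ (f := fun t => F (x, t, d))
    (fun t ht => (H.hasDerivAt_μ (hI t ht)).continuousAt.continuousWithinAt) ⟨hF, hF₁.le⟩
  exact ⟨t, ht.2, hI t ht, ht0⟩

theorem xm_spec {μ d : ℝ} (h : IsNeg Ω F μ d) : (xm Ω F μ d, μ, d) ∈ Ω ∧
    F (xm Ω F μ d, μ, d) = 0 ∧ pd1 F (xm Ω F μ d, μ, d) < 0 := by
  have h1 := H.exists_left_zero h
  rw [xm, dif_pos h1]
  exact h1.choose_spec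

theorem xp_spec {μ d : ℝ} (h : IsNeg Ω F μ d) : (xp Ω F μ d, μ, d) ∈ Ω ∧
    F (xp Ω F μ d, μ, d) = 0 ∧ 0 < pd1 F (xp Ω F μ d, μ, d) := by
  have h1 := H.exists_right_zero h
  rw [xp, dif_pos h1]
  exact h1.choose_spec

theorem xm_eq {x μ d : ℝ} (h : (x, μ, d) ∈ Ω) (h0 : F (x, μ, d) = 0)
    (hx : pd1 F (x, μ, d) < 0) : xm Ω F μ d = x := by
  obtain ⟨h1, h2, h3⟩ := H.xm_spec (H.isNeg_of_pd1_ne h h0 hx.ne)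
  exact H.eq_of_pd1_neg h1 h h2 h0 h3.le hx.le

theorem xp_eq {x μ d : ℝ} (h : (x, μ, d) ∈ Ω) (h0 : F (x, μ, d) = 0)
    (hx : 0 < pd1 F (x, μ, d)) : xp Ω F μ d = x := by
  obtain ⟨h1, h2, h3⟩ := H.xp_spec (H.isNeg_of_pd1_ne h h0 hx.ne')
  exact H.eq_of_pd1_pos h1 h h2 h0 h3.le hx.le

theorem mz_eq {x μ d : ℝ} (h : (x, μ, d) ∈ Ω) (h0 : F (x, μ, d) = 0) : mz Ω F x d = μ := by
  obtain ⟨h1, h2⟩ := mz_spec (⟨μ, h, h0⟩ : HasZero Ω F x d)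
  exact H.eq_of_zero h1 h h2 h0

theorem contDiffAt_zero {φ : ℝ → ℝ → ℝ} {μ d : ℝ} (h1 : (φ μ d, μ, d) ∈ Ω)
    (h2 : F (φ μ d, μ, d) = 0) (h3 : pd1 F (φ μ d, μ, d) ≠ 0)
    (hu : ∀ᶠ p in 𝓝 (φ μ d, μ, d), F p = 0 → φ p.2.1 p.2.2 = p.1) :
    ContDiffAt ℝ ∞ (fun q : ℝ × ℝ => φ q.1 q.2) (μ, d) := by
  have hperm : ContDiff ℝ ∞ fun q : (ℝ × ℝ) × ℝ => (q.2, q.1.1, q.1.2) := by fun_prop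
  refine contDiffAt_of_unique_real_zero
    (f := fun q : (ℝ × ℝ) × ℝ => F (q.2, q.1.1, q.1.2)) (y := φ μ d)
    (ContDiffAt.comp (g := F) ((μ, d), φ μ d) (H.contDiffAt h1) hperm.contDiffAt) h2 h3
    (H.hasDerivAt_x h1) ?_
  have hc : ContinuousAt (fun q : (ℝ × ℝ) × ℝ => (q.2, q.1.1, q.1.2)) ((μ, d), φ μ d) :=
    hperm.continuous.continuousAt
  exact hc.eventually hu

theorem contDiffAt_xm {μ d : ℝ} (h : IsNeg Ω F μ d) :
    ContDiffAt ℝ ∞ (fun q : ℝ × ℝ => xm Ω F q.1 q.2) (μ, d) := by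
  obtain ⟨h1, h2, h3⟩ := H.xm_spec h
  refine H.contDiffAt_zero h1 h2 h3.ne ?_
  filter_upwards [H.isOpen.mem_nhds h1,
    (H.contDiffAt_pd1 h1).continuousAt.eventually (gt_mem_nhds h3)] with q hq hq' h0
    using H.xm_eq hq h0 hq'

theorem contDiffAt_xp {μ d : ℝ} (h : IsNeg Ω F μ d) :
    ContDiffAt ℝ ∞ (fun q : ℝ × ℝ => xp Ω F q.1 q.2) (μ, d) := by
  obtain ⟨h1, h2, h3⟩ := H.xp_spec h
  refine H.contDiffAt_zero h1 h2 h3.ne' ?_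
  filter_upwards [H.isOpen.mem_nhds h1,
    (H.contDiffAt_pd1 h1).continuousAt.eventually (lt_mem_nhds h3)] with q hq hq' h0
    using H.xp_eq hq h0 hq'

theorem contDiffAt_mz {x d : ℝ} (h : HasZero Ω F x d) :
    ContDiffAt ℝ ∞ (fun q : ℝ × ℝ => mz Ω F q.1 q.2) (x, d) := by
  obtain ⟨h1, h2⟩ := mz_spec h
  have hperm : ContDiff ℝ ∞ fun q : (ℝ × ℝ) × ℝ => (q.1.1, q.2, q.1.2) := by fun_prop
  refine contDiffAt_of_unique_real_zero
    (f := fun q : (ℝ × ℝ) × ℝ => F (q.1.1, q.2, q.1.2)) (y := mz Ω F x d)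
    (ContDiffAt.comp (g := F) ((x, d), mz Ω F x d) (H.contDiffAt h1) hperm.contDiffAt) h2
    (H.decreasing _ h1 h2).ne (H.hasDerivAt_μ h1) ?_
  have hc : ContinuousAt (fun q : (ℝ × ℝ) × ℝ => (q.1.1, q.2, q.1.2)) ((x, d), mz Ω F x d) :=
    hperm.continuous.continuousAt
  filter_upwards [hc.eventually (H.isOpen.mem_nhds h1)] with q hq h0
  exact H.mz_eq hq h0

theorem eventually_hasZero {x d : ℝ} (h : HasZero Ω F x d) :
    ∀ᶠ q : ℝ × ℝ in 𝓝 (x, d), HasZero Ω F q.1 q.2 := by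
  obtain ⟨h1, h2⟩ := mz_spec h
  have hperm : ContDiff ℝ ∞ fun q : (ℝ × ℝ) × ℝ => (q.1.1, q.2, q.1.2) := by fun_prop
  have hc : ContinuousAt (fun q : (ℝ × ℝ) × ℝ => (q.1.1, q.2, q.1.2)) ((x, d), mz Ω F x d) :=
    hperm.continuous.continuousAt
  have := eventually_exists_real_zero
    (f := fun q : (ℝ × ℝ) × ℝ => F (q.1.1, q.2, q.1.2)) (y := mz Ω F x d)
    (ContDiffAt.comp (g := F) ((x, d), mz Ω F x d) (H.contDiffAt h1) hperm.contDiffAt) h2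
    (H.decreasing _ h1 h2).ne (H.hasDerivAt_μ h1) (hc (H.isOpen.mem_nhds h1))
  filter_upwards [this] with q hq
  obtain ⟨z, hz, hz0⟩ := hq
  exact ⟨z, hz, hz0⟩

theorem hasDerivAt_mz {x d : ℝ} (h : HasZero Ω F x d) :
    HasDerivAt (fun t => mz Ω F t d)
      (-pd1 F (x, mz Ω F x d, d) / pd2 F (x, mz Ω F x d, d)) x := by
  obtain ⟨h1, h2⟩ := mz_spec h
  have hne := (H.decreasing _ h1 h2).ne
  have hm : DifferentiableAt ℝ (fun t => mz Ω F t d) x :=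
    ((H.contDiffAt_mz h).differentiableAt (by simp)).comp x
      (f := fun t : ℝ => (t, d)) (by fun_prop)
  have h3 := hasDerivAt_curve_pd (a := id) (b := fun t => mz Ω F t d)
    ((H.contDiffAt h1).differentiableAt (by simp)) (hasDerivAt_id x) hm.hasDerivAt
  have h4 : (fun s => F (id s, mz Ω F s d, d)) =ᶠ[𝓝 x] fun _ => 0 := by
    have hc : ContinuousAt (fun t : ℝ => (t, d)) x := by fun_prop
    filter_upwards [hc.eventually (H.eventually_hasZero h)] with t ht
    exact (mz_spec ht).2
  have h5 := (h3.congr_of_eventuallyEq h4.symm).unique (hasDerivAt_const x (0 : ℝ))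
  have h6 : deriv (fun t => mz Ω F t d) x
      = -pd1 F (x, mz Ω F x d, d) / pd2 F (x, mz Ω F x d, d) := by
    rw [eq_div_iff hne]
    simp only [id] at h5
    linarith
  rw [← h6]
  exact hm.hasDerivAt

/-- The slope of `F` in the first variable along the curve of zeros. -/
theorem hasDerivAt_pd1_mz {x d : ℝ} (h : HasZero Ω F x d) (h0 : pd1 F (x, mz Ω F x d, d) = 0) :
    HasDerivAt (fun t => pd1 F (t, mz Ω F t d, d)) (pd1 (pd1 F) (x, mz Ω F x d, d)) x := by
  have h1 := H.hasDerivAt_mz h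
  rw [h0, neg_zero, zero_div] at h1
  have := hasDerivAt_curve_pd (a := id) (b := fun t => mz Ω F t d)
    ((H.contDiffAt_pd1 (mz_spec h).1).differentiableAt (by simp)) (hasDerivAt_id x) h1
  simpa using this

theorem contDiffAt_pd1_mz {x d : ℝ} (h : HasZero Ω F x d) :
    ContDiffAt ℝ ∞ (fun q : ℝ × ℝ => pd1 F (q.1, mz Ω F q.1 q.2, q.2)) (x, d) :=
  ContDiffAt.comp (g := pd1 F) (f := fun q : ℝ × ℝ => (q.1, mz Ω F q.1 q.2, q.2)) (x, d)
    (H.contDiffAt_pd1 (mz_spec h).1)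
    (contDiffAt_fst.prodMk ((H.contDiffAt_mz h).prodMk contDiffAt_snd))

theorem exists_second_deriv {x d : ℝ} (h : HasZero Ω F x d) (h0 : pd1 F (x, mz Ω F x d, d) = 0) :
    ∃ c > 0, HasDerivAt (deriv fun t => mz Ω F t d) c x := by
  obtain ⟨h1, h2⟩ := mz_spec h
  have hneg := H.decreasing _ h1 h2
  have hev : (deriv fun t => mz Ω F t d) =ᶠ[𝓝 x]
      fun t => pd1 F (t, mz Ω F t d, d) * (-(pd2 F (t, mz Ω F t d, d))⁻¹) := by
    have hc : ContinuousAt (fun t : ℝ => (t, d)) x := by fun_prop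
    filter_upwards [hc.eventually (H.eventually_hasZero h)] with t ht
    rw [(H.hasDerivAt_mz ht).deriv]; ring
  have hk : DifferentiableAt ℝ (fun t => -(pd2 F (t, mz Ω F t d, d))⁻¹) x :=
    ((hasDerivAt_curve_pd (a := id) (b := fun t => mz Ω F t d)
      ((H.contDiffAt_pd2 h1).differentiableAt (by simp)) (hasDerivAt_id x)
      (H.hasDerivAt_mz h)).differentiableAt.fun_inv hneg.ne).neg
  have := ((H.hasDerivAt_pd1_mz h h0).mul hk.hasDerivAt).congr_of_eventuallyEq hev
  rw [h0, zero_mul, add_zero] at this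
  exact ⟨_, mul_pos (H.convex _ h1) (neg_pos.2 (inv_lt_zero.2 hneg)), this⟩

theorem xm_lt_xp {μ d : ℝ} (h : IsNeg Ω F μ d) : xm Ω F μ d < xp Ω F μ d := by
  obtain ⟨h1, h2, h3⟩ := H.xm_spec h
  obtain ⟨k1, k2, k3⟩ := H.xp_spec h
  by_contra! hle
  rcases hle.eq_or_lt with heq | hlt
  · rw [heq] at k3; linarith
  · have := H.pd1_lt (H.pos k1) hlt h1; linarith

theorem neg_of_mem_Ioo {μ d x : ℝ} (h : IsNeg Ω F μ d) (hx : x ∈ Ioo (xm Ω F μ d) (xp Ω F μ d)) :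
    F (x, μ, d) < 0 := by
  obtain ⟨h1, h2, h3⟩ := H.xm_spec h
  obtain ⟨k1, k2, k3⟩ := H.xp_spec h
  have hxΩ := H.down _ _ _ k1 x ⟨(H.pos h1).trans hx.1, hx.2.le⟩
  rcases le_total (pd1 F (x, μ, d)) 0 with hle | hle
  · have := H.lt_of_pd1_nonpos (H.pos h1) hx.1 hxΩ hle; linarith
  · have := H.lt_of_pd1_nonneg (H.pos hxΩ) hx.2 k1 hle; linarith

theorem mem_Icc_of_nonpos {μ d x : ℝ} (hx : (x, μ, d) ∈ Ω) (h : IsNeg Ω F μ d)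
    (h0 : F (x, μ, d) ≤ 0) : x ∈ Icc (xm Ω F μ d) (xp Ω F μ d) := by
  obtain ⟨h1, h2, h3⟩ := H.xm_spec h
  obtain ⟨k1, k2, k3⟩ := H.xp_spec h
  constructor
  · by_contra! hlt
    have := H.lt_of_pd1_nonpos (H.pos hx) hlt h1 h3.le; linarith
  · by_contra! hlt
    have := H.lt_of_pd1_nonneg (H.pos k1) hlt hx k3.le; linarith

/-- Over the interval between the two zeros for `μ`, the zero set is the graph of a function of `x`
with values at most `μ`. -/
theorem hasZero_of_mem_Icc {μ d x : ℝ} (h : IsNeg Ω F μ d)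
    (hx : x ∈ Icc (xm Ω F μ d) (xp Ω F μ d)) : HasZero Ω F x d ∧ mz Ω F x d ≤ μ := by
  obtain ⟨h1, h2, h3⟩ := H.xm_spec h
  obtain ⟨k1, k2, k3⟩ := H.xp_spec h
  have hxΩ := H.down _ _ _ k1 x ⟨(H.pos h1).trans_le hx.1, hx.2⟩
  have hle : F (x, μ, d) ≤ 0 := by
    rcases hx.1.eq_or_lt with e | hl
    · rw [← e, h2]
    rcases hx.2.eq_or_lt with e | hr
    · rw [e, k2]
    exact (H.neg_of_mem_Ioo h ⟨hl, hr⟩).le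
  obtain ⟨μ', hμ', hΩ, h0⟩ := H.hasZero_of_nonpos hxΩ hle
  exact ⟨⟨μ', hΩ, h0⟩, by rw [H.mz_eq hΩ h0]; exact hμ'⟩

/-- For parameters with a negative value there is exactly one fold point between the two zeros. -/
theorem exists_fold {μ d : ℝ} (h : IsNeg Ω F μ d) :
    ∃ x ∈ Ioo (xm Ω F μ d) (xp Ω F μ d), pd1 F (x, mz Ω F x d, d) = 0 ∧
      (∀ t ∈ Ico (xm Ω F μ d) x, pd1 F (t, mz Ω F t d, d) < 0) ∧
      ∀ t ∈ Ioc x (xp Ω F μ d), 0 < pd1 F (t, mz Ω F t d, d) := by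
  obtain ⟨h1, h2, h3⟩ := H.xm_spec h
  obtain ⟨k1, k2, k3⟩ := H.xp_spec h
  have hlt := H.xm_lt_xp h
  set a := xm Ω F μ d
  set b := xp Ω F μ d
  have hc : ∀ t ∈ Icc a b, ContinuousAt (fun t => pd1 F (t, mz Ω F t d, d)) t := fun t ht =>
    ContinuousAt.comp (g := fun q : ℝ × ℝ => pd1 F (q.1, mz Ω F q.1 q.2, q.2))
      (f := fun t : ℝ => (t, d)) (H.contDiffAt_pd1_mz (H.hasZero_of_mem_Icc h ht).1).continuousAt
      (by fun_prop)
  have hco : ContinuousOn (fun t => pd1 F (t, mz Ω F t d, d)) (Icc a b) := fun t ht =>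
    (hc t ht).continuousWithinAt
  have ea : pd1 F (a, mz Ω F a d, d) < 0 := by rw [H.mz_eq h1 h2]; exact h3
  have eb : 0 < pd1 F (b, mz Ω F b d, d) := by rw [H.mz_eq k1 k2]; exact k3
  obtain ⟨x, hx, hx0⟩ := intermediate_value_Ioo hlt.le hco ⟨ea, eb⟩
  have hup : ∀ t ∈ Icc a b, pd1 F (t, mz Ω F t d, d) = 0 →
      (∀ᶠ y in 𝓝[>] t, 0 < pd1 F (y, mz Ω F y d, d)) ∧
        ∀ᶠ y in 𝓝[<] t, pd1 F (y, mz Ω F y d, d) < 0 := fun t ht ht0 => by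
    have hz := (H.hasZero_of_mem_Icc h ht).1
    exact upcrossing_of_deriv_pos (H.hasDerivAt_pd1_mz hz ht0) (H.convex _ (mz_spec hz).1) ht0
  refine ⟨x, hx, hx0, ?_, ?_⟩
  · exact neg_of_upcrossing (hco.mono (Icc_subset_Icc_right hx.2.le)) hx0
      fun t ht => hup t ⟨ht.1, ht.2.trans hx.2.le⟩
  · exact pos_of_upcrossing (hco.mono (Icc_subset_Icc_left hx.1.le)) hx0
      fun t ht => hup t ⟨hx.1.le.trans ht.1, ht.2⟩

theorem xf_spec {μ d : ℝ} (h : IsNeg Ω F μ d) : xf Ω F μ d ∈ Ioo (xm Ω F μ d) (xp Ω F μ d) ∧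
    pd1 F (xf Ω F μ d, mz Ω F (xf Ω F μ d) d, d) = 0 ∧
      (∀ t ∈ Ico (xm Ω F μ d) (xf Ω F μ d), pd1 F (t, mz Ω F t d, d) < 0) ∧
      ∀ t ∈ Ioc (xf Ω F μ d) (xp Ω F μ d), 0 < pd1 F (t, mz Ω F t d, d) := by
  have h1 := H.exists_fold h
  rw [xf, dif_pos h1]
  exact h1.choose_spec

theorem contDiffAt_xf {μ d : ℝ} (h : ∀ᶠ d' in 𝓝 d, IsNeg Ω F μ d') :
    ContDiffAt ℝ ∞ (fun d => xf Ω F μ d) d := by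
  have hd := h.self_of_nhds
  obtain ⟨h1, h2, h3⟩ := H.xf_spec hd
  have hz := (H.hasZero_of_mem_Icc hd (Ioo_subset_Icc_self h1)).1
  refine contDiffAt_of_unique_real_zero
    (f := fun q : ℝ × ℝ => pd1 F (q.2, mz Ω F q.2 q.1, q.1)) (y := xf Ω F μ d)
    (ContDiffAt.comp (g := fun q : ℝ × ℝ => pd1 F (q.1, mz Ω F q.1 q.2, q.2))
      (f := fun q : ℝ × ℝ => (q.2, q.1)) (d, xf Ω F μ d) (H.contDiffAt_pd1_mz hz)
      (by fun_prop)) h2 (H.convex _ (mz_spec hz).1).ne' (H.hasDerivAt_pd1_mz hz h2) ?_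
  have ha : ContinuousAt (fun q : ℝ × ℝ => xm Ω F μ q.1) (d, xf Ω F μ d) :=
    ContinuousAt.comp (g := fun q : ℝ × ℝ => xm Ω F q.1 q.2) (f := fun q : ℝ × ℝ => (μ, q.1))
      (H.contDiffAt_xm hd).continuousAt (by fun_prop)
  have hb : ContinuousAt (fun q : ℝ × ℝ => xp Ω F μ q.1) (d, xf Ω F μ d) :=
    ContinuousAt.comp (g := fun q : ℝ × ℝ => xp Ω F q.1 q.2) (f := fun q : ℝ × ℝ => (μ, q.1))
      (H.contDiffAt_xp hd).continuousAt (by fun_prop)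
  have hx : ContinuousAt (fun q : ℝ × ℝ => q.2) (d, xf Ω F μ d) := continuousAt_snd
  have hd' : ∀ᶠ q : ℝ × ℝ in 𝓝 (d, xf Ω F μ d), IsNeg Ω F μ q.1 :=
    (continuousAt_fst (p := (d, xf Ω F μ d))).eventually h
  filter_upwards [ha.eventually_lt hx h1.1, hx.eventually_lt hb h1.2, hd'] with q hqa hqb hqd h0
  obtain ⟨-, -, k2, k3⟩ := H.xf_spec hqd
  rcases lt_trichotomy q.2 (xf Ω F μ q.1) with hlt | heq | hlt
  · have := k2 q.2 ⟨hqa.le, hlt⟩; linarith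
  · exact heq.symm
  · have := k3 q.2 ⟨hlt, hqb.le⟩; linarith

end IsReduced

end Reduced

/-! ### The nonlinearity near the transcritical point and near the upper equilibrium -/

section LocalModel

theorem abs_sub_le_of_hasDerivAt {φ φ' : ℝ → ℝ} {a b C : ℝ}
    (h : ∀ s ∈ uIcc a b, HasDerivAt φ (φ' s) s) (hC : ∀ s ∈ uIcc a b, |φ' s| ≤ C) :
    |φ b - φ a| ≤ C * |b - a| :=
  (convex_uIcc a b).norm_image_sub_le_of_norm_hasDerivWithin_le
    (fun s hs => (h s hs).hasDerivWithinAt) hC left_mem_uIcc right_mem_uIcc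

theorem mem_closedBall_of_abs {t t₀ μ B : ℝ} (ht : |t - t₀| ≤ B) (hμ : |μ| ≤ B) :
    (t, μ) ∈ Metric.closedBall (t₀, (0 : ℝ)) B := by
  rw [Metric.mem_closedBall, dist_eq_norm, Prod.norm_def]
  simp only [Prod.fst_sub, Prod.snd_sub, sub_zero, Real.norm_eq_abs]
  exact max_le ht hμ

theorem exists_lipschitz_ball {h : ℝ × ℝ → ℝ} (hh : ContDiff ℝ ∞ h) (t₀ : ℝ) :
    ∃ C > 0, ∀ {t μ B : ℝ}, B ≤ 1 → |t - t₀| ≤ B → |μ| ≤ B →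
      |h (t, μ) - h (t₀, 0)| ≤ C * B := by
  obtain ⟨C, hC⟩ := (isCompact_closedBall (t₀, (0 : ℝ)) 1).exists_bound_of_continuousOn
    (hh.continuous_fderiv (by simp)).continuousOn
  refine ⟨max C 1, by positivity, fun {t μ B} hB ht hμ => ?_⟩
  refine ((convex_closedBall (t₀, (0 : ℝ)) 1).norm_image_sub_le_of_norm_fderiv_le
    (fun x _ => hh.differentiable (by simp) x) (fun x hx => (hC x hx).trans (le_max_left _ _))
    (Metric.mem_closedBall_self zero_le_one)
    (mem_closedBall_of_abs (ht.trans hB) (hμ.trans hB))).trans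
    (mul_le_mul_of_nonneg_left ?_ (by positivity))
  rw [← dist_eq_norm]
  exact mem_closedBall_of_abs ht hμ

theorem exists_bound_ball {h : ℝ × ℝ → ℝ} (hh : ContDiff ℝ ∞ h) (t₀ : ℝ) :
    ∃ C > 0, ∀ {t μ : ℝ}, |t - t₀| ≤ 1 → |μ| ≤ 1 → |h (t, μ)| ≤ C := by
  obtain ⟨C, hC⟩ := (isCompact_closedBall (t₀, (0 : ℝ)) 1).exists_bound_of_continuousOn
    hh.continuous.continuousOn
  exact ⟨max C 1, by positivity, fun {t μ} ht hμ =>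
    (hC _ (mem_closedBall_of_abs ht hμ)).trans (le_max_left _ _)⟩

/-- A continuous function that vanishes on `(0, 1)` vanishes at `0`. -/
theorem eq_zero_of_Ioo {φ : ℝ → ℝ} (hφ : ContinuousAt φ 0) (h : ∀ t ∈ Ioo (0 : ℝ) 1, φ t = 0) :
    φ 0 = 0 := by
  refine tendsto_nhds_unique (hφ.tendsto.mono_left nhdsWithin_le_nhds : Tendsto φ (𝓝[>] 0) _)
    (tendsto_const_nhds.congr' ?_)
  filter_upwards [Ioo_mem_nhdsGT one_pos] with t ht using (h t ht).symm

/-- The limit of `φ t / t ^ 2` is half the second derivative. -/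
theorem tendsto_div_sq {φ φ' : ℝ → ℝ} {c : ℝ} (h : ∀ t, HasDerivAt φ (φ' t) t) (h0 : φ 0 = 0)
    (h1 : φ' 0 = 0) (h2 : HasDerivAt φ' c 0) :
    Tendsto (fun t => φ t / t ^ 2) (𝓝[>] 0) (𝓝 (c / 2)) := by
  have hs : Tendsto (fun t => φ' t / (2 * t)) (𝓝[>] 0) (𝓝 (c / 2)) := by
    have h3 := (hasDerivAt_iff_tendsto_slope.1 h2).mono_left
      (nhdsWithin_mono 0 fun y (hy : y ∈ Ioi (0 : ℝ)) => ne_of_gt hy)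
    refine (h3.div_const 2).congr fun t => ?_
    rw [slope_def_field, h1, sub_zero, sub_zero, div_div, mul_comm]
  refine HasDerivAt.lhopital_zero_nhdsGT (f' := φ') (g' := fun t => 2 * t)
    (Eventually.of_forall h) (Eventually.of_forall fun t => ?_) ?_ ?_ ?_ hs
  · simpa using hasDerivAt_pow 2 t
  · filter_upwards [self_mem_nhdsWithin] with t (ht : 0 < t)
    positivity
  · have := (h 0).continuousAt.tendsto
    rw [h0] at this
    exact this.mono_left nhdsWithin_le_nhds
  · have : Tendsto (fun t : ℝ => t ^ 2) (𝓝 0) (𝓝 (0 ^ 2)) := (continuous_pow 2).tendsto 0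
    rw [zero_pow two_ne_zero] at this
    exact this.mono_left nhdsWithin_le_nhds

theorem D1_D2_comm {g : ℝ × ℝ → ℝ} (hg : ContDiff ℝ ∞ g) (p : ℝ × ℝ) :
    D1 (D2 g) p = D2 (D1 g) p := by
  have h1 := ((contDiff_infty.1 hg 2).contDiffAt (x := p)).isSymmSndFDerivAt (by simp)
  have h2 : DifferentiableAt ℝ (fderiv ℝ g) p :=
    (hg.fderiv_right (m := ∞) (by simp)).differentiable (by simp) p
  have e : ∀ v w : ℝ × ℝ, fderiv ℝ (fun q => fderiv ℝ g q v) p w = fderiv ℝ (fderiv ℝ g) p w v :=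
    fun v w => by
      rw [fderiv_clm_apply h2 (differentiableAt_const v)]
      simp
  change fderiv ℝ (fun q => fderiv ℝ g q (0, 1)) p (1, 0)
    = fderiv ℝ (fun q => fderiv ℝ g q (1, 0)) p (0, 1)
  rw [e, e]
  exact h1 _ _

/-- Quantitative form of the assumptions on the nonlinearity `g` for small positive `μ`: on
`[-μ, 2 μ]` it is close to `t ^ 2 - μ t`, and on `[1 - r, 1 + r]` it is decreasing, with a zero
within `K μ ^ 2` of `1 + a μ`. -/
structure LocalModel (g : ℝ × ℝ → ℝ) (um up : ℝ → ℝ) (a K Λ r μ₀ : ℝ) : Prop where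
  smooth : ContDiff ℝ ∞ g
  one_le : 1 ≤ Λ
  r_pos : 0 < r
  r_le : r ≤ 1 / 4
  K_nonneg : 0 ≤ K
  K_le : K ≤ Λ
  a_le : |a| ≤ Λ
  μ₀_pos : 0 < μ₀
  small : Λ ^ 2 * √μ₀ ≤ 1 / 10 ^ 6
  margin : ∀ μ ∈ Ioo 0 μ₀, |a| * μ + K * μ ^ 2 ≤ r / 2
  zero : ∀ μ ∈ Ioo 0 μ₀, g (0, μ) = 0
  val : ∀ μ ∈ Ioo 0 μ₀, ∀ t ∈ Icc (-μ) (2 * μ), |g (t, μ) - (t ^ 2 - μ * t)| ≤ Λ * μ ^ 2 * |t|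
  d1 : ∀ μ ∈ Ioo 0 μ₀, ∀ t ∈ Icc (-μ) (2 * μ), |D1 g (t, μ) - (2 * t - μ)| ≤ Λ * μ ^ 2
  d11 : ∀ μ ∈ Ioo 0 μ₀, ∀ t ∈ Icc (-μ) (2 * μ), |D1 (D1 g) (t, μ) - 2| ≤ Λ * μ
  d2 : ∀ μ ∈ Ioo 0 μ₀, ∀ t ∈ Icc (-μ) (2 * μ), |D2 g (t, μ) + t| ≤ Λ * μ * |t|
  d21 : ∀ μ ∈ Ioo 0 μ₀, ∀ t ∈ Icc (-μ) (2 * μ), |D2 (D1 g) (t, μ) + 1| ≤ Λ * μ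
  one_d1 : ∀ μ ∈ Ioo 0 μ₀, ∀ t ∈ Icc (1 - r) (1 + r), D1 g (t, μ) ≤ -(1 / Λ)
  one_d11 : ∀ μ ∈ Ioo 0 μ₀, ∀ t ∈ Icc (1 - r) (1 + r), |D1 (D1 g) (t, μ)| ≤ Λ
  one_d2 : ∀ μ ∈ Ioo 0 μ₀, ∀ t ∈ Icc (1 - r) (1 + r), |D2 g (t, μ)| ≤ Λ
  one_d21 : ∀ μ ∈ Ioo 0 μ₀, ∀ t ∈ Icc (1 - r) (1 + r), |D2 (D1 g) (t, μ)| ≤ Λ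
  one_upper : ∀ μ ∈ Ioo 0 μ₀, g (1 + a * μ + K * μ ^ 2, μ) ≤ 0
  one_lower : ∀ μ ∈ Ioo 0 μ₀, 3 * μ ^ 2 ≤ g (1 + a * μ - K * μ ^ 2, μ)
  up_mem : ∀ μ ∈ Ioo 0 μ₀, up μ ∈ Icc (1 - r) (1 + r)
  up_zero : ∀ μ ∈ Ioo 0 μ₀, g (up μ, μ) = 0
  um_mem : ∀ μ ∈ Ioo 0 μ₀, um μ ∈ Ioo 0 (2 * μ)
  um_zero : ∀ μ ∈ Ioo 0 μ₀, g (um μ, μ) = 0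

variable {f : ℝ → ℝ → ℝ} {um up : ℝ → ℝ}

theorem IsTranscritical.apply_up (hf : IsTranscritical f um up) {μ : ℝ} (hμ : μ ∈ Ioo (0 : ℝ) 1) :
    f (up μ) μ = 0 :=
  (hf.zeros μ hμ (up μ) ((hf.pos μ hμ).1.trans (hf.pos μ hμ).2).le).2 (Or.inr (Or.inr rfl))

/-- The derivatives of the nonlinearity at the transcritical point. -/
theorem IsTranscritical.derivs_zero (hf : IsTranscritical f um up) :
    (∀ μ ∈ Ico (0 : ℝ) 1, f 0 μ = 0) ∧ D1 (fun p : ℝ × ℝ => f p.1 p.2) (0, 0) = 0 ∧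
      D1 (D1 fun p : ℝ × ℝ => f p.1 p.2) (0, 0) = 2 ∧
      D2 (D1 fun p : ℝ × ℝ => f p.1 p.2) (0, 0) = -1 ∧
      ∀ μ ∈ Ioo (0 : ℝ) 1, D2 (fun p : ℝ × ℝ => f p.1 p.2) (0, μ) = 0 := by
  set g : ℝ × ℝ → ℝ := fun p => f p.1 p.2 with hgdef
  have hg : ContDiff ℝ ∞ g := hf.smooth
  have hz : ∀ μ ∈ Ioo (0 : ℝ) 1, g (0, μ) = 0 := fun μ hμ =>
    (hf.zeros μ hμ 0 le_rfl).2 (Or.inl rfl)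
  have hpos : ∀ᶠ t in 𝓝[>] (0 : ℝ), t ∈ Ioo (0 : ℝ) 1 := Ioo_mem_nhdsGT one_pos
  have h00 : g (0, 0) = 0 :=
    eq_zero_of_Ioo (hg.continuous.comp
      (by fun_prop : Continuous fun μ : ℝ => ((0 : ℝ), μ))).continuousAt hz
  have hz' : ∀ μ ∈ Ico (0 : ℝ) 1, g (0, μ) = 0 := fun μ hμ => by
    rcases hμ.1.eq_or_lt with rfl | h
    · exact h00
    · exact hz μ ⟨h, hμ.2⟩
  have hD2 : ∀ μ ∈ Ioo (0 : ℝ) 1, D2 g (0, μ) = 0 := fun μ hμ => by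
    refine (hasDerivAt_D2 hg 0 μ).unique ((hasDerivAt_const μ (0 : ℝ)).congr_of_eventuallyEq ?_)
    filter_upwards [Ioo_mem_nhds hμ.1 hμ.2] with t ht using hz t ht
  have hD200 : D2 g (0, 0) = 0 := eq_zero_of_Ioo
    ((contDiff_D2 hg).continuous.comp
      (by fun_prop : Continuous fun μ : ℝ => ((0 : ℝ), μ))).continuousAt hD2
  have hD22 : D2 (D2 g) (0, 0) = 0 := by
    have h1 := (hasDerivAt_iff_tendsto_slope.1 (hasDerivAt_D2 (contDiff_D2 hg) 0 0)).mono_left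
      (nhdsWithin_mono 0 fun y (hy : y ∈ Ioi (0 : ℝ)) => ne_of_gt hy)
    refine tendsto_nhds_unique h1 (tendsto_const_nhds.congr' ?_)
    filter_upwards [hpos] with t ht
    rw [slope_def_field, hD2 t ht, hD200, sub_zero, zero_div]
  obtain ⟨C, hC⟩ := hf.taylor.bound
  -- the expansion along the lines `μ = ε u`
  have hline : ∀ ε : ℝ, 0 ≤ ε → ∀ᶠ t in 𝓝[>] (0 : ℝ),
      |g (t, ε * t) - (1 - ε) * t ^ 2| ≤ C * (ε ^ 2 + (ε + 1) * t) * t ^ 2 := fun ε hε => by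
    have h1 : Tendsto (fun t : ℝ => (t, ε * t)) (𝓝[>] 0) (𝓝 (0, 0)) :=
      (Continuous.tendsto' (by fun_prop) _ _ (by simp)).mono_left nhdsWithin_le_nhds
    filter_upwards [h1.eventually hC, hpos] with t ht ht0
    have e1 : f t (ε * t) - (-(ε * t) * t + t ^ 2) = g (t, ε * t) - (1 - ε) * t ^ 2 := by
      rw [hgdef]; ring
    have e2 : ‖(ε * t) ^ 2 + |ε * t| * t ^ 2 + |t| ^ 3‖ = (ε ^ 2 + (ε + 1) * t) * t ^ 2 := by
      have h0 := ht0.1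
      rw [abs_of_nonneg (by positivity : (0 : ℝ) ≤ ε * t), abs_of_pos h0, Real.norm_eq_abs,
        abs_of_nonneg (by positivity)]
      ring
    rw [e1, e2, Real.norm_eq_abs] at ht
    rw [mul_assoc]; exact ht
  have hD1 : D1 g (0, 0) = 0 := by
    have h1 := (hasDerivAt_iff_tendsto_slope.1 (hasDerivAt_D1 hg 0 0)).mono_left
      (nhdsWithin_mono 0 fun y (hy : y ∈ Ioi (0 : ℝ)) => ne_of_gt hy)
    have h2 : Tendsto (fun t : ℝ => (1 + C * t) * t) (𝓝[>] 0) (𝓝 0) :=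
      (Continuous.tendsto' (by fun_prop) _ _ (by simp)).mono_left nhdsWithin_le_nhds
    refine tendsto_nhds_unique h1 (squeeze_zero_norm' ?_ h2)
    filter_upwards [hline 0 le_rfl, hpos] with t ht ht0
    rw [slope_def_field, h00, sub_zero, sub_zero, norm_div, Real.norm_eq_abs, Real.norm_eq_abs,
      abs_of_pos ht0.1, div_le_iff₀ ht0.1]
    simp only [zero_mul, sub_zero, one_mul] at ht
    have := abs_le.1 ht
    rw [abs_le]
    constructor <;> nlinarith [ht0.1, sq_nonneg t]
  -- the second derivative along the lines
  have hsnd : ∀ ε : ℝ, Tendsto (fun t => g (t, ε * t) / t ^ 2) (𝓝[>] 0)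
      (𝓝 ((D1 (D1 g) (0, 0) + 2 * ε * D2 (D1 g) (0, 0)) / 2)) := fun ε => by
    have hl : ∀ t : ℝ, HasDerivAt (fun s => ε * s) ε t := fun t => by
      simpa using (hasDerivAt_id t).const_mul ε
    have h1 : ∀ t, HasDerivAt (fun t => g (t, ε * t)) (D1 g (t, ε * t) + D2 g (t, ε * t) * ε) t :=
      fun t => by simpa using hasDerivAt_curve hg (hasDerivAt_id t) (hl t)
    have h2 : HasDerivAt (fun t => D1 g (t, ε * t) + D2 g (t, ε * t) * ε)
        (D1 (D1 g) (0, 0) + 2 * ε * D2 (D1 g) (0, 0)) 0 := by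
      have k1 := hasDerivAt_curve (contDiff_D1 hg) (hasDerivAt_id (0 : ℝ)) (hl 0)
      have k2 := hasDerivAt_curve (contDiff_D2 hg) (hasDerivAt_id (0 : ℝ)) (hl 0)
      simp only [id, mul_zero, mul_one] at k1 k2
      rw [D1_D2_comm hg, hD22] at k2
      refine (k1.add (k2.mul_const ε)).congr_deriv ?_
      ring
    exact tendsto_div_sq h1 (by simpa using h00) (by simp [hD1, hD200]) h2
  have hlim : ∀ ε : ℝ, 0 ≤ ε →
      |(D1 (D1 g) (0, 0) + 2 * ε * D2 (D1 g) (0, 0)) / 2 - (1 - ε)| ≤ C * ε ^ 2 := fun ε hε => by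
    have h1 := ((hsnd ε).sub_const (1 - ε)).abs
    have h2 : Tendsto (fun t : ℝ => C * (ε ^ 2 + (ε + 1) * t)) (𝓝[>] 0) (𝓝 (C * ε ^ 2)) :=
      (Continuous.tendsto' (by fun_prop) _ _ (by simp)).mono_left nhdsWithin_le_nhds
    refine le_of_tendsto_of_tendsto h1 h2 ?_
    filter_upwards [hline ε hε, hpos] with t ht ht0
    have h3 : (0 : ℝ) < t ^ 2 := by have := ht0.1; positivity
    have e : g (t, ε * t) / t ^ 2 - (1 - ε) = (g (t, ε * t) - (1 - ε) * t ^ 2) / t ^ 2 := by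
      rw [sub_div, mul_div_cancel_right₀ _ h3.ne']
    rw [e, abs_div, abs_of_pos h3, div_le_iff₀ h3]
    exact ht
  have h11 : D1 (D1 g) (0, 0) = 2 := by
    have := hlim 0 le_rfl
    simp only [mul_zero, zero_mul, add_zero, sub_zero, ne_eq, OfNat.ofNat_ne_zero,
      not_false_eq_true, zero_pow] at this
    have := abs_nonpos_iff.1 this
    linarith
  refine ⟨hz', hD1, h11, ?_, hD2⟩
  have h3 : Tendsto (fun ε : ℝ => C * ε) (𝓝[>] 0) (𝓝 0) :=
    (Continuous.tendsto' (by fun_prop) _ _ (by simp)).mono_left nhdsWithin_le_nhds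
  have h4 : |D2 (D1 g) (0, 0) + 1| ≤ 0 := by
    refine ge_of_tendsto h3 ?_
    filter_upwards [hpos] with ε hε
    have h5 := hlim ε hε.1.le
    rw [h11] at h5
    have e : (2 + 2 * ε * D2 (D1 g) (0, 0)) / 2 - (1 - ε) = ε * (D2 (D1 g) (0, 0) + 1) := by ring
    rw [e, abs_mul, abs_of_pos hε.1] at h5
    have : ε * |D2 (D1 g) (0, 0) + 1| ≤ ε * (C * ε) := by linarith
    exact le_of_mul_le_mul_left this hε.1
  have := abs_nonpos_iff.1 h4
  linarith

theorem exists_slope_of_D1 {g : ℝ × ℝ → ℝ} (hg : ContDiff ℝ ∞ g) (μ : ℝ) {s t : ℝ} (hst : s < t) :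
    ∃ c ∈ Ioo s t, g (t, μ) - g (s, μ) = D1 g (c, μ) * (t - s) := by
  obtain ⟨c, hc, h⟩ := exists_hasDerivAt_eq_slope (fun t => g (t, μ)) (fun t => D1 g (t, μ)) hst
    (fun t _ => (hasDerivAt_D1 hg t μ).continuousAt.continuousWithinAt)
    fun t _ => hasDerivAt_D1 hg t μ
  refine ⟨c, hc, ?_⟩
  rw [h, div_mul_cancel₀ _ (sub_pos.2 hst).ne']

/-- Taylor estimates near the transcritical point. -/
theorem IsTranscritical.exists_bounds_zero (hf : IsTranscritical f um up) :
    ∃ L > 0, ∀ μ ∈ Ioo (0 : ℝ) (1 / 2), ∀ t ∈ Icc (-μ) (2 * μ),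
      |f t μ - (t ^ 2 - μ * t)| ≤ L * μ ^ 2 * |t| ∧
      |D1 (fun p : ℝ × ℝ => f p.1 p.2) (t, μ) - (2 * t - μ)| ≤ L * μ ^ 2 ∧
      |D1 (D1 (fun p : ℝ × ℝ => f p.1 p.2)) (t, μ) - 2| ≤ L * μ ∧
      |D2 (fun p : ℝ × ℝ => f p.1 p.2) (t, μ) + t| ≤ L * μ * |t| ∧
      |D2 (D1 (fun p : ℝ × ℝ => f p.1 p.2)) (t, μ) + 1| ≤ L * μ := by
  obtain ⟨hz, h1, h11, h21, h2⟩ := hf.derivs_zero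
  have hg := hf.smooth
  change ContDiff ℝ ∞ (fun p : ℝ × ℝ => f p.1 p.2) at hg
  set g : ℝ × ℝ → ℝ := fun p => f p.1 p.2 with hgdef
  obtain ⟨C₁, hC₁, hL₁⟩ := exists_lipschitz_ball (contDiff_D1 (contDiff_D1 hg)) 0
  obtain ⟨C₂, hC₂, hL₂⟩ := exists_lipschitz_ball (contDiff_D2 (contDiff_D1 hg)) 0
  set C := C₁ + C₂
  have hb11 : ∀ {t μ B : ℝ}, B ≤ 1 → |t| ≤ B → |μ| ≤ B → |D1 (D1 g) (t, μ) - 2| ≤ C * B :=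
    fun {t μ B} hB ht hμ => by
      have := hL₁ (t := t) hB (by rwa [sub_zero]) hμ
      rw [h11] at this
      exact this.trans (mul_le_mul_of_nonneg_right (le_add_of_nonneg_right hC₂.le)
        ((abs_nonneg t).trans ht))
  have hb21 : ∀ {t μ B : ℝ}, B ≤ 1 → |t| ≤ B → |μ| ≤ B → |D2 (D1 g) (t, μ) + 1| ≤ C * B :=
    fun {t μ B} hB ht hμ => by
      have := hL₂ (t := t) hB (by rwa [sub_zero]) hμ
      rw [h21, sub_neg_eq_add] at this
      exact this.trans (mul_le_mul_of_nonneg_right (le_add_of_nonneg_left hC₁.le)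
        ((abs_nonneg t).trans ht))
  refine ⟨6 * C, by positivity, fun μ hμ => ?_⟩
  have hμ0 := hμ.1
  have hμ1 : 2 * μ ≤ 1 := by linarith [hμ.2]
  have hμa : |μ| ≤ 2 * μ := by rw [abs_of_pos hμ0]; linarith
  have hta : ∀ t ∈ Icc (-μ) (2 * μ), |t| ≤ 2 * μ := fun t ht =>
    abs_le.2 ⟨by linarith [ht.1], ht.2⟩
  have hu : ∀ t ∈ Icc (-μ) (2 * μ), ∀ s ∈ uIcc 0 t, s ∈ Icc (-μ) (2 * μ) ∧ |s| ≤ |t| :=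
    fun t ht s hs => by
      rcases le_total 0 t with h | h
      · rw [uIcc_of_le h] at hs
        exact ⟨⟨by linarith [hs.1], hs.2.trans ht.2⟩, abs_le_abs_of_nonneg hs.1 hs.2⟩
      · rw [uIcc_of_ge h] at hs
        exact ⟨⟨ht.1.trans hs.1, by linarith [hs.2]⟩, abs_le_abs_of_nonpos hs.2 hs.1⟩
  have e0 : |D1 g (0, μ) + μ| ≤ 2 * C * μ ^ 2 := by
    have := abs_sub_le_of_hasDerivAt (φ := fun s => D1 g (0, s) + s) (a := 0) (b := μ)
      (φ' := fun s => D2 (D1 g) (0, s) + 1) (C := C * (2 * μ))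
      (fun s _ => (hasDerivAt_D2 (contDiff_D1 hg) 0 s).add (hasDerivAt_id s))
      (fun s hs => by
        rw [uIcc_of_le hμ0.le] at hs
        exact hb21 hμ1 (by simp [hμ0.le]) (by rw [abs_of_nonneg hs.1]; linarith [hs.2]))
    simp only [h1, add_zero, sub_zero, abs_of_pos hμ0] at this
    linarith
  have e1 : ∀ t ∈ Icc (-μ) (2 * μ), |D1 g (t, μ) - (2 * t - μ)| ≤ 6 * C * μ ^ 2 := fun t ht => by
    have := abs_sub_le_of_hasDerivAt (φ := fun s => D1 g (s, μ) - (2 * s - μ)) (a := 0) (b := t)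
      (φ' := fun s => D1 (D1 g) (s, μ) - 2) (C := C * (2 * μ))
      (fun s _ => (hasDerivAt_D1 (contDiff_D1 hg) s μ).sub
        (by simpa using ((hasDerivAt_id s).const_mul 2).sub_const μ))
      (fun s hs => hb11 hμ1 (hta s (hu t ht s hs).1) hμa)
    simp only [sub_zero, mul_zero, zero_sub, sub_neg_eq_add] at this
    have h3 : C * (2 * μ) * |t| ≤ C * (2 * μ) * (2 * μ) :=
      mul_le_mul_of_nonneg_left (hta t ht) (by positivity)
    have h4 := abs_le.1 (this.trans h3)
    have h5 := abs_le.1 e0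
    rw [abs_le]; constructor <;> nlinarith
  intro t ht
  refine ⟨?_, e1 t ht, ?_, ?_, ?_⟩
  · have := abs_sub_le_of_hasDerivAt (φ := fun s => g (s, μ) - (s ^ 2 - μ * s)) (a := 0) (b := t)
      (φ' := fun s => D1 g (s, μ) - (2 * s - μ)) (C := 6 * C * μ ^ 2)
      (fun s _ => (hasDerivAt_D1 hg s μ).sub
        (by simpa using ((hasDerivAt_pow 2 s).fun_sub ((hasDerivAt_id s).const_mul μ))))
      (fun s hs => e1 s (hu t ht s hs).1)
    have hz0 : g (0, μ) = 0 := hz μ ⟨hμ0.le, by linarith⟩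
    simp only [hz0, sub_zero, ne_eq, OfNat.ofNat_ne_zero, not_false_eq_true, zero_pow, mul_zero]
      at this
    exact this
  · refine (hb11 hμ1 (hta t ht) hμa).trans ?_
    nlinarith [mul_pos (show 0 < C by positivity) hμ0]
  · have := abs_sub_le_of_hasDerivAt (φ := fun s => D2 g (s, μ) + s) (a := 0) (b := t)
      (φ' := fun s => D2 (D1 g) (s, μ) + 1) (C := C * (2 * μ))
      (fun s _ => by
        rw [← D1_D2_comm hg]
        exact (hasDerivAt_D1 (contDiff_D2 hg) s μ).add (hasDerivAt_id s))
      (fun s hs => hb21 hμ1 (hta s (hu t ht s hs).1) hμa)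
    have hz0 : D2 g (0, μ) = 0 := h2 μ ⟨hμ0, by linarith⟩
    simp only [hz0, add_zero, sub_zero] at this
    refine this.trans (mul_le_mul_of_nonneg_right ?_ (abs_nonneg _))
    nlinarith [mul_pos (show 0 < C by positivity) hμ0]
  · refine (hb21 hμ1 (hta t ht) hμa).trans ?_
    nlinarith [mul_pos (show 0 < C by positivity) hμ0]

/-- Estimates near the limit `1` of the upper equilibrium. -/
theorem IsTranscritical.exists_bounds_one (hf : IsTranscritical f um up) :
    ∃ a K L r : ℝ, 0 < L ∧ 0 < r ∧ r ≤ 1 / 4 ∧ 0 ≤ K ∧ ∃ ρ > 0, ∀ μ ∈ Ioo (0 : ℝ) ρ,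
      |a| * μ + K * μ ^ 2 ≤ r / 2 ∧ (∀ t ∈ Icc (1 - r) (1 + r),
        D1 (fun p : ℝ × ℝ => f p.1 p.2) (t, μ) ≤ -(1 / L) ∧
        |D1 (D1 (fun p : ℝ × ℝ => f p.1 p.2)) (t, μ)| ≤ L ∧
        |D2 (fun p : ℝ × ℝ => f p.1 p.2) (t, μ)| ≤ L ∧
        |D2 (D1 (fun p : ℝ × ℝ => f p.1 p.2)) (t, μ)| ≤ L) ∧
      f (1 + a * μ + K * μ ^ 2) μ ≤ 0 ∧ 3 * μ ^ 2 ≤ f (1 + a * μ - K * μ ^ 2) μ := by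
  have hg := hf.smooth
  change ContDiff ℝ ∞ (fun p : ℝ × ℝ => f p.1 p.2) at hg
  set g : ℝ × ℝ → ℝ := fun p => f p.1 p.2 with hgdef
  have hg10 : g (1, 0) = 0 := by
    have h1 : Tendsto (fun μ : ℝ => g (up μ, μ)) (𝓝[>] 0) (𝓝 (g (1, 0))) :=
      (hg.continuous.tendsto (1, 0)).comp
        (hf.up_zero.prodMk_nhds (tendsto_id.mono_left nhdsWithin_le_nhds))
    refine tendsto_nhds_unique h1 (tendsto_const_nhds.congr' ?_)
    filter_upwards [Ioo_mem_nhdsGT one_pos] with t ht using (hf.apply_up ht).symm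
  have hc0 : D1 g (1, 0) < 0 := by
    have h1 : fu f 1 0 = D1 g (1, 0) := (hasDerivAt_D1 hg 1 0).deriv
    rw [← h1]; exact hf.hyperbolic
  set c : ℝ := -D1 g (1, 0) with hc
  have hcpos : 0 < c := neg_pos.2 hc0
  obtain ⟨C₁, hC₁, hL₁⟩ := exists_lipschitz_ball (contDiff_D1 hg) 1
  obtain ⟨C₂, hC₂, hL₂⟩ := exists_lipschitz_ball (contDiff_D2 hg) 1
  obtain ⟨B₁, hB₁, hb₁⟩ := exists_bound_ball (contDiff_D1 (contDiff_D1 hg)) 1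
  obtain ⟨B₂, hB₂, hb₂⟩ := exists_bound_ball (contDiff_D2 hg) 1
  obtain ⟨B₃, hB₃, hb₃⟩ := exists_bound_ball (contDiff_D2 (contDiff_D1 hg)) 1
  set a : ℝ := D2 g (1, 0) / c with ha
  set C₃ : ℝ := (C₁ * |a| + C₂) * (|a| + 1) with hC₃
  have hC₃0 : 0 ≤ C₃ := by positivity
  set K : ℝ := 2 * (C₃ + 3) / c with hK
  have hK0 : 0 < K := by positivity
  set r : ℝ := min (1 / 4) (c / (2 * C₁)) with hr
  have hr0 : 0 < r := lt_min (by norm_num) (by positivity)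
  have hr1 : r ≤ 1 / 4 := min_le_left _ _
  have hr2 : C₁ * r ≤ c / 2 := by
    have : r ≤ c / (2 * C₁) := min_le_right _ _
    rw [le_div_iff₀ (by positivity)] at this
    linarith
  set L : ℝ := 2 / c + B₁ + B₂ + B₃ with hL
  have hL0 : 0 < L := by positivity
  refine ⟨a, K, L, r, hL0, hr0, hr1, hK0.le, min r (r / (2 * (|a| + K + 1))),
    lt_min hr0 (by positivity), fun μ hμ => ?_⟩
  have hμ0 := hμ.1
  have hμr : μ ≤ r := (hμ.2.trans_le (min_le_left _ _)).le
  have hμ1 : μ * (2 * (|a| + K + 1)) ≤ r := by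
    have := (hμ.2.trans_le (min_le_right _ _)).le
    rwa [le_div_iff₀ (by positivity)] at this
  have hmargin : |a| * μ + K * μ ^ 2 ≤ r / 2 := by
    have : K * μ ^ 2 ≤ K * μ := by
      refine mul_le_mul_of_nonneg_left ?_ hK0.le
      nlinarith
    nlinarith [abs_nonneg a]
  have hder : ∀ t ∈ Icc (1 - r) (1 + r), D1 g (t, μ) ≤ -(c / 2) := fun t ht => by
    have := hL₁ (t := t) (μ := μ) (B := r) (by linarith)
      (abs_le.2 ⟨by linarith [ht.1], by linarith [ht.2]⟩) (by rw [abs_of_pos hμ0]; exact hμr)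
    have := (abs_le.1 this).2
    rw [hc] at hr2 ⊢
    linarith
  have hpsi : |g (1 + a * μ, μ)| ≤ C₃ * μ ^ 2 := by
    have hl : ∀ t : ℝ, HasDerivAt (fun s => 1 + a * s) a t := fun t => by
      simpa using ((hasDerivAt_id t).const_mul a).const_add 1
    have := abs_sub_le_of_hasDerivAt (φ := fun s => g (1 + a * s, s)) (a := 0) (b := μ)
      (φ' := fun s => D1 g (1 + a * s, s) * a + D2 g (1 + a * s, s)) (C := C₃ * μ)
      (fun s _ => by simpa using hasDerivAt_curve hg (hl s) (hasDerivAt_id s)) (fun s hs => by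
        rw [uIcc_of_le hμ0.le] at hs
        have hB : (|a| + 1) * μ ≤ 1 := by nlinarith [abs_nonneg a]
        have hs1 : |1 + a * s - 1| ≤ (|a| + 1) * μ := by
          rw [add_sub_cancel_left, abs_mul, abs_of_nonneg hs.1]
          nlinarith [abs_nonneg a, hs.2, hs.1]
        have hs2 : |s| ≤ (|a| + 1) * μ := by
          rw [abs_of_nonneg hs.1]; nlinarith [abs_nonneg a, hs.2]
        have k1 := hL₁ hB hs1 hs2
        have k2 := hL₂ hB hs1 hs2
        have e : D1 g (1 + a * s, s) * a + D2 g (1 + a * s, s)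
            = (D1 g (1 + a * s, s) - D1 g (1, 0)) * a + (D2 g (1 + a * s, s) - D2 g (1, 0)) := by
          have : a * c = D2 g (1, 0) := by rw [ha, div_mul_cancel₀ _ hcpos.ne']
          rw [← this, hc]; ring
        rw [e]
        refine (abs_add_le _ _).trans ?_
        rw [abs_mul]
        have := mul_le_mul_of_nonneg_right k1 (abs_nonneg a)
        rw [hC₃]
        linarith)
    simp only [mul_zero, add_zero, hg10, sub_zero, abs_of_pos hμ0] at this
    rw [sq, ← mul_assoc]; exact this
  have ha1 := neg_abs_le (a * μ)
  have ha2 := le_abs_self (a * μ)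
  rw [abs_mul, abs_of_pos hμ0] at ha1 ha2
  have hKμ : 0 < K * μ ^ 2 := by positivity
  have hKc : c / 2 * (K * μ ^ 2) = (C₃ + 3) * μ ^ 2 := by
    rw [hK]; field_simp
  have hdec : ∀ {x : ℝ}, 1 - r ≤ x → x + K * μ ^ 2 ≤ 1 + r →
      g (x + K * μ ^ 2, μ) + (C₃ + 3) * μ ^ 2 ≤ g (x, μ) := fun {x} h1 h2 => by
    obtain ⟨s, hs, h⟩ := exists_slope_of_D1 hg μ (show x < x + K * μ ^ 2 by linarith)
    have h3 := mul_le_mul_of_nonneg_right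
      (hder s ⟨h1.trans hs.1.le, hs.2.le.trans h2⟩) hKμ.le
    rw [add_sub_cancel_left] at h
    rw [neg_mul, hKc, ← h] at h3
    linarith
  clear_value K C₃
  have hp := abs_le.1 hpsi
  refine ⟨hmargin, fun t ht => ⟨(hder t ht).trans ?_, ?_, ?_, ?_⟩, ?_, ?_⟩
  · rw [neg_le_neg_iff, div_le_iff₀ hL0, hL]
    have : c / 2 * (2 / c) = 1 := by field_simp
    nlinarith [mul_pos hcpos hB₁, mul_pos hcpos hB₂, mul_pos hcpos hB₃]
  all_goals try
    have ht1 : |t - 1| ≤ 1 := abs_le.2 ⟨by linarith [ht.1], by linarith [ht.2]⟩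
    have hμ2 : |μ| ≤ 1 := by rw [abs_of_pos hμ0]; linarith
    have hc2 : 0 < 2 / c := by positivity
  · exact (hb₁ ht1 hμ2).trans (by rw [hL]; linarith)
  · exact (hb₂ ht1 hμ2).trans (by rw [hL]; linarith)
  · exact (hb₃ ht1 hμ2).trans (by rw [hL]; linarith)
  · have := hdec (x := 1 + a * μ) (by linarith) (by linarith)
    change g (1 + a * μ + K * μ ^ 2, μ) ≤ 0
    linarith [hp.2, sq_nonneg μ]
  · have := hdec (x := 1 + a * μ - K * μ ^ 2) (by linarith) (by linarith)
    rw [sub_add_cancel] at this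
    change 3 * μ ^ 2 ≤ g (1 + a * μ - K * μ ^ 2, μ)
    linarith [hp.1]

/-- All estimates hold with common constants for small `μ`. -/
theorem IsTranscritical.exists_localModel (hf : IsTranscritical f um up) :
    ∃ a K Λ r μ₀, LocalModel (fun p : ℝ × ℝ => f p.1 p.2) um up a K Λ r μ₀ := by
  obtain ⟨L₀, hL₀, h0⟩ := hf.exists_bounds_zero
  obtain ⟨a, K, L₁, r, hL₁, hr, hr1, hK, ρ, hρ, h1⟩ := hf.exists_bounds_one
  have hup : ∀ᶠ μ in 𝓝[>] (0 : ℝ), up μ ∈ Icc (1 - r) (1 + r) :=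
    hf.up_zero.eventually (Icc_mem_nhds (by linarith) (by linarith))
  obtain ⟨ρ', hρ', hup'⟩ := mem_nhdsGT_iff_exists_Ioo_subset.1 hup
  set Λ : ℝ := 1 + L₀ + L₁ + K + |a| with hΛ
  have hΛ1 : 1 ≤ Λ := by rw [hΛ]; linarith [abs_nonneg a]
  have hΛ0 : 0 < Λ := by linarith
  set s : ℝ := 1 / (10 ^ 6 * Λ ^ 2) with hs
  have hs0 : 0 < s := by positivity
  set μ₀ : ℝ := min (min (1 / 4) ρ) (min ρ' (s ^ 2)) with hμ₀
  have hμ₀0 : 0 < μ₀ := lt_min (lt_min (by norm_num) hρ) (lt_min hρ' (by positivity))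
  have k1 : μ₀ ≤ 1 / 4 := (min_le_left _ _).trans (min_le_left _ _)
  have k2 : μ₀ ≤ ρ := (min_le_left _ _).trans (min_le_right _ _)
  have k3 : μ₀ ≤ ρ' := (min_le_right _ _).trans (min_le_left _ _)
  have k4 : μ₀ ≤ s ^ 2 := (min_le_right _ _).trans (min_le_right _ _)
  have hsmall : Λ ^ 2 * √μ₀ ≤ 1 / 10 ^ 6 := by
    have : √μ₀ ≤ s := (Real.sqrt_le_left hs0.le).2 k4
    calc Λ ^ 2 * √μ₀ ≤ Λ ^ 2 * s := mul_le_mul_of_nonneg_left this (by positivity)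
      _ = 1 / 10 ^ 6 := by rw [hs]; field_simp
  have hΛμ : ∀ μ ∈ Ioo 0 μ₀, Λ * μ ≤ 1 / 10 ^ 6 := fun μ hμ => by
    refine le_trans ?_ hsmall
    have h3 : μ ≤ √μ₀ := hμ.2.le.trans (Real.le_sqrt_of_sq_le (by nlinarith))
    exact mul_le_mul (by nlinarith) h3 hμ.1.le (by positivity)
  have b0 : ∀ μ ∈ Ioo 0 μ₀, μ ∈ Ioo (0 : ℝ) (1 / 2) := fun μ hμ => ⟨hμ.1, by linarith [hμ.2]⟩
  have b1 : ∀ μ ∈ Ioo 0 μ₀, μ ∈ Ioo (0 : ℝ) ρ := fun μ hμ => ⟨hμ.1, hμ.2.trans_le k2⟩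
  have hLΛ : L₀ ≤ Λ := by rw [hΛ]; linarith [abs_nonneg a]
  have hL1Λ : L₁ ≤ Λ := by rw [hΛ]; linarith [abs_nonneg a]
  have hupm : ∀ μ ∈ Ioo 0 μ₀, up μ ∈ Icc (1 - r) (1 + r) := fun μ hμ =>
    hup' ⟨hμ.1, hμ.2.trans_le k3⟩
  have hIoo : ∀ μ ∈ Ioo 0 μ₀, μ ∈ Ioo (0 : ℝ) 1 := fun μ hμ => ⟨hμ.1, by linarith [hμ.2]⟩
  have hval : ∀ μ ∈ Ioo 0 μ₀, ∀ t ∈ Icc (-μ) (2 * μ),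
      |f t μ - (t ^ 2 - μ * t)| ≤ Λ * μ ^ 2 * |t| := fun μ hμ t ht =>
    (h0 μ (b0 μ hμ) t ht).1.trans (by gcongr)
  have hum : ∀ μ ∈ Ioo 0 μ₀, um μ ∈ Ioo 0 (2 * μ) := fun μ hμ => by
    have hμ0 := hμ.1
    have hΛm := hΛμ μ hμ
    have e1 := abs_le.1 (hval μ hμ (μ / 2) ⟨by linarith, by linarith⟩)
    have e2 := abs_le.1 (hval μ hμ (2 * μ) ⟨by linarith, le_rfl⟩)
    rw [abs_of_pos (by linarith)] at e1 e2
    have hm2 : 0 < μ ^ 2 := by positivity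
    have n1 : f (μ / 2) μ < 0 := by nlinarith
    have n2 : 0 < f (2 * μ) μ := by nlinarith
    have hc : Continuous fun t => f t μ :=
      hf.smooth.continuous.comp (by fun_prop : Continuous fun t : ℝ => (t, μ))
    obtain ⟨t, ht, ht0⟩ := intermediate_value_Ioo (by linarith : μ / 2 ≤ 2 * μ) hc.continuousOn
      ⟨n1, n2⟩
    have htpos : 0 < t := by linarith [ht.1]
    rcases (hf.zeros μ (hIoo μ hμ) t htpos.le).1 ht0 with h | h | h
    · linarith
    · rw [← h]; exact ⟨htpos, ht.2⟩
    · have h5 := (hupm μ hμ).1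
      rw [← h] at h5
      linarith [ht.2, hμ.2]
  exact ⟨a, K, Λ, r, μ₀,
    { smooth := hf.smooth
      one_le := hΛ1
      r_pos := hr
      r_le := hr1
      K_nonneg := hK
      K_le := by rw [hΛ]; linarith [abs_nonneg a]
      a_le := by rw [hΛ]; linarith [abs_nonneg a]
      μ₀_pos := hμ₀0
      small := hsmall
      margin := fun μ hμ => (h1 μ (b1 μ hμ)).1
      zero := fun μ hμ => hf.derivs_zero.1 μ ⟨hμ.1.le, (hIoo μ hμ).2⟩
      val := hval
      d1 := fun μ hμ t ht => (h0 μ (b0 μ hμ) t ht).2.1.trans (by gcongr)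
      d11 := fun μ hμ t ht => (h0 μ (b0 μ hμ) t ht).2.2.1.trans
        (mul_le_mul_of_nonneg_right hLΛ hμ.1.le)
      d2 := fun μ hμ t ht => (h0 μ (b0 μ hμ) t ht).2.2.2.1.trans
        (mul_le_mul_of_nonneg_right (mul_le_mul_of_nonneg_right hLΛ hμ.1.le) (abs_nonneg _))
      d21 := fun μ hμ t ht => (h0 μ (b0 μ hμ) t ht).2.2.2.2.trans
        (mul_le_mul_of_nonneg_right hLΛ hμ.1.le)
      one_d1 := fun μ hμ t ht => ((h1 μ (b1 μ hμ)).2.1 t ht).1.trans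
        (neg_le_neg (one_div_le_one_div_of_le hL₁ hL1Λ))
      one_d11 := fun μ hμ t ht => ((h1 μ (b1 μ hμ)).2.1 t ht).2.1.trans hL1Λ
      one_d2 := fun μ hμ t ht => ((h1 μ (b1 μ hμ)).2.1 t ht).2.2.1.trans hL1Λ
      one_d21 := fun μ hμ t ht => ((h1 μ (b1 μ hμ)).2.1 t ht).2.2.2.trans hL1Λ
      one_upper := fun μ hμ => (h1 μ (b1 μ hμ)).2.2.1
      one_lower := fun μ hμ => (h1 μ (b1 μ hμ)).2.2.2
      up_mem := hupm
      up_zero := fun μ hμ => hf.apply_up (hIoo μ hμ)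
      um_mem := hum
      um_zero := fun μ hμ => (hf.zeros μ (hIoo μ hμ) (um μ) (hum μ hμ).1.le).2
        (Or.inr (Or.inl rfl)) }⟩

end LocalModel

/-! ### Steady states off the critical orbit -/

section Between

theorem nb_const (c : ℝ) (p : ℤ × ℤ) : nb (fun _ => c) p = 4 * c := by unfold nb; ring

theorem nb_nonneg {u : ℤ × ℤ → ℝ} (h : ∀ q, 0 ≤ u q) (p : ℤ × ℤ) : 0 ≤ nb u p := by
  have := nb_mono (u := fun _ => (0 : ℝ)) h p
  rwa [nb_const, mul_zero] at this

/-- Between an ordered pair of a lower and an upper solution there is a solution. -/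
theorem exists_solution_between {C : Set (ℤ × ℤ)} {d L A B : ℝ} (hd : 0 < d) (hL : 0 < L)
    {h : ℝ → ℝ} (hh : ∀ s ∈ Icc A B, ∀ t ∈ Icc A B, s ≤ t → h s - h t ≤ L * (t - s))
    {lo hi : ℤ × ℤ → ℝ} (hle : ∀ p, lo p ≤ hi p) (hA : ∀ p, A ≤ lo p) (hB : ∀ p, hi p ≤ B)
    (hC : ∀ p ∈ C, lo p = hi p) (hlo : ∀ p ∉ C, 0 ≤ d * (nb lo p - 4 * lo p) + h (lo p))
    (hhi : ∀ p ∉ C, d * (nb hi p - 4 * hi p) + h (hi p) ≤ 0) :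
    ∃ u : ℤ × ℤ → ℝ, (∀ p, lo p ≤ u p ∧ u p ≤ hi p) ∧
      ∀ p ∉ C, d * (nb u p - 4 * u p) + h (u p) = 0 := by
  classical
  set τ : ℝ := (4 * d + L)⁻¹ with hτ
  have hτ0 : 0 < τ := by positivity
  have hτ1 : τ * (4 * d + L) = 1 := inv_mul_cancel₀ (by positivity)
  let Φ : (ℤ × ℤ → ℝ) → ℤ × ℤ → ℝ := fun u p =>
    if p ∈ C then lo p else u p + τ * (d * (nb u p - 4 * u p) + h (u p))
  have hΦC : ∀ u, ∀ p ∈ C, Φ u p = lo p := fun u p hp => if_pos hp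
  have hΦn : ∀ u, ∀ p ∉ C, Φ u p = u p + τ * (d * (nb u p - 4 * u p) + h (u p)) :=
    fun u p hp => if_neg hp
  have hmono : ∀ u v : ℤ × ℤ → ℝ, (∀ p, lo p ≤ u p) → (∀ p, v p ≤ hi p) → (∀ p, u p ≤ v p) →
      ∀ p, Φ u p ≤ Φ v p := fun u v hu hv huv p => by
    by_cases hp : p ∈ C
    · rw [hΦC _ p hp, hΦC _ p hp]
    rw [hΦn _ p hp, hΦn _ p hp]
    have h1 := hh (u p) ⟨(hA p).trans (hu p), (huv p).trans ((hv p).trans (hB p))⟩ (v p)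
      ⟨(hA p).trans ((hu p).trans (huv p)), (hv p).trans (hB p)⟩ (huv p)
    have h2 := mul_le_mul_of_nonneg_left (nb_mono huv p) hd.le
    have h3 : d * (nb u p - 4 * u p) + h (u p) - (d * (nb v p - 4 * v p) + h (v p))
        ≤ (4 * d + L) * (v p - u p) := by linarith
    have h4 := mul_le_mul_of_nonneg_left h3 hτ0.le
    rw [← mul_assoc, hτ1, one_mul] at h4
    linarith
  have hΦlo : ∀ p, lo p ≤ Φ lo p := fun p => by
    by_cases hp : p ∈ C
    · rw [hΦC _ p hp]
    · rw [hΦn _ p hp]; have := mul_nonneg hτ0.le (hlo p hp); linarith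
  have hΦhi : ∀ p, Φ hi p ≤ hi p := fun p => by
    by_cases hp : p ∈ C
    · rw [hΦC _ p hp, hC p hp]
    · rw [hΦn _ p hp]; have := mul_nonneg hτ0.le (neg_nonneg.2 (hhi p hp)); linarith
  let S : Set (ℤ × ℤ → ℝ) := {v | (∀ p, lo p ≤ v p) ∧ (∀ p, v p ≤ hi p) ∧ ∀ p, v p ≤ Φ v p}
  have hloS : lo ∈ S := ⟨fun _ => le_rfl, hle, hΦlo⟩
  let u : ℤ × ℤ → ℝ := fun p => ⨆ v : S, (v : ℤ × ℤ → ℝ) p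
  have hbdd : ∀ p, BddAbove (range fun v : S => (v : ℤ × ℤ → ℝ) p) := fun p =>
    ⟨hi p, by rintro _ ⟨v, rfl⟩; exact v.2.2.1 p⟩
  have hle_u : ∀ v ∈ S, ∀ p, v p ≤ u p := fun v hv p => le_ciSup (hbdd p) (⟨v, hv⟩ : S)
  have : Nonempty S := ⟨⟨lo, hloS⟩⟩
  have hlou : ∀ p, lo p ≤ u p := hle_u lo hloS
  have huhi : ∀ p, u p ≤ hi p := fun p => ciSup_le fun v => v.2.2.1 p
  have huΦ : ∀ p, u p ≤ Φ u p := fun p => ciSup_le fun v =>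
    (v.2.2.2 p).trans (hmono v u v.2.1 huhi (hle_u v v.2) p)
  have hΦS : Φ u ∈ S := by
    refine ⟨fun p => (hlou p).trans (huΦ p), fun p => ?_, fun p => ?_⟩
    · exact (hmono u hi hlou (fun _ => le_rfl) huhi p).trans (hΦhi p)
    · exact hmono u (Φ u) hlou
        (fun q => (hmono u hi hlou (fun _ => le_rfl) huhi q).trans (hΦhi q)) huΦ p
  refine ⟨u, fun p => ⟨hlou p, huhi p⟩, fun p hp => ?_⟩
  have h1 := le_antisymm (huΦ p) (hle_u _ hΦS p)
  rw [hΦn _ p hp] at h1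
  have h2 : τ * (d * (nb u p - 4 * u p) + h (u p)) = 0 := by linarith
  exact (mul_eq_zero.1 h2).resolve_left hτ0.ne'

end Between

/-- The reflection `n ↦ c - n`. -/
def Site.flip (σ : Site) (p : ℤ × ℤ) : ℤ × ℤ := (σ.c - p.1, p.2)

/-- Zero sites next to the set `P`. -/
def bdry (P C : Set (ℤ × ℤ)) : Set (ℤ × ℤ) := {p | p ∉ P ∧ p ∉ C ∧ nb (ind ℝ P) p ≠ 0}

/-- The combinatorial data of a fold. The sites in `P` are close to the upper equilibrium, the
critical orbit `C` passes from small values to `u₋`, and every other site is close to zero. Each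
critical site has `j` neighbours in `P`, each remaining site at most one. If the fold is special,
then `j = 1` and there are noncritical sites next to `P`, which are close to a fold themselves. -/
structure IsConfig (σ : Site) (P C : Set (ℤ × ℤ)) (p₀ : ℤ × ℤ) (j : ℝ) (special : Prop) :
    Prop where
  mem : p₀ ∈ C
  disj : ∀ p ∈ P, p ∉ C
  flip_P : ∀ p, σ.flip p ∈ P ↔ p ∈ P
  swap_P : ∀ p : ℤ × ℤ, p.swap ∈ P ↔ p ∈ P
  flip_C : ∀ p, σ.flip p ∈ C ↔ p ∈ C
  swap_C : ∀ p : ℤ × ℤ, p.swap ∈ C ↔ p ∈ C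
  orbit : ∀ w : ℤ × ℤ → ℝ, IsD4Symmetric σ w → ∀ p ∈ C, w p = w p₀
  nb_C : ∀ p ∈ C, nb (ind ℝ P) p = j
  nb_Z : ∀ p ∉ P, p ∉ C → nb (ind ℝ P) p = 0 ∨ nb (ind ℝ P) p = 1
  j_eq : j = 1 ∨ j = 2
  ordinary : ¬special → j = 1 → ∀ p ∉ P, p ∉ C → nb (ind ℝ P) p = 0
  special_j : special → j = 1
  special_Y : special → ∀ p ∈ bdry P C, nb (ind ℝ C) p = 1 ∧ nb (ind ℝ (bdry P C)) p = 0
  special_C : special → nb (ind ℝ C) p₀ + nb (ind ℝ (bdry P C)) p₀ = 2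

namespace LocalModel

variable {g : ℝ × ℝ → ℝ} {um up : ℝ → ℝ} {a K Λ r μ₀ : ℝ}

/-- The sizes of `μ` and `Λ`, in terms of `q = √μ`. -/
theorem exists_sqrt (H : LocalModel g um up a K Λ r μ₀) {μ : ℝ} (hμ : μ ∈ Ioo 0 μ₀) :
    ∃ q, 0 < q ∧ √μ = q ∧ μ = q ^ 2 ∧ Λ ^ 2 * q ≤ 1 / 10 ^ 6 ∧ Λ * q ≤ 1 / 10 ^ 6 ∧
      q ≤ 1 / 10 ^ 6 := by
  have h1 := H.one_le
  have hq : 0 < √μ := Real.sqrt_pos.2 hμ.1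
  have h2 : Λ ^ 2 * √μ ≤ 1 / 10 ^ 6 := by
    refine le_trans ?_ H.small
    have := Real.sqrt_le_sqrt hμ.2.le
    gcongr
  refine ⟨√μ, hq, rfl, (Real.sq_sqrt hμ.1.le).symm, h2, ?_, ?_⟩
  · refine le_trans ?_ h2
    refine mul_le_mul_of_nonneg_right ?_ hq.le
    nlinarith
  · refine le_trans ?_ h2
    have : (1 : ℝ) ≤ Λ ^ 2 := one_le_pow₀ h1
    nlinarith

theorem mul_le (H : LocalModel g um up a K Λ r μ₀) {μ : ℝ} (hμ : μ ∈ Ioo 0 μ₀) :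
    Λ * μ ≤ 1 / 10 ^ 6 := by
  obtain ⟨q, hq, -, rfl, -, hΛ, hq1⟩ := H.exists_sqrt hμ
  nlinarith

end LocalModel

/-- The upper bound for the values on `P`. -/
def hiP (a K μ : ℝ) : ℝ := 1 + a * μ + K * μ ^ 2

/-- The lower bound for the values on `P`. -/
def loP (a K μ : ℝ) : ℝ := 1 + a * μ - K * μ ^ 2

/-- The upper bound for the values at zero sites next to `P`. It stays below the fold point
`μ / 2` of `t ^ 2 - μ t`. -/
def topY (μ : ℝ) : ℝ := μ / 2 - μ * √μ / 16

/-- The function that delimits the parameters `(x, μ, d)` for which the system off the critical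
orbit is solved. In the special case it bounds the left-hand side of the equation at a zero site
next to `P` with the value `topY μ`, which is a strict supersolution if `gap < 0`. Otherwise the
condition `gap < 0` only keeps `d` of the order of `μ ^ 2`. -/
def gap (g : ℝ × ℝ → ℝ) (a K j : ℝ) (special : Prop) (p : ℝ × ℝ × ℝ) : ℝ :=
  open Classical in
  if special then p.2.2 * (hiP a K p.2.1 + p.1 + 16 * p.2.1 ^ 2 - 4 * topY p.2.1)
      + g (topY p.2.1, p.2.1)
    else 7 / 2 * j * p.2.2 - p.2.1 ^ 2

/-- The parameters `(x, μ, d)` for which the system off the critical orbit is solved. -/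
def dom (g : ℝ × ℝ → ℝ) (a K j μ₀ : ℝ) (special : Prop) : Set (ℝ × ℝ × ℝ) :=
  {p | 0 < p.1 ∧ p.1 < 2 * p.2.1 ∧ p.2.1 < μ₀ ∧ 0 < p.2.2 ∧ gap g a K j special p < 0}

/-- `u` takes the value `x` on `C` and is a steady state off `C`. -/
def IsSol (g : ℝ × ℝ → ℝ) (C : Set (ℤ × ℤ)) (x μ d : ℝ) (u : ℤ × ℤ → ℝ) : Prop :=
  (∀ p ∈ C, u p = x) ∧ ∀ p ∉ C, d * (nb u p - 4 * u p) + g (u p, μ) = 0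

/-- The order interval that contains the solution. -/
structure IsBoxed (P C : Set (ℤ × ℤ)) (a K μ : ℝ) (u : ℤ × ℤ → ℝ) : Prop where
  onP : ∀ p ∈ P, u p ∈ Icc (loP a K μ) (hiP a K μ)
  onY : ∀ p ∈ bdry P C, u p ∈ Icc 0 (topY μ)
  onZ : ∀ p ∉ P, p ∉ C → p ∉ bdry P C → u p ∈ Icc 0 (8 * μ ^ 2)

/-- The region in which the system off the critical orbit is dissipative. -/
structure InReg (P C : Set (ℤ × ℤ)) (r μ : ℝ) (u : ℤ × ℤ → ℝ) : Prop where
  onP : ∀ p ∈ P, u p ∈ Ioo (1 - r) (1 + r)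
  onZ : ∀ p ∉ P, p ∉ C → u p ∈ Ioo (-μ) (μ / 2 - μ * √μ / 32)

section Solve

variable {g : ℝ × ℝ → ℝ} {um up : ℝ → ℝ} {a K Λ r μ₀ : ℝ} {σ : Site} {P C : Set (ℤ × ℤ)}
  {p₀ : ℤ × ℤ} {j : ℝ} {special : Prop}

theorem dom_pos {x μ d : ℝ} (h : (x, μ, d) ∈ dom g a K j μ₀ special) :
    0 < x ∧ x < 2 * μ ∧ μ ∈ Ioo 0 μ₀ ∧ 0 < d ∧ gap g a K j special (x, μ, d) < 0 := by
  obtain ⟨h1, h2, h3, h4, h5⟩ := h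
  simp only at h1 h2 h3 h4
  exact ⟨h1, h2, ⟨by linarith, h3⟩, h4, h5⟩

theorem IsConfig.j_pos (hC : IsConfig σ P C p₀ j special) : 1 ≤ j ∧ j ≤ 2 := by
  rcases hC.j_eq with h | h <;> rw [h] <;> norm_num

theorem gap_special (hs : special) (x μ d : ℝ) : gap g a K j special (x, μ, d)
    = d * (hiP a K μ + x + 16 * μ ^ 2 - 4 * topY μ) + g (topY μ, μ) := if_pos hs

theorem gap_ordinary (hs : ¬special) (x μ d : ℝ) : gap g a K j special (x, μ, d)
    = 7 / 2 * j * d - μ ^ 2 := if_neg hs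

theorem InReg.convex {μ : ℝ} {u v : ℤ × ℤ → ℝ} (hu : InReg P C r μ u) (hv : InReg P C r μ v)
    {p : ℤ × ℤ} (hp : p ∉ C) {c : ℝ} (hc : c ∈ uIcc (u p) (v p)) :
    InReg P C r μ (fun q => open Classical in if q = p then c else u q) := by
  classical
  refine ⟨fun q hq => ?_, fun q hq hq' => ?_⟩
  · show (if q = p then c else u q) ∈ _
    split_ifs with h
    · subst h; exact ordConnected_Ioo.uIcc_subset (hu.onP q hq) (hv.onP q hq) hc
    · exact hu.onP q hq
  · show (if q = p then c else u q) ∈ _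
    split_ifs with h
    · subst h; exact ordConnected_Ioo.uIcc_subset (hu.onZ q hq hq') (hv.onZ q hq hq') hc
    · exact hu.onZ q hq hq'

variable (H : LocalModel g um up a K Λ r μ₀)

include H

theorem LocalModel.bounds_P {μ : ℝ} (hμ : μ ∈ Ioo 0 μ₀) :
    |loP a K μ - 1| ≤ r / 2 ∧ |hiP a K μ - 1| ≤ r / 2 ∧ loP a K μ ≤ hiP a K μ ∧
      |loP a K μ - 1| ≤ 1 / 10 ^ 5 ∧ |hiP a K μ - 1| ≤ 1 / 10 ^ 5 := by
  have h1 := H.margin μ hμ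
  have hK : 0 ≤ K * μ ^ 2 := mul_nonneg H.K_nonneg (sq_nonneg μ)
  have h2 := neg_abs_le (a * μ)
  have h3 := le_abs_self (a * μ)
  rw [abs_mul, abs_of_pos hμ.1] at h2 h3
  have h4 : |a| * μ ≤ 1 / 10 ^ 6 :=
    (mul_le_mul_of_nonneg_right H.a_le hμ.1.le).trans (H.mul_le hμ)
  have h5 : K * μ ^ 2 ≤ 1 / 10 ^ 6 := by
    obtain ⟨q, hq, -, rfl, -, hΛ, hq1⟩ := H.exists_sqrt hμ
    calc K * (q ^ 2) ^ 2 ≤ Λ * (q ^ 2) ^ 2 := mul_le_mul_of_nonneg_right H.K_le (sq_nonneg _)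
      _ = Λ * q ^ 2 * q ^ 2 := by ring
      _ ≤ 1 / 10 ^ 6 * 1 := mul_le_mul (H.mul_le hμ) (pow_le_one₀ hq.le (by linarith))
          (by positivity) (by norm_num)
      _ = _ := by ring
  unfold loP hiP
  simp only [abs_le]
  refine ⟨⟨?_, ?_⟩, ⟨?_, ?_⟩, ?_, ⟨?_, ?_⟩, ?_, ?_⟩ <;> linarith

/-- The nonlinearity at the upper bound for zero sites next to `P`. -/
theorem LocalModel.bounds_topY {μ : ℝ} (hμ : μ ∈ Ioo 0 μ₀) :
    49 / 100 * μ ≤ topY μ ∧ topY μ ≤ μ / 2 ∧ |g (topY μ, μ) + μ ^ 2 / 4| ≤ 1 / 1000 * μ ^ 2 := by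
  obtain ⟨q, hq, hsq, rfl, -, hΛ, hq1⟩ := H.exists_sqrt hμ
  have hΛ1 := H.one_le
  rw [topY, hsq]
  have hq2 : 0 < q ^ 2 := by positivity
  have h0 : 0 ≤ q ^ 2 * q / 16 := by positivity
  have h1 : q ^ 2 * q / 16 ≤ 1 / 1000 * q ^ 2 := by nlinarith
  have hmem : q ^ 2 / 2 - q ^ 2 * q / 16 ∈ Icc (-q ^ 2) (2 * q ^ 2) :=
    ⟨by linarith, by linarith⟩
  have h2 := H.val _ hμ _ hmem
  refine ⟨by linarith, by linarith, ?_⟩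
  rw [abs_of_nonneg (show 0 ≤ q ^ 2 / 2 - q ^ 2 * q / 16 by linarith)] at h2
  have h3 : Λ * (q ^ 2) ^ 2 * (q ^ 2 / 2 - q ^ 2 * q / 16) ≤ 1 / 10 ^ 6 * (q ^ 2) ^ 2 := by
    calc Λ * (q ^ 2) ^ 2 * (q ^ 2 / 2 - q ^ 2 * q / 16)
        ≤ Λ * (q ^ 2) ^ 2 * q ^ 2 := mul_le_mul_of_nonneg_left (by linarith) (by positivity)
      _ = Λ * q ^ 2 * (q ^ 2) ^ 2 := by ring
      _ ≤ _ := mul_le_mul_of_nonneg_right (H.mul_le hμ) (by positivity)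
  have h4 : (q ^ 2 / 2 - q ^ 2 * q / 16) ^ 2 - q ^ 2 * (q ^ 2 / 2 - q ^ 2 * q / 16)
      = -((q ^ 2) ^ 2 / 4) + (q ^ 2) ^ 2 * q ^ 2 / 256 := by ring
  have h5 : (q ^ 2) ^ 2 * q ^ 2 / 256 ≤ 1 / 10 ^ 6 * (q ^ 2) ^ 2 := by
    have : q ^ 2 ≤ 1 / 10 ^ 6 := by nlinarith
    nlinarith [sq_nonneg (q ^ 2)]
  have h6 : 0 ≤ (q ^ 2) ^ 2 * q ^ 2 / 256 := by positivity
  have h7 := abs_le.1 h2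
  rw [abs_le]
  constructor <;> nlinarith [sq_nonneg (q ^ 2)]

/-- In the parameter region `d` is at most of the order of `μ ^ 2`. There is room for the fold,
which is at `μ ^ 2 = 4 j d` up to lower order terms. -/
theorem LocalModel.le_sq_of_dom
    (hC : IsConfig σ P C p₀ j special) {x μ d : ℝ} (h : (x, μ, d) ∈ dom g a K j μ₀ special) :
    7 / 2 * j * d ≤ μ ^ 2 := by
  obtain ⟨h1, h2, hμ, hd, hG⟩ := dom_pos h
  by_cases hs : special
  · rw [gap_special hs] at hG
    rw [hC.special_j hs]
    obtain ⟨k1, k2, k3⟩ := H.bounds_topY hμ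
    obtain ⟨-, -, -, -, k4⟩ := H.bounds_P hμ
    have k5 := (abs_le.1 k4).1
    have k6 := (abs_le.1 k3).1
    obtain ⟨q, hq, hsq, hqq, -, hΛ, hq1⟩ := H.exists_sqrt hμ
    have hμs : μ ≤ 1 / 10 ^ 6 := by nlinarith
    have h3 : d * (98 / 100) ≤ d * (hiP a K μ + x + 16 * μ ^ 2 - 4 * topY μ) :=
      mul_le_mul_of_nonneg_left (by nlinarith [sq_nonneg μ]) hd.le
    nlinarith [sq_nonneg μ]
  · rw [gap_ordinary hs] at hG
    linarith

theorem LocalModel.upper_Z {μ d N : ℝ} (hμ : μ ∈ Ioo 0 μ₀)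
    (hd : 0 < d) (hd2 : 7 / 2 * d ≤ μ ^ 2) (hN : N ≤ 8 * μ) :
    d * (N - 4 * (8 * μ ^ 2)) + g (8 * μ ^ 2, μ) ≤ 0 := by
  obtain ⟨q, hq, hsq, hqq, -, hΛ, hq1⟩ := H.exists_sqrt hμ
  have hμ0 := hμ.1
  have hμs : μ ≤ 1 / 10 ^ 6 := by nlinarith
  have hΛμ := H.mul_le hμ
  have h10 := (abs_le.1 (H.val μ hμ (8 * μ ^ 2) ⟨by nlinarith, by nlinarith⟩)).2
  rw [abs_of_nonneg (by positivity)] at h10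
  have h11 : d * (N - 4 * (8 * μ ^ 2)) ≤ 2 / 7 * μ ^ 2 * (8 * μ) := by
    refine (mul_le_mul_of_nonneg_left (show N - 4 * (8 * μ ^ 2) ≤ 8 * μ by
      nlinarith [sq_nonneg μ]) hd.le).trans ?_
    exact mul_le_mul_of_nonneg_right (by linarith) (by linarith)
  have h12 : Λ * μ ^ 2 * (8 * μ ^ 2) ≤ 1 / 10 ^ 5 * μ ^ 3 := by
    calc Λ * μ ^ 2 * (8 * μ ^ 2) = Λ * μ * (8 * μ ^ 3) := by ring
      _ ≤ 1 / 10 ^ 6 * (8 * μ ^ 3) := mul_le_mul_of_nonneg_right hΛμ (by positivity)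
      _ ≤ _ := by nlinarith [pow_pos hμ0 3]
  have h13 : (8 * μ ^ 2) ^ 2 ≤ 1 / 10 ^ 4 * μ ^ 3 := by
    have : (8 * μ ^ 2) ^ 2 = 64 * μ * μ ^ 3 := by ring
    rw [this]
    exact mul_le_mul_of_nonneg_right (by linarith) (pow_pos hμ0 3).le
  have h16 := pow_pos hμ0 3
  linarith

set_option maxHeartbeats 400000 in
/-- Existence of a solution with prescribed value on the critical orbit. -/
theorem LocalModel.exists_sol
    (hC : IsConfig σ P C p₀ j special) {x μ d : ℝ} (h : (x, μ, d) ∈ dom g a K j μ₀ special) :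
    ∃ u : LInf ℝ, IsSol g C x μ d u ∧ IsBoxed P C a K μ u := by
  classical
  have hle := H.le_sq_of_dom hC h
  obtain ⟨hx, hx2, hμ, hd, hG⟩ := dom_pos h
  have hj := hC.j_pos
  obtain ⟨t1, t2, t3⟩ := H.bounds_topY hμ
  obtain ⟨-, -, p1, p2, p3⟩ := H.bounds_P hμ
  have p2' := abs_le.1 p2
  have p3' := abs_le.1 p3
  have t3' := abs_le.1 t3
  obtain ⟨q, hq, hsq, hqq, -, hΛ, hq1⟩ := H.exists_sqrt hμ
  have hμ0 := hμ.1
  have hμs : μ ≤ 1 / 10 ^ 6 := by nlinarith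
  have hΛμ := H.mul_le hμ
  have hd2 : 7 / 2 * d ≤ μ ^ 2 := le_trans (by nlinarith) hle
  set lo : ℤ × ℤ → ℝ := fun p => if p ∈ P then loP a K μ else if p ∈ C then x else 0 with hlo
  set hi : ℤ × ℤ → ℝ := fun p => if p ∈ P then hiP a K μ else if p ∈ C then x else
    if p ∈ bdry P C then topY μ else 8 * μ ^ 2 with hhi
  have loP' : ∀ p ∈ P, lo p = loP a K μ := fun p hp => if_pos hp
  have hiP' : ∀ p ∈ P, hi p = hiP a K μ := fun p hp => if_pos hp
  have loZ : ∀ p ∉ P, p ∉ C → lo p = 0 := fun p hp hp' => by rw [hlo]; simp [hp, hp']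
  have hiY : ∀ p ∈ bdry P C, hi p = topY μ := fun p hp => by
    rw [hhi]; simp [hp, hp.1, hp.2.1]
  have hiZ : ∀ p ∉ P, p ∉ C → p ∉ bdry P C → hi p = 8 * μ ^ 2 := fun p hp hp' hpb => by
    rw [hhi]; simp [hp, hp', hpb]
  have loC : ∀ p ∈ C, lo p = x := fun p hp => by
    have : p ∉ P := fun h => hC.disj p h hp
    rw [hlo]; simp [hp, this]
  have hiC : ∀ p ∈ C, hi p = x := fun p hp => by
    have : p ∉ P := fun h => hC.disj p h hp
    rw [hhi]; simp [hp, this]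
  have h8 : 8 * μ ^ 2 ≤ μ / 2 := by nlinarith
  have cases : ∀ p, p ∈ P ∨ p ∈ C ∨ p ∈ bdry P C ∨ (p ∉ P ∧ p ∉ C ∧ p ∉ bdry P C) := fun p => by
    by_cases k1 : p ∈ P
    · exact Or.inl k1
    by_cases k2 : p ∈ C
    · exact Or.inr (Or.inl k2)
    by_cases k3 : p ∈ bdry P C
    · exact Or.inr (Or.inr (Or.inl k3))
    exact Or.inr (Or.inr (Or.inr ⟨k1, k2, k3⟩))
  have hlohi : ∀ p, 0 ≤ lo p ∧ lo p ≤ hi p ∧ hi p ≤ hiP a K μ := fun p => by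
    rcases cases p with k | k | k | ⟨k1, k2, k3⟩
    · rw [loP' p k, hiP' p k]; exact ⟨by linarith, p1, le_rfl⟩
    · rw [loC p k, hiC p k]; exact ⟨hx.le, le_rfl, by linarith⟩
    · rw [loZ p k.1 k.2.1, hiY p k]; exact ⟨le_rfl, by linarith, by linarith⟩
    · rw [loZ p k1 k2, hiZ p k1 k2 k3]; exact ⟨le_rfl, by positivity, by linarith⟩
  have hhi2 : ∀ p, hi p ≤ hiP a K μ * ind ℝ P p + 2 * μ * (1 - ind ℝ P p) := fun p => by
    by_cases k : p ∈ P
    · rw [hiP' p k, ind_of_mem k]; linarith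
    rw [ind_of_notMem k]
    rcases cases p with k' | k' | k' | ⟨k1, k2, k3⟩
    · exact absurd k' k
    · rw [hiC p k']; linarith
    · rw [hiY p k']; linarith
    · rw [hiZ p k1 k2 k3]; linarith
  have hnbhi2 : ∀ p, nb hi p ≤ hiP a K μ * nb (ind ℝ P) p + 2 * μ * (4 - nb (ind ℝ P) p) :=
    fun p => (nb_mono hhi2 p).trans_eq (by unfold nb; ring)
  have hcont : ContinuousOn (fun t => D1 g (t, μ)) (Icc 0 (hiP a K μ)) :=
    ((contDiff_D1 H.smooth).continuous.comp (by fun_prop)).continuousOn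
  obtain ⟨B, hB⟩ := isCompact_Icc.exists_bound_of_continuousOn hcont
  obtain ⟨u, hu, hsol⟩ := exists_solution_between (C := C) (d := d) (L := max B 1) (A := 0)
    (B := hiP a K μ) hd (by positivity) (h := fun t => g (t, μ)) (fun s hs t ht hst => by
      have := abs_sub_le_of_hasDerivAt (φ := fun t => g (t, μ)) (a := s) (b := t) (C := max B 1)
        (fun y _ => hasDerivAt_D1 H.smooth y μ) (fun y hy => by
          rw [uIcc_of_le hst] at hy
          exact (hB y ⟨hs.1.trans hy.1, hy.2.trans ht.2⟩).trans (le_max_left _ _))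
      rw [abs_of_nonneg (sub_nonneg.2 hst)] at this
      linarith [(abs_le.1 this).1])
    (lo := lo) (hi := hi) (fun p => (hlohi p).2.1) (fun p => (hlohi p).1)
    (fun p => (hlohi p).2.2) (fun p hp => by rw [loC p hp, hiC p hp])
    (fun p hp => by
      have hnb : 0 ≤ nb lo p := nb_nonneg (fun q => (hlohi q).1) p
      have hdn := mul_nonneg hd.le hnb
      rcases cases p with k | k | k | ⟨k1, k2, k3⟩
      · rw [loP' p k]
        have := H.one_lower μ hμ
        change 3 * μ ^ 2 ≤ g (loP a K μ, μ) at this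
        have h9 : d * loP a K μ ≤ d * (101 / 100) :=
          mul_le_mul_of_nonneg_left (by linarith) hd.le
        nlinarith [sq_nonneg μ]
      · exact absurd k hp
      · rw [loZ p k.1 k.2.1, H.zero μ hμ]; linarith
      · rw [loZ p k1 k2, H.zero μ hμ]; linarith)
    (fun p hp => by
      rcases cases p with k | k | k | ⟨k1, k2, k3⟩
      · rw [hiP' p k]
        have h10 := H.one_upper μ hμ
        change g (hiP a K μ, μ) ≤ 0 at h10
        have h9 : nb hi p ≤ 4 * hiP a K μ :=
          (nb_mono (fun q => (hlohi q).2.2) p).trans_eq (nb_const _ p)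
        have := mul_le_mul_of_nonneg_left h9 hd.le
        linarith
      · exact absurd k hp
      · rw [hiY p k]
        have hn1 : nb (ind ℝ P) p = 1 := (hC.nb_Z p k.1 k.2.1).resolve_left k.2.2
        by_cases hs : special
        · rw [gap_special hs] at hG
          obtain ⟨s1, s2⟩ := hC.special_Y hs p k
          have : nb hi p = hiP a K μ + x + 16 * μ ^ 2 := by
            have e : ∀ q, hi q = hiP a K μ * ind ℝ P q + x * ind ℝ C q
                + topY μ * ind ℝ (bdry P C) q
                + 8 * μ ^ 2 * (1 - ind ℝ P q - ind ℝ C q - ind ℝ (bdry P C) q) := fun q => by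
              rcases cases q with k' | k' | k' | ⟨k1, k2, k3⟩
              · rw [hiP' q k', ind_of_mem k', ind_of_notMem (hC.disj q k'),
                  ind_of_notMem fun h : q ∈ bdry P C => h.1 k']; ring
              · rw [hiC q k', ind_of_mem k', ind_of_notMem fun h => hC.disj q h k',
                  ind_of_notMem fun h : q ∈ bdry P C => h.2.1 k']; ring
              · rw [hiY q k', ind_of_mem k', ind_of_notMem k'.1, ind_of_notMem k'.2.1]; ring
              · rw [hiZ q k1 k2 k3, ind_of_notMem k1, ind_of_notMem k2, ind_of_notMem k3]; ring
            have e2 : nb hi p = hiP a K μ * nb (ind ℝ P) p + x * nb (ind ℝ C) p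
                + topY μ * nb (ind ℝ (bdry P C)) p + 8 * μ ^ 2 * (4 - nb (ind ℝ P) p
                  - nb (ind ℝ C) p - nb (ind ℝ (bdry P C)) p) := by
              unfold nb; rw [e, e, e, e]; ring
            rw [e2, hn1, s1, s2]; ring
          rw [this]; exact hG.le
        · have hj2 : j = 2 := by
            rcases hC.j_eq with h1 | h2
            · exact absurd (hC.ordinary hs h1 p k.1 k.2.1) k.2.2
            · exact h2
          rw [hj2] at hle
          have h9 := hnbhi2 p
          rw [hn1] at h9
          have h10 : d * (nb hi p - 4 * topY μ) ≤ d * (102 / 100) :=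
            mul_le_mul_of_nonneg_left (by linarith) hd.le
          nlinarith [sq_nonneg μ]
      · rw [hiZ p k1 k2 k3]
        have hn0 : nb (ind ℝ P) p = 0 := by
          by_contra hne; exact k3 ⟨k1, k2, hne⟩
        have h9 := hnbhi2 p
        rw [hn0] at h9
        exact H.upper_Z hμ hd hd2 (by linarith))
  refine ⟨ofBound u (hiP a K μ) fun p => ?_, ⟨fun p hp => ?_, hsol⟩, ?_, ?_, ?_⟩
  · rw [Real.norm_eq_abs, abs_of_nonneg ((hlohi p).1.trans (hu p).1)]
    exact (hu p).2.trans (hlohi p).2.2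
  · have := hu p
    rw [loC p hp, hiC p hp] at this
    exact le_antisymm this.2 this.1
  · intro p hp
    have := hu p
    rw [loP' p hp, hiP' p hp] at this
    exact this
  · intro p hp
    have := hu p
    rw [loZ p hp.1 hp.2.1, hiY p hp] at this
    exact this
  · intro p k1 k2 k3
    have := hu p
    rw [loZ p k1 k2, hiZ p k1 k2 k3] at this
    exact this

theorem LocalModel.inReg {μ : ℝ} (hμ : μ ∈ Ioo 0 μ₀)
    {u : ℤ × ℤ → ℝ} (hu : IsBoxed P C a K μ u) : InReg P C r μ u := by
  obtain ⟨k1, k2, -, -, -⟩ := H.bounds_P hμ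
  have k1' := abs_le.1 k1
  have k2' := abs_le.1 k2
  have hr := H.r_pos
  obtain ⟨q, hq, hsq, hqq, -, hΛ, hq1⟩ := H.exists_sqrt hμ
  have hμ0 := hμ.1
  have h0 : 0 < μ * √μ := by rw [hsq]; positivity
  have h1 : μ * √μ ≤ 1 / 10 ^ 6 * μ := by rw [hsq]; nlinarith
  refine ⟨fun p hp => ?_, fun p hp hp' => ?_⟩
  · have := hu.onP p hp
    exact ⟨by linarith [this.1], by linarith [this.2]⟩
  · by_cases hpb : p ∈ bdry P C
    · have := hu.onY p hpb
      rw [topY] at this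
      exact ⟨by linarith [this.1], by linarith [this.2]⟩
    · have := hu.onZ p hp hp' hpb
      have hμs : μ ≤ 1 / 10 ^ 6 := by nlinarith
      exact ⟨by linarith [this.1], by nlinarith [this.2]⟩

/-- Dissipativity in the region. -/
theorem LocalModel.D1_le {μ : ℝ} (hμ : μ ∈ Ioo 0 μ₀) {t : ℝ}
    (ht : t ∈ Ioo (-μ) (μ / 2 - μ * √μ / 32)) : D1 g (t, μ) ≤ -(μ * √μ / 32) := by
  obtain ⟨q, hq, hsq, hqq, -, hΛ, hq1⟩ := H.exists_sqrt hμ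
  have h0 : 0 < μ * √μ := by rw [hsq]; have := hμ.1; positivity
  have h1 := (abs_le.1 (H.d1 μ hμ t ⟨ht.1.le, by linarith [ht.2, hμ.1]⟩)).2
  have h2 : Λ * μ ^ 2 ≤ μ * √μ / 32 := by
    rw [hsq]
    calc Λ * μ ^ 2 = Λ * q * (μ * q) := by rw [hqq]; ring
      _ ≤ 1 / 10 ^ 6 * (μ * q) := mul_le_mul_of_nonneg_right hΛ (by have := hμ.1; positivity)
      _ ≤ _ := by rw [hsq] at h0; linarith
  linarith [ht.2]

theorem LocalModel.D1_le_of_inReg {μ : ℝ} (hμ : μ ∈ Ioo 0 μ₀)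
    {u : ℤ × ℤ → ℝ} (hu : InReg P C r μ u) {p : ℤ × ℤ} (hp : p ∉ C) :
    D1 g (u p, μ) ≤ -(μ * √μ / 32) := by
  by_cases hP : p ∈ P
  · refine (H.one_d1 μ hμ _ (Ioo_subset_Icc_self (hu.onP p hP))).trans (neg_le_neg ?_)
    obtain ⟨q, hq, hsq, hqq, -, hΛ, hq1⟩ := H.exists_sqrt hμ
    have hΛ1 := H.one_le
    rw [le_div_iff₀ (by linarith), hsq, hqq]
    have : q ^ 2 * q / 32 * Λ = Λ * q * (q ^ 2 / 32) := by ring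
    rw [this]
    calc Λ * q * (q ^ 2 / 32) ≤ 1 / 10 ^ 6 * 1 :=
          mul_le_mul hΛ (by nlinarith) (by positivity) (by norm_num)
      _ ≤ 1 := by norm_num
  · exact H.D1_le hμ (hu.onZ p hP hp)

/-- Uniqueness in the dissipative region. -/
theorem LocalModel.sol_unique {x μ d : ℝ}
    (hμ : μ ∈ Ioo 0 μ₀) (hd : 0 < d) {u v : LInf ℝ} (hu : IsSol g C x μ d u)
    (hv : IsSol g C x μ d v) (hur : InReg P C r μ u) (hvr : InReg P C r μ v) : u = v := by
  classical
  have hslope : ∀ p, ∃ c, p ∉ C →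
      c ≤ -(μ * √μ / 32) ∧ g (u p, μ) - g (v p, μ) = c * (u p - v p) := fun p => by
    by_cases hp : p ∈ C
    · exact ⟨0, fun h => absurd hp h⟩
    rcases eq_or_ne (u p) (v p) with heq | hne
    · exact ⟨_, fun _ => ⟨le_rfl, by rw [heq]; ring⟩⟩
    · obtain ⟨c, hc, he⟩ : ∃ c ∈ uIcc (u p) (v p),
          g (u p, μ) - g (v p, μ) = D1 g (c, μ) * (u p - v p) := by
        rcases hne.lt_or_gt with hlt | hlt
        · obtain ⟨c, hc, he⟩ := exists_slope_of_D1 H.smooth μ hlt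
          refine ⟨c, ?_, by linarith⟩
          rw [uIcc_of_le hlt.le]; exact Ioo_subset_Icc_self hc
        · obtain ⟨c, hc, he⟩ := exists_slope_of_D1 H.smooth μ hlt
          refine ⟨c, ?_, he⟩
          rw [uIcc_of_ge hlt.le]; exact Ioo_subset_Icc_self hc
      refine ⟨D1 g (c, μ), fun _ => ⟨?_, he⟩⟩
      have := H.D1_le_of_inReg hμ (hur.convex hvr hp hc) hp
      simpa using this
  choose c hc using hslope
  have hδ : 0 < μ * √μ / 32 := by have := hμ.1; positivity
  refine linf_ext fun p => ?_
  have key := norm_le_of_dominant (C := C) (v := u - v) (B := 0) (c := c) (g := fun _ => 0) hd hδ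
    (fun p hp => (hc p hp).1) (fun p hp => ?_) (fun p _ => by simp) (fun p hp => ?_) p
  · exact sub_eq_zero.1 (norm_le_zero_iff.1 key)
  · have h1 := hu.2 p hp
    have h2 := hv.2 p hp
    have h3 := (hc p hp).2
    have h4 : nb (u - v : LInf ℝ) p = nb u p - nb v p := nb_sub u v p
    rw [h4]
    change d * (nb u p - nb v p) + (c p - 4 * d) * (u p - v p) = 0
    linarith
  · change ‖u p - v p‖ ≤ 0
    rw [hu.1 p hp, hv.1 p hp, sub_self, norm_zero]

end Solve

/-! ### Smooth dependence on the parameters -/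

section Sol

open Classical in
/-- The solution in the dissipative region that takes the value `x` on the critical orbit, as a
function of `(x, μ, d)`. -/
def sol (g : ℝ × ℝ → ℝ) (P C : Set (ℤ × ℤ)) (r : ℝ) (p : ℝ × ℝ × ℝ) : LInf ℝ :=
  if h : ∃ u : LInf ℝ, IsSol g C p.1 p.2.1 p.2.2 u ∧ InReg P C r p.2.1 u then h.choose else 0

theorem hasDerivAt_nb {u : ℝ → LInf ℝ} {u' : LInf ℝ} {t : ℝ} (h : HasDerivAt u u' t) (p : ℤ × ℤ) :
    HasDerivAt (fun s => nb (u s) p) (nb u' p) t :=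
  ((ev ℝ p).comp (nbOp ℝ)).hasFDerivAt.comp_hasDerivAt t h

theorem hasDerivAt_apply {u : ℝ → LInf ℝ} {u' : LInf ℝ} {t : ℝ} (h : HasDerivAt u u' t)
    (p : ℤ × ℤ) : HasDerivAt (fun s => u s p) (u' p) t :=
  (ev ℝ p).hasFDerivAt.comp_hasDerivAt t h

/-- The steady-state equation, differentiated along a curve. -/
theorem hasDerivAt_equation {g : ℝ × ℝ → ℝ} (hg : ContDiff ℝ ∞ g) {u : ℝ → LInf ℝ} {u' : LInf ℝ}
    {M : ℝ → ℝ} {M' t : ℝ} (d : ℝ) (hu : HasDerivAt u u' t) (hM : HasDerivAt M M' t) (p : ℤ × ℤ) :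
    HasDerivAt (fun s => d * (nb (u s) p - 4 * u s p) + g (u s p, M s))
      (d * (nb u' p - 4 * u' p) + (D1 g (u t p, M t) * u' p + D2 g (u t p, M t) * M')) t :=
  (((hasDerivAt_nb hu p).sub ((hasDerivAt_apply hu p).const_mul 4)).const_mul d).add
    (hasDerivAt_curve hg (hasDerivAt_apply hu p) hM)

variable {g : ℝ × ℝ → ℝ} {um up : ℝ → ℝ} {a K Λ r μ₀ : ℝ} {σ : Site} {P C : Set (ℤ × ℤ)}
  {p₀ : ℤ × ℤ} {j : ℝ} {special : Prop}

theorem LocalModel.sol_eq (H : LocalModel g um up a K Λ r μ₀) {x μ d : ℝ} (hμ : μ ∈ Ioo 0 μ₀)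
    (hd : 0 < d) {u : LInf ℝ} (hu : IsSol g C x μ d u) (hur : InReg P C r μ u) :
    sol g P C r (x, μ, d) = u := by
  have h : ∃ u : LInf ℝ, IsSol g C x μ d u ∧ InReg P C r μ u := ⟨u, hu, hur⟩
  have e : sol g P C r (x, μ, d) = h.choose := dif_pos h
  rw [e]
  exact H.sol_unique hμ hd h.choose_spec.1 hu h.choose_spec.2 hur

theorem continuous_topY : Continuous topY := by unfold topY; fun_prop

theorem continuous_gap (hg : Continuous g) : Continuous (gap g a K j special) := by
  have ht := continuous_topY
  by_cases hs : special
  · have : gap g a K j special = fun p : ℝ × ℝ × ℝ =>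
        p.2.2 * (hiP a K p.2.1 + p.1 + 16 * p.2.1 ^ 2 - 4 * topY p.2.1)
        + g (topY p.2.1, p.2.1) := by funext p; exact if_pos hs
    rw [this]; unfold hiP; fun_prop
  · have : gap g a K j special = fun p : ℝ × ℝ × ℝ => 7 / 2 * j * p.2.2 - p.2.1 ^ 2 := by
      funext p; exact if_neg hs
    rw [this]; fun_prop

theorem nb_flip (σ : Site) (u : ℤ × ℤ → ℝ) (p : ℤ × ℤ) :
    nb (fun q => u (σ.flip q)) p = nb u (σ.flip p) := by
  have e1 : σ.c - (p.1 + 1) = σ.c - p.1 - 1 := by ring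
  have e2 : σ.c - (p.1 - 1) = σ.c - p.1 + 1 := by ring
  unfold nb Site.flip
  simp only [e1, e2]
  ring

theorem nb_swap (u : ℤ × ℤ → ℝ) (p : ℤ × ℤ) :
    nb (fun q => u q.swap) p = nb u p.swap := by
  unfold nb
  simp only [Prod.swap]
  ring

theorem IsD4Symmetric.nb_isD4Symmetric {u : ℤ × ℤ → ℝ} (hu : IsD4Symmetric σ u) :
    IsD4Symmetric σ (nb u) := fun n m => by
  constructor
  · have := nb_flip σ u (n, m)
    have e : (fun q => u (σ.flip q)) = u := by
      funext ⟨k, l⟩; exact (hu k l).1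
    rw [e] at this
    exact this.symm
  · have := nb_swap u (n, m)
    have e : (fun q : ℤ × ℤ => u q.swap) = u := by
      funext ⟨k, l⟩; exact (hu k l).2
    rw [e] at this
    exact this.symm

/-- The equation that is left on the critical orbit. -/
def red (g : ℝ × ℝ → ℝ) (P C : Set (ℤ × ℤ)) (r : ℝ) (p₀ : ℤ × ℤ) (π : ℝ × ℝ × ℝ) : ℝ :=
  π.2.2 * (nb (sol g P C r π) p₀ - 4 * π.1) + g (π.1, π.2.1)

/-- The derivative of the solution in the direction `e`. -/
def dsol (g : ℝ × ℝ → ℝ) (P C : Set (ℤ × ℤ)) (r : ℝ) (e π : ℝ × ℝ × ℝ) : LInf ℝ :=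
  fderiv ℝ (sol g P C r) π e

theorem hasDerivAt_line1 (x μ d : ℝ) :
    HasDerivAt (fun t : ℝ => ((t, μ, d) : ℝ × ℝ × ℝ)) (1, 0, 0) x :=
  (hasDerivAt_id x).prodMk ((hasDerivAt_const x μ).prodMk (hasDerivAt_const x d))

theorem hasDerivAt_line2 (x μ d : ℝ) :
    HasDerivAt (fun t : ℝ => ((x, t, d) : ℝ × ℝ × ℝ)) (0, 1, 0) μ :=
  (hasDerivAt_const μ x).prodMk ((hasDerivAt_id μ).prodMk (hasDerivAt_const μ d))

variable (H : LocalModel g um up a K Λ r μ₀)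
  (hC : IsConfig σ P C p₀ j special)

include H hC

theorem LocalModel.sol_spec
    {x μ d : ℝ} (h : (x, μ, d) ∈ dom g a K j μ₀ special) :
    IsSol g C x μ d (sol g P C r (x, μ, d)) ∧ IsBoxed P C a K μ (sol g P C r (x, μ, d)) := by
  obtain ⟨hx, hx2, hμ, hd, hG⟩ := dom_pos h
  obtain ⟨u, hu, hb⟩ := H.exists_sol hC h
  rw [H.sol_eq hμ hd hu (H.inReg hμ hb)]
  exact ⟨hu, hb⟩

omit hC in
theorem LocalModel.isOpen_dom : IsOpen (dom g a K j μ₀ special) := by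
  have h1 : IsOpen {p : ℝ × ℝ × ℝ | 0 < p.1} := isOpen_lt (by fun_prop) (by fun_prop)
  have h2 : IsOpen {p : ℝ × ℝ × ℝ | p.1 < 2 * p.2.1} := isOpen_lt (by fun_prop) (by fun_prop)
  have h3 : IsOpen {p : ℝ × ℝ × ℝ | p.2.1 < μ₀} := isOpen_lt (by fun_prop) (by fun_prop)
  have h4 : IsOpen {p : ℝ × ℝ × ℝ | 0 < p.2.2} := isOpen_lt (by fun_prop) (by fun_prop)
  have h5 : IsOpen {p : ℝ × ℝ × ℝ | gap g a K j special p < 0} := 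
    isOpen_lt (continuous_gap H.smooth.continuous) (by fun_prop)
  exact h1.inter (h2.inter (h3.inter (h4.inter h5)))

omit hC in
/-- The region is stable under small perturbations. -/
theorem LocalModel.eventually_inReg {μ : ℝ}
    (hμ : μ ∈ Ioo 0 μ₀) {u : LInf ℝ} (hu : IsBoxed P C a K μ u) :
    ∀ᶠ q : ℝ × LInf ℝ in 𝓝 (μ, u), InReg P C r q.1 q.2 := by
  obtain ⟨k1, k2, -, -, -⟩ := H.bounds_P hμ
  obtain ⟨t1, t2, -⟩ := H.bounds_topY hμ
  have k1' := abs_le.1 k1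
  have k2' := abs_le.1 k2
  obtain ⟨s, hs, hsq, hqq, -, hΛ, hq1⟩ := H.exists_sqrt hμ
  have hμ0 := hμ.1
  have h0 : 0 < μ * √μ := by rw [hsq]; positivity
  have hn : ContinuousAt (fun q : ℝ × LInf ℝ => ‖q.2 - u‖) (μ, u) := by fun_prop
  have hb1 : ContinuousAt (fun q : ℝ × LInf ℝ => q.1 / 2 - q.1 * √q.1 / 32) (μ, u) := by fun_prop
  have hfst : ContinuousAt (fun q : ℝ × LInf ℝ => q.1) (μ, u) := continuousAt_fst
  have e1 := hn.eventually (gt_mem_nhds (show ‖(μ, u).2 - u‖ < r / 2 by simp [H.r_pos]))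
  have e2 := hn.eventually_lt hfst (by simpa using hμ0)
  have e3 := (hn.add_const (topY μ)).eventually_lt hb1 (by
    simp only [sub_self, norm_zero, zero_add]; rw [topY]; linarith)
  filter_upwards [e1, e2, e3] with q h1 h2 h3
  have hqu : ∀ p, |q.2 p - u p| ≤ ‖q.2 - u‖ := fun p => norm_apply_le (q.2 - u) p
  refine ⟨fun p hp => ?_, fun p hp hp' => ?_⟩
  · have := hu.onP p hp
    have h4 := abs_le.1 (hqu p)
    exact ⟨by linarith [this.1], by linarith [this.2]⟩
  · have h4 := abs_le.1 (hqu p)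
    have h5 : u p ∈ Icc 0 (topY μ) := by
      by_cases hpb : p ∈ bdry P C
      · exact hu.onY p hpb
      · have := hu.onZ p hp hp' hpb
        have hμs : μ ≤ 1 / 10 ^ 6 := by nlinarith
        exact ⟨this.1, this.2.trans (by nlinarith)⟩
    exact ⟨by linarith [h5.1], by linarith [h5.2]⟩

set_option maxHeartbeats 800000 in
theorem LocalModel.contDiffAt_sol {π : ℝ × ℝ × ℝ} (h : π ∈ dom g a K j μ₀ special) :
    ContDiffAt ℝ ∞ (sol g P C r) π := by
  obtain ⟨x, μ, d⟩ := π
  obtain ⟨hx, hx2, hμ, hd, hG⟩ := dom_pos h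
  obtain ⟨hs, hb⟩ := H.sol_spec hC h
  set u := sol g P C r (x, μ, d)
  have hδ : 0 < μ * √μ / 32 := by have := hμ.1; positivity
  let Ψ : (ℝ × ℝ × ℝ) × LInf ℝ → LInf ℝ := fun q =>
    mulOp ℝ (ind ℝ Cᶜ) (q.1.2.2 • (nbOp ℝ q.2 - (4 : ℝ) • q.2)
      + nem g H.smooth.continuous (q.2, q.1.2.1)) + mulOp ℝ (ind ℝ C) (q.2 - q.1.1 • ind ℝ univ)
  have hΨn : ∀ q, ∀ p ∉ C, Ψ q p = q.1.2.2 * (nb q.2 p - 4 * q.2 p) + g (q.2 p, q.1.2.1) :=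
    fun q p hp => by
      change ind ℝ Cᶜ p * (q.1.2.2 * (nb q.2 p - 4 * q.2 p) + g (q.2 p, q.1.2.1))
        + ind ℝ C p * (q.2 p - q.1.1 * ind ℝ univ p) = _
      rw [ind_of_mem (by simpa using hp), ind_of_notMem hp]; ring
  have hΨC : ∀ q, ∀ p ∈ C, Ψ q p = q.2 p - q.1.1 := fun q p hp => by
    change ind ℝ Cᶜ p * (q.1.2.2 * (nb q.2 p - 4 * q.2 p) + g (q.2 p, q.1.2.1))
      + ind ℝ C p * (q.2 p - q.1.1 * ind ℝ univ p) = _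
    rw [ind_of_notMem (by simpa using hp), ind_of_mem hp, ind_of_mem (mem_univ p)]; ring
  have hΨiff : ∀ q, Ψ q = 0 ↔ IsSol g C q.1.1 q.1.2.1 q.1.2.2 q.2 := fun q => by
    constructor
    · intro h0
      refine ⟨fun p hp => ?_, fun p hp => ?_⟩
      · have := hΨC q p hp
        rw [h0] at this
        exact (sub_eq_zero.1 this.symm)
      · rw [← hΨn q p hp, h0]; rfl
    · intro h0
      refine linf_ext fun p => ?_
      by_cases hp : p ∈ C
      · rw [hΨC q p hp, h0.1 p hp, sub_self]; rfl
      · rw [hΨn q p hp, h0.2 p hp]; rfl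
  have hΨs : ContDiff ℝ ∞ Ψ := by
    have := contDiff_nem H.smooth
    fun_prop
  set L : LInf ℝ →L[ℝ] LInf ℝ := pinned C d (nem (D1 g) (contDiff_D1 H.smooth).continuous (u, μ))
    with hL
  have hder : HasFDerivAt (fun z => Ψ ((x, μ, d), z)) L u := by
    have h1 : HasFDerivAt (fun z : LInf ℝ => nem g H.smooth.continuous (z, μ)) _ u :=
      HasFDerivAt.comp (g := nem g H.smooth.continuous) (f := fun z : LInf ℝ => (z, μ)) u
        (hasFDerivAt_nem H.smooth (u, μ)) (hasFDerivAt_prodMk_left u μ)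
    have h2 : HasFDerivAt (fun z : LInf ℝ => d • (nbOp ℝ z - (4 : ℝ) • z)) _ u :=
      ((nbOp ℝ).hasFDerivAt.sub ((hasFDerivAt_id u).const_smul (4 : ℝ))).const_smul d
    have h3 : HasFDerivAt (fun z => Ψ ((x, μ, d), z)) _ u :=
      ((mulOp ℝ (ind ℝ Cᶜ)).hasFDerivAt.comp u (h2.add h1)).add
        ((mulOp ℝ (ind ℝ C)).hasFDerivAt.comp u ((hasFDerivAt_id u).sub_const (x • ind ℝ univ)))
    refine h3.congr_fderiv ?_
    ext1 v
    refine linf_ext fun p => ?_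
    by_cases hp : p ∈ C
    · rw [hL, pinned_apply_of_mem hp]
      change ind ℝ Cᶜ p * (d * (nb v p - 4 * v p) + (D1 g (u p, μ) * v p + 0 * D2 g (u p, μ)))
        + ind ℝ C p * v p = _
      rw [ind_of_notMem (by simpa using hp), ind_of_mem hp]; ring
    · rw [hL, pinned_apply_of_notMem hp]
      change ind ℝ Cᶜ p * (d * (nb v p - 4 * v p) + (D1 g (u p, μ) * v p + 0 * D2 g (u p, μ)))
        + ind ℝ C p * v p = _
      rw [ind_of_mem (by simpa using hp), ind_of_notMem hp, nem_apply]
      simp only [RCLike.ofReal_real_eq_id, id_eq]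
      ring
  have hinv : L.IsInvertible := by
    obtain ⟨U, hU⟩ := isUnit_pinned (𝕜 := ℝ) (C := C) hd hδ
      (V := nem (D1 g) (contDiff_D1 H.smooth).continuous (u, μ))
      fun p hp => H.D1_le_of_inReg hμ (H.inReg hμ hb) hp
    exact ⟨ContinuousLinearEquiv.unitsEquiv ℝ (LInf ℝ) U, hU⟩
  refine contDiffAt_of_unique_zero (f := Ψ) (y := u) hΨs.contDiffAt ((hΨiff _).2 hs) hinv hder ?_
  have hc1 : ContinuousAt (fun q : (ℝ × ℝ × ℝ) × LInf ℝ => (q.1.2.1, q.2)) ((x, μ, d), u) := by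
    fun_prop
  have hc2 : ContinuousAt (fun q : (ℝ × ℝ × ℝ) × LInf ℝ => q.1) ((x, μ, d), u) := by fun_prop
  filter_upwards [hc1.eventually (H.eventually_inReg hμ hb),
    hc2.eventually (H.isOpen_dom.mem_nhds h)] with q hq hq' h0
  obtain ⟨⟨x', μ', d'⟩, v⟩ := q
  obtain ⟨-, -, hμ', hd', -⟩ := dom_pos hq'
  exact H.sol_eq hμ' hd' ((hΨiff _).1 h0) hq

theorem LocalModel.sol_comp {x μ d : ℝ} (h : (x, μ, d) ∈ dom g a K j μ₀ special)
    {ρ : ℤ × ℤ → ℤ × ℤ} (hnb : ∀ (u : ℤ × ℤ → ℝ) p, nb (fun q => u (ρ q)) p = nb u (ρ p))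
    (hP : ∀ p, ρ p ∈ P ↔ p ∈ P) (hCρ : ∀ p, ρ p ∈ C ↔ p ∈ C) (p : ℤ × ℤ) :
    sol g P C r (x, μ, d) (ρ p) = sol g P C r (x, μ, d) p := by
  obtain ⟨hx, hx2, hμ, hd, hG⟩ := dom_pos h
  obtain ⟨hs, hb⟩ := H.sol_spec hC h
  have hr := H.inReg hμ hb
  set u := sol g P C r (x, μ, d)
  set v : LInf ℝ := ofBound (fun q => u (ρ q)) ‖u‖ fun q => norm_apply_le u _ with hv
  have hvs : IsSol g C x μ d v := ⟨fun q hq => hs.1 _ ((hCρ q).2 hq), fun q hq => by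
    have := hs.2 (ρ q) fun h => hq ((hCρ q).1 h)
    rw [← hnb] at this
    exact this⟩
  have hvr : InReg P C r μ v := ⟨fun q hq => hr.onP _ ((hP q).2 hq), fun q hq hq' =>
    hr.onZ _ (fun h => hq ((hP q).1 h)) fun h => hq' ((hCρ q).1 h)⟩
  have := H.sol_unique hμ hd hvs hs hvr hr
  exact congrArg (fun w : LInf ℝ => w p) this

theorem LocalModel.isD4Symmetric_sol {x μ d : ℝ} (h : (x, μ, d) ∈ dom g a K j μ₀ special) :
    IsD4Symmetric σ (sol g P C r (x, μ, d)) := fun n m =>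
  ⟨H.sol_comp hC h (nb_flip σ) hC.flip_P hC.flip_C (n, m),
    H.sol_comp hC h nb_swap hC.swap_P hC.swap_C (n, m)⟩

/-- By symmetry, only the equation at one critical site is left. -/
theorem LocalModel.isSteadyState_iff {x μ d : ℝ} (h : (x, μ, d) ∈ dom g a K j μ₀ special) :
    IsSteadyState (fun u μ => g (u, μ)) (sol g P C r (x, μ, d)) μ d
      ↔ red g P C r p₀ (x, μ, d) = 0 := by
  obtain ⟨hs, hb⟩ := H.sol_spec hC h
  have hsym := H.isD4Symmetric_sol hC h
  constructor
  · intro hst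
    have := hst p₀.1 p₀.2
    rw [lap_eq_nb] at this
    simp only [Prod.mk.eta, hs.1 p₀ hC.mem] at this
    exact this
  · intro h0 n m
    rw [lap_eq_nb]
    by_cases hp : (n, m) ∈ C
    · have h1 := hC.orbit _ hsym.nb_isD4Symmetric (n, m) hp
      rw [h1]
      simp only [hs.1 _ hp]
      exact h0
    · exact hs.2 _ hp

section Derivatives

theorem LocalModel.contDiffAt_dsol (e : ℝ × ℝ × ℝ) {π : ℝ × ℝ × ℝ}
    (h : π ∈ dom g a K j μ₀ special) : ContDiffAt ℝ ∞ (dsol g P C r e) π :=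
  ((H.contDiffAt_sol hC h).fderiv_right (m := ∞) (by simp)).clm_apply contDiffAt_const

/-- The linear equation for a derivative of the solution in a direction along which `d` is
constant. -/
theorem LocalModel.dsol_equation {c : ℝ → ℝ × ℝ × ℝ} {x' μ' t : ℝ}
    (h : c t ∈ dom g a K j μ₀ special) (hc : HasDerivAt c (x', μ', 0) t)
    (hd : ∀ s, (c s).2.2 = (c t).2.2) : ∃ v : LInf ℝ,
      HasDerivAt (fun s => sol g P C r (c s)) v t ∧ v = dsol g P C r (x', μ', 0) (c t) ∧
      (∀ p ∈ C, v p = x') ∧ ∀ p ∉ C, (c t).2.2 * (nb v p - 4 * v p)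
        + (D1 g (sol g P C r (c t) p, (c t).2.1) * v p
          + D2 g (sol g P C r (c t) p, (c t).2.1) * μ') = 0 := by
  have hder : HasDerivAt (fun s => sol g P C r (c s)) (dsol g P C r (x', μ', 0) (c t)) t :=
    HasFDerivAt.comp_hasDerivAt (f := c) t
      ((H.contDiffAt_sol hC h).differentiableAt (by simp)).hasFDerivAt hc
  have hev : ∀ᶠ s in 𝓝 t, c s ∈ dom g a K j μ₀ special :=
    hc.continuousAt.eventually (H.isOpen_dom.mem_nhds h)
  have hc1 : HasDerivAt (fun s => (c s).1) x' t := 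
    (ContinuousLinearMap.fst ℝ ℝ (ℝ × ℝ)).hasFDerivAt.comp_hasDerivAt t hc
  have hc2 : HasDerivAt (fun s => (c s).2.1) μ' t :=
    ((ContinuousLinearMap.fst ℝ ℝ ℝ).comp (ContinuousLinearMap.snd ℝ ℝ (ℝ × ℝ))).hasFDerivAt
      |>.comp_hasDerivAt t hc
  refine ⟨_, hder, rfl, fun p hp => ?_, fun p hp => ?_⟩
  · refine (hasDerivAt_apply hder p).unique (hc1.congr_of_eventuallyEq ?_)
    filter_upwards [hev] with s hs
    exact (H.sol_spec hC hs).1.1 p hp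
  · refine (hasDerivAt_equation H.smooth (c t).2.2 hder hc2 p).unique
      ((hasDerivAt_const t (0 : ℝ)).congr_of_eventuallyEq ?_)
    filter_upwards [hev] with s hs
    rw [← hd s]
    exact (H.sol_spec hC hs).1.2 p hp

theorem LocalModel.dsol_x
    {x μ d : ℝ} (h : (x, μ, d) ∈ dom g a K j μ₀ special) :
    (∀ p ∈ C, dsol g P C r (1, 0, 0) (x, μ, d) p = 1) ∧
    ∀ p ∉ C, d * (nb (dsol g P C r (1, 0, 0) (x, μ, d)) p - 4 * dsol g P C r (1, 0, 0) (x, μ, d) p)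
      + D1 g (sol g P C r (x, μ, d) p, μ) * dsol g P C r (1, 0, 0) (x, μ, d) p = 0 := by
  obtain ⟨v, -, rfl, h1, h2⟩ := H.dsol_equation hC (c := fun t => (t, μ, d)) h
    (hasDerivAt_line1 x μ d) fun _ => rfl
  refine ⟨h1, fun p hp => ?_⟩
  have := h2 p hp
  rw [mul_zero, add_zero] at this
  exact this

theorem LocalModel.dsol_μ
    {x μ d : ℝ} (h : (x, μ, d) ∈ dom g a K j μ₀ special) :
    (∀ p ∈ C, dsol g P C r (0, 1, 0) (x, μ, d) p = 0) ∧
    ∀ p ∉ C, d * (nb (dsol g P C r (0, 1, 0) (x, μ, d)) p - 4 * dsol g P C r (0, 1, 0) (x, μ, d) p)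
      + (D1 g (sol g P C r (x, μ, d) p, μ) * dsol g P C r (0, 1, 0) (x, μ, d) p
        + D2 g (sol g P C r (x, μ, d) p, μ)) = 0 := by
  obtain ⟨v, -, rfl, h1, h2⟩ := H.dsol_equation hC (c := fun t => (x, t, d)) h
    (hasDerivAt_line2 x μ d) fun _ => rfl
  refine ⟨h1, fun p hp => ?_⟩
  have := h2 p hp
  rw [mul_one] at this
  exact this

/-- The equation for the second derivative in `x`. -/
theorem LocalModel.dsol_xx
    {x μ d : ℝ} (h : (x, μ, d) ∈ dom g a K j μ₀ special) : ∃ w : LInf ℝ,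
      HasDerivAt (fun t => dsol g P C r (1, 0, 0) (t, μ, d)) w x ∧ (∀ p ∈ C, w p = 0) ∧
      ∀ p ∉ C, d * (nb w p - 4 * w p) + D1 g (sol g P C r (x, μ, d) p, μ) * w p
        + D1 (D1 g) (sol g P C r (x, μ, d) p, μ) * dsol g P C r (1, 0, 0) (x, μ, d) p ^ 2 = 0 := by
  have hl := hasDerivAt_line1 x μ d
  have hder : HasDerivAt (fun t => dsol g P C r (1, 0, 0) (t, μ, d)) _ x :=
    HasFDerivAt.comp_hasDerivAt (f := fun t : ℝ => ((t, μ, d) : ℝ × ℝ × ℝ)) x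
      ((H.contDiffAt_dsol hC (1, 0, 0) h).differentiableAt (by simp)).hasFDerivAt hl
  have hev : ∀ᶠ s in 𝓝 x, (s, μ, d) ∈ dom g a K j μ₀ special :=
    hl.continuousAt.eventually (H.isOpen_dom.mem_nhds h)
  obtain ⟨v, hv, hv', h1, h2⟩ := H.dsol_equation hC (c := fun t => (t, μ, d)) h hl fun _ => rfl
  refine ⟨_, hder, fun p hp => ?_, fun p hp => ?_⟩
  · refine (hasDerivAt_apply hder p).unique ((hasDerivAt_const x (1 : ℝ)).congr_of_eventuallyEq ?_)
    filter_upwards [hev] with s hs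
    exact (H.dsol_x hC hs).1 p hp
  · have k1 := ((hasDerivAt_nb hder p).sub ((hasDerivAt_apply hder p).const_mul 4)).const_mul d
    have k2 := (hasDerivAt_curve (contDiff_D1 H.smooth) (hasDerivAt_apply hv p)
      (hasDerivAt_const x μ)).mul (hasDerivAt_apply hder p)
    have k3 := (k1.add k2).unique ((hasDerivAt_const x (0 : ℝ)).congr_of_eventuallyEq (by
      filter_upwards [hev] with s hs
      exact (H.dsol_x hC hs).2 p hp))
    rw [hv'] at k3
    rw [mul_zero, add_zero] at k3
    linear_combination k3

theorem LocalModel.contDiffAt_red {π : ℝ × ℝ × ℝ} (h : π ∈ dom g a K j μ₀ special) :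
    ContDiffAt ℝ ∞ (red g P C r p₀) π := by
  have h1 : ContDiffAt ℝ ∞ (fun π => nb (sol g P C r π) p₀) π :=
    ((ev ℝ p₀).comp (nbOp ℝ)).contDiff.contDiffAt.comp π (H.contDiffAt_sol hC h)
  have h2 : ContDiffAt ℝ ∞ (fun π : ℝ × ℝ × ℝ => g (π.1, π.2.1)) π :=
    H.smooth.contDiffAt.comp π (by fun_prop)
  exact (ContDiffAt.mul (by fun_prop) (h1.sub (by fun_prop))).add h2

theorem LocalModel.pd1_red
    {x μ d : ℝ} (h : (x, μ, d) ∈ dom g a K j μ₀ special) :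
    pd1 (red g P C r p₀) (x, μ, d)
      = d * (nb (dsol g P C r (1, 0, 0) (x, μ, d)) p₀ - 4) + D1 g (x, μ) := by
  obtain ⟨v, hv, rfl, -, -⟩ := H.dsol_equation hC (c := fun t => (t, μ, d)) h
    (hasDerivAt_line1 x μ d) fun _ => rfl
  refine (IsReduced.hasDerivAt_fst ((H.contDiffAt_red hC h).differentiableAt (by simp))).unique ?_
  have h1 := (((hasDerivAt_nb hv p₀).sub ((hasDerivAt_id x).const_mul 4)).const_mul d).add
    (hasDerivAt_D1 H.smooth x μ)
  rw [mul_one] at h1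
  exact h1

theorem LocalModel.pd2_red
    {x μ d : ℝ} (h : (x, μ, d) ∈ dom g a K j μ₀ special) :
    pd2 (red g P C r p₀) (x, μ, d)
      = d * nb (dsol g P C r (0, 1, 0) (x, μ, d)) p₀ + D2 g (x, μ) := by
  obtain ⟨v, hv, rfl, -, -⟩ := H.dsol_equation hC (c := fun t => (x, t, d)) h
    (hasDerivAt_line2 x μ d) fun _ => rfl
  refine (IsReduced.hasDerivAt_snd ((H.contDiffAt_red hC h).differentiableAt (by simp))).unique ?_
  have h1 := (((hasDerivAt_nb hv p₀).sub (hasDerivAt_const μ (4 * x))).const_mul d).add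
    (hasDerivAt_D2 H.smooth x μ)
  rw [sub_zero] at h1
  exact h1

theorem LocalModel.pd11_red
    {x μ d : ℝ} (h : (x, μ, d) ∈ dom g a K j μ₀ special) {w : LInf ℝ}
    (hw : HasDerivAt (fun t => dsol g P C r (1, 0, 0) (t, μ, d)) w x) :
    pd1 (pd1 (red g P C r p₀)) (x, μ, d) = d * nb w p₀ + D1 (D1 g) (x, μ) := by
  have hev : ∀ᶠ s in 𝓝 x, (s, μ, d) ∈ dom g a K j μ₀ special :=
    (hasDerivAt_line1 x μ d).continuousAt.eventually (H.isOpen_dom.mem_nhds h)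
  have hd : ContDiffAt ℝ ∞ (pd1 (red g P C r p₀)) (x, μ, d) :=
    ((H.contDiffAt_red hC h).fderiv_right (m := ∞) (by simp)).clm_apply contDiffAt_const
  refine (IsReduced.hasDerivAt_fst (hd.differentiableAt (by simp))).unique ?_
  have h1 := (((hasDerivAt_nb hw p₀).sub_const 4).const_mul d).add
    (hasDerivAt_D1 (contDiff_D1 H.smooth) x μ)
  refine h1.congr_of_eventuallyEq ?_
  filter_upwards [hev] with s hs
  exact H.pd1_red hC hs

end Derivatives

end Sol

/-! ### The reduced equation is convex in `x` and decreasing in `μ` -/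

theorem abs_le_of_dominant {C : Set (ℤ × ℤ)} {d δ B : ℝ} (hd : 0 < d) (hδ : 0 < δ)
    {v : LInf ℝ} {c G : ℤ × ℤ → ℝ} (hc : ∀ p ∉ C, c p ≤ -δ)
    (hv : ∀ p ∉ C, d * (nb v p - 4 * v p) + (c p * v p + G p) = 0)
    (hG : ∀ p ∉ C, |G p| ≤ B * -c p) (hC : ∀ p ∈ C, |v p| ≤ B) (p : ℤ × ℤ) : |v p| ≤ B := by
  refine norm_le_of_dominant (C := C) (v := v) (c := c) (g := fun p => -G p) hd hδ hc
    (fun p hp => ?_) (fun p hp => ?_) hC p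
  · have := hv p hp
    change d * nb v p + (c p - 4 * d) * v p = -G p
    linarith
  · rw [norm_neg]; exact hG p hp

theorem abs_nb_sub_le {u : ℤ × ℤ → ℝ} {B : ℝ} (h : ∀ q, |u q| ≤ B) (p : ℤ × ℤ) :
    |nb u p| ≤ 4 * B := by
  have h1 := nb_mono (u := u) (v := fun _ => B) (fun q => (abs_le.1 (h q)).2) p
  have h2 := nb_mono (u := fun _ => -B) (v := u) (fun q => (abs_le.1 (h q)).1) p
  rw [nb_const] at h1 h2
  rw [abs_le]; constructor <;> linarith

section Estimates

variable {g : ℝ × ℝ → ℝ} {um up : ℝ → ℝ} {a K Λ r μ₀ : ℝ} {σ : Site} {P C : Set (ℤ × ℤ)}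
  {p₀ : ℤ × ℤ} {j : ℝ} {special : Prop}

theorem LocalModel.delta_pos {μ : ℝ} (hμ : 0 < μ) : 0 < μ * √μ / 32 := by positivity

theorem LocalModel.mem_Icc_of_inReg (_H : LocalModel g um up a K Λ r μ₀) {μ : ℝ}
    (hμ : μ ∈ Ioo 0 μ₀) {u : ℤ × ℤ → ℝ} (hu : InReg P C r μ u) {p : ℤ × ℤ} (hp : p ∉ P)
    (hp' : p ∉ C) : u p ∈ Icc (-μ) (2 * μ) ∧ |u p| ≤ μ := by
  have := hu.onZ p hp hp'
  have h0 := LocalModel.delta_pos hμ.1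
  have hμ0 := hμ.1
  refine ⟨⟨this.1.le, by linarith [this.2]⟩, ?_⟩
  rw [abs_le]
  exact ⟨this.1.le, by linarith [this.2]⟩

variable (H : LocalModel g um up a K Λ r μ₀)
  (hC : IsConfig σ P C p₀ j special) {x μ d : ℝ} (h : (x, μ, d) ∈ dom g a K j μ₀ special)

include H hC h

/-- The sizes of the parameters, in terms of `q = √μ`. -/
theorem LocalModel.exists_sqrt_dom :
    ∃ q, 0 < q ∧ √μ = q ∧ μ = q ^ 2 ∧ Λ ^ 2 * q ≤ 1 / 10 ^ 6 ∧ Λ * q ≤ 1 / 10 ^ 6 ∧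
      q ≤ 1 / 10 ^ 6 ∧ d ≤ 2 / 7 * q ^ 4 ∧ Λ * μ ≤ 1 / 10 ^ 6 * q ∧ μ ≤ 1 / 10 ^ 6 * q := by
  have hle := H.le_sq_of_dom hC h
  obtain ⟨-, -, hμ, hd, -⟩ := dom_pos h
  have hj := hC.j_pos
  obtain ⟨q, hq, hsq, rfl, hΛ2, hΛ, hq1⟩ := H.exists_sqrt hμ
  refine ⟨q, hq, hsq, rfl, hΛ2, hΛ, hq1, ?_, ?_, ?_⟩
  · have : d ≤ j * d := by nlinarith
    have e : (q ^ 2) ^ 2 = q ^ 4 := by ring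
    rw [e] at hle
    linarith
  · rw [sq, ← mul_assoc]; exact mul_le_mul_of_nonneg_right hΛ hq.le
  · rw [sq]; exact mul_le_mul_of_nonneg_right hq1 hq.le

theorem LocalModel.nb_sol_bounds
    (p : ℤ × ℤ) : loP a K μ * nb (ind ℝ P) p ≤ nb (sol g P C r (x, μ, d)) p ∧
      nb (sol g P C r (x, μ, d)) p
        ≤ hiP a K μ * nb (ind ℝ P) p + 2 * μ * (4 - nb (ind ℝ P) p) ∧
      ∀ p, 0 ≤ sol g P C r (x, μ, d) p := by
  obtain ⟨hs, hb⟩ := H.sol_spec hC h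
  obtain ⟨q, hq, hsq, hqq, -, -, hq1, -, -, hμq⟩ := H.exists_sqrt_dom hC h
  obtain ⟨hx, hx2, hμ, hd, -⟩ := dom_pos h
  obtain ⟨t1, t2, -⟩ := H.bounds_topY hμ
  obtain ⟨-, -, p1, p2, -⟩ := H.bounds_P hμ
  have p2' := abs_le.1 p2
  have hμ0 := hμ.1
  have h8 : 8 * μ ^ 2 ≤ 2 * μ := by nlinarith
  set u := sol g P C r (x, μ, d)
  have key : ∀ p, 0 ≤ u p ∧ loP a K μ * ind ℝ P p ≤ u p ∧
      u p ≤ hiP a K μ * ind ℝ P p + 2 * μ * (1 - ind ℝ P p) := fun p => by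
    by_cases k : p ∈ P
    · have := hb.onP p k
      rw [ind_of_mem k]
      exact ⟨by linarith [this.1], by linarith [this.1], by linarith [this.2]⟩
    have : 0 ≤ u p ∧ u p ≤ 2 * μ := by
      by_cases k2 : p ∈ C
      · rw [hs.1 p k2]; exact ⟨hx.le, hx2.le⟩
      by_cases k3 : p ∈ bdry P C
      · have := hb.onY p k3; exact ⟨this.1, by linarith [this.2]⟩
      · have := hb.onZ p k k2 k3; exact ⟨this.1, by linarith [this.2]⟩
    rw [ind_of_notMem k]
    exact ⟨this.1, by linarith [this.1], by linarith [this.2]⟩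
  refine ⟨?_, ?_, fun p => (key p).1⟩
  · exact (nb_mono (fun q => (key q).2.1) p).trans_eq' (by unfold nb; ring)
  · exact (nb_mono (fun q => (key q).2.2) p).trans_eq (by unfold nb; ring)

/-- The derivative of the solution with respect to the value on the critical orbit is bounded by
one, and it is small at zero sites. -/
theorem LocalModel.abs_dsol_x_le :
    (∀ p, |dsol g P C r (1, 0, 0) (x, μ, d) p| ≤ 1) ∧
      ∀ p ∉ P, p ∉ C → |dsol g P C r (1, 0, 0) (x, μ, d) p| ≤ 37 * √μ := by
  obtain ⟨hs, hb⟩ := H.sol_spec hC h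
  obtain ⟨q, hq, hsq, hqq, -, -, hq1, hdq, -, hμq⟩ := H.exists_sqrt_dom hC h
  obtain ⟨hx, hx2, hμ, hd, -⟩ := dom_pos h
  obtain ⟨e1, e2⟩ := H.dsol_x hC h
  have hr := H.inReg hμ hb
  have hδ := LocalModel.delta_pos hμ.1
  have hle : ∀ p, |dsol g P C r (1, 0, 0) (x, μ, d) p| ≤ 1 := by
    refine abs_le_of_dominant (C := C) (G := fun _ => 0) hd hδ
      (fun p hp => H.D1_le_of_inReg hμ hr hp) (fun p hp => ?_) (fun p hp => ?_) fun p hp => ?_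
    · rw [add_zero]; exact e2 p hp
    · have := H.D1_le_of_inReg hμ hr hp
      rw [abs_zero]; linarith
    · rw [e1 p hp, abs_one]
  refine ⟨hle, fun p hp hp' => ?_⟩
  have h1 := norm_apply_le_of_dominant (𝕜 := ℝ) (v := dsol g P C r (1, 0, 0) (x, μ, d)) (p := p)
    (c := D1 g (sol g P C r (x, μ, d) p, μ)) (g := 0) (B := 1) (G := 0) hd hδ
    (H.D1_le_of_inReg hμ hr hp') (by
      have := e2 p hp'
      simp only [RCLike.ofReal_real_eq_id, id_eq]
      linarith) hle (by simp)
  refine h1.trans ?_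
  rw [div_le_iff₀ hδ, hsq, hqq]
  have e : 37 * q * (q ^ 2 * q / 32) = 37 / 32 * q ^ 4 := by ring
  rw [e]
  nlinarith [pow_pos hq 4]

theorem LocalModel.abs_pd1_red_sub_le :
    |pd1 (red g P C r p₀) (x, μ, d) - D1 g (x, μ)| ≤ 8 * d := by
  obtain ⟨-, -, -, hd, -⟩ := dom_pos h
  have h1 := abs_nb_sub_le (H.abs_dsol_x_le hC h).1 p₀
  have h1' := abs_le.1 h1
  rw [H.pd1_red hC h, add_sub_cancel_right, abs_mul, abs_of_pos hd, mul_comm 8]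
  refine mul_le_mul_of_nonneg_left ?_ hd.le
  rw [abs_le]; constructor <;> linarith

/-- The reduced function is convex in `x`, like `x ^ 2`: the second derivative of the solution is of
order `1 / √μ`, and it enters with the factor `d`. -/
theorem LocalModel.one_le_pd11_red :
    1 ≤ pd1 (pd1 (red g P C r p₀)) (x, μ, d) := by
  obtain ⟨hs, hb⟩ := H.sol_spec hC h
  obtain ⟨q, hq, hsq, hqq, hΛ2, -, hq1, hdq, hΛμ, hμq⟩ := H.exists_sqrt_dom hC h
  obtain ⟨hx, hx2, hμ, hd, -⟩ := dom_pos h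
  obtain ⟨w, hw, e1, e2⟩ := H.dsol_xx hC h
  obtain ⟨v1, v2⟩ := H.abs_dsol_x_le hC h
  have hr := H.inReg hμ hb
  have hδ := LocalModel.delta_pos hμ.1
  have hΛ1 := H.one_le
  have hwle : ∀ p, |w p| ≤ 2 * 10 ^ 5 / q := by
    refine abs_le_of_dominant (C := C) hd hδ (fun p hp => H.D1_le_of_inReg hμ hr hp)
      (fun p hp => by rw [← add_assoc]; exact e2 p hp) (fun p hp => ?_) fun p hp => ?_
    · rw [abs_mul, abs_of_nonneg (sq_nonneg (dsol g P C r (1, 0, 0) (x, μ, d) p))]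
      have hv1 := v1 p
      have hv0 := abs_nonneg (dsol g P C r (1, 0, 0) (x, μ, d) p)
      rw [← sq_abs (dsol g P C r (1, 0, 0) (x, μ, d) p)]
      by_cases hP : p ∈ P
      · have h1 := H.one_d11 μ hμ _ (Ioo_subset_Icc_self (hr.onP p hP))
        have h2 := H.one_d1 μ hμ _ (Ioo_subset_Icc_self (hr.onP p hP))
        calc _ ≤ Λ * 1 := mul_le_mul h1 (by nlinarith) (sq_nonneg _) (by linarith)
          _ ≤ 2 * 10 ^ 5 / q * (1 / Λ) := by
            rw [div_mul_div_comm, le_div_iff₀ (by positivity)]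
            nlinarith
          _ ≤ _ := mul_le_mul_of_nonneg_left (by linarith) (by positivity)
      · have h1 := abs_le.1 (H.d11 μ hμ _ (H.mem_Icc_of_inReg hμ hr hP hp).1)
        have h2 := H.D1_le_of_inReg hμ hr hp
        have h3 := v2 p hP hp
        rw [hsq] at h3
        calc _ ≤ 3 * (37 * q) ^ 2 := by
              refine mul_le_mul (abs_le.2 ⟨by linarith, by linarith⟩) ?_ (sq_nonneg _) (by norm_num)
              exact pow_le_pow_left₀ hv0 h3 2
          _ ≤ 2 * 10 ^ 5 / q * (μ * √μ / 32) := by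
            rw [hsq, hqq]
            have : 2 * 10 ^ 5 / q * (q ^ 2 * q / 32) = 6250 * q ^ 2 := by field_simp; norm_num
            rw [this]; nlinarith [sq_nonneg q]
          _ ≤ _ := mul_le_mul_of_nonneg_left (by linarith) (by positivity)
    · rw [e1 p hp, abs_zero]; positivity
  rw [H.pd11_red hC h hw]
  have h1 := (abs_le.1 (abs_nb_sub_le hwle p₀)).1
  have h2 := (abs_le.1 (H.d11 μ hμ x ⟨by linarith, by linarith⟩)).1
  have h3 : d * (4 * (2 * 10 ^ 5 / q)) ≤ 1 / 2 := by
    calc _ ≤ 2 / 7 * q ^ 4 * (4 * (2 * 10 ^ 5 / q)) :=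
          mul_le_mul_of_nonneg_right hdq (by positivity)
      _ = 16 / 7 * 10 ^ 5 * q * q * q := by field_simp; norm_num
      _ ≤ 16 / 7 * 10 ^ 5 * (1 / 10 ^ 6) * (1 / 10 ^ 6) * (1 / 10 ^ 6) := by gcongr
      _ ≤ _ := by norm_num
  have h4 := mul_le_mul_of_nonneg_left h1 hd.le
  linarith

/-- The derivative of the solution with respect to `μ`. -/
theorem LocalModel.abs_dsol_μ_le
    (p : ℤ × ℤ) : |dsol g P C r (0, 1, 0) (x, μ, d) p| ≤ 33 / √μ := by
  obtain ⟨hs, hb⟩ := H.sol_spec hC h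
  obtain ⟨q, hq, hsq, hqq, hΛ2, hΛ, hq1, hdq, hΛμ, hμq⟩ := H.exists_sqrt_dom hC h
  obtain ⟨hx, hx2, hμ, hd, -⟩ := dom_pos h
  obtain ⟨e1, e2⟩ := H.dsol_μ hC h
  have hr := H.inReg hμ hb
  have hδ := LocalModel.delta_pos hμ.1
  have hΛ1 := H.one_le
  have hμ0 := hμ.1
  rw [hsq]
  refine abs_le_of_dominant (C := C) hd hδ (fun p hp => H.D1_le_of_inReg hμ hr hp) e2
    (fun p hp => ?_) (fun p hp => ?_) p
  · by_cases hP : p ∈ P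
    · have h1 := H.one_d2 μ hμ _ (Ioo_subset_Icc_self (hr.onP p hP))
      have h2 := H.one_d1 μ hμ _ (Ioo_subset_Icc_self (hr.onP p hP))
      calc _ ≤ Λ := h1
        _ ≤ 33 / q * (1 / Λ) := by
          rw [div_mul_div_comm, le_div_iff₀ (by positivity)]
          nlinarith
        _ ≤ _ := mul_le_mul_of_nonneg_left (by linarith) (by positivity)
    · obtain ⟨m1, m2⟩ := H.mem_Icc_of_inReg hμ hr hP hp
      have h1 := abs_le.1 (H.d2 μ hμ _ m1)
      have h2 := H.D1_le_of_inReg hμ hr hp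
      have h3 : Λ * μ * |sol g P C r (x, μ, d) p| ≤ 1 / 100 * μ :=
        mul_le_mul (by linarith) m2 (abs_nonneg _) (by norm_num)
      have m2' := abs_le.1 m2
      calc _ ≤ 101 / 100 * μ := abs_le.2 ⟨by linarith, by linarith⟩
        _ ≤ 33 / q * (μ * √μ / 32) := by
          rw [hsq]
          have : 33 / q * (μ * q / 32) = 33 / 32 * μ := by field_simp
          rw [this]; linarith
        _ ≤ _ := mul_le_mul_of_nonneg_left (by linarith) (by positivity)
  · rw [e1 p hp, abs_zero]; positivity

/-- The leading terms of the reduced function. -/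
theorem LocalModel.abs_nb_sol_sub_le :
    |red g P C r p₀ (x, μ, d) - j * d - g (x, μ)| ≤ 20 * Λ * μ * d := by
  obtain ⟨q, hq, hsq, hqq, hΛ2, hΛ, hq1, hdq, hΛμ, hμq⟩ := H.exists_sqrt_dom hC h
  obtain ⟨hx, hx2, hμ, hd, -⟩ := dom_pos h
  obtain ⟨n1, n2, -⟩ := H.nb_sol_bounds hC h p₀
  rw [hC.nb_C p₀ hC.mem] at n1 n2
  have hj := hC.j_pos
  have hΛ1 := H.one_le
  have hμ0 := hμ.1
  have e : red g P C r p₀ (x, μ, d) - j * d - g (x, μ)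
      = d * (nb (sol g P C r (x, μ, d)) p₀ - 4 * x - j) := by unfold red; ring
  rw [e, abs_mul, abs_of_pos hd, mul_comm]
  refine mul_le_mul_of_nonneg_right ?_ hd.le
  have h1 : |a * μ| ≤ Λ * μ := by
    rw [abs_mul, abs_of_pos hμ0]; exact mul_le_mul_of_nonneg_right H.a_le hμ0.le
  have h1' := abs_le.1 h1
  have h2 : K * μ ^ 2 ≤ Λ * μ := by
    have : K * μ ≤ Λ * 1 := mul_le_mul H.K_le (by linarith) hμ0.le (by linarith)
    nlinarith
  have h0 : 0 ≤ K * μ ^ 2 := mul_nonneg H.K_nonneg (sq_nonneg μ)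
  have h3 : μ ≤ Λ * μ := by nlinarith
  unfold loP at n1
  unfold hiP at n2
  have h4 : -(4 * (Λ * μ)) ≤ (a * μ - K * μ ^ 2) * j := by nlinarith
  have h5 : (a * μ + K * μ ^ 2) * j ≤ 4 * (Λ * μ) := by nlinarith
  rw [abs_le]
  constructor <;> nlinarith

/-- The reduced function is positive if the value on the critical orbit is very small. -/
theorem LocalModel.red_pos_of_small
    (hxd : 3 * μ * x ≤ d) : 0 < red g P C r p₀ (x, μ, d) := by
  obtain ⟨q, hq, hsq, hqq, hΛ2, hΛ, hq1, hdq, hΛμ, hμq⟩ := H.exists_sqrt_dom hC h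
  have h1 := (abs_le.1 (H.abs_nb_sol_sub_le hC h)).1
  obtain ⟨hx, hx2, hμ, hd, -⟩ := dom_pos h
  have hμ0 := hμ.1
  have h2 := (abs_le.1 (H.val μ hμ x ⟨by linarith, hx2.le⟩)).1
  rw [abs_of_pos hx] at h2
  have hj := hC.j_pos
  have h3 : 20 * Λ * μ * d ≤ 1 / 100 * d := mul_le_mul_of_nonneg_right (by linarith) hd.le
  have h4 : d ≤ j * d := by nlinarith
  have h5 : Λ * μ ^ 2 * x ≤ 1 / 100 * d := by
    have : Λ * μ ^ 2 * x = Λ * μ * (μ * x) := by ring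
    rw [this]
    have : 0 < μ * x := by positivity
    nlinarith
  nlinarith [sq_nonneg x]

theorem LocalModel.red_pos_of_large
    (hxμ : 8 / 5 * μ ≤ x) : 0 < red g P C r p₀ (x, μ, d) := by
  obtain ⟨q, hq, hsq, hqq, hΛ2, hΛ, hq1, hdq, hΛμ, hμq⟩ := H.exists_sqrt_dom hC h
  obtain ⟨-, -, n0⟩ := H.nb_sol_bounds hC h p₀
  have n1 := nb_nonneg n0 p₀
  obtain ⟨hx, hx2, hμ, hd, -⟩ := dom_pos h
  have hμ0 := hμ.1
  have h2 := (abs_le.1 (H.val μ hμ x ⟨by linarith, hx2.le⟩)).1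
  rw [abs_of_pos hx] at h2
  have h3 : 0 ≤ d * nb (sol g P C r (x, μ, d)) p₀ := mul_nonneg hd.le n1
  have h4 : d ≤ 1 / 100 * μ := by nlinarith
  have h5 : Λ * μ ^ 2 * x ≤ 1 / 100 * μ * x := by
    refine mul_le_mul_of_nonneg_right ?_ hx.le
    nlinarith
  unfold red
  nlinarith

/-- The reduced function decreases in `μ` through its zeros, since `d < 3 μ x` there. -/
theorem LocalModel.pd2_red_le
    (h0 : red g P C r p₀ (x, μ, d) = 0) : pd2 (red g P C r p₀) (x, μ, d) ≤ -(4 / 5 * x) := by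
  obtain ⟨q, hq, hsq, hqq, hΛ2, hΛ, hq1, hdq, hΛμ, hμq⟩ := H.exists_sqrt_dom hC h
  have hle : d < 3 * μ * x := by
    by_contra! hlt
    exact absurd h0 (H.red_pos_of_small hC h hlt).ne'
  obtain ⟨hx, hx2, hμ, hd, -⟩ := dom_pos h
  have h2 := (abs_le.1 (H.d2 μ hμ x ⟨by linarith, hx2.le⟩)).2
  rw [abs_of_pos hx] at h2
  have h3 := (abs_le.1 (abs_nb_sub_le (H.abs_dsol_μ_le hC h) p₀)).2
  rw [hsq] at h3
  have h4 : d * (4 * (33 / q)) ≤ 1 / 100 * x := by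
    calc d * (4 * (33 / q)) ≤ 3 * μ * x * (4 * (33 / q)) :=
          mul_le_mul_of_nonneg_right hle.le (by positivity)
      _ = 396 * q * x := by rw [hqq]; field_simp; norm_num
      _ ≤ _ := mul_le_mul_of_nonneg_right (by linarith) hx.le
  have h5 := mul_le_mul_of_nonneg_left h3 hd.le
  have h6 : Λ * μ * x ≤ 1 / 100 * x := mul_le_mul_of_nonneg_right (by linarith) hx.le
  rw [H.pd2_red hC h]
  linarith

/-- At zeros of the reduced function where the nonlinearity is nearly critical, `μ` is close to
`2 √(j d)`. -/
theorem LocalModel.abs_sub_sqrt_le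
    (h0 : red g P C r p₀ (x, μ, d) = 0) (hcr : |D1 g (x, μ)| ≤ 96 * d) :
    |μ - 2 * √(j * d)| ≤ 3000 * Λ * d := by
  obtain ⟨q, hq, hsq, hqq, hΛ2, hΛ, hq1, hdq, hΛμ, hμq⟩ := H.exists_sqrt_dom hC h
  have h1 := abs_le.1 (H.abs_nb_sol_sub_le hC h)
  rw [h0] at h1
  have hle := H.le_sq_of_dom hC h
  obtain ⟨hx, hx2, hμ, hd, -⟩ := dom_pos h
  have hμ0 := hμ.1
  have hj := hC.j_pos
  have hΛ1 := H.one_le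
  have h2 := abs_le.1 (H.val μ hμ x ⟨by linarith, hx2.le⟩)
  rw [abs_of_pos hx] at h2
  have h3 := abs_le.1 (H.d1 μ hμ x ⟨by linarith, hx2.le⟩)
  have hcr' := abs_le.1 hcr
  have hdμ : d ≤ 2 / 7 * μ ^ 2 := by nlinarith
  have h4 : |2 * x - μ| ≤ 100 * Λ * μ ^ 2 := by
    have := le_mul_of_one_le_left (sq_nonneg μ) hΛ1
    rw [abs_le]; constructor <;> linarith
  have h5 : (2 * x - μ) ^ 2 ≤ μ ^ 3 := by
    rw [← sq_abs]
    calc |2 * x - μ| ^ 2 ≤ (100 * Λ * μ ^ 2) ^ 2 := pow_le_pow_left₀ (abs_nonneg _) h4 2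
      _ = 10000 * (Λ * μ) * (Λ * μ) * μ ^ 2 := by ring
      _ ≤ 10000 * (1 / 10 ^ 6 * q) * (1 / 10 ^ 6 * q) * μ ^ 2 := by
        have : 0 ≤ Λ * μ := by positivity
        gcongr
      _ = 10000 / 10 ^ 12 * (μ * μ ^ 2) := by rw [hqq]; ring
      _ ≤ μ ^ 3 := by have := pow_pos hμ0 3; nlinarith
  have h6 : Λ * μ ^ 2 * x ≤ 2 * Λ * μ ^ 3 := by
    calc Λ * μ ^ 2 * x ≤ Λ * μ ^ 2 * (2 * μ) := mul_le_mul_of_nonneg_left hx2.le (by positivity)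
      _ = _ := by ring
  have h7 : 20 * Λ * μ * d ≤ 6 * Λ * μ ^ 3 := by
    calc 20 * Λ * μ * d ≤ 20 * Λ * μ * (2 / 7 * μ ^ 2) :=
          mul_le_mul_of_nonneg_left hdμ (by positivity)
      _ = 40 / 7 * (Λ * μ ^ 3) := by ring
      _ ≤ 6 * (Λ * μ ^ 3) := mul_le_mul_of_nonneg_right (by norm_num) (by positivity)
      _ = _ := by ring
  have h8 : |μ ^ 2 - 4 * (j * d)| ≤ 33 * Λ * μ ^ 3 := by
    have := le_mul_of_one_le_left (pow_pos hμ0 3).le hΛ1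
    have e : x ^ 2 - μ * x = (2 * x - μ) ^ 2 / 4 - μ ^ 2 / 4 := by ring
    rw [e] at h2
    have h0 := sq_nonneg (2 * x - μ)
    generalize (2 * x - μ) ^ 2 = S at h2 h5 h0
    rw [abs_le]
    constructor <;> linarith [h1.1, h1.2, h2.1, h2.2]
  have hjd : 0 < j * d := by nlinarith
  set s := √(j * d) with hs
  have hs0 : 0 < s := Real.sqrt_pos.2 hjd
  have hs2 : j * d = s ^ 2 := (Real.sq_sqrt hjd.le).symm
  have h9 : |μ - 2 * s| * μ ≤ 33 * Λ * μ ^ 3 := by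
    calc |μ - 2 * s| * μ ≤ |μ - 2 * s| * (μ + 2 * s) :=
          mul_le_mul_of_nonneg_left (by linarith) (abs_nonneg _)
      _ = |μ ^ 2 - 4 * (j * d)| := by
        rw [hs2, ← abs_of_pos (show 0 < μ + 2 * s by linarith), ← abs_mul]
        congr 1; ring
      _ ≤ _ := h8
  have h10 : |μ - 2 * s| ≤ 33 * Λ * μ ^ 2 := by
    refine le_of_mul_le_mul_right (h9.trans_eq ?_) hμ0
    ring
  have h11 : μ ^ 2 ≤ 20 * d := by
    have h12 : 33 * Λ * μ ^ 3 ≤ 1 / 10 * μ ^ 2 := by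
      have : 33 * Λ * μ ^ 3 = 33 * (Λ * μ) * μ ^ 2 := by ring
      rw [this]
      exact mul_le_mul_of_nonneg_right (by linarith) (sq_nonneg μ)
    have h13 := (abs_le.1 h8).2
    have h14 : j * d ≤ 2 * d := mul_le_mul_of_nonneg_right hj.2 hd.le
    linarith
  calc |μ - 2 * s| ≤ 33 * Λ * μ ^ 2 := h10
    _ ≤ 33 * Λ * (20 * d) := mul_le_mul_of_nonneg_left h11 (by positivity)
    _ ≤ _ := by
      have : 0 < Λ * d := by positivity
      linarith

end Estimates

/-! ### The domain of the reduced equation -/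

section Domain

variable {g : ℝ × ℝ → ℝ} {um up : ℝ → ℝ} {a K Λ r μ₀ : ℝ} {σ : Site} {P C : Set (ℤ × ℤ)}
  {p₀ : ℤ × ℤ} {j : ℝ} {special : Prop}

theorem hasDerivAt_topY {μ : ℝ} (hμ : 0 < μ) : HasDerivAt topY (1 / 2 - 3 / 32 * √μ) μ := by
  have h1 : HasDerivAt (fun t : ℝ => t / 2 - t * √t / 16) _ μ :=
    ((hasDerivAt_id μ).div_const 2).sub
      (((hasDerivAt_id μ).mul (Real.hasDerivAt_sqrt hμ.ne')).div_const 16)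
  refine h1.congr_deriv ?_
  have h3 : μ = √μ ^ 2 := (Real.sq_sqrt hμ.le).symm
  have h4 : id μ * (1 / (2 * √μ)) = √μ / 2 := by
    rw [id]; nth_rewrite 1 [h3]; field_simp
  rw [h4]; ring

theorem gap_mono {x x' μ d : ℝ} (hd : 0 < d) (hx : x' ≤ x) :
    gap g a K j special (x', μ, d) ≤ gap g a K j special (x, μ, d) := by
  by_cases hs : special
  · rw [gap_special hs, gap_special hs]
    have := mul_le_mul_of_nonneg_left hx hd.le
    linarith
  · rw [gap_ordinary hs, gap_ordinary hs]

variable (H : LocalModel g um up a K Λ r μ₀)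
  (hC : IsConfig σ P C p₀ j special)

include H hC

theorem LocalModel.gap_anti {x μ μ' d : ℝ} (h : (x, μ, d) ∈ dom g a K j μ₀ special)
    (hμ' : μ' ∈ Ico μ μ₀) : gap g a K j special (x, μ', d) ≤ gap g a K j special (x, μ, d) := by
  have hle := H.le_sq_of_dom hC h
  obtain ⟨hx, hx2, hμ, hd, -⟩ := dom_pos h
  have hμ0 := hμ.1
  have hj := hC.j_pos
  by_cases hs : special
  swap
  · rw [gap_ordinary hs, gap_ordinary hs]
    have := hμ'.1
    nlinarith
  have hdμ : d ≤ 2 / 7 * μ ^ 2 := by nlinarith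
  have hder : ∀ ν ∈ Icc μ μ', HasDerivAt (fun ν => gap g a K j special (x, ν, d))
      (d * (a + 2 * K * ν + 32 * ν - 4 * (1 / 2 - 3 / 32 * √ν))
        + (D1 g (topY ν, ν) * (1 / 2 - 3 / 32 * √ν) + D2 g (topY ν, ν) * 1)) ν := fun ν hν => by
    have h0 : 0 < ν := hμ0.trans_le hν.1
    have h1 := hasDerivAt_topY h0
    have h2 := hasDerivAt_curve H.smooth h1 (hasDerivAt_id ν)
    have k0 : HasDerivAt (fun ν : ℝ => ν ^ 2) (2 * ν) ν := by simpa using hasDerivAt_pow 2 ν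
    have k1 : HasDerivAt (hiP a K) (a * 1 + K * (2 * ν)) ν :=
      (((hasDerivAt_id ν).const_mul a).const_add 1).add (k0.const_mul K)
    have h4 := ((((k1.add_const x).add (k0.const_mul 16)).sub (h1.const_mul 4)).const_mul d).add h2
    refine (h4.congr_of_eventuallyEq (Eventually.of_forall fun t => ?_)).congr_deriv ?_
    · exact gap_special hs x t d
    · simp only [id]; ring
  have hanti : AntitoneOn (fun ν => gap g a K j special (x, ν, d)) (Icc μ μ') := by
    refine antitoneOn_of_deriv_nonpos (convex_Icc μ μ')
      (fun ν hν => (hder ν hν).continuousAt.continuousWithinAt)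
      (fun ν hν => (hder ν (interior_subset hν)).differentiableAt.differentiableWithinAt)
      fun ν hν => ?_
    rw [(hder ν (interior_subset hν)).deriv]
    have hν' := interior_subset hν
    have hνI : ν ∈ Ioo 0 μ₀ := ⟨hμ0.trans_le hν'.1, hν'.2.trans_lt hμ'.2⟩
    have hν0 := hνI.1
    obtain ⟨q, hq, hsq, hqq, -, hΛ, hq1⟩ := H.exists_sqrt hνI
    obtain ⟨t1, t2, -⟩ := H.bounds_topY hνI
    have hpos : 0 < ν * √ν := by rw [hsq]; positivity
    have h1 : D1 g (topY ν, ν) ≤ 0 := by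
      have := H.D1_le hνI (t := topY ν) ⟨by linarith, by rw [topY]; linarith⟩
      linarith
    have h2 := (abs_le.1 (H.d2 ν hνI (topY ν) ⟨by linarith, by linarith⟩)).2
    rw [abs_of_nonneg (by linarith)] at h2
    have hΛν := H.mul_le hνI
    have hΛ1 := H.one_le
    have h3 : Λ * ν * topY ν ≤ 1 / 10 ^ 6 * topY ν :=
      mul_le_mul_of_nonneg_right hΛν (by linarith)
    have h4 : a + 2 * K * ν + 32 * ν - 4 * (1 / 2 - 3 / 32 * √ν) ≤ 40 * Λ := by
      have := (abs_le.1 H.a_le).2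
      have hν1 : ν ≤ 1 := by nlinarith
      have : K * ν ≤ Λ * 1 := mul_le_mul H.K_le hν1 hν0.le (by linarith)
      rw [hsq]; linarith
    have h5 : d * (a + 2 * K * ν + 32 * ν - 4 * (1 / 2 - 3 / 32 * √ν)) ≤ 1 / 100 * ν := by
      calc _ ≤ d * (40 * Λ) := mul_le_mul_of_nonneg_left h4 hd.le
        _ ≤ ν ^ 2 * (40 * Λ) := by
          refine mul_le_mul_of_nonneg_right ?_ (by linarith)
          nlinarith [hν'.1]
        _ = 40 * (Λ * ν) * ν := by ring
        _ ≤ _ := mul_le_mul_of_nonneg_right (by linarith) hν0.le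
    have h6 : D1 g (topY ν, ν) * (1 / 2 - 3 / 32 * √ν) ≤ 0 := by
      refine mul_nonpos_of_nonpos_of_nonneg h1 ?_
      rw [hsq]; linarith
    linarith
  exact hanti ⟨le_rfl, hμ'.1⟩ ⟨hμ'.1, le_rfl⟩ hμ'.1

set_option maxHeartbeats 1600000 in
/-- The reduced function is positive where the gap condition is about to fail. In the special case
the noncritical sites next to `P` are then close to a fold themselves, and their values lift the
reduced function. -/
theorem LocalModel.red_pos_of_gap {x μ d : ℝ} (h : (x, μ, d) ∈ dom g a K j μ₀ special)
    (hG : -d ^ 2 ≤ gap g a K j special (x, μ, d)) : 0 < red g P C r p₀ (x, μ, d) := by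
  obtain ⟨q, hq, hsq, hqq, hΛ2, hΛ, hq1, hdq, hΛμ, hμq⟩ := H.exists_sqrt_dom hC h
  have h1 := (abs_le.1 (H.abs_nb_sol_sub_le hC h)).1
  obtain ⟨hs, hb⟩ := H.sol_spec hC h
  obtain ⟨nb1, nb2, nb0⟩ := H.nb_sol_bounds hC h p₀
  obtain ⟨hx, hx2, hμ, hd, -⟩ := dom_pos h
  have hμ0 := hμ.1
  have hj := hC.j_pos
  have hμs : μ ≤ 1 / 10 ^ 12 := by linarith
  have hdμ : d ≤ 2 / 7 * μ ^ 2 := by nlinarith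
  have hd2 : d ^ 2 ≤ 1 / 10 ^ 6 * d := by
    rw [sq]
    exact mul_le_mul_of_nonneg_right (hdμ.trans (by nlinarith)) hd.le
  have hΛ1 := H.one_le
  by_cases hsp : special
  swap
  · rw [gap_ordinary hsp] at hG
    have h2 := (abs_le.1 (H.val μ hμ x ⟨by linarith, hx2.le⟩)).1
    rw [abs_of_pos hx] at h2
    have h3 : 20 * Λ * μ * d ≤ 1 / 10 ^ 6 * d := mul_le_mul_of_nonneg_right (by linarith) hd.le
    have h4 : Λ * μ ^ 2 * x ≤ 1 / 10 ^ 6 * μ ^ 2 := by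
      calc Λ * μ ^ 2 * x = Λ * x * μ ^ 2 := by ring
        _ ≤ _ := mul_le_mul_of_nonneg_right (by nlinarith) (sq_nonneg μ)
    have h5 : x ^ 2 - μ * x ≥ -(μ ^ 2 / 4) := by nlinarith [sq_nonneg (x - μ / 2)]
    have h6 : d ≤ j * d := by nlinarith
    have h7 : 0 < μ ^ 2 := by positivity
    linarith
  rw [gap_special hsp] at hG
  have hj1 := hC.special_j hsp
  obtain ⟨-, -, p1, p2, p3⟩ := H.bounds_P hμ
  obtain ⟨t1, t2, t3⟩ := H.bounds_topY hμ
  have p2' := abs_le.1 p2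
  have p3' := abs_le.1 p3
  have t3' := abs_le.1 t3
  have h7 : 0 < μ ^ 2 := by positivity
  set u := sol g P C r (x, μ, d) with hu
  set b := topY μ with hbdef
  -- the gap condition bounds `d` from below
  have hdl : 248 / 1000 * μ ^ 2 ≤ d := by
    have : d * (hiP a K μ + x + 16 * μ ^ 2 - 4 * b) ≤ d * (10001 / 10000) :=
      mul_le_mul_of_nonneg_left (by nlinarith) hd.le
    linarith
  -- a noncritical site next to `P` cannot be much smaller than the fold value
  have hY : ∀ p ∈ bdry P C, 2 / 5 * μ ≤ u p := fun p hp => by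
    by_contra! hlt
    have e := hs.2 p hp.2.1
    have hup := (hb.onY p hp).1
    have hn := (H.nb_sol_bounds hC h p).1
    rw [(hC.nb_Z p hp.1 hp.2.1).resolve_left hp.2.2, mul_one] at hn
    have h8 := (abs_le.1 (H.val μ hμ (u p) ⟨by linarith, by linarith⟩)).1
    rw [abs_of_nonneg hup] at h8
    have h9 : Λ * μ ^ 2 * u p ≤ 1 / 10 ^ 6 * μ ^ 2 := by
      calc Λ * μ ^ 2 * u p = Λ * u p * μ ^ 2 := by ring
        _ ≤ _ := mul_le_mul_of_nonneg_right (by nlinarith) (sq_nonneg μ)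
    have h10 : u p ^ 2 - μ * u p ≥ -(24 / 100 * μ ^ 2) := by
      have := mul_nonneg (sub_nonneg.2 hlt.le) (show 0 ≤ 3 / 5 * μ - u p by linarith)
      linarith
    have h11 : d * (9999 / 10000) ≤ d * (nb u p - 4 * u p) :=
      mul_le_mul_of_nonneg_left (by linarith) hd.le
    linarith
  have hnb : loP a K μ + 2 * min x (2 / 5 * μ) ≤ nb u p₀ := by
    have key : ∀ p, loP a K μ * ind ℝ P p
        + min x (2 / 5 * μ) * (ind ℝ C p + ind ℝ (bdry P C) p) ≤ u p := fun p => by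
      by_cases k : p ∈ P
      · rw [ind_of_mem k, ind_of_notMem (hC.disj p k), ind_of_notMem fun h : p ∈ bdry P C => h.1 k]
        linarith [(hb.onP p k).1]
      rw [ind_of_notMem k]
      by_cases k2 : p ∈ C
      · rw [ind_of_mem k2, ind_of_notMem fun h : p ∈ bdry P C => h.2.1 k2, hs.1 p k2]
        linarith [min_le_left x (2 / 5 * μ)]
      rw [ind_of_notMem k2]
      by_cases k3 : p ∈ bdry P C
      · rw [ind_of_mem k3]
        linarith [hY p k3, min_le_right x (2 / 5 * μ)]
      · rw [ind_of_notMem k3]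
        linarith [nb0 p]
    have h8 := nb_mono key p₀
    have h9 := hC.special_C hsp
    have h10 := hC.nb_C p₀ hC.mem
    rw [hj1] at h10
    have e : nb (fun p => loP a K μ * ind ℝ P p
        + min x (2 / 5 * μ) * (ind ℝ C p + ind ℝ (bdry P C) p)) p₀
        = loP a K μ * nb (ind ℝ P) p₀
        + min x (2 / 5 * μ) * (nb (ind ℝ C) p₀ + nb (ind ℝ (bdry P C)) p₀) := by unfold nb; ring
    rw [e, h9, h10] at h8
    linarith
  -- compare the nonlinearity at `x` with its value at the fold
  have hφ := abs_sub_le_of_hasDerivAt (φ := fun t => g (t, μ) - (t ^ 2 - μ * t)) (a := b) (b := x)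
    (C := Λ * μ ^ 2) (φ' := fun t => D1 g (t, μ) - (2 * t - μ)) (fun t _ => by
      refine (hasDerivAt_D1 H.smooth t μ).sub ?_
      have := ((hasDerivAt_id t).pow 2).sub ((hasDerivAt_id t).const_mul μ)
      refine this.congr_deriv ?_
      simp only [id]; ring) (fun t ht => H.d1 μ hμ t (by
      refine uIcc_subset_Icc ⟨?_, ?_⟩ ⟨?_, ?_⟩ ht <;> linarith))
  have hφ' := (abs_le.1 hφ).1
  have hbq : b = μ / 2 - μ * q / 16 := by rw [hbdef, topY, hsq]
  set y := x - b with hy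
  have hx' : x = b + y := by rw [hy]; ring
  have hΛy : Λ * μ ^ 2 * |y| ≤ 1 / 10 ^ 6 * (μ * q) * |y| := by
    refine mul_le_mul_of_nonneg_right ?_ (abs_nonneg _)
    nlinarith
  have hy2 : |y| ^ 2 = y ^ 2 := sq_abs y
  have hgx : y ^ 2 - 1 / 7 * (μ * q) * |y| ≤ g (x, μ) - g (b, μ) := by
    have h8 : x ^ 2 - μ * x - (b ^ 2 - μ * b) = y ^ 2 - (μ * q) / 8 * y := by
      rw [hx', hbq]; ring
    have h9 : (μ * q) / 8 * y ≤ (μ * q) / 8 * |y| :=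
      mul_le_mul_of_nonneg_left (le_abs_self y) (by positivity)
    have h10 : 0 ≤ μ * q * |y| := by positivity
    linarith
  have hyoung : 1 / 7 * (μ * q) * |y| ≤ 1 / 2 * y ^ 2 + 1 / 98 * μ ^ 3 := by
    have : μ ^ 3 = (μ * q) ^ 2 := by rw [hqq]; ring
    rw [this, ← hy2]
    nlinarith [sq_nonneg (|y| - 1 / 7 * (μ * q))]
  have hμ3 : 0 < μ ^ 3 := by positivity
  have hdn : d * (29 / 100 * μ - 5 * |y|) ≤ d * (nb u p₀ - 4 * x
      - (hiP a K μ + x + 16 * μ ^ 2 - 4 * b) + 2 * K * μ ^ 2 + 16 * μ ^ 2) := by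
    refine mul_le_mul_of_nonneg_left ?_ hd.le
    have e : hiP a K μ = loP a K μ + 2 * K * μ ^ 2 := by unfold hiP loP; ring
    rw [e]
    rcases le_total x (2 / 5 * μ) with hm | hm
    · rw [min_eq_left hm] at hnb
      have : -y ≤ |y| := neg_le_abs y
      have : y ≤ 0 := by linarith
      linarith [abs_nonneg y]
    · rw [min_eq_right hm] at hnb
      have : y ≤ |y| := le_abs_self y
      linarith
  have hsmall : d * (2 * K * μ ^ 2 + 16 * μ ^ 2) ≤ 1 / 1000 * μ ^ 3 := by
    have h8 : 2 * K * μ ^ 2 + 16 * μ ^ 2 ≤ 18 * Λ * μ ^ 2 := by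
      have := H.K_le
      nlinarith
    calc _ ≤ 2 / 7 * μ ^ 2 * (18 * Λ * μ ^ 2) :=
          mul_le_mul hdμ h8 (by have := H.K_nonneg; positivity) (by positivity)
      _ = 36 / 7 * (Λ * μ) * μ ^ 3 := by ring
      _ ≤ _ := mul_le_mul_of_nonneg_right (by linarith) hμ3.le
  have hdy : 5 * (d * |y|) ≤ 1 / 2 * y ^ 2 + 1 / 1000 * μ ^ 3 := by
    have h8 : d * |y| ≤ 2 / 7 * μ ^ 2 * |y| := mul_le_mul_of_nonneg_right hdμ (abs_nonneg _)
    have h9 : μ ^ 4 ≤ 1 / 10 ^ 6 * μ ^ 3 := by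
      have : μ ^ 4 = μ * μ ^ 3 := by ring
      rw [this]; exact mul_le_mul_of_nonneg_right (by linarith) hμ3.le
    have h10 : 0 ≤ (|y| - 10 / 7 * μ ^ 2) ^ 2 := sq_nonneg _
    have h11 : (|y| - 10 / 7 * μ ^ 2) ^ 2 = y ^ 2 - 20 / 7 * μ ^ 2 * |y| + 100 / 49 * μ ^ 4 := by
      rw [← hy2]; ring
    rw [h11] at h10
    linarith
  have hdμ3 : 248 / 1000 * μ ^ 3 ≤ d * μ := by
    calc 248 / 1000 * μ ^ 3 = 248 / 1000 * μ ^ 2 * μ := by ring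
      _ ≤ _ := mul_le_mul_of_nonneg_right hdl hμ0.le
  have hd3 : d ^ 2 ≤ 1 / 1000 * μ ^ 3 := by
    calc d ^ 2 ≤ (2 / 7 * μ ^ 2) ^ 2 := pow_le_pow_left₀ hd.le hdμ 2
      _ = 4 / 49 * μ * μ ^ 3 := by ring
      _ ≤ _ := mul_le_mul_of_nonneg_right (by linarith) hμ3.le
  have hred : red g P C r p₀ (x, μ, d) = d * (nb u p₀ - 4 * x) + g (x, μ) := rfl
  rw [hred]
  linarith

/-- On a path in the parameter region along which the gap condition fails at the end, the reduced
function is positive somewhere before that. -/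
theorem LocalModel.exists_red_pos {c : ℝ → ℝ × ℝ} (hc : Continuous c) {s t d : ℝ} (hst : s ≤ t)
    (h : ∀ τ ∈ Icc s t, 0 < (c τ).1 ∧ (c τ).1 < 2 * (c τ).2 ∧ (c τ).2 < μ₀) (hd : 0 < d)
    (hs : gap g a K j special ((c s).1, (c s).2, d) < 0)
    (ht : 0 ≤ gap g a K j special ((c t).1, (c t).2, d)) :
    ∃ τ ∈ Icc s t, ((c τ).1, (c τ).2, d) ∈ dom g a K j μ₀ special ∧
      0 < red g P C r p₀ ((c τ).1, (c τ).2, d) := by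
  have hd2 : -d ^ 2 < 0 := by have := pow_pos hd 2; linarith
  have hcont : Continuous fun τ => gap g a K j special ((c τ).1, (c τ).2, d) :=
    (continuous_gap H.smooth.continuous).comp (by fun_prop)
  obtain ⟨τ, hτ, e⟩ := intermediate_value_Icc hst hcont.continuousOn
    (show max (gap g a K j special ((c s).1, (c s).2, d)) (-d ^ 2) ∈ _ from
      ⟨le_max_left _ _, (max_le hs.le hd2.le).trans ht⟩)
  simp only at e
  obtain ⟨h1, h2, h3⟩ := h τ hτ
  have hmem : ((c τ).1, (c τ).2, d) ∈ dom g a K j μ₀ special :=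
    ⟨h1, h2, h3, hd, by rw [e]; exact max_lt hs hd2⟩
  exact ⟨τ, hτ, hmem, H.red_pos_of_gap hC hmem (by rw [e]; exact le_max_right _ _)⟩

/-- The reduced function satisfies the assumptions on a scalar equation with a fold. -/
theorem LocalModel.isReduced :
    IsReduced (dom g a K j μ₀ special) (red g P C r p₀) μ₀ where
  isOpen := H.isOpen_dom
  smooth := fun _ h => (H.contDiffAt_red hC h).contDiffWithinAt
  lt_μ₀ := fun _ _ _ h => (dom_pos h).2.2.1.2
  down := fun x μ d h x' hx' => by
    obtain ⟨hx, hx2, hμ, hd, hG⟩ := dom_pos h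
    exact ⟨hx'.1, hx'.2.trans_lt hx2, hμ.2, hd, (gap_mono hd hx'.2).trans_lt hG⟩
  up := fun x μ d h μ' hμ' => by
    have := H.gap_anti hC h hμ'
    obtain ⟨hx, hx2, hμ, hd, hG⟩ := dom_pos h
    exact ⟨hx, hx2.trans_le (mul_le_mul_of_nonneg_left hμ'.1 zero_le_two), hμ'.2, hd,
      this.trans_lt hG⟩
  escape_left := fun x μ d h => by
    obtain ⟨hx, hx2, hμ, hd, hG⟩ := dom_pos h
    have hμ0 := hμ.1
    have hle : min x (d / (3 * μ)) ≤ x := min_le_left _ _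
    have hpos : 0 < min x (d / (3 * μ)) := lt_min hx (by positivity)
    refine ⟨_, ⟨hpos, hle⟩, H.red_pos_of_small hC ⟨hpos, hle.trans_lt hx2, hμ.2, hd,
      (gap_mono hd hle).trans_lt hG⟩ ?_⟩
    have : min x (d / (3 * μ)) ≤ d / (3 * μ) := min_le_right _ _
    rw [le_div_iff₀ (by positivity)] at this
    linarith
  escape_right := fun x μ d h => by
    obtain ⟨hx, hx2, hμ, hd, hG⟩ := dom_pos h
    have hμ0 := hμ.1
    rcases le_total (8 / 5 * μ) x with hxμ | hxμ
    · exact ⟨x, le_rfl, h, H.red_pos_of_large hC h hxμ⟩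
    rcases lt_or_ge (gap g a K j special (8 / 5 * μ, μ, d)) 0 with h1 | h1
    · have hmem : (8 / 5 * μ, μ, d) ∈ dom g a K j μ₀ special :=
        ⟨by positivity, by show 8 / 5 * μ < 2 * μ; linarith, hμ.2, hd, h1⟩
      exact ⟨_, hxμ, hmem, H.red_pos_of_large hC hmem le_rfl⟩
    · obtain ⟨t, ht, hmem, hpos⟩ := H.exists_red_pos hC (c := fun t => (t, μ)) (by fun_prop) hxμ
        (fun t ht => ⟨hx.trans_le ht.1, by show t < 2 * μ; linarith [ht.2], hμ.2⟩) hd hG h1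
      exact ⟨t, ht.1, hmem, hpos⟩
  escape_down := fun x μ d h => by
    obtain ⟨hx, hx2, hμ, hd, hG⟩ := dom_pos h
    have hμ0 := hμ.1
    rcases le_total (8 / 5 * μ) x with hxμ | hxμ
    · exact ⟨μ, le_rfl, h, H.red_pos_of_large hC h hxμ⟩
    have hle : 5 / 8 * x ≤ μ := by linarith
    rcases lt_or_ge (gap g a K j special (x, 5 / 8 * x, d)) 0 with h1 | h1
    · have hmem : (x, 5 / 8 * x, d) ∈ dom g a K j μ₀ special :=
        ⟨hx, by show x < 2 * (5 / 8 * x); linarith, hle.trans_lt hμ.2, hd, h1⟩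
      exact ⟨_, hle, hmem, H.red_pos_of_large hC hmem (by linarith)⟩
    · obtain ⟨t, ht, hmem, hpos⟩ := H.exists_red_pos hC (c := fun t => (x, -t)) (by fun_prop)
        (neg_le_neg hle) (fun t ht => ⟨hx, by show x < 2 * -t; linarith [ht.2], by
          show -t < μ₀; linarith [ht.1, hμ.2]⟩) hd (by simpa using hG) (by simpa using h1)
      exact ⟨-t, by linarith [ht.1], hmem, hpos⟩
  convex := fun ⟨_, _, _⟩ h => zero_lt_one.trans_le (H.one_le_pd11_red hC h)
  decreasing := fun ⟨_, _, _⟩ h h0 => by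
    have := H.pd2_red_le hC h h0
    have := (dom_pos h).1
    linarith

end Domain

/-! ### The branch of zeros through the fold -/

section Branch

theorem hasDerivAt_moebius {A B s : ℝ} (h : A * (1 + s) + B * (1 - s) ≠ 0) :
    HasDerivAt (fun s => 2 * A * B * s / (A * (1 + s) + B * (1 - s)))
      (2 * A * B * (A + B) / (A * (1 + s) + B * (1 - s)) ^ 2) s := by
  have h1 : HasDerivAt (fun s : ℝ => 2 * A * B * s) (2 * A * B) s := by
    simpa using (hasDerivAt_id s).const_mul (2 * A * B)
  have h2 : HasDerivAt (fun s : ℝ => A * (1 + s) + B * (1 - s)) (A - B) s := by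
    refine ((((hasDerivAt_id s).const_add 1).const_mul A).add
      (((hasDerivAt_id s).const_sub 1).const_mul B)).congr_deriv ?_
    ring
  refine (h1.div h2 h).congr_deriv ?_
  congr 1
  ring

namespace IsReduced

variable {Ω : Set (ℝ × ℝ × ℝ)} {F : ℝ × ℝ × ℝ → ℝ} {μ₀ μ₁ d : ℝ}

/-- The interval between the two zeros of `F (·, μ₁, d)`, parametrized over `[-1, 1]` by a
projective map that sends `0` to the fold. -/
def cv (Ω : Set (ℝ × ℝ × ℝ)) (F : ℝ × ℝ × ℝ → ℝ) (μ₁ s d : ℝ) : ℝ :=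
  xf Ω F μ₁ d + 2 * (xf Ω F μ₁ d - xm Ω F μ₁ d) * (xp Ω F μ₁ d - xf Ω F μ₁ d) * s
    / ((xf Ω F μ₁ d - xm Ω F μ₁ d) * (1 + s) + (xp Ω F μ₁ d - xf Ω F μ₁ d) * (1 - s))

theorem cv_zero : cv Ω F μ₁ 0 d = xf Ω F μ₁ d := by simp [cv]

/-- The derivative of `cv` in `s`. -/
def cv' (Ω : Set (ℝ × ℝ × ℝ)) (F : ℝ × ℝ × ℝ → ℝ) (μ₁ s d : ℝ) : ℝ :=
  2 * (xf Ω F μ₁ d - xm Ω F μ₁ d) * (xp Ω F μ₁ d - xf Ω F μ₁ d)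
    * (xf Ω F μ₁ d - xm Ω F μ₁ d + (xp Ω F μ₁ d - xf Ω F μ₁ d))
    / ((xf Ω F μ₁ d - xm Ω F μ₁ d) * (1 + s) + (xp Ω F μ₁ d - xf Ω F μ₁ d) * (1 - s)) ^ 2

/-- The parameter `μ` along the branch. -/
def mu (Ω : Set (ℝ × ℝ × ℝ)) (F : ℝ × ℝ × ℝ → ℝ) (μ₁ s d : ℝ) : ℝ := mz Ω F (cv Ω F μ₁ s d) d

/-- The location of the fold. -/
def fold (Ω : Set (ℝ × ℝ × ℝ)) (F : ℝ × ℝ × ℝ → ℝ) (μ₁ d : ℝ) : ℝ := mu Ω F μ₁ 0 d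

variable (H : IsReduced Ω F μ₀) (h : IsNeg Ω F μ₁ d)

include H h

theorem cv_denom_pos {s : ℝ} (hs : s ∈ Icc (-1 : ℝ) 1) :
    0 < (xf Ω F μ₁ d - xm Ω F μ₁ d) * (1 + s) + (xp Ω F μ₁ d - xf Ω F μ₁ d) * (1 - s) := by
  obtain ⟨⟨h1, h2⟩, -⟩ := H.xf_spec h
  rcases hs.1.eq_or_lt with rfl | h3
  · linarith
  · have := mul_pos (sub_pos.2 h1) (show 0 < 1 + s by linarith)
    have := mul_nonneg (sub_pos.2 h2).le (show 0 ≤ 1 - s by linarith [hs.2])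
    linarith

theorem cv_neg_one : cv Ω F μ₁ (-1) d = xm Ω F μ₁ d := by
  obtain ⟨⟨h1, h2⟩, -⟩ := H.xf_spec h
  have : xp Ω F μ₁ d - xf Ω F μ₁ d ≠ 0 := (sub_pos.2 h2).ne'
  rw [cv]; norm_num; field_simp; ring

theorem cv_one : cv Ω F μ₁ 1 d = xp Ω F μ₁ d := by
  obtain ⟨⟨h1, h2⟩, -⟩ := H.xf_spec h
  have : xf Ω F μ₁ d - xm Ω F μ₁ d ≠ 0 := (sub_pos.2 h1).ne'
  rw [cv]; norm_num; field_simp; ring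

theorem hasDerivAt_cv {s : ℝ}
    (hs : s ∈ Icc (-1 : ℝ) 1) : HasDerivAt (fun s => cv Ω F μ₁ s d) (cv' Ω F μ₁ s d) s :=
  (hasDerivAt_moebius (H.cv_denom_pos h hs).ne').const_add _

theorem cv'_pos {s : ℝ} (hs : s ∈ Icc (-1 : ℝ) 1) :
    0 < cv' Ω F μ₁ s d := by
  obtain ⟨⟨h1, h2⟩, -⟩ := H.xf_spec h
  have := H.cv_denom_pos h hs
  have := sub_pos.2 h1
  have := sub_pos.2 h2
  unfold cv'
  positivity

theorem strictMonoOn_cv : StrictMonoOn (fun s => cv Ω F μ₁ s d) (Icc (-1) 1) := by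
  refine strictMonoOn_of_deriv_pos (convex_Icc _ _)
    (fun s hs => (H.hasDerivAt_cv h hs).continuousAt.continuousWithinAt) fun s hs => ?_
  rw [(H.hasDerivAt_cv h (interior_subset hs)).deriv]
  exact H.cv'_pos h (interior_subset hs)

theorem cv_mem {s : ℝ} (hs : s ∈ Icc (-1 : ℝ) 1) :
    cv Ω F μ₁ s d ∈ Icc (xm Ω F μ₁ d) (xp Ω F μ₁ d) := by
  have h11 : (-1 : ℝ) ≤ 1 := by norm_num
  have hm := (H.strictMonoOn_cv h).monotoneOn
  rw [← H.cv_neg_one h, ← H.cv_one h]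
  exact ⟨hm (left_mem_Icc.2 h11) hs hs.1, hm hs (right_mem_Icc.2 h11) hs.2⟩

theorem exists_cv_eq {x : ℝ}
    (hx : x ∈ Icc (xm Ω F μ₁ d) (xp Ω F μ₁ d)) : ∃ s ∈ Icc (-1 : ℝ) 1, cv Ω F μ₁ s d = x := by
  rw [← H.cv_neg_one h, ← H.cv_one h] at hx
  exact intermediate_value_Icc (by norm_num)
    (fun s hs => (H.hasDerivAt_cv h hs).continuousAt.continuousWithinAt) hx

omit h in
theorem contDiffAt_cv (h : ∀ᶠ d' in 𝓝 d, IsNeg Ω F μ₁ d') {s : ℝ}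
    (hs : s ∈ Icc (-1 : ℝ) 1) : ContDiffAt ℝ ∞ (fun q : ℝ × ℝ => cv Ω F μ₁ q.1 q.2) (s, d) := by
  have h0 := h.self_of_nhds
  have hs' : ContDiffAt ℝ ∞ (fun q : ℝ × ℝ => q.1) (s, d) := contDiffAt_fst
  have hc : ContDiffAt ℝ ∞ (fun q : ℝ × ℝ => (μ₁, q.2)) (s, d) :=
    contDiffAt_const.prodMk contDiffAt_snd
  have hm : ContDiffAt ℝ ∞ (fun q : ℝ × ℝ => xm Ω F μ₁ q.2) (s, d) :=
    ContDiffAt.comp (f := fun q : ℝ × ℝ => (μ₁, q.2)) (s, d) (H.contDiffAt_xm h0) hc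
  have hp : ContDiffAt ℝ ∞ (fun q : ℝ × ℝ => xp Ω F μ₁ q.2) (s, d) :=
    ContDiffAt.comp (f := fun q : ℝ × ℝ => (μ₁, q.2)) (s, d) (H.contDiffAt_xp h0) hc
  have hf : ContDiffAt ℝ ∞ (fun q : ℝ × ℝ => xf Ω F μ₁ q.2) (s, d) :=
    ContDiffAt.comp (f := fun q : ℝ × ℝ => q.2) (s, d) (H.contDiffAt_xf h) contDiffAt_snd
  exact hf.add ((((contDiffAt_const.mul (hf.sub hm)).mul (hp.sub hf)).mul hs').div
    (((hf.sub hm).mul (contDiffAt_const.add hs')).add ((hp.sub hf).mul (contDiffAt_const.sub hs')))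
    (H.cv_denom_pos h0 hs).ne')

theorem hasZero_cv {s : ℝ} (hs : s ∈ Icc (-1 : ℝ) 1) :
    HasZero Ω F (cv Ω F μ₁ s d) d :=
  (H.hasZero_of_mem_Icc h (H.cv_mem h hs)).1

theorem mu_spec {s : ℝ} (hs : s ∈ Icc (-1 : ℝ) 1) :
    (cv Ω F μ₁ s d, mu Ω F μ₁ s d, d) ∈ Ω ∧ F (cv Ω F μ₁ s d, mu Ω F μ₁ s d, d) = 0 :=
  mz_spec (H.hasZero_cv h hs)

omit h in
theorem contDiffAt_mu (h : ∀ᶠ d' in 𝓝 d, IsNeg Ω F μ₁ d') {s : ℝ}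
    (hs : s ∈ Icc (-1 : ℝ) 1) : ContDiffAt ℝ ∞ (fun q : ℝ × ℝ => mu Ω F μ₁ q.1 q.2) (s, d) :=
  ContDiffAt.comp (f := fun q : ℝ × ℝ => (cv Ω F μ₁ q.1 q.2, q.2)) (s, d)
    (H.contDiffAt_mz (H.hasZero_cv h.self_of_nhds hs))
    ((H.contDiffAt_cv h hs).prodMk contDiffAt_snd)

theorem mu_neg_one : mu Ω F μ₁ (-1) d = μ₁ := by
  rw [mu, H.cv_neg_one h]
  exact H.mz_eq (H.xm_spec h).1 (H.xm_spec h).2.1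

theorem mu_one : mu Ω F μ₁ 1 d = μ₁ := by
  rw [mu, H.cv_one h]
  exact H.mz_eq (H.xp_spec h).1 (H.xp_spec h).2.1

theorem hasDerivAt_mu {s : ℝ}
    (hs : s ∈ Icc (-1 : ℝ) 1) : HasDerivAt (fun s => mu Ω F μ₁ s d)
      (-pd1 F (cv Ω F μ₁ s d, mu Ω F μ₁ s d, d) / pd2 F (cv Ω F μ₁ s d, mu Ω F μ₁ s d, d)
        * cv' Ω F μ₁ s d) s :=
  HasDerivAt.comp (h₂ := fun t => mz Ω F t d) (h := fun s => cv Ω F μ₁ s d) s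
    (H.hasDerivAt_mz (H.hasZero_cv h hs)) (H.hasDerivAt_cv h hs)

theorem pd1_cv_neg {s : ℝ} (hs : s ∈ Ico (-1 : ℝ) 0) :
    pd1 F (cv Ω F μ₁ s d, mu Ω F μ₁ s d, d) < 0 := by
  have hs' : s ∈ Icc (-1 : ℝ) 1 := ⟨hs.1, by linarith [hs.2]⟩
  have := H.strictMonoOn_cv h hs' ⟨by norm_num, by norm_num⟩ hs.2
  simp only [cv_zero] at this
  exact (H.xf_spec h).2.2.1 _ ⟨(H.cv_mem h hs').1, this⟩

theorem pd1_cv_pos {s : ℝ} (hs : s ∈ Ioc (0 : ℝ) 1) :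
    0 < pd1 F (cv Ω F μ₁ s d, mu Ω F μ₁ s d, d) := by
  have hs' : s ∈ Icc (-1 : ℝ) 1 := ⟨by linarith [hs.1], hs.2⟩
  have := H.strictMonoOn_cv h ⟨by norm_num, by norm_num⟩ hs' hs.1
  simp only [cv_zero] at this
  exact (H.xf_spec h).2.2.2 _ ⟨this, (H.cv_mem h hs').2⟩

theorem deriv_mu_neg {s : ℝ}
    (hs : s ∈ Ico (-1 : ℝ) 0) : deriv (fun s => mu Ω F μ₁ s d) s < 0 := by
  have hs' : s ∈ Icc (-1 : ℝ) 1 := ⟨hs.1, by linarith [hs.2]⟩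
  rw [(H.hasDerivAt_mu h hs').deriv]
  obtain ⟨k1, k2⟩ := H.mu_spec h hs'
  exact mul_neg_of_neg_of_pos (div_neg_of_pos_of_neg (neg_pos.2 (H.pd1_cv_neg h hs))
    (H.decreasing _ k1 k2)) (H.cv'_pos h hs')

theorem deriv_mu_pos {s : ℝ}
    (hs : s ∈ Ioc (0 : ℝ) 1) : 0 < deriv (fun s => mu Ω F μ₁ s d) s := by
  have hs' : s ∈ Icc (-1 : ℝ) 1 := ⟨by linarith [hs.1], hs.2⟩
  rw [(H.hasDerivAt_mu h hs').deriv]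
  obtain ⟨k1, k2⟩ := H.mu_spec h hs'
  exact mul_pos (div_pos_of_neg_of_neg (neg_neg_iff_pos.2 (H.pd1_cv_pos h hs))
    (H.decreasing _ k1 k2)) (H.cv'_pos h hs')

theorem strictAntiOn_mu : StrictAntiOn (fun s => mu Ω F μ₁ s d) (Icc (-1) 0) := by
  refine strictAntiOn_of_deriv_neg (convex_Icc _ _) (fun s hs =>
    (H.hasDerivAt_mu h ⟨hs.1, by linarith [hs.2]⟩).continuousAt.continuousWithinAt) fun s hs => ?_
  rw [interior_Icc] at hs
  exact H.deriv_mu_neg h ⟨hs.1.le, hs.2⟩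

theorem strictMonoOn_mu : StrictMonoOn (fun s => mu Ω F μ₁ s d) (Icc 0 1) := by
  refine strictMonoOn_of_deriv_pos (convex_Icc _ _) (fun s hs =>
    (H.hasDerivAt_mu h ⟨by linarith [hs.1], hs.2⟩).continuousAt.continuousWithinAt) fun s hs => ?_
  rw [interior_Icc] at hs
  exact H.deriv_mu_pos h ⟨hs.1, hs.2.le⟩

theorem fold_lt_mu_neg {s : ℝ}
    (hs : s ∈ Ico (-1 : ℝ) 0) : fold Ω F μ₁ d < mu Ω F μ₁ s d :=
  H.strictAntiOn_mu h ⟨hs.1, hs.2.le⟩ ⟨by norm_num, le_rfl⟩ hs.2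

theorem fold_lt_mu_pos {s : ℝ}
    (hs : s ∈ Ioc (0 : ℝ) 1) : fold Ω F μ₁ d < mu Ω F μ₁ s d :=
  H.strictMonoOn_mu h ⟨le_rfl, zero_le_one⟩ ⟨hs.1.le, hs.2⟩ hs.1

theorem fold_le_mu {s : ℝ} (hs : s ∈ Icc (-1 : ℝ) 1) :
    fold Ω F μ₁ d ≤ mu Ω F μ₁ s d := by
  rcases lt_trichotomy s 0 with h0 | rfl | h0
  · exact (H.fold_lt_mu_neg h ⟨hs.1, h0⟩).le
  · exact le_rfl
  · exact (H.fold_lt_mu_pos h ⟨h0, hs.2⟩).le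

theorem fold_lt : fold Ω F μ₁ d < μ₁ :=
  (H.fold_lt_mu_pos h (s := 1) ⟨one_pos, le_rfl⟩).trans_eq (H.mu_one h)

theorem fold_spec :
    (xf Ω F μ₁ d, fold Ω F μ₁ d, d) ∈ Ω ∧ F (xf Ω F μ₁ d, fold Ω F μ₁ d, d) = 0 ∧
      pd1 F (xf Ω F μ₁ d, fold Ω F μ₁ d, d) = 0 := by
  have h1 := H.mu_spec h (s := 0) ⟨by norm_num, by norm_num⟩
  have h2 := (H.xf_spec h).2.1
  rw [cv_zero] at h1
  refine ⟨h1.1, h1.2, ?_⟩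
  rw [fold, mu, cv_zero]
  exact h2

theorem isNeg_of_fold_lt {μ : ℝ}
    (hμ : fold Ω F μ₁ d < μ) (hμ₀ : μ < μ₀) : IsNeg Ω F μ d := by
  obtain ⟨h1, h2, -⟩ := H.fold_spec h
  exact ⟨_, H.up _ _ _ h1 μ ⟨hμ.le, hμ₀⟩, H.neg_of_lt h1 h2 hμ hμ₀⟩

theorem deriv_mu_zero : HasDerivAt (fun s => mu Ω F μ₁ s d) 0 0 := by
  have := H.hasDerivAt_mu h (s := 0) ⟨by norm_num, by norm_num⟩
  rw [cv_zero] at this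
  have e : pd1 F (xf Ω F μ₁ d, mu Ω F μ₁ 0 d, d) = 0 := (H.fold_spec h).2.2
  rw [e] at this
  simpa using this

theorem deriv_deriv_mu_pos : 0 < deriv (deriv fun s => mu Ω F μ₁ s d) 0 := by
  have h0 : (0 : ℝ) ∈ Icc (-1 : ℝ) 1 := ⟨by norm_num, by norm_num⟩
  have hz := H.hasZero_cv h h0
  have hpd := (H.xf_spec h).2.1
  rw [cv_zero] at hz
  obtain ⟨c, hc, hd⟩ := H.exists_second_deriv hz hpd
  have hX := H.hasDerivAt_cv h h0
  have hD := H.cv_denom_pos h h0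
  have hX' : DifferentiableAt ℝ (fun s => cv' Ω F μ₁ s d) 0 := by
    unfold cv'
    refine DifferentiableAt.div (by fun_prop) (by fun_prop) (pow_pos hD 2).ne'
  have h1 : HasDerivAt (fun s => deriv (fun t => mz Ω F t d) (cv Ω F μ₁ s d) * cv' Ω F μ₁ s d)
      (c * cv' Ω F μ₁ 0 d ^ 2) 0 := by
    have h2 : HasDerivAt (fun s => deriv (fun t => mz Ω F t d) (cv Ω F μ₁ s d)) _ 0 :=
      HasDerivAt.comp (h₂ := deriv fun t => mz Ω F t d) (h := fun s => cv Ω F μ₁ s d) 0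
        (by rw [cv_zero]; exact hd) hX
    refine (h2.mul hX'.hasDerivAt).congr_deriv ?_
    have h3 := (H.hasDerivAt_mz hz).deriv
    rw [hpd, neg_zero, zero_div] at h3
    rw [cv_zero, h3]
    ring
  have h2 : (deriv fun s => mu Ω F μ₁ s d) =ᶠ[𝓝 0]
      fun s => deriv (fun t => mz Ω F t d) (cv Ω F μ₁ s d) * cv' Ω F μ₁ s d := by
    filter_upwards [Ioo_mem_nhds (show (-1 : ℝ) < 0 by norm_num) zero_lt_one] with s hs
    have hs' := Ioo_subset_Icc_self hs
    rw [(H.hasDerivAt_mz (H.hasZero_cv h hs')).deriv]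
    exact (H.hasDerivAt_mu h hs').deriv
  rw [(h1.congr_of_eventuallyEq h2).deriv]
  have := H.cv'_pos h h0
  positivity

end IsReduced

end Branch

/-! ### The fold branch of the lattice system -/

section FoldBranch

/-- The steady-state problem reduces to the scalar equation `F = 0` on `Ω`: the map `S` assigns to
`(x, μ, d)` the symmetric sequence with value `x` at `p₀` that solves all equations but one. -/
structure IsResolved (f : ℝ → ℝ → ℝ) (σ : Site) (p₀ : ℤ × ℤ) (Ω : Set (ℝ × ℝ × ℝ))
    (F : ℝ × ℝ × ℝ → ℝ) (S : ℝ × ℝ × ℝ → LInf ℝ) : Prop where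
  smooth : ∀ π ∈ Ω, ContDiffAt ℝ ∞ S π
  apply_eq : ∀ x μ d, (x, μ, d) ∈ Ω → S (x, μ, d) p₀ = x
  symm : ∀ π ∈ Ω, IsD4Symmetric σ (S π)
  steady_iff : ∀ x μ d, (x, μ, d) ∈ Ω → (IsSteadyState f (S (x, μ, d)) μ d ↔ F (x, μ, d) = 0)
  isolated : ∀ x μ d, (x, μ, d) ∈ Ω → ∀ᶠ q : ℝ × LInf ℝ in 𝓝 (μ, S (x, μ, d)),
    IsD4Symmetric σ q.2 → IsSteadyState f q.2 q.1 d →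
      (q.2 p₀, q.1, d) ∈ Ω ∧ q.2 = S (q.2 p₀, q.1, d)
  kernel : ∀ x μ d, (x, μ, d) ∈ Ω → ∀ w : LInf ℝ, IsD4Symmetric σ w →
    (∀ n k : ℤ, d * lap w n k + fu f (S (x, μ, d) (n, k)) μ * w (n, k) = 0) →
      w = w p₀ • fderiv ℝ S (x, μ, d) (1, 0, 0)

/-- One of the two branches over `μ ≥ fold`, continued by a constant. -/
def half (Ω : Set (ℝ × ℝ × ℝ)) (F : ℝ × ℝ × ℝ → ℝ) (S : ℝ × ℝ × ℝ → LInf ℝ) (μ₁ : ℝ)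
    (ξ : ℝ → ℝ → ℝ) (μ d : ℝ) : LInf ℝ :=
  if μ ≤ IsReduced.fold Ω F μ₁ d then S (IsReduced.xf Ω F μ₁ d, IsReduced.fold Ω F μ₁ d, d)
  else S (ξ μ d, μ, d)

/-- The solution along the branch. -/
def onBranch (Ω : Set (ℝ × ℝ × ℝ)) (F : ℝ × ℝ × ℝ → ℝ) (S : ℝ × ℝ × ℝ → LInf ℝ) (μ₁ s d : ℝ) :
    LInf ℝ :=
  S (IsReduced.cv Ω F μ₁ s d, IsReduced.mu Ω F μ₁ s d, d)

namespace IsResolved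

open _root_.Lattice.IsReduced

variable {f : ℝ → ℝ → ℝ} {σ : Site} {p₀ : ℤ × ℤ} {Ω : Set (ℝ × ℝ × ℝ)} {F : ℝ × ℝ × ℝ → ℝ}
  {S : ℝ × ℝ × ℝ → LInf ℝ} {μ₀ μ₁ d : ℝ}

theorem half_of_lt {ξ : ℝ → ℝ → ℝ} {μ : ℝ} (hμ : fold Ω F μ₁ d < μ) :
    half Ω F S μ₁ ξ μ d = S (ξ μ d, μ, d) := if_neg hμ.not_ge

theorem half_fold {ξ : ℝ → ℝ → ℝ} :
    half Ω F S μ₁ ξ (fold Ω F μ₁ d) d = onBranch Ω F S μ₁ 0 d := by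
  rw [half, if_pos le_rfl, onBranch, cv_zero, fold]

theorem contDiffAt_onBranch (HS : IsResolved f σ p₀ Ω F S) (R : IsReduced Ω F μ₀)
    (h : ∀ᶠ d' in 𝓝 d, IsNeg Ω F μ₁ d') {s : ℝ} (hs : s ∈ Icc (-1 : ℝ) 1) :
    ContDiffAt ℝ ∞ (fun q : ℝ × ℝ => onBranch Ω F S μ₁ q.1 q.2) (s, d) :=
  ContDiffAt.comp (g := S) (f := fun q : ℝ × ℝ => (cv Ω F μ₁ q.1 q.2, mu Ω F μ₁ q.1 q.2, q.2))
    (s, d)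
    (HS.smooth _ (R.mu_spec h.self_of_nhds hs).1)
    ((R.contDiffAt_cv h hs).prodMk ((R.contDiffAt_mu h hs).prodMk contDiffAt_snd))

theorem contDiffAt_half (HS : IsResolved f σ p₀ Ω F S) (R : IsReduced Ω F μ₀)
    (h : ∀ᶠ d' in 𝓝 d, IsNeg Ω F μ₁ d') {ξ : ℝ → ℝ → ℝ} {μ : ℝ} (hμ : fold Ω F μ₁ d < μ)
    (hξ : ContDiffAt ℝ ∞ (fun q : ℝ × ℝ => ξ q.1 q.2) (μ, d)) (hΩ : (ξ μ d, μ, d) ∈ Ω) :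
    ContDiffAt ℝ ∞ (fun q : ℝ × ℝ => half Ω F S μ₁ ξ q.1 q.2) (μ, d) := by
  have h1 : ContDiffAt ℝ ∞ (fun q : ℝ × ℝ => S (ξ q.1 q.2, q.1, q.2)) (μ, d) :=
    ContDiffAt.comp (g := S) (f := fun q : ℝ × ℝ => (ξ q.1 q.2, q.1, q.2)) (μ, d)
      (HS.smooth _ hΩ) (hξ.prodMk (contDiffAt_fst.prodMk contDiffAt_snd))
  refine h1.congr_of_eventuallyEq ?_
  have hc : ContinuousAt (fun d => fold Ω F μ₁ d) d :=
    ContinuousAt.comp (g := fun q : ℝ × ℝ => mu Ω F μ₁ q.1 q.2) (f := fun d => ((0 : ℝ), d))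
      (R.contDiffAt_mu h ⟨by norm_num, by norm_num⟩).continuousAt (by fun_prop)
  have hc' : ContinuousAt (fun q : ℝ × ℝ => fold Ω F μ₁ q.2) (μ, d) :=
    ContinuousAt.comp (g := fun d => fold Ω F μ₁ d) (f := fun q : ℝ × ℝ => q.2) hc continuousAt_snd
  filter_upwards [hc'.eventually_lt continuousAt_fst hμ] with q hq
  exact half_of_lt hq

theorem half_spec (HS : IsResolved f σ p₀ Ω F S) (R : IsReduced Ω F μ₀) (h : IsNeg Ω F μ₁ d)
    {ξ : ℝ → ℝ → ℝ} {μ : ℝ} (hμ : fold Ω F μ₁ d ≤ μ)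
    (hξ : fold Ω F μ₁ d < μ → (ξ μ d, μ, d) ∈ Ω ∧ F (ξ μ d, μ, d) = 0) :
    IsD4Symmetric σ (half Ω F S μ₁ ξ μ d) ∧ IsSteadyState f (half Ω F S μ₁ ξ μ d) μ d := by
  rcases hμ.eq_or_lt with rfl | hlt
  · obtain ⟨h1, h2, -⟩ := R.fold_spec h
    rw [half, if_pos le_rfl]
    exact ⟨HS.symm _ h1, (HS.steady_iff _ _ _ h1).2 h2⟩
  · rw [half_of_lt hlt]
    exact ⟨HS.symm _ (hξ hlt).1, (HS.steady_iff _ _ _ (hξ hlt).1).2 (hξ hlt).2⟩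

/-- The zeros of the reduced function give a fold branch of steady states. -/
theorem isFoldBranch (HS : IsResolved f σ p₀ Ω F S) (R : IsReduced Ω F μ₀)
    (h : ∀ᶠ d' in 𝓝 d, IsNeg Ω F μ₁ d') :
    IsFoldBranch f σ d (fold Ω F μ₁ d) μ₁ (fun μ => half Ω F S μ₁ (xm Ω F) μ d)
      (fun μ => half Ω F S μ₁ (xp Ω F) μ d) (fun s => onBranch Ω F S μ₁ s d)
      (fun s => mu Ω F μ₁ s d) := by
  have h0 := h.self_of_nhds
  have h00 : (0 : ℝ) ∈ Icc (-1 : ℝ) 1 := ⟨by norm_num, by norm_num⟩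
  have hline : ∀ s : ℝ, ContDiffAt ℝ ∞ (fun s => ((s, d) : ℝ × ℝ)) s := fun s => by fun_prop
  obtain ⟨f1, f2, f3⟩ := R.fold_spec h0
  have hX0 := R.cv'_pos h0 h00
  -- the tangent vector at the fold
  have hU : HasDerivAt (fun s => onBranch Ω F S μ₁ s d)
      (cv' Ω F μ₁ 0 d • fderiv ℝ S (xf Ω F μ₁ d, fold Ω F μ₁ d, d) (1, 0, 0)) 0 := by
    have hc := (R.hasDerivAt_cv h0 h00).prodMk ((R.deriv_mu_zero h0).prodMk (hasDerivAt_const 0 d))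
    have e : (cv Ω F μ₁ 0 d, mu Ω F μ₁ 0 d, d) = (xf Ω F μ₁ d, fold Ω F μ₁ d, d) := by
      rw [cv_zero]; rfl
    have hS : HasFDerivAt S (fderiv ℝ S (xf Ω F μ₁ d, fold Ω F μ₁ d, d))
        (cv Ω F μ₁ 0 d, mu Ω F μ₁ 0 d, d) := by
      rw [e]; exact ((HS.smooth _ f1).differentiableAt (by simp)).hasFDerivAt
    have h1 := HasFDerivAt.comp_hasDerivAt
      (f := fun s => ((cv Ω F μ₁ s d, mu Ω F μ₁ s d, d) : ℝ × ℝ × ℝ)) 0 hS hc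
    refine h1.congr_deriv ?_
    rw [← map_smul]
    congr 1
    simp
  have hUp : HasDerivAt (fun s => onBranch Ω F S μ₁ s d p₀) (cv' Ω F μ₁ 0 d) 0 := by
    refine (R.hasDerivAt_cv h0 h00).congr_of_eventuallyEq ?_
    filter_upwards [Ioo_mem_nhds (show (-1 : ℝ) < 0 by norm_num) zero_lt_one] with s hs
    exact HS.apply_eq _ _ _ (R.mu_spec h0 (Ioo_subset_Icc_self hs)).1
  refine
    { smooth_U := fun s hs => ?_
      smooth_m := fun s hs => ?_
      m_neg_one := R.mu_neg_one h0
      m_zero := rfl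
      m_one := R.mu_one h0
      decreasing := fun s hs => R.deriv_mu_neg h0 ⟨hs.1.le, hs.2⟩
      increasing := fun s hs => R.deriv_mu_pos h0 ⟨hs.1, hs.2.le⟩
      eq_u := fun s hs => ?_
      eq_v := fun s hs => ?_
      regular := fun hz => ?_
      tangent := (R.deriv_mu_zero h0).deriv
      quadratic := R.deriv_deriv_mu_pos h0
      simple_kernel := fun w hw hlin => ?_
      isolated := ?_ }
  · exact (ContDiffAt.comp (g := fun q : ℝ × ℝ => onBranch Ω F S μ₁ q.1 q.2) s
      (HS.contDiffAt_onBranch R h hs) (hline s)).contDiffWithinAt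
  · exact (ContDiffAt.comp (g := fun q : ℝ × ℝ => mu Ω F μ₁ q.1 q.2) s
      (R.contDiffAt_mu h hs) (hline s)).contDiffWithinAt
  · rcases hs.2.eq_or_lt with rfl | hlt
    · exact half_fold.symm
    · have hs' : s ∈ Icc (-1 : ℝ) 1 := ⟨hs.1, by linarith⟩
      obtain ⟨k1, k2⟩ := R.mu_spec h0 hs'
      rw [half_of_lt (R.fold_lt_mu_neg h0 ⟨hs.1, hlt⟩),
        R.xm_eq k1 k2 (R.pd1_cv_neg h0 ⟨hs.1, hlt⟩)]
      rfl
  · rcases hs.1.eq_or_lt with rfl | hlt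
    · exact half_fold.symm
    · have hs' : s ∈ Icc (-1 : ℝ) 1 := ⟨by linarith, hs.2⟩
      obtain ⟨k1, k2⟩ := R.mu_spec h0 hs'
      rw [half_of_lt (R.fold_lt_mu_pos h0 ⟨hlt, hs.2⟩),
        R.xp_eq k1 k2 (R.pd1_cv_pos h0 ⟨hlt, hs.2⟩)]
      rfl
  · rw [hU.deriv] at hz
    rw [hz] at hU
    have h1 := (hasDerivAt_apply hU p₀).unique hUp
    exact hX0.ne h1
  · refine ⟨w p₀ / cv' Ω F μ₁ 0 d, ?_⟩
    rw [hU.deriv, smul_smul, div_mul_cancel₀ _ hX0.ne']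
    refine HS.kernel _ _ _ f1 w hw fun n k => ?_
    have h1 := hlin n k
    simp only [onBranch, cv_zero] at h1
    exact h1
  · have e : onBranch Ω F S μ₁ 0 d = S (xf Ω F μ₁ d, fold Ω F μ₁ d, d) := by
      rw [onBranch, cv_zero]; rfl
    obtain ⟨⟨x1, x2⟩, -⟩ := R.xf_spec h0
    have hcont : ContinuousAt (fun q : ℝ × LInf ℝ => q.2 p₀)
        (fold Ω F μ₁ d, S (xf Ω F μ₁ d, fold Ω F μ₁ d, d)) :=
      ((ev ℝ p₀).continuous.comp continuous_snd).continuousAt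
    have hev := hcont.eventually (Icc_mem_nhds (a := xm Ω F μ₁ d) (b := xp Ω F μ₁ d)
      (x1.trans_eq (HS.apply_eq _ _ _ f1).symm) ((HS.apply_eq _ _ _ f1).trans_lt x2))
    obtain ⟨ε, hε, hball⟩ := Metric.eventually_nhds_iff.1 ((HS.isolated _ _ _ f1).and hev)
    refine ⟨ε, hε, fun w μ hw hst hn hμ => ?_⟩
    have hd : dist (μ, w) (fold Ω F μ₁ d, S (xf Ω F μ₁ d, fold Ω F μ₁ d, d)) < ε := by
      rw [Prod.dist_eq, max_lt_iff]
      exact ⟨by rwa [Real.dist_eq], by rw [dist_eq_norm, ← e]; exact hn⟩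
    obtain ⟨k1, k2⟩ := hball hd
    obtain ⟨k3, k4⟩ := k1 hw hst
    simp only at k2 k3 k4
    have k5 : F (w p₀, μ, d) = 0 := (HS.steady_iff _ _ _ k3).1 (by rw [← k4]; exact hst)
    obtain ⟨s, hs, hsx⟩ := R.exists_cv_eq h0 k2
    refine ⟨s, hs, ?_, ?_⟩
    · simp only [onBranch, mu]; rw [hsx, R.mz_eq k3 k5]; exact k4
    · simp only [mu]; rw [hsx, R.mz_eq k3 k5]

end IsResolved

end FoldBranch

section Resolve

variable {f : ℝ → ℝ → ℝ} {um up : ℝ → ℝ} {a K Λ r μ₀ : ℝ} {σ : Site} {P C : Set (ℤ × ℤ)}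
  {p₀ : ℤ × ℤ} {j : ℝ} {special : Prop}

theorem D1_eq_fu (hf : ContDiff ℝ ∞ fun p : ℝ × ℝ => f p.1 p.2) (x μ : ℝ) :
    D1 (fun p : ℝ × ℝ => f p.1 p.2) (x, μ) = fu f x μ :=
  (hasDerivAt_D1 hf x μ).deriv.symm

theorem LocalModel.isResolved (H : LocalModel (fun p : ℝ × ℝ => f p.1 p.2) um up a K Λ r μ₀)
    (hC : IsConfig σ P C p₀ j special) :
    IsResolved f σ p₀ (dom (fun p : ℝ × ℝ => f p.1 p.2) a K j μ₀ special)
      (red (fun p : ℝ × ℝ => f p.1 p.2) P C r p₀)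
      (sol (fun p : ℝ × ℝ => f p.1 p.2) P C r) where
  smooth := fun π h => H.contDiffAt_sol hC h
  apply_eq := fun x μ d h => (H.sol_spec hC h).1.1 p₀ hC.mem
  symm := fun ⟨_, _, _⟩ h => H.isD4Symmetric_sol hC h
  steady_iff := fun x μ d h => H.isSteadyState_iff hC h
  isolated := fun x μ d h => by
    obtain ⟨hs, hb⟩ := H.sol_spec hC h
    have hμ := (dom_pos h).2.2.1
    have hcont : ContinuousAt (fun q : ℝ × LInf ℝ => (q.2 p₀, q.1, d))
        (μ, sol (fun p : ℝ × ℝ => f p.1 p.2) P C r (x, μ, d)) :=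
      ((ev ℝ p₀).continuous.comp continuous_snd).continuousAt.prodMk (by fun_prop)
    have he : (sol (fun p : ℝ × ℝ => f p.1 p.2) P C r (x, μ, d) p₀, μ, d)
        ∈ dom (fun p : ℝ × ℝ => f p.1 p.2) a K j μ₀ special := by
      rw [hs.1 p₀ hC.mem]; exact h
    have hmem := hcont.eventually (H.isOpen_dom.mem_nhds he)
    filter_upwards [H.eventually_inReg hμ hb, hmem] with q hq hq' hsym hst
    obtain ⟨-, -, hμ', hd', -⟩ := dom_pos hq'
    refine ⟨hq', (H.sol_eq hμ' hd' ⟨fun p hp => hC.orbit _ hsym p hp, fun p _ => ?_⟩ hq).symm⟩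
    have := hst p.1 p.2
    rw [lap_eq_nb] at this
    exact this
  kernel := fun x μ d h w hw hlin => by
    obtain ⟨hs, hb⟩ := H.sol_spec hC h
    obtain ⟨-, -, hμ, hd, -⟩ := dom_pos h
    have hr := H.inReg hμ hb
    obtain ⟨e1, e2⟩ := H.dsol_x hC h
    set v := dsol (fun p : ℝ × ℝ => f p.1 p.2) P C r (1, 0, 0) (x, μ, d) with hv
    refine linf_ext fun p => ?_
    have key := abs_le_of_dominant (C := C) (B := 0) (v := w - w p₀ • v) (G := fun _ => 0) hd
      (LocalModel.delta_pos hμ.1) (fun p hp => H.D1_le_of_inReg hμ hr hp) (fun p hp => ?_)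
      (fun p _ => by simp) (fun p hp => ?_) p
    · exact sub_eq_zero.1 (abs_nonpos_iff.1 key)
    · have h1 := hlin p.1 p.2
      rw [lap_eq_nb, ← D1_eq_fu H.smooth] at h1
      have h2 := e2 p hp
      have h3 : nb (w - w p₀ • v : LInf ℝ) p = nb w p - w p₀ * nb v p := by
        change nb (fun q => w q - w p₀ * v q) p = _
        unfold nb; ring
      rw [h3]
      change d * (nb w p - w p₀ * nb v p - 4 * (w p - w p₀ * v p))
        + (D1 _ (sol _ P C r (x, μ, d) p, μ) * (w p - w p₀ * v p) + 0) = 0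
      linear_combination h1 - w p₀ * h2
    · change |w p - w p₀ * v p| ≤ 0
      rw [hC.orbit _ hw p hp, e1 p hp]; simp

end Resolve

/-! ### The limit of vanishing coupling -/

section Limit

variable {g : ℝ × ℝ → ℝ} {um up : ℝ → ℝ} {a K Λ r μ₀ : ℝ} {σ : Site} {P C : Set (ℤ × ℤ)}
  {p₀ : ℤ × ℤ} {j : ℝ} {special : Prop}

theorem mul_abs_sub_le_of_D1_le (hg : ContDiff ℝ ∞ g) {μ δ s t : ℝ}
    (h : ∀ c ∈ uIcc s t, D1 g (c, μ) ≤ -δ) : δ * |t - s| ≤ |g (t, μ) - g (s, μ)| := by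
  wlog hst : s ≤ t generalizing s t
  · rw [abs_sub_comm t, abs_sub_comm (g (t, μ))]
    exact this (by rwa [uIcc_comm]) (le_of_not_ge hst)
  rcases hst.eq_or_lt with rfl | hlt
  · simp
  obtain ⟨c, hc, he⟩ := exists_slope_of_D1 hg μ hlt
  have h1 := h c (by rw [uIcc_of_le hst]; exact Ioo_subset_Icc_self hc)
  have h2 : 0 < t - s := sub_pos.2 hlt
  rw [he, abs_mul, abs_of_pos h2]
  exact mul_le_mul_of_nonneg_right (by linarith [neg_le_abs (D1 g (c, μ))]) h2.le

variable (H : LocalModel g um up a K Λ r μ₀)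
  (hC : IsConfig σ P C p₀ j special)

include H hC

/-- For small `d` the solution is close to a pattern of equilibria. -/
theorem LocalModel.norm_sol_sub_le {x μ d y : ℝ} (h : (x, μ, d) ∈ dom g a K j μ₀ special)
    {w : LInf ℝ} (hP : ∀ p ∈ P, w p = up μ) (hCw : ∀ p ∈ C, w p = y)
    (hZ : ∀ p ∉ P, p ∉ C → w p = 0) :
    ‖sol g P C r (x, μ, d) - w‖ ≤ 16 * d / (μ * √μ / 32) + |x - y| := by
  obtain ⟨hs, hb⟩ := H.sol_spec hC h
  obtain ⟨q, hq, hsq, hqq, -, hΛ, hq1, -, -, hμq⟩ := H.exists_sqrt_dom hC h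
  obtain ⟨hx, hx2, hμ, hd, -⟩ := dom_pos h
  have hr := H.inReg hμ hb
  have hδ := LocalModel.delta_pos hμ.1
  have hr4 := H.r_le
  set u := sol g P C r (x, μ, d)
  have hu2 : ∀ q, |u q| ≤ 2 := fun q => by
    by_cases k : q ∈ P
    · have := hr.onP q k
      rw [abs_le]; exact ⟨by linarith [this.1], by linarith [this.2]⟩
    by_cases k2 : q ∈ C
    · rw [hs.1 q k2, abs_of_pos hx]; linarith
    · have := (H.mem_Icc_of_inReg hμ hr k k2).2
      linarith
  refine norm_le_of_apply_le fun p => ?_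
  change |u p - w p| ≤ _
  by_cases k2 : p ∈ C
  · rw [hs.1 p k2, hCw p k2]
    have : 0 ≤ 16 * d / (μ * √μ / 32) := by positivity
    linarith
  have hgu : |g (u p, μ)| ≤ 16 * d := by
    have e : g (u p, μ) = -(d * (nb u p - 4 * u p)) := by linarith [hs.2 p k2]
    have h1 := abs_le.1 (abs_nb_sub_le hu2 p)
    have h2 := abs_le.1 (hu2 p)
    rw [e, abs_neg, abs_mul, abs_of_pos hd, mul_comm]
    exact mul_le_mul_of_nonneg_right (abs_le.2 ⟨by linarith, by linarith⟩) hd.le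
  have hle : μ * √μ / 32 * |u p - w p| ≤ |g (u p, μ) - g (w p, μ)| := by
    refine mul_abs_sub_le_of_D1_le H.smooth fun c hc => ?_
    by_cases k : p ∈ P
    · rw [hP p k] at hc
      have h1 := ordConnected_Icc.uIcc_subset (H.up_mem μ hμ) (Ioo_subset_Icc_self (hr.onP p k)) hc
      refine (H.one_d1 μ hμ c h1).trans (neg_le_neg ?_)
      have hΛ1 := H.one_le
      rw [le_div_iff₀ (by linarith), hsq, hqq]
      have : q ^ 2 * q / 32 * Λ = Λ * q * (q ^ 2 / 32) := by ring
      rw [this]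
      calc Λ * q * (q ^ 2 / 32) ≤ 1 / 10 ^ 6 * 1 :=
            mul_le_mul hΛ (by nlinarith) (by positivity) (by norm_num)
        _ ≤ 1 := by norm_num
    · rw [hZ p k k2] at hc
      have hμ0 := hμ.1
      have : μ * √μ ≤ 1 / 10 ^ 6 * μ := by rw [hsq]; nlinarith
      exact H.D1_le hμ (ordConnected_Ioo.uIcc_subset ⟨by linarith, by linarith⟩
        (hr.onZ p k k2) hc)
  have hgw : g (w p, μ) = 0 := by
    by_cases k : p ∈ P
    · rw [hP p k]; exact H.up_zero μ hμ
    · rw [hZ p k k2]; exact H.zero μ hμ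
  rw [hgw, sub_zero] at hle
  have : |u p - w p| ≤ 16 * d / (μ * √μ / 32) := by
    rw [le_div_iff₀ hδ]; linarith
  linarith [abs_nonneg (x - y)]

omit hC in
theorem LocalModel.eventually_mem_dom {x μ : ℝ}
    (hμ : μ ∈ Ioo 0 μ₀) (hx : x ∈ Ioo 0 (2 * μ)) :
    ∀ᶠ d in 𝓝[>] (0 : ℝ), (x, μ, d) ∈ dom g a K j μ₀ special := by
  have hc : Continuous fun d : ℝ => gap g a K j special (x, μ, d) :=
    (continuous_gap H.smooth.continuous).comp (by fun_prop)
  have h0 : gap g a K j special (x, μ, 0) < 0 := by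
    have h2 : 0 < μ ^ 2 := pow_pos hμ.1 2
    by_cases hs : special
    · rw [gap_special hs]
      have := (abs_le.1 (H.bounds_topY hμ).2.2).2
      linarith
    · rw [gap_ordinary hs]; linarith
  filter_upwards [(hc.continuousAt.eventually (gt_mem_nhds h0)).filter_mono nhdsWithin_le_nhds,
    self_mem_nhdsWithin] with d hd hd0
  exact ⟨hx.1, hx.2, hμ.2, hd0, hd⟩

theorem LocalModel.tendsto_red {x μ : ℝ} (hμ : μ ∈ Ioo 0 μ₀) (hx : x ∈ Ioo 0 (2 * μ)) :
    Tendsto (fun d => red g P C r p₀ (x, μ, d)) (𝓝[>] 0) (𝓝 (g (x, μ))) := by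
  rw [tendsto_iff_norm_sub_tendsto_zero]
  have hlim : Tendsto (fun d : ℝ => 20 * Λ * μ * d + j * d) (𝓝[>] 0) (𝓝 0) := by
    have : Continuous fun d : ℝ => 20 * Λ * μ * d + j * d := by fun_prop
    simpa using this.continuousAt.tendsto.mono_left (nhdsWithin_le_nhds (a := (0 : ℝ)))
  refine squeeze_zero' (Eventually.of_forall fun _ => norm_nonneg _) ?_ hlim
  filter_upwards [H.eventually_mem_dom (j := j) (special := special) hμ hx, self_mem_nhdsWithin]
    with d hd hd0
  have h1 := abs_le.1 (H.abs_nb_sol_sub_le hC hd)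
  have h2 : 0 < j * d := mul_pos (by linarith [hC.j_pos.1]) hd0
  rw [Real.norm_eq_abs, abs_le]
  constructor <;> linarith

omit hC in
/-- The sign of the nonlinearity between zero and `2 μ`. -/
theorem LocalModel.sign {μ : ℝ} (hμ : μ ∈ Ioo 0 μ₀) :
    (∀ x ∈ Ioo 0 (um μ), g (x, μ) < 0) ∧ ∀ x ∈ Ioo (um μ) (2 * μ), 0 < g (x, μ) := by
  have hμ0 := hμ.1
  have hΛμ := H.mul_le hμ
  have hmono : StrictMonoOn (deriv fun t => g (t, μ)) (interior (Icc 0 (2 * μ))) := by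
    rw [interior_Icc]
    have e : (deriv fun t => g (t, μ)) = fun t => D1 g (t, μ) :=
      funext fun t => (hasDerivAt_D1 H.smooth t μ).deriv
    rw [e]
    refine strictMonoOn_of_deriv_pos (convex_Ioo _ _)
      (fun t _ => (hasDerivAt_D1 (contDiff_D1 H.smooth) t μ).continuousAt.continuousWithinAt)
      fun t ht => ?_
    rw [interior_Ioo] at ht
    rw [(hasDerivAt_D1 (contDiff_D1 H.smooth) t μ).deriv]
    have := (abs_le.1 (H.d11 μ hμ t ⟨by linarith [ht.1], ht.2.le⟩)).1
    linarith
  have hconv : StrictConvexOn ℝ (Icc 0 (2 * μ)) fun t => g (t, μ) :=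
    hmono.strictConvexOn_of_deriv (convex_Icc _ _)
      (fun t _ => (hasDerivAt_D1 H.smooth t μ).continuousAt.continuousWithinAt)
  have h0 := H.zero μ hμ
  have hu := H.um_zero μ hμ
  have hum := H.um_mem μ hμ
  have key : ∀ x y : ℝ, x ∈ Ioo 0 y → y ≤ 2 * μ → g (x, μ) * y < x * g (y, μ) := fun x y hx hy => by
    have hy0 : 0 < y := hx.1.trans hx.2
    have := hconv.2 (left_mem_Icc.2 (by linarith)) ⟨hy0.le, hy⟩ hy0.ne
      (sub_pos.2 ((div_lt_one hy0).2 hx.2)) (div_pos hx.1 hy0) (sub_add_cancel 1 (x / y))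
    simp only [smul_eq_mul, mul_zero, zero_add, h0] at this
    rw [div_mul_cancel₀ _ hy0.ne', div_mul_eq_mul_div, lt_div_iff₀ hy0] at this
    exact this
  constructor
  · intro x hx
    have := key x (um μ) hx hum.2.le
    rw [hu, mul_zero] at this
    exact neg_of_mul_neg_left this hum.1.le
  · intro x hx
    have := key (um μ) x ⟨hum.1, hx.1⟩ hx.2.le
    rw [hu, zero_mul] at this
    exact pos_of_mul_pos_right this hum.1.le

open _root_.Lattice.IsReduced in
/-- The two zeros of the reduced function converge to the two zeros of the nonlinearity. -/
theorem LocalModel.tendsto_zeros {μ : ℝ} (hμ : μ ∈ Ioo 0 μ₀) :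
    Tendsto (fun d => xm (dom g a K j μ₀ special) (red g P C r p₀) μ d) (𝓝[>] 0) (𝓝 0) ∧
    Tendsto (fun d => xp (dom g a K j μ₀ special) (red g P C r p₀) μ d) (𝓝[>] 0) (𝓝 (um μ)) ∧
    ∀ᶠ d in 𝓝[>] (0 : ℝ), IsNeg (dom g a K j μ₀ special) (red g P C r p₀) μ d := by
  have R := H.isReduced hC
  have hum := H.um_mem μ hμ
  obtain ⟨hneg, hpos⟩ := H.sign hμ
  have hev : ∀ x ∈ Ioo 0 (um μ), ∀ᶠ d in 𝓝[>] (0 : ℝ),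
      IsNeg (dom g a K j μ₀ special) (red g P C r p₀) μ d ∧
      x ∈ Icc (xm (dom g a K j μ₀ special) (red g P C r p₀) μ d)
        (xp (dom g a K j μ₀ special) (red g P C r p₀) μ d) := fun x hx => by
    have hx2 : x ∈ Ioo 0 (2 * μ) := ⟨hx.1, hx.2.trans hum.2⟩
    filter_upwards [H.eventually_mem_dom (j := j) (special := special) hμ hx2,
      (H.tendsto_red hC hμ hx2).eventually (gt_mem_nhds (hneg x hx))] with d h1 h2
    exact ⟨⟨x, h1, h2⟩, R.mem_Icc_of_nonpos h1 ⟨x, h1, h2⟩ h2.le⟩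
  have hhalf : um μ / 2 ∈ Ioo 0 (um μ) := ⟨by linarith [hum.1], by linarith [hum.1]⟩
  have hN := (hev _ hhalf).mono fun d h => h.1
  refine ⟨?_, ?_, hN⟩
  · rw [tendsto_order]
    refine ⟨fun b hb => ?_, fun b hb => ?_⟩
    · filter_upwards [hN] with d hd using hb.trans (R.pos (R.xm_spec hd).1)
    · have hm : min (b / 2) (um μ / 2) ∈ Ioo 0 (um μ) :=
        ⟨lt_min (by linarith) hhalf.1, (min_le_right _ _).trans_lt hhalf.2⟩
      filter_upwards [hev _ hm] with d hd
      exact hd.2.1.trans_lt ((min_le_left _ _).trans_lt (by linarith))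
  · rw [tendsto_order]
    refine ⟨fun b hb => ?_, fun b hb => ?_⟩
    · have hm : max ((b + um μ) / 2) (um μ / 2) ∈ Ioo 0 (um μ) :=
        ⟨hhalf.1.trans_le (le_max_right _ _), max_lt (by linarith) hhalf.2⟩
      filter_upwards [hev _ hm] with d hd
      exact (show b < (b + um μ) / 2 by linarith).trans_le ((le_max_left _ _).trans hd.2.2)
    · have hm : min ((b + um μ) / 2) (um μ / 2 + μ) ∈ Ioo (um μ) (2 * μ) :=
        ⟨lt_min (by linarith) (by linarith [hum.2]), (min_le_right _ _).trans_lt (by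
          linarith [hum.2])⟩
      have hm2 : min ((b + um μ) / 2) (um μ / 2 + μ) ∈ Ioo 0 (2 * μ) := ⟨hum.1.trans hm.1, hm.2⟩
      filter_upwards [hev _ hhalf,
        (H.tendsto_red hC hμ hm2).eventually (lt_mem_nhds (hpos _ hm))] with d hd hd2
      refine lt_of_not_ge fun hle => ?_
      have h1 : min ((b + um μ) / 2) (um μ / 2 + μ) < b :=
        (min_le_left _ _).trans_lt (by linarith)
      have := R.neg_of_mem_Ioo hd.1
        ⟨hd.2.1.trans_lt (hhalf.2.trans hm.1), h1.trans_le hle⟩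
      linarith

end Limit

/-! ### The linearization along the branch -/

section Crossing

variable {Γ : Type} [AddCommGroup Γ] [Fintype Γ] [DecidableEq Γ]

/-- An indexing of the critical orbit by two copies of a finite group of reflections, which acts on
the indices by translation. -/
structure IsOrbitIndex (P C : Set (ℤ × ℤ)) (ι : Γ × Fin 2 → ℤ × ℤ) : Prop where
  inj : Function.Injective ι
  range_eq : range ι = C
  card_le : Fintype.card Γ ≤ 4
  reflection : ∀ g, ∃ ρ : ℤ × ℤ → ℤ × ℤ, Function.Involutive ρ ∧
    (∀ (u : ℤ × ℤ → ℝ) p, nb (fun q => u (ρ q)) p = nb u (ρ p)) ∧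
    (∀ h i, ι (g + h, i) = ρ (ι (h, i))) ∧ (∀ p, ρ p ∈ P ↔ p ∈ P) ∧ ∀ p, ρ p ∈ C ↔ p ∈ C

/-- The potential of the linearization at the zero of the reduced function with given `x`. -/
def pot {g : ℝ × ℝ → ℝ} (hg : ContDiff ℝ ∞ g) (Ω : Set (ℝ × ℝ × ℝ)) (F : ℝ × ℝ × ℝ → ℝ)
    (S : ℝ × ℝ × ℝ → LInf ℝ) (d x : ℝ) : LInf ℝ :=
  nem (D1 g) (contDiff_D1 hg).continuous (S (x, IsReduced.mz Ω F x d, d), IsReduced.mz Ω F x d)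

variable {g : ℝ × ℝ → ℝ} {um up : ℝ → ℝ} {a K Λ r μ₀ : ℝ} {σ : Site} {P C : Set (ℤ × ℤ)}
  {p₀ : ℤ × ℤ} {j : ℝ} {special : Prop} {μ₁ d : ℝ}

open _root_.Lattice.IsReduced

/-- The potential along the branch is differentiable. Where the nonlinearity is nearly critical,
`μ` varies slowly along the branch, and the derivative on the critical orbit is close to two. -/
theorem LocalModel.exists_deriv_pot (H : LocalModel g um up a K Λ r μ₀)
    (hC : IsConfig σ P C p₀ j special) {x : ℝ}
    (hz : HasZero (dom g a K j μ₀ special) (red g P C r p₀) x d) : ∃ V' : LInf ℝ,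
      HasDerivAt (pot H.smooth (dom g a K j μ₀ special) (red g P C r p₀) (sol g P C r) d) V' x ∧
      (|D1 g (x, mz (dom g a K j μ₀ special) (red g P C r p₀) x d)| ≤ 96 * d →
        ‖V'‖ ≤ 7 * Λ ∧ ∃ θ' ≥ 1, ∀ p ∈ C, V' p = θ') := by
  have R := H.isReduced hC
  obtain ⟨hm, h0⟩ := mz_spec hz
  have hmz := R.hasDerivAt_mz hz
  have hpd1 := H.abs_pd1_red_sub_le hC hm
  have hpd2 := H.pd2_red_le hC hm h0
  set μ := mz (dom g a K j μ₀ special) (red g P C r p₀) x d with hμdef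
  set m' := -pd1 (red g P C r p₀) (x, μ, d) / pd2 (red g P C r p₀) (x, μ, d) with hm'
  obtain ⟨v, hv, hv', v1, -⟩ := H.dsol_equation hC
    (c := fun t => (t, mz (dom g a K j μ₀ special) (red g P C r p₀) t d, d)) (x' := 1) (μ' := m')
    (t := x) hm ((hasDerivAt_id x).prodMk (hmz.prodMk (hasDerivAt_const x d))) fun _ => rfl
  have hd1 := contDiff_D1 H.smooth
  refine ⟨nemDeriv (nem _ (contDiff_D1 hd1).continuous (sol g P C r (x, μ, d), μ),
    nem _ (contDiff_D2 hd1).continuous (sol g P C r (x, μ, d), μ)) (v, m'),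
    HasFDerivAt.comp_hasDerivAt x (f := fun t => (sol g P C r (t,
      mz (dom g a K j μ₀ special) (red g P C r p₀) t d, d),
      mz (dom g a K j μ₀ special) (red g P C r p₀) t d)) (hasFDerivAt_nem hd1 _) (hv.prodMk hmz),
    fun hcr => ?_⟩
  obtain ⟨q, hq, hsq, hqq, hΛ2, hΛ, hq1, hdq, hΛμ, hμq⟩ := H.exists_sqrt_dom hC hm
  have hle := H.le_sq_of_dom hC hm
  obtain ⟨hs, hb⟩ := H.sol_spec hC hm
  obtain ⟨hx, hx2, hμ, hd, -⟩ := dom_pos hm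
  have hr := H.inReg hμ hb
  have hμ0 := hμ.1
  have hj := hC.j_pos
  have hΛ1 := H.one_le
  have hdμ : d ≤ 2 / 7 * μ ^ 2 := by nlinarith
  have hxI : x ∈ Icc (-μ) (2 * μ) := ⟨by linarith, hx2.le⟩
  have hxl : 45 / 100 * μ ≤ x := by
    have h1 := (abs_le.1 (H.d1 μ hμ x hxI)).2
    have h2 := (abs_le.1 hcr).1
    have h3 : Λ * μ ^ 2 ≤ 1 / 100 * μ := by
      rw [sq, ← mul_assoc]; exact mul_le_mul_of_nonneg_right (by linarith) hμ0.le
    have h4 : 96 * d ≤ 1 / 100 * μ := by nlinarith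
    linarith
  -- the branch is flat where the nonlinearity is nearly critical
  have hm'le : |m'| ≤ 100 * μ := by
    have h1 : |pd1 (red g P C r p₀) (x, μ, d)| ≤ 104 * d := by
      have h2 := abs_le.1 hpd1
      have h3 := abs_le.1 hcr
      rw [abs_le]; constructor <;> linarith
    have h2 : 36 / 100 * μ ≤ |pd2 (red g P C r p₀) (x, μ, d)| := by
      have := neg_le_abs (pd2 (red g P C r p₀) (x, μ, d))
      linarith
    rw [hm', abs_div, abs_neg, div_le_iff₀ (by linarith)]
    have h3 : 100 * μ * (36 / 100 * μ) ≤ 100 * μ * |pd2 (red g P C r p₀) (x, μ, d)| :=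
      mul_le_mul_of_nonneg_left h2 (by positivity)
    nlinarith
  have hv2 : ∀ p, |v p| ≤ 2 := fun p => by
    have e : v = dsol g P C r (1, 0, 0) (x, μ, d) + m' • dsol g P C r (0, 1, 0) (x, μ, d) := by
      have e0 : ((1, m', 0) : ℝ × ℝ × ℝ) = (1, 0, 0) + m' • (0, 1, 0) := by ext <;> simp
      rw [hv', e0, dsol, dsol, dsol, map_add, map_smul]
    have h1 := (H.abs_dsol_x_le hC hm).1 p
    have h2 := H.abs_dsol_μ_le hC hm p
    rw [hsq] at h2
    have h3 : |m' * dsol g P C r (0, 1, 0) (x, μ, d) p| ≤ 1 := by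
      rw [abs_mul]
      calc _ ≤ 100 * μ * (33 / q) := mul_le_mul hm'le h2 (abs_nonneg _) (by positivity)
        _ = 3300 * q := by rw [hqq]; field_simp; norm_num
        _ ≤ 1 := by linarith
    rw [e]
    change |dsol g P C r (1, 0, 0) (x, μ, d) p + m' * dsol g P C r (0, 1, 0) (x, μ, d) p| ≤ 2
    exact (abs_add_le _ _).trans (by linarith)
  have hderiv : ∀ p, |D1 (D1 g) (sol g P C r (x, μ, d) p, μ)| ≤ 3 * Λ ∧
      |D2 (D1 g) (sol g P C r (x, μ, d) p, μ)| ≤ 2 * Λ := fun p => by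
    by_cases k : p ∈ P
    · have hI := Ioo_subset_Icc_self (hr.onP p k)
      have h1 := H.one_d11 μ hμ _ hI
      have h2 := H.one_d21 μ hμ _ hI
      exact ⟨by linarith, by linarith⟩
    have hI : sol g P C r (x, μ, d) p ∈ Icc (-μ) (2 * μ) := by
      by_cases k2 : p ∈ C
      · rw [hs.1 p k2]; exact hxI
      · exact (H.mem_Icc_of_inReg hμ hr k k2).1
    have h1 := abs_le.1 (H.d11 μ hμ _ hI)
    have h2 := abs_le.1 (H.d21 μ hμ _ hI)
    constructor <;> rw [abs_le] <;> constructor <;> linarith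
  refine ⟨norm_le_of_apply_le fun p => ?_,
    D1 (D1 g) (x, μ) * 1 + m' * D2 (D1 g) (x, μ), ?_, fun p hp => ?_⟩
  · rw [nemDeriv_apply]
    change |D1 (D1 g) (sol g P C r (x, μ, d) p, μ) * v p
      + m' * D2 (D1 g) (sol g P C r (x, μ, d) p, μ)| ≤ _
    obtain ⟨h1, h2⟩ := hderiv p
    refine (abs_add_le _ _).trans ?_
    rw [abs_mul, abs_mul]
    have h3 := mul_le_mul h1 (hv2 p) (abs_nonneg _) (by linarith)
    have h4 : |m'| * |D2 (D1 g) (sol g P C r (x, μ, d) p, μ)| ≤ 1 / 2 * (2 * Λ) :=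
      mul_le_mul (by linarith) h2 (abs_nonneg _) (by norm_num)
    linarith
  · have h1 := (abs_le.1 (H.d11 μ hμ x hxI)).1
    have h2 := abs_le.1 (H.d21 μ hμ x hxI)
    have h3 : |m' * D2 (D1 g) (x, μ)| ≤ 1 / 10 * 2 := by
      rw [abs_mul]
      exact mul_le_mul (by linarith) (abs_le.2 ⟨by linarith, by linarith⟩) (abs_nonneg _)
        (by norm_num)
    have h4 := (abs_le.1 h3).1
    change 1 ≤ _
    linarith
  · rw [nemDeriv_apply, v1 p hp, nem_apply, nem_apply]
    have : (sol g P C r (x, μ, d) p, μ) = (x, μ) := by rw [hs.1 p hp]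
    simp only [this]

/-- The linearizations along the branch, parametrized by `x`, form a crossing family. -/
theorem LocalModel.isCrossingFamily (H : LocalModel g um up a K Λ r μ₀)
    (hC : IsConfig σ P C p₀ j special) {ι : Γ × Fin 2 → ℤ × ℤ} (hI : IsOrbitIndex P C ι)
    (hN : IsNeg (dom g a K j μ₀ special) (red g P C r p₀) μ₁ d)
    (hfar : 2 * √(j * d) + 3000 * Λ * d < μ₁) : ∃ δ,
    IsCrossingFamily ι d δ (xm (dom g a K j μ₀ special) (red g P C r p₀) μ₁ d)
      (xp (dom g a K j μ₀ special) (red g P C r p₀) μ₁ d)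
      (pot H.smooth (dom g a K j μ₀ special) (red g P C r p₀) (sol g P C r) d)
      (fun x => D1 g (x, mz (dom g a K j μ₀ special) (red g P C r p₀) x d)) := by
  have R := H.isReduced hC
  obtain ⟨f1, -, -⟩ := R.fold_spec hN
  set Ω := dom g a K j μ₀ special
  set F := red g P C r p₀
  obtain ⟨q, hq, hsq, hqq, hΛ2, hΛ, hq1, hdq, hΛμ, hμq⟩ := H.exists_sqrt_dom hC f1
  obtain ⟨-, -, hμ, hd, -⟩ := dom_pos f1
  have hΛ1 := H.one_le
  set μl := fold Ω F μ₁ d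
  have hzero : ∀ x ∈ Icc (xm Ω F μ₁ d) (xp Ω F μ₁ d), HasZero Ω F x d ∧ μl ≤ mz Ω F x d :=
    fun x hx => by
      obtain ⟨s, hs, rfl⟩ := R.exists_cv_eq hN hx
      exact ⟨R.hasZero_cv hN hs, R.fold_le_mu hN hs⟩
  have hdq2 : d ^ 2 ≤ 4 / 49 * (q ^ 2 * q ^ 6) := by
    calc d ^ 2 ≤ (2 / 7 * q ^ 4) ^ 2 := pow_le_pow_left₀ hd.le hdq 2
      _ = _ := by ring
  have hq6 : 0 < q ^ 6 := by positivity
  have hfar' : ¬|D1 g (xm Ω F μ₁ d, μ₁)| ≤ 96 * d ∧ ¬|D1 g (xp Ω F μ₁ d, μ₁)| ≤ 96 * d := by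
    obtain ⟨k1, k2, -⟩ := R.xm_spec hN
    obtain ⟨l1, l2, -⟩ := R.xp_spec hN
    constructor <;> intro hle
    · have := (abs_le.1 (H.abs_sub_sqrt_le hC k1 k2 hle)).2; linarith
    · have := (abs_le.1 (H.abs_sub_sqrt_le hC l1 l2 hle)).2; linarith
  refine ⟨q ^ 3 / 64,
    { lt := R.xm_lt_xp hN
      δ_pos := by positivity
      card_le := hI.card_le
      small := ?_
      cont := fun x hx => ?_
      dissipative := fun x hx => ?_
      eq_θ := fun x hx i => ?_
      reflection := fun g => ?_
      left := ?_
      right := ?_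
      cross := fun x hx hθ => ?_ }⟩
  · have e : (q ^ 3 / 64) ^ 2 = q ^ 6 / 4096 := by ring
    have h1 : q ^ 2 * q ^ 6 ≤ 1 / 10 ^ 12 * q ^ 6 :=
      mul_le_mul_of_nonneg_right (by nlinarith) hq6.le
    rw [e]; linarith
  · obtain ⟨V', hV, -⟩ := H.exists_deriv_pot hC (hzero x hx).1
    exact hV.continuousAt.continuousWithinAt
  · obtain ⟨h1, h2⟩ := hzero x hx
    obtain ⟨k1, k2⟩ := mz_spec h1
    obtain ⟨hs, hb⟩ := H.sol_spec hC k1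
    have hμx := (dom_pos k1).2.2.1
    refine ⟨hI.inj, hd, by positivity, fun p hp => ?_⟩
    rw [hI.range_eq] at hp
    refine (H.D1_le_of_inReg hμx (H.inReg hμx hb) hp).trans (neg_le_neg ?_)
    have h3 : μl * √μl ≤ mz Ω F x d * √(mz Ω F x d) :=
      mul_le_mul h2 (Real.sqrt_le_sqrt h2) (Real.sqrt_nonneg _) hμx.1.le
    rw [hsq, hqq] at h3
    linarith
  · have hp : ι i ∈ C := by rw [← hI.range_eq]; exact mem_range_self i
    have := (H.sol_spec hC (mz_spec (hzero x hx).1).1).1.1 _ hp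
    change D1 g (sol g P C r (x, mz Ω F x d, d) (ι i), mz Ω F x d) = _
    rw [this]
  · obtain ⟨ρ, r1, r2, r3, r4, r5⟩ := hI.reflection g
    refine ⟨ρ, r1, r2, r3, fun x hx p => ?_⟩
    have := H.sol_comp hC (mz_spec (hzero x hx).1).1 r2 r4 r5 p
    change D1 _ (sol _ P C r (x, mz Ω F x d, d) (ρ p), mz Ω F x d) = _
    rw [this]; rfl
  · obtain ⟨k1, k2, k3⟩ := R.xm_spec hN
    have h1 := (abs_le.1 (H.abs_pd1_red_sub_le hC k1)).1
    rw [R.mz_eq k1 k2]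
    by_contra! hlt
    exact hfar'.1 (abs_le.2 ⟨hlt, by linarith⟩)
  · obtain ⟨k1, k2, k3⟩ := R.xp_spec hN
    have h1 := (abs_le.1 (H.abs_pd1_red_sub_le hC k1)).2
    rw [R.mz_eq k1 k2]
    by_contra! hlt
    exact hfar'.2 (abs_le.2 ⟨by linarith, hlt⟩)
  · obtain ⟨V', hV, hcr⟩ := H.exists_deriv_pot hC (hzero x (Ioo_subset_Icc_self hx)).1
    obtain ⟨h1, θ', h2, h3⟩ := hcr hθ
    refine ⟨V', θ', hV, fun i => h3 _ (by rw [← hI.range_eq]; exact mem_range_self i), ?_⟩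
    refine lt_of_lt_of_le ?_ h2
    calc 192 * d ^ 2 / (q ^ 3 / 64) ^ 2 * ‖V'‖
        ≤ 192 * (4 / 49 * (q ^ 2 * q ^ 6)) / (q ^ 3 / 64) ^ 2 * (7 * Λ) := by gcongr
      _ = 192 * 4 / 49 * 4096 * 7 * (Λ * q) * q := by field_simp; norm_num
      _ ≤ 192 * 4 / 49 * 4096 * 7 * (1 / 10 ^ 6) * (1 / 10 ^ 6) := by gcongr
      _ < 1 := by norm_num

end Crossing

/-! ### Continuation through the fold -/

section Continuation

variable {Γ : Type} [AddCommGroup Γ] [Fintype Γ] [DecidableEq Γ]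
variable {f : ℝ → ℝ → ℝ} {um up : ℝ → ℝ} {a K Λ r μ₀ : ℝ} {σ : Site} {P C : Set (ℤ × ℤ)}
  {p₀ : ℤ × ℤ} {j : ℝ} {special : Prop}

open _root_.Lattice.IsReduced

/-- The location of the fold, with value zero for vanishing coupling. -/
def foldFun (Ω : Set (ℝ × ℝ × ℝ)) (F : ℝ × ℝ × ℝ → ℝ) (μ₁ d : ℝ) : ℝ :=
  if d ≤ 0 then 0 else fold Ω F μ₁ d

theorem foldFun_of_pos {Ω : Set (ℝ × ℝ × ℝ)} {F : ℝ × ℝ × ℝ → ℝ} {μ₁ d : ℝ} (hd : 0 < d) :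
    foldFun Ω F μ₁ d = fold Ω F μ₁ d := if_neg hd.not_ge

theorem contDiffAt_foldFun {Ω : Set (ℝ × ℝ × ℝ)} {F : ℝ × ℝ × ℝ → ℝ} {μ₁ d : ℝ}
    (R : IsReduced Ω F μ₀) (hd : 0 < d) (h : ∀ᶠ d' in 𝓝 d, IsNeg Ω F μ₁ d') :
    ContDiffAt ℝ ∞ (foldFun Ω F μ₁) d := by
  have h1 : ContDiffAt ℝ ∞ (fun d => fold Ω F μ₁ d) d :=
    ContDiffAt.comp (g := fun q : ℝ × ℝ => mu Ω F μ₁ q.1 q.2) (f := fun d => ((0 : ℝ), d)) d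
      (R.contDiffAt_mu h ⟨by norm_num, by norm_num⟩) (by fun_prop)
  refine h1.congr_of_eventuallyEq ?_
  filter_upwards [lt_mem_nhds hd] with t ht using foldFun_of_pos ht

theorem LocalModel.abs_fold_sub_le {g : ℝ × ℝ → ℝ} (H : LocalModel g um up a K Λ r μ₀)
    (hC : IsConfig σ P C p₀ j special) {μ₁ d : ℝ}
    (hN : IsNeg (dom g a K j μ₀ special) (red g P C r p₀) μ₁ d) :
    |fold (dom g a K j μ₀ special) (red g P C r p₀) μ₁ d - 2 * √j * √d| ≤ 3000 * Λ * d := by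
  obtain ⟨f1, f2, f3⟩ := (H.isReduced hC).fold_spec hN
  have hd := (dom_pos f1).2.2.2.1
  have h1 := H.abs_pd1_red_sub_le hC f1
  rw [f3, zero_sub, abs_neg] at h1
  have h2 := H.abs_sub_sqrt_le hC f1 f2 (h1.trans (by linarith))
  rwa [Real.sqrt_mul (by linarith [hC.j_pos.1]), ← mul_assoc] at h2

/-- A choice of the range of couplings. -/
theorem LocalModel.exists_range {g : ℝ × ℝ → ℝ} (H : LocalModel g um up a K Λ r μ₀)
    (hC : IsConfig σ P C p₀ j special) {μ₁ : ℝ} (hμ₁ : μ₁ ∈ Ioo 0 μ₀) : ∃ d₂ > 0,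
    ∀ d ∈ Ioo 0 d₂, IsNeg (dom g a K j μ₀ special) (red g P C r p₀) μ₁ d ∧
      2 * √(j * d) + 3000 * Λ * d < μ₁ := by
  have hc : ContinuousAt (fun d => 2 * √(j * d) + 3000 * Λ * d) (0 : ℝ) := by fun_prop
  have h1 : ∀ᶠ d in 𝓝[>] (0 : ℝ), 2 * √(j * d) + 3000 * Λ * d < μ₁ :=
    (hc.eventually (gt_mem_nhds (by simpa using hμ₁.1))).filter_mono nhdsWithin_le_nhds
  obtain ⟨d₂, hd₂, hsub⟩ := mem_nhdsGT_iff_exists_Ioo_subset.1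
    ((H.tendsto_zeros hC hμ₁).2.2.and h1)
  exact ⟨d₂, hd₂, fun d hd => hsub hd⟩

theorem LocalModel.tendsto_half {g : ℝ × ℝ → ℝ} (H : LocalModel g um up a K Λ r μ₀)
    (hC : IsConfig σ P C p₀ j special) {μ₁ μ : ℝ} {ξ : ℝ → ℝ → ℝ} {y : ℝ}
    (hξ : Tendsto (fun d => ξ μ d) (𝓝[>] 0) (𝓝 y))
    (hmem : ∀ᶠ d in 𝓝[>] (0 : ℝ), (ξ μ d, μ, d) ∈ dom g a K j μ₀ special)
    (hfold : ∀ᶠ d in 𝓝[>] (0 : ℝ), fold (dom g a K j μ₀ special) (red g P C r p₀) μ₁ d < μ)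
    {w : LInf ℝ} (hP : ∀ p ∈ P, w p = up μ) (hCw : ∀ p ∈ C, w p = y)
    (hZ : ∀ p ∉ P, p ∉ C → w p = 0) :
    Tendsto (fun d => half (dom g a K j μ₀ special) (red g P C r p₀) (sol g P C r) μ₁ ξ μ d)
      (𝓝[>] 0) (𝓝 w) := by
  rw [tendsto_iff_norm_sub_tendsto_zero]
  have hd : Tendsto (fun d : ℝ => 16 * d / (μ * √μ / 32)) (𝓝[>] 0) (𝓝 0) := by
    have : Continuous fun d : ℝ => 16 * d / (μ * √μ / 32) := by fun_prop
    simpa using this.continuousAt.tendsto.mono_left (nhdsWithin_le_nhds (a := (0 : ℝ)))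
  have hx : Tendsto (fun d => |ξ μ d - y|) (𝓝[>] 0) (𝓝 0) := by
    have := (hξ.sub_const y).abs
    simpa using this
  refine squeeze_zero' (Eventually.of_forall fun _ => norm_nonneg _) ?_
    (by simpa using hd.add hx)
  filter_upwards [hmem, hfold] with d h1 h2
  rw [IsResolved.half_of_lt h2]
  exact H.norm_sol_sub_le hC h1 hP hCw hZ

set_option maxHeartbeats 800000 in
/-- A configuration gives rise to a fold at which as many eigenvalues cross as there are critical
sites. -/
theorem IsConfig.continuesThroughFold (hf : IsTranscritical f um up)
    (hC : IsConfig σ P C p₀ j special) {ι : Γ × Fin 2 → ℤ × ℤ} (hI : IsOrbitIndex P C ι)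
    {χ : Γ → Γ → ℤ} (hχ : IsCharTable χ) {k : ℕ} (hk : Fintype.card (Γ × Fin 2) = k)
    {ubar vbar : ℝ → LInf ℝ}
    (hu : ∀ μ, (∀ p ∈ P, ubar μ p = up μ) ∧ ∀ p ∉ P, ubar μ p = 0)
    (hv : ∀ μ, (∀ p ∈ P, vbar μ p = up μ) ∧ (∀ p ∈ C, vbar μ p = um μ) ∧
      ∀ p ∉ P, p ∉ C → vbar μ p = 0) :
    ContinuesThroughFold hf.smooth σ ubar vbar (2 * √j) k := by
  obtain ⟨a, K, Λ, r, μ₀, H⟩ := hf.exists_localModel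
  have R := H.isReduced hC
  have HS := H.isResolved hC
  have hμ₀ := H.μ₀_pos
  have hΛ1 := H.one_le
  have hμ₀1 : μ₀ ≤ 1 := by
    by_contra! hlt
    have h1 : 1 ≤ √μ₀ := Real.one_le_sqrt.2 hlt.le
    have h2 : 1 ≤ Λ ^ 2 := one_le_pow₀ hΛ1
    have := H.small
    nlinarith
  set μ₁ := μ₀ / 2 with hμ₁def
  have hμ₁ : μ₁ ∈ Ioo 0 μ₀ := ⟨by linarith, by linarith⟩
  obtain ⟨d₂, hd₂, hd⟩ := H.exists_range hC hμ₁
  set Ω := dom (fun p : ℝ × ℝ => f p.1 p.2) a K j μ₀ special with hΩ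
  set F := red (fun p : ℝ × ℝ => f p.1 p.2) P C r p₀ with hF
  set S := sol (fun p : ℝ × ℝ => f p.1 p.2) P C r with hS
  have hN : ∀ d ∈ Ioc 0 (d₂ / 2), ∀ᶠ d' in 𝓝 d, IsNeg Ω F μ₁ d' := fun d hd' => by
    filter_upwards [Ioo_mem_nhds hd'.1 (show d < d₂ by linarith [hd'.2])] with t ht
    exact (hd t ht).1
  have hN0 : ∀ d ∈ Ioc 0 (d₂ / 2), IsNeg Ω F μ₁ d := fun d hd' => (hN d hd').self_of_nhds
  have hIoc : ∀ᶠ d in 𝓝[>] (0 : ℝ), d ∈ Ioc 0 (d₂ / 2) := Ioc_mem_nhdsGT (by linarith)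
  have hNμ : ∀ d ∈ Ioc 0 (d₂ / 2), ∀ μ ∈ Ioc (fold Ω F μ₁ d) μ₁, IsNeg Ω F μ d :=
    fun d hd' μ hμ => R.isNeg_of_fold_lt (hN0 d hd') hμ.1 (hμ.2.trans_lt hμ₁.2)
  have hexp : ∀ d ∈ Ioc 0 (d₂ / 2), |fold Ω F μ₁ d - 2 * √j * √d| ≤ 3000 * Λ * d :=
    fun d hd' => H.abs_fold_sub_le hC (hN0 d hd')
  have hfpos : ∀ d ∈ Ioc 0 (d₂ / 2), 0 < fold Ω F μ₁ d := fun d hd' =>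
    (dom_pos (R.fold_spec (hN0 d hd')).1).2.2.1.1
  have hf0 : Tendsto (fun d => fold Ω F μ₁ d) (𝓝[>] 0) (𝓝 0) := by
    have hc : ContinuousAt (fun d => 2 * √j * √d + 3000 * Λ * d) (0 : ℝ) := by fun_prop
    have hc0 := hc.tendsto.mono_left (nhdsWithin_le_nhds (s := Ioi 0))
    simp only [Real.sqrt_zero, mul_zero, add_zero] at hc0
    refine squeeze_zero' (hIoc.mono fun d hd' => (hfpos d hd').le) (hIoc.mono fun d hd' => ?_) hc0
    linarith [(abs_le.1 (hexp d hd')).2]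
  have hμI : ∀ μ ∈ Ioc 0 μ₁, μ ∈ Ioo 0 μ₀ := fun μ hμ => ⟨hμ.1, hμ.2.trans_lt hμ₁.2⟩
  have hcross := fun d (hd' : d ∈ Ioc 0 (d₂ / 2)) => H.isCrossingFamily hC hI (hN0 d hd')
    (hd d ⟨hd'.1, by linarith [hd'.2]⟩).2
  have hlin : ∀ s d, linearization hf.smooth (onBranch Ω F S μ₁ s d) (mu Ω F μ₁ s d) d
      = hop d (cx (pot H.smooth Ω F S d (cv Ω F μ₁ s d))) := fun s d =>
    linearization_eq_hop hf.smooth _ _ d fun p => D1_eq_fu H.smooth _ _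
  refine ⟨d₂ / 2, by positivity, μ₁, ⟨hμ₁.1, by linarith⟩, foldFun Ω F μ₁,
    fun μ d => half Ω F S μ₁ (xm Ω F) μ d, fun μ d => half Ω F S μ₁ (xp Ω F) μ d,
    onBranch Ω F S μ₁, mu Ω F μ₁, fun d hd' => ?_, fun d hd' => ?_, if_pos le_rfl, fun d hd' => ?_,
    ?_, fun d hd' μ hμ => ?_, fun d hd' μ hμ heq => ?_, fun ⟨μ, d⟩ hq => ?_, fun ⟨μ, d⟩ hq => ?_,
    fun μ hμ => ?_, fun ⟨s, d⟩ hq => ?_, fun ⟨s, d⟩ hq => ?_, fun d hd' => ?_, fun d hd' => ?_,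
    fun ε hε => ?_⟩
  · rcases hd'.1.eq_or_lt with rfl | hpos
    · refine ContinuousWithinAt.mono (t := Ici 0) ?_ Icc_subset_Ici_self
      rw [← continuousWithinAt_Ioi_iff_Ici, ContinuousWithinAt, foldFun, if_pos le_rfl]
      refine hf0.congr' ?_
      filter_upwards [self_mem_nhdsWithin] with d hd0 using (foldFun_of_pos hd0).symm
    · exact (contDiffAt_foldFun R hpos (hN d ⟨hpos, hd'.2⟩)).continuousAt.continuousWithinAt
  · exact (contDiffAt_foldFun R hd'.1 (hN d hd')).contDiffWithinAt
  · rw [foldFun_of_pos hd'.1]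
    exact ⟨hfpos d hd', R.fold_lt (hN0 d hd')⟩
  · refine IsBigO.of_bound (3000 * Λ) (hIoc.mono fun d hd' => ?_)
    rw [foldFun_of_pos hd'.1, Real.norm_eq_abs, Real.norm_eq_abs, abs_of_pos hd'.1]
    exact hexp d hd'
  · rw [foldFun_of_pos hd'.1] at hμ
    obtain ⟨k1, k2⟩ := HS.half_spec R (hN0 d hd') (ξ := xm Ω F) hμ.1 fun hlt =>
      ⟨(R.xm_spec (hNμ d hd' μ ⟨hlt, hμ.2⟩)).1, (R.xm_spec (hNμ d hd' μ ⟨hlt, hμ.2⟩)).2.1⟩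
    obtain ⟨k3, k4⟩ := HS.half_spec R (hN0 d hd') (ξ := xp Ω F) hμ.1 fun hlt =>
      ⟨(R.xp_spec (hNμ d hd' μ ⟨hlt, hμ.2⟩)).1, (R.xp_spec (hNμ d hd' μ ⟨hlt, hμ.2⟩)).2.1⟩
    exact ⟨k1, k2, k3, k4⟩
  · rw [foldFun_of_pos hd'.1] at hμ
    have hn := hNμ d hd' μ hμ
    simp only at heq
    rw [IsResolved.half_of_lt hμ.1, IsResolved.half_of_lt hμ.1] at heq
    have h1 := HS.apply_eq _ _ _ (R.xm_spec hn).1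
    rw [heq, HS.apply_eq _ _ _ (R.xp_spec hn).1] at h1
    exact (R.xm_lt_xp hn).ne' h1
  · obtain ⟨hd', hμ⟩ := hq
    simp only at hd' hμ
    rw [foldFun_of_pos hd'.1] at hμ
    have hn := hNμ d hd' μ hμ
    exact (HS.contDiffAt_half R (hN d hd') hμ.1 (R.contDiffAt_xm hn)
      (R.xm_spec hn).1).contDiffWithinAt
  · obtain ⟨hd', hμ⟩ := hq
    simp only at hd' hμ
    rw [foldFun_of_pos hd'.1] at hμ
    have hn := hNμ d hd' μ hμ
    exact (HS.contDiffAt_half R (hN d hd') hμ.1 (R.contDiffAt_xp hn)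
      (R.xp_spec hn).1).contDiffWithinAt
  · obtain ⟨z1, z2, z3⟩ := H.tendsto_zeros hC (hμI μ hμ)
    have hfl := hf0.eventually (gt_mem_nhds hμ.1)
    refine ⟨H.tendsto_half hC z1 (z3.mono fun d h => (R.xm_spec h).1) hfl (hu μ).1
      (fun p hp => (hu μ).2 p fun h => hC.disj p h hp) fun p hp _ => (hu μ).2 p hp,
      H.tendsto_half hC z2 (z3.mono fun d h => (R.xp_spec h).1) hfl (hv μ).1
      (hv μ).2.1 (hv μ).2.2⟩
  · exact (HS.contDiffAt_onBranch R (hN d hq.2) hq.1).contDiffWithinAt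
  · exact (R.contDiffAt_mu (hN d hq.2) hq.1).contDiffWithinAt
  · rw [foldFun_of_pos hd'.1]
    exact HS.isFoldBranch R (hN d hd')
  · have hn := hN0 d hd'
    obtain ⟨δ, hδ⟩ := hcross d hd'
    exact hδ.eigenvaluesCross hχ (X := fun s => cv Ω F μ₁ s d)
      (fun s hs => (R.hasDerivAt_cv hn hs).continuousAt.continuousWithinAt)
      (R.strictMonoOn_cv hn) (R.cv_neg_one hn) (R.cv_one hn)
      (fun s hs => ⟨_, R.cv'_pos hn (Ioo_subset_Icc_self hs),
        R.hasDerivAt_cv hn (Ioo_subset_Icc_self hs)⟩) (fun s _ => hlin s d) hk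
  · -- at a crossing, both `μ` and the fold are within `O(d)` of `2 √(j d)`, and `d ≤ μl ^ 2`
    refine ⟨(ε / (6000 * Λ)) ^ 2, by positivity, fun d hd' hlt s hs h0 => ?_⟩
    have hn := hN0 d hd'
    obtain ⟨δ, hδ⟩ := hcross d hd'
    rw [hlin] at h0
    have hθ := hδ.abs_le_of_zero_mem_spectrum hχ (R.cv_mem hn hs) h0
    obtain ⟨k1, k2⟩ := R.mu_spec hn hs
    have h1 := (abs_le.1 (H.abs_sub_sqrt_le hC k1 k2 hθ)).2
    rw [Real.sqrt_mul (by linarith [hC.j_pos.1]), ← mul_assoc] at h1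
    have h2 := (abs_le.1 (hexp d hd')).1
    have h3 := H.le_sq_of_dom hC (R.fold_spec hn).1
    have hfp := hfpos d hd'
    have h4 : √d ≤ fold Ω F μ₁ d := by
      rw [← Real.sqrt_sq hfp.le]
      refine Real.sqrt_le_sqrt ?_
      have := hC.j_pos.1
      nlinarith [hd'.1]
    have h5 : √d ≤ ε / (6000 * Λ) := by
      rw [← Real.sqrt_sq (show 0 ≤ ε / (6000 * Λ) by positivity)]
      exact Real.sqrt_le_sqrt hlt.le
    have h6 : 6000 * Λ * d ≤ ε * fold Ω F μ₁ d := by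
      have h7 : 6000 * Λ * √d ≤ ε := by
        rw [le_div_iff₀ (by positivity)] at h5
        linarith
      calc 6000 * Λ * d = 6000 * Λ * √d * √d := by
            rw [mul_assoc (6000 * Λ), Real.mul_self_sqrt hd'.1.le]
        _ ≤ _ := mul_le_mul h7 h4 (Real.sqrt_nonneg _) hε.le
    rw [foldFun_of_pos hd'.1]
    linarith

end Continuation

/-! ### Configurations of patches -/

section Patches

variable {σ : Site} {N M A B : ℤ}

theorem Site.c_eq (σ : Site) : σ.c = 1 ∨ σ.c = 2 := by cases σ <;> simp [Site.c]

/-- The larger coordinate of the representative of a site in the wedge `1 ≤ m ≤ n`. -/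
def Site.hi (σ : Site) (p : ℤ × ℤ) : ℤ := max (max p.1 (σ.c - p.1)) (max p.2 (σ.c - p.2))

/-- The smaller coordinate of the representative of a site in the wedge `1 ≤ m ≤ n`. -/
def Site.lo (σ : Site) (p : ℤ × ℤ) : ℤ := min (max p.1 (σ.c - p.1)) (max p.2 (σ.c - p.2))

/-- The sites at which `ū^{(N,M)}` is nonzero. -/
def upSet (σ : Site) (N M : ℤ) : Set (ℤ × ℤ) := {p | σ.hi p < N ∨ σ.hi p = N ∧ σ.lo p ≤ M}

/-- The orbit of `(A, B)`. -/
def orbitSet (σ : Site) (A B : ℤ) : Set (ℤ × ℤ) := {p | σ.hi p = A ∧ σ.lo p = B}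

theorem Site.wedge (σ : Site) (p : ℤ × ℤ) : 1 ≤ σ.lo p ∧ σ.lo p ≤ σ.hi p := by
  have := σ.c_eq
  unfold Site.hi Site.lo
  omega

theorem Site.hi_lo_of_wedge (σ : Site) {n m : ℤ} (hm : 1 ≤ m) (hmn : m ≤ n) :
    σ.hi (n, m) = n ∧ σ.lo (n, m) = m := by
  have := σ.c_eq
  unfold Site.hi Site.lo
  simp only
  omega

/-- The reflection `x ↦ c - x`, or the identity. -/
def Site.refl (σ : Site) (s : ZMod 2) (x : ℤ) : ℤ := if s = 0 then x else σ.c - x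

theorem Site.refl_eq (σ : Site) (s : ZMod 2) (x : ℤ) :
    σ.refl s x = x ∨ σ.refl s x = σ.c - x := by
  unfold Site.refl; split_ifs <;> simp

theorem Site.refl_add (σ : Site) (s t : ZMod 2) (x : ℤ) :
    σ.refl (s + t) x = σ.refl s (σ.refl t x) := by
  have h : ∀ s t : ZMod 2, (s + t = 0 ↔ (s = 0 ↔ t = 0)) := by decide
  unfold Site.refl
  by_cases hs : s = 0 <;> by_cases ht : t = 0 <;> simp [h, hs, ht]

theorem Site.max_refl (σ : Site) (s : ZMod 2) (x : ℤ) :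
    max (σ.refl s x) (σ.c - σ.refl s x) = max x (σ.c - x) := by
  rcases σ.refl_eq s x with h | h
  · rw [h]
  · rw [h]; omega

theorem Site.hi_refl (σ : Site) (s t : ZMod 2) (p : ℤ × ℤ) :
    σ.hi (σ.refl s p.1, σ.refl t p.2) = σ.hi p ∧ σ.lo (σ.refl s p.1, σ.refl t p.2) = σ.lo p := by
  simp only [Site.hi, Site.lo, σ.max_refl, and_self]

theorem nb_refl (σ : Site) (s t : ZMod 2) (u : ℤ × ℤ → ℝ) (p : ℤ × ℤ) :
    nb (fun q => u (σ.refl s q.1, σ.refl t q.2)) p = nb u (σ.refl s p.1, σ.refl t p.2) := by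
  have e : ∀ x : ℤ, σ.c - (x + 1) = σ.c - x - 1 ∧ σ.c - (x - 1) = σ.c - x + 1 := fun x =>
    ⟨by ring, by ring⟩
  unfold nb Site.refl
  by_cases hs : s = 0 <;> by_cases ht : t = 0 <;>
    simp only [hs, ht, if_true, if_false, (e _).1, (e _).2] <;> ring

theorem Site.hi_flip (σ : Site) (p : ℤ × ℤ) :
    σ.hi (σ.flip p) = σ.hi p ∧ σ.lo (σ.flip p) = σ.lo p := by
  have := σ.hi_refl 1 0 p
  simpa [Site.refl, Site.flip] using this

theorem Site.hi_swap (σ : Site) (p : ℤ × ℤ) : σ.hi p.swap = σ.hi p ∧ σ.lo p.swap = σ.lo p :=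
  ⟨max_comm _ _, min_comm _ _⟩

theorem IsD4Symmetric.eq_wedge {w : ℤ × ℤ → ℝ} (hw : IsD4Symmetric σ w) (p : ℤ × ℤ) :
    w p = w (σ.hi p, σ.lo p) := by
  have h1 : ∀ n m, w (max n (σ.c - n), m) = w (n, m) := fun n m => by
    rcases max_choice n (σ.c - n) with h | h <;> rw [h]
    exact (hw n m).1
  have h2 : w (max p.1 (σ.c - p.1), max p.2 (σ.c - p.2)) = w p := by
    rw [h1, ← (hw _ _).2, h1, (hw _ _).2]
  unfold Site.hi Site.lo
  rcases le_total (max p.1 (σ.c - p.1)) (max p.2 (σ.c - p.2)) with h | h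
  · rw [max_eq_right h, min_eq_left h, ← h2]
    exact (hw _ _).2.symm
  · rw [max_eq_left h, min_eq_right h, h2]

/-- Sets that are described by the representative in the wedge have a symmetric indicator. -/
theorem nb_ind_eq {S : Set (ℤ × ℤ)}
    (hS : ∀ p q, σ.hi p = σ.hi q ∧ σ.lo p = σ.lo q → (p ∈ S ↔ q ∈ S)) (p : ℤ × ℤ) :
    nb (ind ℝ S) p = nb (ind ℝ S) (σ.hi p, σ.lo p) := by
  have key : ∀ p q, σ.hi p = σ.hi q ∧ σ.lo p = σ.lo q → ind ℝ S p = ind ℝ S q := fun p q hpq => by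
    by_cases h : p ∈ S
    · rw [ind_of_mem h, ind_of_mem ((hS p q hpq).1 h)]
    · rw [ind_of_notMem h, ind_of_notMem fun h' => h ((hS p q hpq).2 h')]
  have hsym : IsD4Symmetric σ (ind ℝ S) := fun n m =>
    ⟨key _ _ (σ.hi_flip (n, m)), key _ _ (σ.hi_swap (n, m))⟩
  exact hsym.nb_isD4Symmetric.eq_wedge p

open Classical in
theorem nb_ind (S : Set (ℤ × ℤ)) (n m : ℤ) : nb (ind ℝ S) (n, m)
    = (if (n + 1, m) ∈ S then 1 else 0) + (if (n - 1, m) ∈ S then 1 else 0)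
      + (if (n, m + 1) ∈ S then 1 else 0) + (if (n, m - 1) ∈ S then 1 else 0) := by
  have : ∀ p, ind ℝ S p = if p ∈ S then 1 else 0 := fun p => by
    split_ifs with h
    · exact ind_of_mem h
    · exact ind_of_notMem h
  unfold nb
  simp only [this]

theorem upSet_congr {p q : ℤ × ℤ} (h : σ.hi p = σ.hi q ∧ σ.lo p = σ.lo q) :
    p ∈ upSet σ N M ↔ q ∈ upSet σ N M := by
  unfold upSet; simp only [mem_ofPred_eq, h]

theorem orbitSet_congr {p q : ℤ × ℤ} (h : σ.hi p = σ.hi q ∧ σ.lo p = σ.lo q) :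
    p ∈ orbitSet σ A B ↔ q ∈ orbitSet σ A B := by
  unfold orbitSet; simp only [mem_ofPred_eq, h]

/-- Where a site of the wedge next to a patch `hi < N`, or `hi = N` and `lo ≤ M`, has neighbours in
the patch. -/
theorem nb_upSet {n m : ℤ} (hm : 1 ≤ m) (hmn : m ≤ n) (hM : 1 ≤ M) (hMN : M ≤ N)
    (hp : (n, m) ∉ upSet σ N M) : nb (ind ℝ (upSet σ N M)) (n, m)
      = if n = N ∧ m = M + 1 then 2 else if n = N + 1 ∧ m ≤ M ∨ n = N ∧ m < N then 1 else 0 := by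
  have hc := σ.c_eq
  have e : ∀ q, q ∈ upSet σ N M ↔ σ.hi q < N ∨ σ.hi q = N ∧ σ.lo q ≤ M := fun _ => Iff.rfl
  rw [e, (σ.hi_lo_of_wedge hm hmn).1, (σ.hi_lo_of_wedge hm hmn).2] at hp
  have h0 : ¬(n + 1, m) ∈ upSet σ N M := by
    rw [e, (σ.hi_lo_of_wedge hm (show m ≤ n + 1 by omega)).1]; omega
  have h1 : (n - 1, m) ∈ upSet σ N M ↔
      (n = N + 1 ∧ m ≤ M) ∨ (n = N ∧ m < N) ∨ (n = N ∧ m = N ∧ N = M + 1) := by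
    rw [e]; unfold Site.hi Site.lo; simp only; omega
  have h2 : ¬(n, m + 1) ∈ upSet σ N M := by rw [e]; unfold Site.hi Site.lo; simp only; omega
  have h3 : (n, m - 1) ∈ upSet σ N M ↔ n = N ∧ m = M + 1 := by
    rw [e]; unfold Site.hi Site.lo; simp only; omega
  rw [nb_ind, if_neg h0, if_neg h2]
  simp only [h1, h3]
  split_ifs <;> first | (norm_num; done) | (exfalso; omega)

theorem nb_upSet_eq (hM : 1 ≤ M) (hMN : M ≤ N) {p : ℤ × ℤ} (hp : p ∉ upSet σ N M) :
    nb (ind ℝ (upSet σ N M)) p = if σ.hi p = N ∧ σ.lo p = M + 1 then 2 else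
      if σ.hi p = N + 1 ∧ σ.lo p ≤ M ∨ σ.hi p = N ∧ σ.lo p < N then 1 else 0 := by
  obtain ⟨h1, h2⟩ := σ.wedge p
  have h34 : _ ∧ _ := ⟨(σ.hi_lo_of_wedge h1 h2).1.symm, (σ.hi_lo_of_wedge h1 h2).2.symm⟩
  rw [nb_ind_eq (fun _ _ => upSet_congr) p, nb_upSet h1 h2 hM hMN ((upSet_congr h34).not.1 hp)]

theorem orbitSet_orbit {w : ℤ × ℤ → ℝ} (hw : IsD4Symmetric σ w) {p : ℤ × ℤ}
    (hp : p ∈ orbitSet σ A B) : w p = w (A, B) := by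
  rw [hw.eq_wedge p, hp.1, hp.2]

/-- Adding a site to an incomplete side of a patch. -/
theorem isConfig_side (hM : 1 ≤ M) (hMN : M + 1 ≤ N) :
    IsConfig σ (upSet σ N M) (orbitSet σ N (M + 1)) (N, M + 1) 2 False where
  mem := σ.hi_lo_of_wedge (by omega) hMN
  disj p hp hp' := by
    unfold upSet at hp; unfold orbitSet at hp'; simp only [mem_ofPred_eq] at hp hp'; omega
  flip_P p := upSet_congr (σ.hi_flip p)
  swap_P p := upSet_congr (σ.hi_swap p)
  flip_C p := orbitSet_congr (σ.hi_flip p)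
  swap_C p := orbitSet_congr (σ.hi_swap p)
  orbit w hw p hp := orbitSet_orbit hw hp
  nb_C p hp := by
    have hp' : p ∉ upSet σ N M := fun h => by
      unfold upSet at h; unfold orbitSet at hp; simp only [mem_ofPred_eq] at h hp; omega
    rw [nb_upSet_eq hM (by omega) hp']
    exact if_pos hp
  nb_Z p hp hp' := by
    have hp₂ : ¬(σ.hi p = N ∧ σ.lo p = M + 1) := hp'
    rw [nb_upSet_eq hM (by omega) hp, if_neg hp₂]
    split_ifs <;> simp
  j_eq := Or.inr rfl
  ordinary _ h := by norm_num at h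
  special_j h := h.elim
  special_Y h := h.elim
  special_C h := h.elim

/-- Starting a new side of a square patch. -/
theorem isConfig_square (hN : N = 1 ∨ N = 2) :
    IsConfig σ (upSet σ N N) (orbitSet σ (N + 1) 1) (N + 1, 1) 1 (N = 2) := by
  have hnb : ∀ p ∉ upSet σ N N, nb (ind ℝ (upSet σ N N)) p
      = if σ.hi p = N + 1 ∧ σ.lo p ≤ N then 1 else 0 := fun p hp => by
    have hw := σ.wedge p
    rw [nb_upSet_eq (by omega) le_rfl hp, if_neg (by omega)]
    unfold upSet at hp
    simp only [mem_ofPred_eq] at hp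
    split_ifs <;> first | rfl | (exfalso; omega)
  have hdisj : ∀ p ∈ upSet σ N N, p ∉ orbitSet σ (N + 1) 1 := fun p hp hp' => by
    unfold upSet at hp; unfold orbitSet at hp'; simp only [mem_ofPred_eq] at hp hp'; omega
  have hY : N = 2 → bdry (upSet σ N N) (orbitSet σ (N + 1) 1) = orbitSet σ 3 2 := by
    rintro rfl
    ext p
    have hw := σ.wedge p
    constructor
    · rintro ⟨h1, h2, h3⟩
      rw [hnb p h1] at h3
      unfold orbitSet at h2 ⊢
      simp only [mem_ofPred_eq] at h2 ⊢
      have : σ.hi p = 2 + 1 ∧ σ.lo p ≤ 2 := by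
        by_contra h; exact h3 (if_neg h)
      omega
    · intro h
      unfold orbitSet at h
      simp only [mem_ofPred_eq] at h
      have h1 : p ∉ upSet σ 2 2 := by unfold upSet; simp only [mem_ofPred_eq]; omega
      refine ⟨h1, by unfold orbitSet; simp only [mem_ofPred_eq]; omega, ?_⟩
      rw [hnb p h1, if_pos (by omega)]
      exact one_ne_zero
  have hc := σ.c_eq
  refine
    { mem := σ.hi_lo_of_wedge le_rfl (by omega)
      disj := hdisj
      flip_P := fun p => upSet_congr (σ.hi_flip p)
      swap_P := fun p => upSet_congr (σ.hi_swap p)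
      flip_C := fun p => orbitSet_congr (σ.hi_flip p)
      swap_C := fun p => orbitSet_congr (σ.hi_swap p)
      orbit := fun w hw p hp => orbitSet_orbit hw hp
      nb_C := fun p hp => ?_
      nb_Z := fun p hp _ => ?_
      j_eq := Or.inl rfl
      ordinary := fun h _ p hp hp' => ?_
      special_j := fun _ => rfl
      special_Y := fun h p hp => ?_
      special_C := fun h => ?_ }
  · rw [hnb p fun h => hdisj p h hp]
    unfold orbitSet at hp
    simp only [mem_ofPred_eq] at hp
    exact if_pos (by omega)
  · rw [hnb p hp]; split_ifs <;> simp
  · have hw := σ.wedge p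
    rw [hnb p hp]
    unfold orbitSet at hp'
    simp only [mem_ofPred_eq] at hp'
    exact if_neg (by omega)
  · rw [hY h] at hp ⊢
    subst h
    rw [nb_ind_eq (fun _ _ => orbitSet_congr) p,
      nb_ind_eq (S := orbitSet σ 3 2) (fun _ _ => orbitSet_congr) p, hp.1, hp.2, nb_ind, nb_ind]
    unfold orbitSet Site.hi Site.lo
    simp only [mem_ofPred_eq]
    constructor <;> split_ifs <;> first | (norm_num; done) | (exfalso; omega)
  · rw [hY h]
    subst h
    rw [nb_ind, nb_ind]
    unfold orbitSet Site.hi Site.lo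
    simp only [mem_ofPred_eq]
    rcases hc with hc | hc <;> simp only [hc] <;> norm_num

theorem mem_orbitSet {p : ℤ × ℤ} (hA : A ≥ 1) (hB : B ≥ 1) (hBA : B ≤ A) : p ∈ orbitSet σ A B ↔
    (p.1 = A ∨ p.1 = σ.c - A) ∧ (p.2 = B ∨ p.2 = σ.c - B) ∨
      (p.1 = B ∨ p.1 = σ.c - B) ∧ (p.2 = A ∨ p.2 = σ.c - A) := by
  have := σ.c_eq
  unfold orbitSet Site.hi Site.lo
  simp only [mem_ofPred_eq]
  omega

section Index

variable {Γ : Type} [AddCommGroup Γ] [Fintype Γ] [DecidableEq Γ]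

/-- Indexing an orbit by two base points and a group of reflections in both coordinates. -/
theorem isOrbitIndex_of_base {s t : Γ → ZMod 2} (hs : ∀ g h, s (g + h) = s g + s h)
    (ht : ∀ g h, t (g + h) = t g + t h) (b : Fin 2 → ℤ × ℤ) (hcard : Fintype.card Γ ≤ 4)
    (hinj : Function.Injective fun i : Γ × Fin 2 =>
      (σ.refl (s i.1) (b i.2).1, σ.refl (t i.1) (b i.2).2))
    (hrange : range (fun i : Γ × Fin 2 =>
      (σ.refl (s i.1) (b i.2).1, σ.refl (t i.1) (b i.2).2)) = orbitSet σ A B) :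
    IsOrbitIndex (upSet σ N M) (orbitSet σ A B) fun i : Γ × Fin 2 =>
      (σ.refl (s i.1) (b i.2).1, σ.refl (t i.1) (b i.2).2) where
  inj := hinj
  range_eq := hrange
  card_le := hcard
  reflection g := by
    have h2 : ∀ z : ZMod 2, z + z = 0 := by decide
    refine ⟨fun p => (σ.refl (s g) p.1, σ.refl (t g) p.2), fun p => ?_, nb_refl σ _ _,
      fun h i => ?_, fun p => upSet_congr (σ.hi_refl (s g) (t g) p),
      fun p => orbitSet_congr (σ.hi_refl (s g) (t g) p)⟩
    · simp only [← σ.refl_add, h2]; simp [Site.refl]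
    · simp only [hs, ht, σ.refl_add]

theorem forall_zmod_two {p : ZMod 2 → Prop} (h0 : p 0) (h1 : p 1) (s : ZMod 2) : p s := by
  have : s = 0 ∨ s = 1 := by revert s; decide
  rcases this with rfl | rfl
  · exact h0
  · exact h1

theorem Site.refl_zero (σ : Site) (x : ℤ) : σ.refl 0 x = x := if_pos rfl

theorem Site.refl_one (σ : Site) (x : ℤ) : σ.refl 1 x = σ.c - x := if_neg (by decide)

/-- An orbit of eight sites. -/
theorem isOrbitIndex_eight (hB : 1 ≤ B) (hBA : B < A) (h : σ.c ≠ 2 * B) :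
    IsOrbitIndex (upSet σ N M) (orbitSet σ A B) fun i : (ZMod 2 × ZMod 2) × Fin 2 =>
      (σ.refl i.1.1 (if i.2 = 0 then (A, B) else (B, A)).1,
        σ.refl i.1.2 (if i.2 = 0 then (A, B) else (B, A)).2) := by
  have hc := σ.c_eq
  refine isOrbitIndex_of_base (s := Prod.fst) (t := Prod.snd) (fun _ _ => rfl) (fun _ _ => rfl)
    (fun i : Fin 2 => if i = 0 then (A, B) else (B, A)) (by simp) ?_ ?_
  · rintro ⟨⟨s, t⟩, i⟩ ⟨⟨s', t'⟩, i'⟩ heq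
    obtain ⟨h1, h2⟩ := Prod.ext_iff.1 heq
    simp only at h1 h2
    revert h1 h2
    fin_cases i <;> fin_cases i' <;> revert s t s' t' <;>
    refine forall_zmod_two (forall_zmod_two (forall_zmod_two (forall_zmod_two ?_ ?_)
      (forall_zmod_two ?_ ?_)) (forall_zmod_two (forall_zmod_two ?_ ?_) (forall_zmod_two ?_ ?_)))
      (forall_zmod_two (forall_zmod_two (forall_zmod_two ?_ ?_)
      (forall_zmod_two ?_ ?_)) (forall_zmod_two (forall_zmod_two ?_ ?_) (forall_zmod_two ?_ ?_)))
      <;> intro _ h1 h2 <;> simp [Site.refl_zero, Site.refl_one] at h1 h2 ⊢ <;> omega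
  · ext p
    rw [mem_orbitSet (by omega) hB hBA.le]
    constructor
    · rintro ⟨⟨⟨s, t⟩, i⟩, rfl⟩
      simp only
      have h1 := σ.refl_eq s A
      have h2 := σ.refl_eq s B
      have h3 := σ.refl_eq t A
      have h4 := σ.refl_eq t B
      split_ifs
      · exact Or.inl ⟨h1, h4⟩
      · exact Or.inr ⟨h2, h3⟩
    · have key : ∀ x y, x = y ∨ x = σ.c - y → ∃ s, σ.refl s y = x := by
        rintro x y (rfl | rfl)
        · exact ⟨0, σ.refl_zero _⟩
        · exact ⟨1, σ.refl_one _⟩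
      rintro (⟨h1, h2⟩ | ⟨h1, h2⟩) <;> obtain ⟨s, hs⟩ := key _ _ h1 <;>
        obtain ⟨t, ht⟩ := key _ _ h2
      · exact ⟨((s, t), 0), Prod.ext hs ht⟩
      · exact ⟨((s, t), 1), Prod.ext hs ht⟩

/-- An orbit of four sites with base points `b₀` and `b₁`, on which the point reflection acts. -/
theorem isOrbitIndex_four {b₀ b₁ : ℤ × ℤ} (h0 : σ.c ≠ 2 * b₀.1 ∨ σ.c ≠ 2 * b₀.2)
    (h1 : σ.c ≠ 2 * b₁.1 ∨ σ.c ≠ 2 * b₁.2) (hne : b₀ ≠ b₁)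
    (hne' : b₀ ≠ (σ.c - b₁.1, σ.c - b₁.2))
    (hmem : ∀ p, p ∈ orbitSet σ A B ↔ p = b₀ ∨ p = (σ.c - b₀.1, σ.c - b₀.2) ∨ p = b₁ ∨
      p = (σ.c - b₁.1, σ.c - b₁.2)) :
    IsOrbitIndex (upSet σ N M) (orbitSet σ A B) fun i : ZMod 2 × Fin 2 =>
      (σ.refl i.1 (if i.2 = 0 then b₀ else b₁).1, σ.refl i.1 (if i.2 = 0 then b₀ else b₁).2) := by
  have hc := σ.c_eq
  rw [Ne, Prod.ext_iff] at hne hne'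
  refine isOrbitIndex_of_base (s := id) (t := id) (fun _ _ => rfl) (fun _ _ => rfl)
    (fun i : Fin 2 => if i = 0 then b₀ else b₁) (by simp) ?_ ?_
  · rintro ⟨s, i⟩ ⟨s', i'⟩ heq
    obtain ⟨h2, h3⟩ := Prod.ext_iff.1 heq
    simp only [id] at h2 h3
    revert h2 h3
    fin_cases i <;> fin_cases i' <;> revert s s' <;>
    refine forall_zmod_two (forall_zmod_two ?_ ?_) (forall_zmod_two ?_ ?_)
      <;> intro _ h2 h3 <;> simp [Site.refl_zero, Site.refl_one] at h2 h3 ⊢ <;> omega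
  · ext p
    rw [hmem]
    constructor
    · rintro ⟨⟨s, i⟩, rfl⟩
      revert s
      fin_cases i <;> refine forall_zmod_two ?_ ?_ <;> simp [Site.refl_zero, Site.refl_one]
    · rintro (rfl | rfl | rfl | rfl)
      · exact ⟨(0, 0), Prod.ext (σ.refl_zero _) (σ.refl_zero _)⟩
      · exact ⟨(1, 0), Prod.ext (σ.refl_one _) (σ.refl_one _)⟩
      · exact ⟨(0, 1), Prod.ext (σ.refl_zero _) (σ.refl_zero _)⟩
      · exact ⟨(1, 1), Prod.ext (σ.refl_one _) (σ.refl_one _)⟩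

end Index

end Patches

/-! ### The patterns on the wedge -/

theorem patternU_spec (σ : Site) (a : ℝ) (N M : ℤ) :
    (∀ p ∈ upSet σ N M, patternU σ a N M p = a) ∧ ∀ p ∉ upSet σ N M, patternU σ a N M p = 0 := by
  have e : ∀ p, patternU σ a N M p = wedgeU a N M (σ.hi p) (σ.lo p) := fun _ => rfl
  refine ⟨fun p hp => ?_, fun p hp => ?_⟩ <;> have hw := σ.wedge p <;>
    unfold upSet at hp <;> simp only [mem_ofPred_eq] at hp <;> rw [e] <;> unfold wedgeU
  · exact if_pos (by omega)
  · exact if_neg (by omega)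

/-- `v̄^{(A,B)}` arises from `ū^{(N,M)}` by putting `u₋` on the orbit of `(A, B)`, if `(A, B)` is
the site that follows `(N, M)` in the order in which the wedge is filled. -/
theorem patternV_spec (σ : Site) (b a : ℝ) {N M A B : ℤ}
    (h : A = N ∧ B = M + 1 ∨ A = N + 1 ∧ B = 1 ∧ M = N) :
    (∀ p ∈ upSet σ N M, patternV σ b a A B p = a) ∧
    (∀ p ∈ orbitSet σ A B, patternV σ b a A B p = b) ∧
    ∀ p ∉ upSet σ N M, p ∉ orbitSet σ A B → patternV σ b a A B p = 0 := by
  have e : ∀ p, patternV σ b a A B p = wedgeV b a A B (σ.hi p) (σ.lo p) := fun _ => rfl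
  have e₁ : ∀ q, q ∈ upSet σ N M ↔ σ.hi q < N ∨ σ.hi q = N ∧ σ.lo q ≤ M := fun _ => Iff.rfl
  have e₂ : ∀ q, q ∈ orbitSet σ A B ↔ σ.hi q = A ∧ σ.lo q = B := fun _ => Iff.rfl
  simp only [e, e₁, e₂]
  refine ⟨fun p hp => ?_, fun p hp => ?_, fun p hp hp' => ?_⟩ <;> have hw := σ.wedge p <;>
    unfold wedgeV
  · exact if_pos (by omega)
  · rw [if_neg (by omega), if_pos (by omega)]
  · rw [if_neg (by omega), if_neg (by omega)]

variable {f : ℝ → ℝ → ℝ} {um up : ℝ → ℝ}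

theorem continuesThroughFold_side (hf : IsTranscritical f um up) (σ : Site) {N M : ℤ}
    (hM : 1 ≤ M) (hMN : M + 1 ≤ N) :
    ContinuesThroughFold hf.smooth σ (fun μ => patternU σ (up μ) N M)
      (fun μ => patternV σ (um μ) (up μ) N (M + 1)) (2 * √2) (if M + 1 = N then 4 else 8) := by
  have hc := σ.c_eq
  split_ifs with h
  · subst h
    refine (isConfig_side hM le_rfl).continuesThroughFold hf
      (isOrbitIndex_four (b₀ := (M + 1, M + 1)) (b₁ := (M + 1, σ.c - (M + 1)))
        (Or.inl ?_) (Or.inl ?_) ?_ ?_ fun p => ?_) isCharTable_charTwo (by simp)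
        (fun μ => patternU_spec σ _ _ _) fun μ => patternV_spec σ _ _ (Or.inl ⟨rfl, rfl⟩)
    · simp only; omega
    · simp only; omega
    · rw [Ne, Prod.ext_iff]; simp only; omega
    · rw [Ne, Prod.ext_iff]; simp only; omega
    · rw [mem_orbitSet (by omega) (by omega) le_rfl]
      simp only [Prod.ext_iff]
      omega
  · exact (isConfig_side hM hMN).continuesThroughFold hf
      (isOrbitIndex_eight (by omega) (by omega) (by omega))
      (isCharTable_charTwo.prod isCharTable_charTwo) (by simp)
      (fun μ => patternU_spec σ _ _ _) fun μ => patternV_spec σ _ _ (Or.inl ⟨rfl, rfl⟩)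

theorem continuesThroughFold_square (hf : IsTranscritical f um up) (σ : Site) {N : ℤ}
    (hN : N = 1 ∨ N = 2) :
    ContinuesThroughFold hf.smooth σ (fun μ => patternU σ (up μ) N N)
      (fun μ => patternV σ (um μ) (up μ) (N + 1) 1) 2
      (match σ with
        | Site.off => 8
        | Site.on => 4) := by
  have h2 : (2 : ℝ) = 2 * √1 := by simp
  cases σ
  · have h := (isConfig_square (σ := Site.off) hN).continuesThroughFold hf
      (isOrbitIndex_eight le_rfl (by omega) (by simp [Site.c]))
      (isCharTable_charTwo.prod isCharTable_charTwo) (k := 8) (by simp)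
      (fun μ => patternU_spec _ (up μ) _ _)
      fun μ => patternV_spec _ (um μ) (up μ) (Or.inr ⟨rfl, rfl, rfl⟩)
    rwa [← h2] at h
  · have h := (isConfig_square (σ := Site.on) hN).continuesThroughFold hf
      (isOrbitIndex_four (b₀ := (N + 1, 1)) (b₁ := (1, N + 1))
        (Or.inl ?_) (Or.inr ?_) ?_ ?_ fun p => ?_) isCharTable_charTwo (k := 4) (by simp)
      (fun μ => patternU_spec _ (up μ) _ _)
      fun μ => patternV_spec _ (um μ) (up μ) (Or.inr ⟨rfl, rfl, rfl⟩)
    · rwa [← h2] at h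
    · simp only [Site.c]; omega
    · simp only [Site.c]; omega
    · rw [Ne, Prod.ext_iff]; simp only; omega
    · rw [Ne, Prod.ext_iff]; simp only [Site.c]; omega
    · rw [mem_orbitSet (by omega) (by omega) (by omega)]
      simp only [Prod.ext_iff, Site.c]
      omega

end Lattice

end

theorem mainTheorem6 (f : ℝ → ℝ → ℝ) (um up : ℝ → ℝ)
    (hf : Lattice.IsTranscritical f um up) (σ : Lattice.Site) :
    (∀ N M : ℕ, 2 ≤ N → 1 ≤ M → M ≤ N - 1 →
      Lattice.ContinuesThroughFold hf.smooth σ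
        (fun μ => Lattice.patternU σ (up μ) N M)
        (fun μ => Lattice.patternV σ (um μ) (up μ) N (M + 1))
        (2 * √2) (if M = N - 1 then 4 else 8)) ∧
    (∀ N : ℕ, N = 1 ∨ N = 2 →
      Lattice.ContinuesThroughFold hf.smooth σ
        (fun μ => Lattice.patternU σ (up μ) N N)
        (fun μ => Lattice.patternV σ (um μ) (up μ) (N + 1) 1)
        2 (match σ with
          | Lattice.Site.off => 8
          | Lattice.Site.on => 4)) := by
  refine ⟨fun N M hN hM hMN => ?_, fun N hN => ?_⟩
  · have h := Lattice.continuesThroughFold_side hf σ (N := N) (M := M) (by omega) (by omega)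
    have hk : ((M : ℤ) + 1 = N) = (M = N - 1) := by rw [eq_iff_iff]; omega
    simpa only [hk] using h
  · exact Lattice.continuesThroughFold_square hf σ (N := N) (by omega)
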